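/- \textbf{Setting.} Let $z>0$. For a permutation $w$ let $\Upsilon_n w\in S_n$ be obtained by deleting all points $>n$ from its cycles. The space $\mathfrak S^z$ of virtual permutations is the inverse limit of the groups $S_n$ under the maps $\Upsilon$, with the probability measure $\mu^z$ whose image in each $S_n$ is the Ewens distribution $g\mapsto z^{[g]}/(z(z+1)\cdots(z+n-1))$, $[g]$ = number of cycles. The bisymmetric group $\mathbb S$ (pairs $(h_1,h_2)$ of permutations of $\mathbb N$ such that $h_1h_2^{-1}$ has finite support) acts on $\mathfrak S^z$ by $\mathfrak u\mapsto h_1^{-1}\mathfrak u h_2$. The space $\mathfrak S^z_n$ of half-occupied restaurants is the quotient of $\mathfrak S^z$ obtained by forgetting the guests $>n$. Its points are $\mathfrak t=\mathfrak t[\tau,\{l_i\},\{\ell_\nu\}]$ with $\tau\in S_n$, $l_1,\dots,l_n>0$ and a countable collection $\ell_\nu>0$ such that $\sum l_i+\sum\ell_\nu=1$: the cycles of $\tau$ are the tables with guests, $l_i$ is the length of the arc from the guest $i$ to the next guest $\tau(i)$, and $\{\ell_\nu\}$ is the unordered collection of lengths of tables without guests (lengths are asymptotic frequencies of guests). The collection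 $\{\ell_\nu\}$ is regarded as a point configuration. A $g\in\mathbb S$ determines the polymorphism $\Xi_{n,n}(g)$ of $\mathfrak S^z_n$: the joint law, for $\mathfrak u$ distributed by $\mu^z$, of the class of $\mathfrak u$, the class of $\mathfrak u g$, and the Radon--Nikodym derivative at $\mathfrak u$ of the transformation $\mathfrak u\mapsto\mathfrak ug$. It depends only on the double coset (chip) of $g$ in $\mathcal S(n,n)=\mathbb K_n\backslash\mathbb S/\mathbb K_n$, where $\mathbb K_n$ is the group of pairs $(h,h)$ with $h$ fixing $1,\dots,n$. The spreaded image of a point $\mathfrak t$ is the conditional measure of $\Xi_{n,n}(g)$ at $\mathfrak t$; it is a measure on $\mathbb R_{>0}\times\mathfrak S^z_n$, defined for almost all $\mathfrak t$. \textbf{The chip.} Let $\sigma\in S_n$, $\phi_1,\dots,\phi_n\in\mathbb Z_{\ge0}$, and integers $k_1,\dots,k_p\ge2$. The chip $\mathfrak b=\mathfrak b[\sigma,\{\phi_i\},\{k_j\}]\in\mathcal S(n,n)$ has the left arcs $j\downarrow j$ of length $0$, the right arcs $j\downarrow\sigma(j)$ of length $\phi_j$, and circles of lengths $k_1,\dots,k_p$.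 Put $N=n+\sum\phi_i+\sum k_j$, and let $\iota_m$ be the number of $j$ with $k_j=m$. \textbf{Surfaces.} A checker surface is a closed oriented, possibly disconnected, surface glued from equally many white and black triangles, each white side being glued to the black side of the same colour; sides are coloured $a,b,c$ clockwise on white and anticlockwise on black triangles. Vertices of type $A$, $B$, $C$ are those between sides of colours $\{b,c\}$, $\{a,c\}$, $\{a,b\}$. The order $\mathrm{ord}$ of a vertex is the number of white triangles at it. Let $\Gamma[\mathfrak b,\mathfrak t]$ be the set of isomorphism classes of triples $(\Sigma,F,\omega)$, where $\Sigma$ is a checker surface with $N$ white and $N$ black triangles, $F$ is an injective labelling of white triangles by $1,\dots,n$, and $\omega$ is an injective map from the set of $B$-vertices to the set of tables of $\mathfrak t$, such that: (1) going clockwise around $A$-vertices, the label following $i$ is $\sigma(i)$, with exactly $\phi_i$ label-less white triangles between them; and there is a bijection between the $A$-vertices and the union of the set of cycles of $\sigma$ and the set of the $p$ circles, under which a vertex corresponding to a cycle carries exactly the labels in that cycle, and a vertex corresponding to the $j$-th circle carries no labels and has order $k_j$; (2) the labels at a $B$-vertex $B$ are precisely the guests at the table $\omega(B)$, in the same cyclic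 order clockwise: the label clockwise after $i$ is $\tau(i)$. Let $\Phi$ (resp. $\Psi$) be the set of $B$-vertices (resp. $C$-vertices) without labels. For $i\in\{1,\dots,n\}$ let $T(i)$ be the set of black triangles passed when going clockwise around a $B$-vertex from the label $i$ to the next label, and for $B\in\Phi$ let $T(B)$ be the set of all black triangles at $B$. Let $R(j)$ be the set of black triangles passed when going counterclockwise around a $C$-vertex from the label $j$ to the next label, and for $C\in\Psi$ let $R(C)$ be the set of all black triangles at $C$. Let $\rho\in S_n$ be the permutation formed by the counterclockwise cycles of labels at $C$-vertices. Let $\mathrm{Aut}_B(\Sigma,F)$ be the group of automorphisms of $\Sigma$ fixing all $B$-vertices and all labelled triangles. For $m_1,\dots,m_q\ge0$ not all zero and $s>0$ let $\Theta_q[m_1,\dots,m_q;s]$ be the Dirichlet distribution: the probability measure on the simplex $x_1+\dots+x_q=s$, $x_j\ge0$, supported on the face $x_j=0$ for all $j$ with $m_j=0$, with density $\Gamma(\sum m_j)\,s^{1-\sum m_j}\prod_{m_j>0}x_j^{m_j-1}/\Gamma(m_j)$ there with respect to the product of all $dx_j$ ($m_j>0$) but one. \textbf{Theorem.} For almost all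 $\mathfrak t=\mathfrak t[\tau,\{l_i\},\{\ell_\nu\}]\in\mathfrak S^z_n$ the spreaded image of $\mathfrak t$ under $\mathfrak b$ is the probability measure $$ \prod_j k_j\ \prod_m\iota_m!\sum_{(\Sigma,F,\omega)\in\Gamma[\mathfrak b,\mathfrak t]}\frac1{\#\mathrm{Aut}_B(\Sigma,F)}\ \prod_{i=1}^n\frac{l_i^{\#T(i)-1}}{(\#T(i)-1)!}\ \prod_{B\in\Phi}\frac{\ell_{\omega(B)}^{\mathrm{ord}(B)}}{(\mathrm{ord}(B)-1)!}\ \Bigl(\delta_{z^{\#\{C\text{-vertices}\}-\#\{B\text{-vertices}\}}}\times\mathcal R_{\Sigma,F,\omega}\Bigr), $$ where $\mathcal R_{\Sigma,F,\omega}$ is the law of the half-occupied restaurant obtained from $\mathfrak t$ by replacing $\tau$ by $\rho$, the arc lengths $\{l_i\}$ by $\{x_j\}_{j\le n}$, and the lengths $\{\ell_{\omega(B)}\}_{B\in\Phi}$ of the framed guest-free tables by $\{x_C\}_{C\in\Psi}$, with the vector $(\{x_j\}_{j\le n},\{x_C\}_{C\in\Psi})$ distributed according to the convolution of the $n+\#\Phi$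 Dirichlet distributions $$ \Theta_{n+\#\Psi}\bigl[\{\#(T(i)\cap R(j))\}_{j\le n},\{\#(T(i)\cap R(C))\}_{C\in\Psi};\,l_i\bigr]\quad(i\le n), $$ $$ \Theta_{n+\#\Psi}\bigl[\{\#(T(B)\cap R(j))\}_{j\le n},\{\#(T(B)\cap R(C))\}_{C\in\Psi};\,\ell_{\omega(B)}\bigr]\quad(B\in\Phi). $$ -/

import Mathlib

open MeasureTheory ProbabilityTheory Filter Topology
open scoped ENNReal

namespace Chips

/-! ## Virtual permutations -/

/-- Removal of the point `a` from the cycle decomposition of `w`. -/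
def removePoint (a : ℕ) (w : Equiv.Perm ℕ) : Equiv.Perm ℕ := Equiv.swap a (w a) * w

/-- Successive removal of the points `n + k - 1, …, n + 1, n`. -/
def reduce (n : ℕ) : ℕ → Equiv.Perm ℕ → Equiv.Perm ℕ
  | 0, w => w
  | k + 1, w => reduce n k (removePoint (n + k) w)

/-- A point of the inverse limit of the symmetric groups: `perm n` is a permutation of
`{0, …, n - 1}` (extended by the identity to `ℕ`), and `perm n` is obtained from
`perm (n + 1)` by removing `n` from its cycle. -/
@[ext]
structure VirtualPerm where
  perm : ℕ → Equiv.Perm ℕ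
  fixes : ∀ n i, n ≤ i → perm n i = i
  compat : ∀ n, removePoint n (perm (n + 1)) = perm n

/-- The `σ`-algebra generated by the cylinder sets. -/
instance : MeasurableSpace VirtualPerm :=
  MeasurableSpace.generateFrom {s | ∃ n g, s = {u : VirtualPerm | u.perm n = g}}

lemma removePoint_comm (a b : ℕ) (w : Equiv.Perm ℕ) :
    removePoint a (removePoint b w) = removePoint b (removePoint a w) := by
  have inj := w.injective
  ext x
  simp only [removePoint, Equiv.Perm.mul_apply, Equiv.swap_apply_def]
  have h1 : w a = w b ↔ a = b := inj.eq_iff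
  have h2 : w x = w a ↔ x = a := inj.eq_iff
  have h3 : w x = w b ↔ x = b := inj.eq_iff
  grind

lemma removePoint_self (a : ℕ) (w : Equiv.Perm ℕ) : removePoint a w a = a := by
  simp [removePoint]

lemma removePoint_of_fixed {a : ℕ} {w : Equiv.Perm ℕ} (h : w a = a) : removePoint a w = w := by
  simp [removePoint, h, Equiv.Perm.ext_iff]

lemma removePoint_idem (a : ℕ) (w : Equiv.Perm ℕ) :
    removePoint a (removePoint a w) = removePoint a w :=
  removePoint_of_fixed (removePoint_self a w)

lemma removePoint_apply_fixed {a i : ℕ} {w : Equiv.Perm ℕ} (h : w i = i) :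
    removePoint a w i = i := by
  by_cases hi : i = a
  · subst hi; exact removePoint_self _ _
  · have : w a ≠ i := fun e => hi (w.injective (h.trans e.symm))
    simp [removePoint, h, Equiv.swap_apply_of_ne_of_ne hi this.symm]

lemma reduce_removePoint (n k a : ℕ) (w : Equiv.Perm ℕ) :
    reduce n k (removePoint a w) = removePoint a (reduce n k w) := by
  induction k generalizing w with
  | zero => rfl
  | succ k ih => simp only [reduce]; rw [removePoint_comm, ih]

lemma reduce_absorb {n k a : ℕ} (h1 : n ≤ a) (h2 : a < n + k) (w : Equiv.Perm ℕ) :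
    reduce n k (removePoint a w) = reduce n k w := by
  induction k generalizing w with
  | zero => omega
  | succ k ih =>
    simp only [reduce]
    rcases Nat.lt_or_ge a (n + k) with h | h
    · rw [removePoint_comm, ih h]
    · obtain rfl : a = n + k := by omega
      rw [removePoint_idem]

lemma reduce_succ_left (n k : ℕ) (w : Equiv.Perm ℕ) :
    reduce n (k + 1) w = removePoint n (reduce (n + 1) k w) := by
  induction k generalizing w with
  | zero => rfl
  | succ k ih =>
    rw [reduce, ih, reduce, show n + (k + 1) = n + 1 + k by ring]

lemma reduce_apply_fixed {n k i : ℕ} {w : Equiv.Perm ℕ} (h : w i = i) :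
    reduce n k w i = i := by
  induction k generalizing w with
  | zero => exact h
  | succ k ih => exact ih (removePoint_apply_fixed h)

lemma reduce_apply_mid {n k i : ℕ} (h1 : n ≤ i) (h2 : i < n + k) (w : Equiv.Perm ℕ) :
    reduce n k w i = i := by
  induction k generalizing w with
  | zero => omega
  | succ k ih =>
    rcases Nat.lt_or_ge i (n + k) with h | h
    · exact ih h _
    · obtain rfl : i = n + k := by omega
      rw [reduce]
      exact reduce_apply_fixed (removePoint_self _ _)

lemma reduce_stable {n M : ℕ} {w : Equiv.Perm ℕ} (h : ∀ i, M ≤ i → w i = i) :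
    ∀ k, M ≤ k → reduce n k w = reduce n M w := by
  intro k hk
  induction k, hk using Nat.le_induction with
  | base => rfl
  | succ k hk ih => rw [reduce, removePoint_of_fixed (h _ (by omega)), ih]

/-- The bisymmetric group: pairs of permutations of `ℕ` that differ by a permutation with
finite support. -/
def bisymmetricGroup : Subgroup (Equiv.Perm ℕ × Equiv.Perm ℕ) where
  carrier := {g | {i | (g.1 * g.2⁻¹) i ≠ i}.Finite}
  one_mem' := by simp
  mul_mem' := by
    intro g h hg hh
    refine (hg.union (hh.preimage (f := (g.1⁻¹ : Equiv.Perm ℕ)) (by simp))).subset ?_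
    intro i hi
    by_contra hc
    apply hi
    simp only [Set.mem_union, Set.mem_ofPred_eq, Set.mem_preimage, not_or, not_not,
      Equiv.Perm.mul_apply] at hc
    simp only [Prod.fst_mul, Prod.snd_mul, mul_inv_rev, Equiv.Perm.mul_apply]
    have e : g.2⁻¹ i = g.1⁻¹ i := by
      rw [Equiv.Perm.eq_inv_iff_eq]; exact hc.1
    rw [e, hc.2]; simp
  inv_mem' := by
    intro g hg
    refine (hg.preimage (f := (g.2 : Equiv.Perm ℕ)) (by simp)).subset ?_
    intro i hi hc
    apply hi
    have e : g.1 i = g.2 i := by simpa using hc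
    simp [← e]

/-- `v = h₁⁻¹ u h₂`: for each `n`, the permutation `v.perm n` is obtained from
`h₁⁻¹ (u.perm N) h₂` with large `N` by removing all points `≥ n` from its cycles. -/
def IsTranslate (h : Equiv.Perm ℕ × Equiv.Perm ℕ) (u v : VirtualPerm) : Prop :=
  ∀ n, ∀ᶠ N in atTop, ∀ᶠ k in atTop, reduce n k (h.1⁻¹ * u.perm N * h.2) = v.perm n

lemma exists_isTranslate (h : bisymmetricGroup) (u : VirtualPerm) :
    ∃ v, IsTranslate (h : Equiv.Perm ℕ × Equiv.Perm ℕ) u v := by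
  obtain ⟨⟨h1, h2⟩, hh⟩ := h
  set V : ℕ → Equiv.Perm ℕ := fun N => h1⁻¹ * u.perm N * h2 with hV
  have hfin : {x | h2 x ≠ h1 x}.Finite := by
    have hh' : {i | (h1 * h2⁻¹) i ≠ i}.Finite := hh
    refine (hh'.preimage (f := (h2 : Equiv.Perm ℕ)) (by simp)).subset ?_
    intro i hi hc
    apply hi
    simpa using hc.symm
  have hsupp : ∀ N, ∃ M, ∀ i, M ≤ i → V N i = i := by
    intro N
    have hf : {x | V N x ≠ x}.Finite := by
      refine (hfin.union ((Set.finite_lt_nat N).preimage (f := (h1 : Equiv.Perm ℕ))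
        (by simp))).subset ?_
      intro x hx
      by_contra hc
      apply hx
      simp only [Set.mem_union, Set.mem_ofPred_eq, Set.mem_preimage, not_or, not_not,
        not_lt] at hc
      simp [hV, hc.1, u.fixes N _ hc.2]
    obtain ⟨M, hM⟩ := hf.bddAbove
    refine ⟨M + 1, fun i hi => ?_⟩
    by_contra hc
    have := hM hc
    omega
  choose M hM using hsupp
  have hlim : ∀ n N k, M N ≤ k → reduce n k (V N) = reduce n (M N) (V N) :=
    fun n N k hk => reduce_stable (hM N) k hk
  have hstep : ∀ n, ∃ N0, ∀ N, N0 ≤ N →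
      reduce n (M (N + 1)) (V (N + 1)) = reduce n (M N) (V N) := by
    intro n
    have hbad : ({x | h2 x ≠ h1 x} ∪ Set.Iio n).Finite := hfin.union (Set.finite_Iio n)
    obtain ⟨N0, hN0⟩ := (hbad.image h1).bddAbove
    refine ⟨N0 + 1, fun N hN => ?_⟩
    have hnot : h1⁻¹ N ∉ ({x | h2 x ≠ h1 x} ∪ Set.Iio n) := by
      intro hc
      have := hN0 (Set.mem_image_of_mem h1 hc)
      have : N ≤ N0 := by simpa using this
      omega
    simp only [Set.mem_union, Set.mem_ofPred_eq, Set.mem_Iio, not_or, not_not, not_lt] at hnot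
    obtain ⟨ha, hb⟩ := hnot
    have hv : removePoint (h1⁻¹ N) (V (N + 1)) = V N := by
      have hu := u.compat N
      simp only [hV, ← hu, removePoint]
      have e : h2 (h1⁻¹ N) = N := by simpa using ha
      simp only [Equiv.Perm.mul_apply, e]
      rw [Equiv.swap_apply_apply h1⁻¹ N (u.perm (N + 1) N)]
      simp [mul_assoc]
    set k := max (max (M (N + 1)) (M N)) (h1⁻¹ N + 1)
    rw [← hlim n (N + 1) k (by omega), ← hlim n N k (by omega), ← hv]
    exact (reduce_absorb hb (by omega) _).symm
  have hex : ∀ n, ∃ w, ∀ᶠ N in atTop, ∀ᶠ k in atTop, reduce n k (V N) = w := by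
    intro n
    obtain ⟨N0, hN0⟩ := hstep n
    refine ⟨reduce n (M N0) (V N0), ?_⟩
    filter_upwards [eventually_ge_atTop N0] with N hN
    filter_upwards [eventually_ge_atTop (M N)] with k hk
    rw [hlim n N k hk]
    clear hk
    induction N, hN using Nat.le_induction with
    | base => rfl
    | succ N hN ih => rw [hN0 N hN, ih]
  choose w hw using hex
  refine ⟨⟨w, ?_, ?_⟩, hw⟩
  · intro n i hi
    obtain ⟨N, hN⟩ := (hw n).exists
    obtain ⟨k, hk, hk'⟩ := (hN.and (eventually_ge_atTop (i + 1))).exists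
    rw [← hk]
    exact reduce_apply_mid hi (by omega) _
  · intro n
    obtain ⟨N, hN, hN'⟩ := ((hw n).and (hw (n + 1))).exists
    obtain ⟨k, hk, hk'⟩ := (((tendsto_add_atTop_nat 1).eventually hN).and hN').exists
    rw [← hk, ← hk', ← reduce_succ_left]

/-- The action `u ↦ h₁⁻¹ u h₂` of the bisymmetric group on virtual permutations. -/
noncomputable def act (h : bisymmetricGroup) (u : VirtualPerm) : VirtualPerm :=
  (exists_isTranslate h u).choose

lemma act_spec (h : bisymmetricGroup) (u : VirtualPerm) :
    IsTranslate (h : Equiv.Perm ℕ × Equiv.Perm ℕ) u (act h u) :=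
  (exists_isTranslate h u).choose_spec

/-! ## The measure on virtual permutations -/

/-- The permutation of `{0, …, n - 1}` built by successively seating the guests
`0, …, n - 1`: the guest `m` is placed immediately before the guest `c m` if `c m < m`, and
opens a new cycle if `c m = m`. -/
def seatPerm (c : ∀ n : ℕ, Fin (n + 1)) : ℕ → Equiv.Perm ℕ
  | 0 => 1
  | n + 1 => Equiv.swap n (c n : ℕ) * seatPerm c n

lemma seatPerm_fixes (c : ∀ n : ℕ, Fin (n + 1)) (n i : ℕ) (hi : n ≤ i) :
    seatPerm c n i = i := by
  induction n with
  | zero => rfl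
  | succ n ih =>
    have := (c n).isLt
    rw [seatPerm, Equiv.Perm.mul_apply, ih (by omega)]
    exact Equiv.swap_apply_of_ne_of_ne (by omega) (by omega)

lemma seatPerm_succ_self (c : ∀ n : ℕ, Fin (n + 1)) (n : ℕ) :
    seatPerm c (n + 1) n = c n := by
  rw [seatPerm, Equiv.Perm.mul_apply, seatPerm_fixes c n n le_rfl, Equiv.swap_apply_left]

lemma seatPerm_compat (c : ∀ n : ℕ, Fin (n + 1)) (n : ℕ) :
    removePoint n (seatPerm c (n + 1)) = seatPerm c n := by
  rw [removePoint, seatPerm_succ_self, seatPerm, ← mul_assoc, Equiv.swap_mul_self, one_mul]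

/-- The virtual permutation built by successively seating all guests. -/
def ofSeats (c : ∀ n : ℕ, Fin (n + 1)) : VirtualPerm :=
  ⟨seatPerm c, seatPerm_fixes c, seatPerm_compat c⟩

/-- The law of the seat of the guest `n`: weight `z` for a new cycle, weight `1` for each of
the `n` other seats. -/
noncomputable def seatLaw (z : ℝ) (hz : 0 < z) (n : ℕ) : PMF (Fin (n + 1)) :=
  PMF.normalize (fun j => if j = Fin.last n then ENNReal.ofReal z else 1)
    (by
      intro h
      have := ENNReal.tsum_eq_zero.1 h (Fin.last n)
      simp at this
      linarith)
    (by
      rw [tsum_fintype]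
      refine ENNReal.sum_ne_top.2 fun j _ => ?_
      split_ifs <;> simp)

/-- The probability measure on virtual permutations whose image in each `S_n` is the Ewens
distribution with parameter `z`, see `virtualMeasure_apply`. -/
noncomputable def virtualMeasure (z : ℝ) (hz : 0 < z) : Measure VirtualPerm :=
  (Measure.infinitePi fun n => (seatLaw z hz n).toMeasure).map ofSeats

/-- The number of cycles of a permutation `g` of `{0, …, n - 1}`, counted by their smallest
elements. -/
noncomputable def cycleCount (n : ℕ) (g : Equiv.Perm ℕ) : ℕ :=
  {i ∈ Set.Iio n | ∀ j, g.SameCycle i j → i ≤ j}.ncard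

lemma seatLaw_apply (z : ℝ) (hz : 0 < z) (n : ℕ) (j : Fin (n + 1)) :
    seatLaw z hz n j = ENNReal.ofReal ((if j = Fin.last n then z else 1) / (z + n)) := by
  have hs : (∑' j : Fin (n + 1), (if j = Fin.last n then ENNReal.ofReal z else 1)) =
      ENNReal.ofReal (z + n) := by
    rw [tsum_fintype, Fin.sum_univ_castSucc, ENNReal.ofReal_add hz.le (by positivity)]
    simp [Fin.castSucc_ne_last, add_comm]
  rw [seatLaw, PMF.normalize_apply, hs, ENNReal.ofReal_div_of_pos (by positivity),
    div_eq_mul_inv]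
  split_ifs <;> simp

lemma measurable_ofSeats : Measurable ofSeats := by
  refine measurable_generateFrom ?_
  rintro _ ⟨n, g, rfl⟩
  change MeasurableSet {c | seatPerm c n = g}
  induction n generalizing g with
  | zero => exact by simp [seatPerm]
  | succ n ih =>
    have : {c | seatPerm c (n + 1) = g} =
        ⋃ j : Fin (n + 1), {c | c n = j} ∩ {c | seatPerm c n = Equiv.swap n (j : ℕ) * g} := by
      ext c
      simp only [Set.mem_ofPred_eq, Set.mem_iUnion, Set.mem_inter_iff]
      constructor
      · intro h
        refine ⟨c n, rfl, ?_⟩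
        rw [← h, seatPerm, ← mul_assoc, Equiv.swap_mul_self, one_mul]
      · rintro ⟨j, rfl, h⟩
        rw [seatPerm, h, ← mul_assoc, Equiv.swap_mul_self, one_mul]
    rw [this]
    refine MeasurableSet.iUnion fun j => MeasurableSet.inter ?_ (ih _)
    exact (measurable_pi_apply (X := fun n : ℕ => Fin (n + 1)) n) (measurableSet_singleton j)

instance (z : ℝ) (hz : 0 < z) : IsProbabilityMeasure (virtualMeasure z hz) :=
  Measure.isProbabilityMeasure_map measurable_ofSeats.aemeasurable

lemma removePoint_fixes {n : ℕ} {g : Equiv.Perm ℕ} (hg : ∀ i, n + 1 ≤ i → g i = i) (i : ℕ)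
    (hi : n ≤ i) : removePoint n g i = i := by
  rcases hi.eq_or_lt with rfl | h
  · exact removePoint_self _ _
  · exact removePoint_apply_fixed (hg i h)

lemma sameCycle_removePoint_of_pow {n : ℕ} (g : Equiv.Perm ℕ) (k : ℕ) : ∀ i, i ≠ n →
    (g ^ k) i ≠ n → (removePoint n g).SameCycle i ((g ^ k) i) := by
  induction k using Nat.strong_induction_on with
  | _ k ih =>
    intro i hi hk
    match k with
    | 0 => simp [Equiv.Perm.SameCycle.refl]
    | k + 1 =>
      rw [pow_succ, Equiv.Perm.mul_apply] at hk ⊢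
      by_cases h : g i = n
      · match k with
        | 0 => exact absurd h hk
        | m + 1 =>
          have hgn : g n ≠ n := fun e => hi (g.injective (h.trans e.symm))
          have e : removePoint n g i = g n := by simp [removePoint, h]
          rw [h, pow_succ, Equiv.Perm.mul_apply] at hk ⊢
          have := ih m (by omega) (g n) hgn hk
          rw [← e] at this ⊢
          exact Equiv.Perm.sameCycle_apply_left.1 this
      · have hne : g i ≠ g n := fun e => hi (g.injective e)
        have e : removePoint n g i = g i := by
          simp [removePoint, Equiv.swap_apply_of_ne_of_ne h hne]
        have := ih k (by omega) (g i) h hk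
        nth_rw 1 [← e] at this
        exact Equiv.Perm.sameCycle_apply_left.1 this

lemma sameCycle_of_removePoint_pow {n : ℕ} (g : Equiv.Perm ℕ) (k : ℕ) (i : ℕ) (hi : i ≠ n) :
    g.SameCycle i ((removePoint n g ^ k) i) ∧ (removePoint n g ^ k) i ≠ n := by
  induction k with
  | zero => exact ⟨by simp [Equiv.Perm.SameCycle.refl], by simpa using hi⟩
  | succ k ih =>
    obtain ⟨h1, h2⟩ := ih
    rw [pow_succ', Equiv.Perm.mul_apply]
    set x := (removePoint n g ^ k) i
    constructor
    · by_cases h : g x = n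
      · have e : removePoint n g x = g n := by simp [removePoint, h]
        rw [e, ← h]
        exact Equiv.Perm.sameCycle_apply_right.2 (Equiv.Perm.sameCycle_apply_right.2 h1)
      · have hne : g x ≠ g n := fun e => h2 (g.injective e)
        have e : removePoint n g x = g x := by
          simp [removePoint, Equiv.swap_apply_of_ne_of_ne h hne]
        rw [e]
        exact Equiv.Perm.sameCycle_apply_right.2 h1
    · intro e
      exact h2 ((removePoint n g).injective (e.trans (removePoint_self n g).symm))

lemma exists_pow_of_sameCycle {g : Equiv.Perm ℕ} {i j : ℕ} (h : g.SameCycle i j) :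
    ∃ k : ℕ, (g ^ k) i = j ∨ (g ^ k) j = i := by
  obtain ⟨k, hk⟩ := h
  obtain ⟨m, rfl | rfl⟩ := k.eq_nat_or_neg
  · exact ⟨m, Or.inl (by simpa using hk)⟩
  · refine ⟨m, Or.inr ?_⟩
    rw [← hk]; simp

lemma sameCycle_removePoint {n i j : ℕ} (g : Equiv.Perm ℕ) (hi : i ≠ n) (hj : j ≠ n) :
    (removePoint n g).SameCycle i j ↔ g.SameCycle i j := by
  constructor <;> intro h <;> obtain ⟨k, rfl | rfl⟩ := exists_pow_of_sameCycle h
  · exact (sameCycle_of_removePoint_pow g k i hi).1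
  · exact (sameCycle_of_removePoint_pow g k j hj).1.symm
  · exact sameCycle_removePoint_of_pow g k i hi hj
  · exact (sameCycle_removePoint_of_pow g k j hj hi).symm

lemma cycleCount_succ {n : ℕ} {g : Equiv.Perm ℕ} (hg : ∀ i, n + 1 ≤ i → g i = i) :
    cycleCount (n + 1) g = cycleCount n (removePoint n g) + if g n = n then 1 else 0 := by
  have hgn : g n < n + 1 := by
    by_contra hc
    have := g.injective (hg (g n) (by omega))
    omega
  have hlt : ∀ i < n, ((∀ j, g.SameCycle i j → i ≤ j) ↔
      ∀ j, (removePoint n g).SameCycle i j → i ≤ j) := by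
    intro i hi
    refine forall_congr' fun j => ?_
    by_cases hj : j = n
    · subst hj; simp [hi.le]
    · rw [sameCycle_removePoint g hi.ne hj]
  have hn : (∀ j, g.SameCycle n j → n ≤ j) ↔ g n = n := by
    constructor
    · intro h
      have := h (g n) (Equiv.Perm.sameCycle_apply_right.2 (Equiv.Perm.SameCycle.refl _ _))
      omega
    · intro h j hj
      exact ((Equiv.Perm.SameCycle.eq_of_left hj h)).le
  have hfin : {i ∈ Set.Iio n | ∀ j, (removePoint n g).SameCycle i j → i ≤ j}.Finite :=
    (Set.finite_Iio n).subset (Set.sep_subset _ _)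
  by_cases h : g n = n
  · rw [if_pos h, cycleCount, cycleCount, ← Set.ncard_insert_of_notMem (a := n) (by simp) hfin]
    congr 1
    ext i
    simp only [Set.mem_Iio, Set.mem_insert_iff]
    constructor
    · rintro ⟨h1, h2⟩
      rcases Nat.lt_succ_iff_lt_or_eq.1 h1 with h1 | h1
      · exact Or.inr ⟨h1, (hlt i h1).1 h2⟩
      · exact Or.inl h1
    · rintro (rfl | ⟨h1, h2⟩)
      · exact ⟨by omega, hn.2 h⟩
      · exact ⟨by omega, (hlt i h1).2 h2⟩
  · rw [if_neg h, cycleCount, cycleCount, add_zero]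
    congr 1
    ext i
    simp only [Set.mem_Iio]
    constructor
    · rintro ⟨h1, h2⟩
      rcases Nat.lt_succ_iff_lt_or_eq.1 h1 with h1 | rfl
      · exact ⟨h1, (hlt i h1).1 h2⟩
      · exact absurd (hn.1 h2) h
    · rintro ⟨h1, h2⟩
      exact ⟨by omega, (hlt i h1).2 h2⟩

theorem virtualMeasure_apply (z : ℝ) (hz : 0 < z) (n : ℕ) (g : Equiv.Perm ℕ)
    (hg : ∀ i, n ≤ i → g i = i) :
    virtualMeasure z hz {u | u.perm n = g} =
      ENNReal.ofReal (z ^ cycleCount n g / ∏ i ∈ Finset.range n, (z + i)) := by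
  rw [virtualMeasure, Measure.map_apply measurable_ofSeats
    (MeasurableSpace.measurableSet_generateFrom ⟨n, g, rfl⟩)]
  change Measure.infinitePi _ {c | seatPerm c n = g} = _
  have key : ∃ s : ∀ m : ℕ, Fin (m + 1), {c | seatPerm c n = g} =
      Set.pi (Finset.range n) (fun m => {s m}) ∧
      ∏ m ∈ Finset.range n, (if s m = Fin.last m then z else 1) = z ^ cycleCount n g := by
    induction n generalizing g with
    | zero =>
      refine ⟨fun m => 0, ?_, ?_⟩
      · have : g = 1 := by ext i; simpa using hg i (by omega)
        subst this
        ext c; simp [seatPerm]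
      · simp [cycleCount]
    | succ n ih =>
      obtain ⟨s, hs, hs'⟩ := ih (removePoint n g) (removePoint_fixes hg)
      have hgn : g n < n + 1 := by
        by_contra hc
        have := g.injective (hg (g n) (by omega))
        omega
      refine ⟨Function.update s n ⟨g n, hgn⟩, ?_, ?_⟩
      · ext c
        have : c ∈ {c | seatPerm c n = removePoint n g} ↔
          c ∈ Set.pi (Finset.range n) (fun m => {s m}) := by rw [hs]
        simp only [Set.mem_ofPred_eq, Set.mem_pi, Finset.coe_range, Set.mem_Iio,
          Set.mem_singleton_iff] at this ⊢
        constructor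
        · intro h m hm
          rcases Nat.lt_succ_iff_lt_or_eq.1 hm with hm | rfl
          · rw [Function.update_of_ne hm.ne]
            exact this.1 (by rw [← h, seatPerm_compat]) m hm
          · rw [Function.update_self]
            ext
            rw [← seatPerm_succ_self, h]
        · intro h
          have h1 := this.2 fun m hm => by
            have := h m (by omega)
            rwa [Function.update_of_ne hm.ne] at this
          have h2 := h n (by omega)
          rw [Function.update_self] at h2
          rw [seatPerm, h1, h2, removePoint, ← mul_assoc, Equiv.swap_mul_self, one_mul]
      · rw [Finset.prod_range_succ, cycleCount_succ hg, pow_add, ← hs']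
        congr 1
        · refine Finset.prod_congr rfl fun m hm => ?_
          rw [Function.update_of_ne (Finset.mem_range.1 hm).ne]
        · rw [Function.update_self]
          by_cases h : g n = n <;> simp [h, Fin.ext_iff]
  obtain ⟨s, hs, hs'⟩ := key
  rw [hs, Measure.infinitePi_pi _ (fun _ _ => measurableSet_singleton _), ← hs',
    ← Finset.prod_div_distrib, ENNReal.ofReal_prod_of_nonneg]
  · refine Finset.prod_congr rfl fun m _ => ?_
    rw [PMF.toMeasure_apply_singleton _ _ (measurableSet_singleton _), seatLaw_apply]
  · intro m _
    split_ifs <;> positivity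

/-! ## Half-occupied restaurants -/

instance (n : ℕ) : MeasurableSpace (Equiv.Perm (Fin n)) := ⊤

/-- The restriction to `Fin n` of a permutation of `ℕ` that fixes all `i ≥ n`. -/
def toFinPerm (n : ℕ) (w : Equiv.Perm ℕ) (hw : ∀ i, n ≤ i → w i = i) : Equiv.Perm (Fin n) :=
  Fin.equivSubtype.symm.permCongr (w.subtypePerm (p := fun i => i < n) (by
    intro i
    constructor
    · intro h
      by_contra hc
      rw [hw i (by omega)] at h
      exact hc h
    · intro h
      by_contra hc
      have := w.injective (hw (w i) (by omega))
      omega))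

/-- Half-occupied restaurants with the guests `Fin n`, up to rotations of the tables: the
permutation `τ` that sends each guest to the next guest at the same table, the lengths `l i`
of the arcs from the guest `i` to the guest `τ i`, and the point configuration of the lengths
of the tables without guests, as the sum of the unit masses at these lengths. -/
abbrev HalfRestaurant (n : ℕ) : Type :=
  Equiv.Perm (Fin n) × (Fin n → ℝ) × Measure ℝ

/-- The half-occupied restaurant with permutation `τ`, arcs `l i`, and guest-free tables of
lengths `ℓ ν`. -/
noncomputable def HalfRestaurant.ofData {n : ℕ} {ι : Type} (τ : Equiv.Perm (Fin n)) (l : Fin n → ℝ)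
    (ℓ : ι → ℝ) : HalfRestaurant n :=
  (τ, l, Measure.sum fun ν => Measure.dirac (ℓ ν))

/-- The number of elements between `i` and the next guest `< n` in its cycle of `u.perm N`. -/
noncomputable def gap (u : VirtualPerm) (n N i : ℕ) : ℕ :=
  sInf {p | (u.perm N ^ (p + 1)) i < n}

/-- The length of the arc from the guest `i` to the next guest `< n`. -/
noncomputable def arcLength (u : VirtualPerm) (n i : ℕ) : ℝ :=
  limUnder atTop fun N : ℕ => (gap u n N i : ℝ) / N

/-- The length of the table of the guest `m`. -/
noncomputable def tableLength (u : VirtualPerm) (m : ℕ) : ℝ :=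
  limUnder atTop fun N : ℕ => (Function.minimalPeriod (u.perm N) m : ℝ) / N

/-- Forgetting all guests `≥ n`. A table without guests `< n` is represented by its smallest
guest `m ≥ n`, i.e. by an `m` that opens a new cycle in `u.perm (m + 1)`. -/
noncomputable def forget (n : ℕ) (u : VirtualPerm) : HalfRestaurant n :=
  HalfRestaurant.ofData (toFinPerm n (u.perm n) (u.fixes n)) (fun i => arcLength u n i)
    (fun m : {m : ℕ // n ≤ m ∧ u.perm (m + 1) m = m} => tableLength u m)

/-- The distribution on half-occupied restaurants. -/
noncomputable def restaurantMeasure (z : ℝ) (hz : 0 < z) (n : ℕ) : Measure (HalfRestaurant n) :=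
  (virtualMeasure z hz).map (forget n)

/-- The Radon–Nikodym derivative `g'` of the transformation `u ↦ u g`, i.e.
`μ (A g) = ∫_A g' dμ`. -/
noncomputable def radonNikodym (z : ℝ) (hz : 0 < z) (g : bisymmetricGroup) (u : VirtualPerm) : ℝ :=
  (((virtualMeasure z hz).map (act g⁻¹)).rnDeriv (virtualMeasure z hz) u).toReal

/-- The polymorphism of the space of half-occupied restaurants determined by `g`, as a measure
on the product of two copies of the space and the half-line `t > 0`: arrange the guests `≥ n`
at random, apply `g`, and forget the guests `≥ n`, i.e. the joint law of the class of `u`, the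
class of `u g`, and the Radon–Nikodym derivative of `g` at `u`. -/
noncomputable def polymorphism (z : ℝ) (hz : 0 < z) (n : ℕ) (g : bisymmetricGroup) :
    Measure (HalfRestaurant n × HalfRestaurant n × ℝ) :=
  (virtualMeasure z hz).map fun u => (forget n u, forget n (act g u), radonNikodym z hz g u)

/-! ## Chips -/

/-- The left and the right half of a diagram. -/
inductive Side
  | left
  | right

/-- The other half. -/
def Side.swap : Side → Side
  | left => right
  | right => left

/-- The top and the bottom of a diagram. -/
inductive Level
  | top
  | bottom

/-- The circles of a diagram. -/
abbrev Node : Type := Side × Level × ℕ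

/-- The component of a pair of permutations on a given side. -/
def component (g : Equiv.Perm ℕ × Equiv.Perm ℕ) : Side → Equiv.Perm ℕ
  | .left => g.1
  | .right => g.2

/-- The other end of the vertical arc: the `i`-th top circle is joined to the `g i`-th bottom
circle. -/
def vertical (g : Equiv.Perm ℕ × Equiv.Perm ℕ) : Node → Node
  | (s, .top, i) => (s, .bottom, component g s i)
  | (s, .bottom, i) => (s, .top, (component g s)⁻¹ i)

/-- The other end of the horizontal arc with a cross. -/
def horizontal : Node → Node
  | (s, v, i) => (s.swap, v, i)

/-- The ends of the arcs of a chip: the first `β` circles on the top and the first `α` circles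
on the bottom, on both sides. The other circles are joined by horizontal arcs. -/
def IsEnd (α β : ℕ) : Node → Prop
  | (_, .top, i) => i < β
  | (_, .bottom, i) => i < α

/-- One horizontal arc followed by one vertical arc. -/
def advance (g : Equiv.Perm ℕ × Equiv.Perm ℕ) (x : Node) : Node := vertical g (horizontal x)

/-- A chip: `arc x y c` says that there is an arc with ends `x` and `y` with `c` crosses (of
length `c / 2`), and `circles m` is the number of circles of length `m`, with those of length
at most `1` removed. -/
@[ext]
structure Chip where
  arc : Node → Node → ℕ → Prop
  circles : ℕ → ℕ∞

/-- The node `x` lies on a closed component of the diagram. -/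
def OnCircle (α β : ℕ) (g : Equiv.Perm ℕ × Equiv.Perm ℕ) (x : Node) : Prop :=
  ∀ i : ℕ, ¬ IsEnd α β ((advance g)^[i] x)

/-- The set of nodes of the closed component of `x`. -/
def circleOf (g : Equiv.Perm ℕ × Equiv.Perm ℕ) (x : Node) : Set Node :=
  {y | ∃ i : ℕ, y = (advance g)^[i] x ∨ y = horizontal ((advance g)^[i] x)}

/-- The chip in `S(α, β)` of an element of the bisymmetric group: its arcs and circles are the
connected components of the diagram. A circle of length `m` has `2 m` crosses. -/
noncomputable def chipOf (α β : ℕ) (g : Equiv.Perm ℕ × Equiv.Perm ℕ) : Chip where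
  arc x y c := IsEnd α β x ∧ IsEnd α β y ∧ (advance g)^[c] (vertical g x) = y ∧
    ∀ i < c, ¬ IsEnd α β ((advance g)^[i] (vertical g x))
  circles m := if 2 ≤ m then
      {C : Set Node | ∃ x, OnCircle α β g x ∧ Function.minimalPeriod (advance g) x = 2 * m ∧
        C = circleOf g x}.encard
    else 0

/-- The chip with trivial left half, with arcs of length `φ j` from `j` on the top to `σ j` on
the bottom of the right half, and with circles of lengths `k j`. -/
noncomputable def leftTrivialChip {n p : ℕ} (σ : Equiv.Perm (Fin n)) (φ : Fin n → ℕ) (k : Fin p → ℕ) :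
    Chip where
  arc x y c :=
    (∃ j : Fin n, c = 0 ∧
      ((x = (.left, .top, (j : ℕ)) ∧ y = (.left, .bottom, (j : ℕ))) ∨
        (x = (.left, .bottom, (j : ℕ)) ∧ y = (.left, .top, (j : ℕ))))) ∨
    (∃ j : Fin n, c = 2 * φ j ∧
      ((x = (.right, .top, (j : ℕ)) ∧ y = (.right, .bottom, (σ j : ℕ))) ∨
        (x = (.right, .bottom, (σ j : ℕ)) ∧ y = (.right, .top, (j : ℕ)))))
  circles m := {j | k j = m}.encard

/-! ## Checker surfaces -/

/-- The cycles of a permutation (fixed points included). -/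
abbrev Cycles {α : Type} (g : Equiv.Perm α) : Type := Quotient (Equiv.Perm.SameCycle.setoid g)

/-- A checker surface glued from `N` white and `N` black triangles, with sides coloured
`a, b, c` clockwise on white and anticlockwise on black triangles: the side `a` of the white
triangle `w` is glued to the side `a` of the black triangle `a w`, etc. -/
structure CheckerSurface (N : ℕ) where
  a : Equiv.Perm (Fin N)
  b : Equiv.Perm (Fin N)
  c : Equiv.Perm (Fin N)

namespace CheckerSurface

variable {N : ℕ} (S : CheckerSurface N)

/-- The next white triangle clockwise around the vertex between the sides `b` and `c`. -/
def rotA : Equiv.Perm (Fin N) := S.c⁻¹ * S.b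

/-- The next white triangle clockwise around the vertex between the sides `a` and `c`; the side
`c` of the white triangle is crossed first. -/
def rotB : Equiv.Perm (Fin N) := S.a⁻¹ * S.c

/-- The next white triangle counterclockwise around the vertex between the sides `a` and `b`;
the side `b` of the white triangle is crossed first. -/
def rotC : Equiv.Perm (Fin N) := S.a⁻¹ * S.b

/-- The `A`-vertex of a white triangle; the type of `A`-vertices is `Cycles S.rotA`. -/
def vertexA (w : Fin N) : Cycles S.rotA := Quotient.mk _ w

/-- The `B`-vertex of a white triangle. -/
def vertexB (w : Fin N) : Cycles S.rotB := Quotient.mk _ w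

/-- The `C`-vertex of a white triangle. -/
def vertexC (w : Fin N) : Cycles S.rotC := Quotient.mk _ w

/-- The order of an `A`-vertex: the number of white triangles at it. -/
noncomputable def ordA (A : Cycles S.rotA) : ℕ := Nat.card {w // S.vertexA w = A}

/-- The order of a `B`-vertex. -/
noncomputable def ordB (B : Cycles S.rotB) : ℕ := Nat.card {w // S.vertexB w = B}

/-- `p` on white and `q` on black triangles define an isomorphism of checker surfaces. -/
def IsIso (S S' : CheckerSurface N) (p q : Equiv.Perm (Fin N)) : Prop :=
  ∀ w, S'.a (p w) = q (S.a w) ∧ S'.b (p w) = q (S.b w) ∧ S'.c (p w) = q (S.c w)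

end CheckerSurface

section Labels

variable {N n : ℕ} (r : Equiv.Perm (Fin N)) (F : Fin n ↪ Fin N)

/-- The number of steps of the rotation `r` from the triangle labelled `i` to the next labelled
triangle. -/
noncomputable def returnTime (i : Fin n) : ℕ := sInf {m | 0 < m ∧ (r ^ m) (F i) ∈ Set.range F}

lemma returnTime_spec (i : Fin n) :
    0 < returnTime r F i ∧ (r ^ returnTime r F i) (F i) ∈ Set.range F :=
  Nat.sInf_mem (s := {m | 0 < m ∧ (r ^ m) (F i) ∈ Set.range F})
    ⟨orderOf r, orderOf_pos r, i, by simp [pow_orderOf_eq_one]⟩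

lemma exists_nextLabel (i : Fin n) : ∃ j, F j = (r ^ returnTime r F i) (F i) :=
  (returnTime_spec r F i).2

lemma nextLabel_injective :
    Function.Injective fun i => (exists_nextLabel r F i).choose := by
  have key : ∀ i j, (r ^ returnTime r F i) (F i) = (r ^ returnTime r F j) (F j) →
      returnTime r F i ≤ returnTime r F j → i = j := by
    intro i j h hle
    obtain ⟨d, hd⟩ := Nat.exists_eq_add_of_le hle
    rw [hd, pow_add, Equiv.Perm.mul_apply] at h
    have h' := (r ^ returnTime r F i).injective h
    rcases Nat.eq_zero_or_pos d with rfl | hpos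
    · exact F.injective (by simpa using h')
    · have : returnTime r F j ≤ d := Nat.sInf_le ⟨hpos, i, h'⟩
      have := (returnTime_spec r F i).1
      omega
  intro i j h
  have h' : (r ^ returnTime r F i) (F i) = (r ^ returnTime r F j) (F j) := by
    rw [← (exists_nextLabel r F i).choose_spec, ← (exists_nextLabel r F j).choose_spec]
    exact congrArg F h
  rcases le_total (returnTime r F i) (returnTime r F j) with hle | hle
  · exact key i j h' hle
  · exact (key j i h'.symm hle).symm

/-- The permutation of the labels that sends `i` to the next label met by the rotation `r`
started at the triangle labelled `i`. -/
noncomputable def nextLabel : Equiv.Perm (Fin n) :=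
  Equiv.ofBijective _ (Finite.injective_iff_bijective.1 (nextLabel_injective r F))

lemma nextLabel_spec (i : Fin n) : F (nextLabel r F i) = (r ^ returnTime r F i) (F i) :=
  (exists_nextLabel r F i).choose_spec

end Labels

/-- The guests at a table; the tables of a half-occupied restaurant are the cycles of `τ` and
the guest-free tables, which are enumerated by `ℕ`. -/
def guests {n : ℕ} {τ : Equiv.Perm (Fin n)} : Cycles τ ⊕ ℕ → Set (Fin n)
  | .inl T => {i | Quotient.mk _ i = T}
  | .inr _ => ∅

/-- A checker surface with a labelling `F` of some white triangles by the guests, and a map `ω`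
from the set of `B`-vertices to the set of tables. -/
structure Decorated {n : ℕ} (N : ℕ) (τ : Equiv.Perm (Fin n)) where
  surface : CheckerSurface N
  F : Fin n ↪ Fin N
  ω : Cycles surface.rotB → Cycles τ ⊕ ℕ

namespace Decorated

variable {n N : ℕ} {τ : Equiv.Perm (Fin n)}

/-- The compatibility conditions between the decorations, the chip, and the restaurant. -/
structure Admissible {p : ℕ} (σ : Equiv.Perm (Fin n)) (φ : Fin n → ℕ) (k : Fin p → ℕ)
    (x : Decorated N τ) : Prop where
  /-- Around `A`-vertices, the label `σ i` follows the label `i` clockwise, -/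
  next_A : nextLabel x.surface.rotA x.F = σ
  /-- with precisely `φ i` label-less white triangles between them. -/
  between_A : ∀ i, returnTime x.surface.rotA x.F i = φ i + 1
  /-- The `A`-vertices correspond bijectively to the cycles of `σ` and the circles of the
  chip. -/
  vertices_A : ∃ e : Cycles x.surface.rotA ≃ Cycles σ ⊕ Fin p, ∀ A,
    (∀ s, e A = .inl s → ∀ i, x.surface.vertexA (x.F i) = A ↔ Quotient.mk _ i = s) ∧
    (∀ j, e A = .inr j → x.surface.ordA A = k j ∧ ∀ i, x.surface.vertexA (x.F i) ≠ A)
  /-- Different `B`-vertices are sent to different tables. -/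
  injective : Function.Injective x.ω
  /-- The labels at a `B`-vertex are the guests at the corresponding table, -/
  labels_B : ∀ B i, x.surface.vertexB (x.F i) = B ↔ i ∈ guests (x.ω B)
  /-- in the same cyclic order, clockwise. -/
  next_B : nextLabel x.surface.rotB x.F = τ

/-- Isomorphism of decorated surfaces. -/
instance isoSetoid (N : ℕ) (τ : Equiv.Perm (Fin n)) : Setoid (Decorated N τ) where
  r x y := ∃ p q, CheckerSurface.IsIso x.surface y.surface p q ∧ (∀ i, p (x.F i) = y.F i) ∧
    ∀ w, y.ω (y.surface.vertexB (p w)) = x.ω (x.surface.vertexB w)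
  iseqv := by
    refine ⟨fun x => ⟨1, 1, fun w => ⟨rfl, rfl, rfl⟩, fun i => rfl, fun w => rfl⟩, ?_, ?_⟩
    · rintro x y ⟨p, q, h1, h2, h3⟩
      refine ⟨p⁻¹, q⁻¹, fun w => ?_, fun i => ?_, fun w => ?_⟩
      · obtain ⟨ha, hb, hc⟩ := h1 (p⁻¹ w)
        have e : p (p⁻¹ w) = w := by simp
        rw [e] at ha hb hc
        simp [ha, hb, hc]
      · rw [← h2]; simp
      · rw [← h3]; simp
    · rintro x y z ⟨p, q, h1, h2, h3⟩ ⟨p', q', h1', h2', h3'⟩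
      refine ⟨p' * p, q' * q, fun w => ?_, fun i => ?_, fun w => ?_⟩
      · obtain ⟨ha, hb, hc⟩ := h1 w
        obtain ⟨ha', hb', hc'⟩ := h1' (p w)
        simp [ha, hb, hc, ha', hb', hc']
      · simp [h2, h2']
      · simp only [Equiv.Perm.mul_apply, h3', h3]

/-- The isomorphism classes of admissible decorated surfaces. -/
def Classes {p : ℕ} (N : ℕ) (τ σ : Equiv.Perm (Fin n)) (φ : Fin n → ℕ) (k : Fin p → ℕ) : Type :=
  Quotient ((isoSetoid N τ).comap (Subtype.val : {x : Decorated N τ // x.Admissible σ φ k} → _))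

variable (x : Decorated N τ)

/-- The number of automorphisms fixing all `B`-vertices and all labelled triangles. -/
noncomputable def cardAut : ℕ :=
  Nat.card {pq : Equiv.Perm (Fin N) × Equiv.Perm (Fin N) //
    CheckerSurface.IsIso x.surface x.surface pq.1 pq.2 ∧ (∀ i, pq.1 (x.F i) = x.F i) ∧
    ∀ w, x.surface.vertexB (pq.1 w) = x.surface.vertexB w}

/-- The set `Φ` of `B`-vertices without labels. -/
def FreeB : Type := {B : Cycles x.surface.rotB // ∀ i, x.surface.vertexB (x.F i) ≠ B}

/-- The set `Ψ` of `C`-vertices without labels. -/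
def FreeC : Type := {C : Cycles x.surface.rotC // ∀ i, x.surface.vertexC (x.F i) ≠ C}

noncomputable instance : Fintype x.FreeB :=
  @Fintype.ofFinite _ (inferInstanceAs
    (Finite (Subtype fun B : Cycles x.surface.rotB => ∀ i, x.surface.vertexB (x.F i) ≠ B)))

noncomputable instance : Fintype x.FreeC :=
  @Fintype.ofFinite _ (inferInstanceAs
    (Finite (Subtype fun C : Cycles x.surface.rotC => ∀ i, x.surface.vertexC (x.F i) ≠ C)))

/-- The sets `T(·)` of black triangles: for a label `i`, the triangles met on the clockwise way
around a `B`-vertex from the label `i` to the next label; for a label-less `B`-vertex, all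
black triangles at it. -/
def T : Fin n ⊕ x.FreeB → Set (Fin N)
  | .inl i => {y | ∃ m < returnTime x.surface.rotB x.F i,
      y = x.surface.c ((x.surface.rotB ^ m) (x.F i))}
  | .inr B => {y | ∃ w, x.surface.vertexB w = B.1 ∧ y = x.surface.c w}

/-- The sets `R(·)` of black triangles: for a label `j`, the triangles met on the
counterclockwise way around a `C`-vertex from the label `j` to the next label; for a label-less
`C`-vertex, all black triangles at it. -/
def R : Fin n ⊕ x.FreeC → Set (Fin N)
  | .inl j => {y | ∃ m < returnTime x.surface.rotC x.F j,
      y = x.surface.b ((x.surface.rotC ^ m) (x.F j))}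
  | .inr C => {y | ∃ w, x.surface.vertexC w = C.1 ∧ y = x.surface.b w}

/-- The permutation `ρ` formed by the counterclockwise cycles of labels at `C`-vertices. -/
noncomputable def ρ : Equiv.Perm (Fin n) := nextLabel x.surface.rotC x.F

/-- The length of the guest-free table corresponding to a label-less `B`-vertex. -/
def freeLength (ℓ : ℕ → ℝ) (B : x.FreeB) : ℝ := Sum.elim (fun _ => 0) ℓ (x.ω B.1)

end Decorated

/-! ## Dirichlet distributions -/

section Dirichlet

variable {ι : Type} [Fintype ι]

open Classical in
/-- The point of the simplex `∑ x_i = s` with the coordinates `y i` for `i ≠ j`, `0 < m i`, and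
with zero coordinates for `i ≠ j`, `m i ≤ 0`. -/
noncomputable def simplexPoint (m : ι → ℝ) (s : ℝ) (j : ι) (y : {i // 0 < m i ∧ i ≠ j} → ℝ)
    (i : ι) : ℝ :=
  if i = j then s - ∑ i, y i else if h : 0 < m i ∧ i ≠ j then y ⟨i, h⟩ else 0

open Classical in
/-- The Dirichlet distribution on the simplex `∑ x_i = s`, `x_i ≥ 0`, with parameters `m i ≥ 0`:
it is supported on the face of those `i` for which `m i > 0`, where it has the density
proportional to `∏ x_i ^ (m i - 1)` with respect to the product of the differentials of all
coordinates except one. -/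
noncomputable def dirichlet (m : ι → ℝ) (s : ℝ) : Measure (ι → ℝ) :=
  if h : ∃ j, 0 < m j then
    ((volume : Measure ({i // 0 < m i ∧ i ≠ h.choose} → ℝ)).withDensity fun y =>
      if ∀ i, 0 ≤ simplexPoint m s h.choose y i then
        ENNReal.ofReal (Real.Gamma (∑ i, m i) * s ^ (1 - ∑ i, m i) *
          ∏ i with 0 < m i, simplexPoint m s h.choose y i ^ (m i - 1) / Real.Gamma (m i))
      else 0).map (simplexPoint m s h.choose)
  else Measure.dirac 0

/-- The convolution of a finite family of measures: the image of the product measure under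
addition. -/
noncomputable def convolution {κ : Type} [Fintype κ] (μ : κ → Measure (ι → ℝ)) :
    Measure (ι → ℝ) :=
  (Measure.pi μ).map fun x => ∑ r, x r

end Dirichlet

/-! ## The spreaded image -/

namespace Decorated

variable {n N : ℕ} {τ : Equiv.Perm (Fin n)} (x : Decorated N τ)

/-- The law of the new lengths: the convolution of Dirichlet distributions. -/
noncomputable def newLengths (l : Fin n → ℝ) (ℓ : ℕ → ℝ) : Measure (Fin n ⊕ x.FreeC → ℝ) :=
  convolution fun t : Fin n ⊕ x.FreeB =>
    dirichlet (fun s => (Nat.card ↥(x.T t ∩ x.R s) : ℝ)) (Sum.elim l (x.freeLength ℓ) t)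

/-- Replacement of `τ`, the arcs and the framed tables by `ρ` and the new lengths `y`. -/
noncomputable def replace (ℓ : ℕ → ℝ) (y : Fin n ⊕ x.FreeC → ℝ) : HalfRestaurant n :=
  HalfRestaurant.ofData (ι := {ν : ℕ // .inr ν ∉ Set.range x.ω} ⊕ x.FreeC) x.ρ
    (fun j => y (.inl j)) (Sum.elim (fun ν => ℓ ν) fun C => y (.inr C))

/-- The exponent `#{C-vertices} - #{B-vertices}`. -/
noncomputable def exponent : ℤ :=
  (Nat.card (Cycles x.surface.rotC) : ℤ) - Nat.card (Cycles x.surface.rotB)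

/-- The numerical coefficient of a summand. -/
noncomputable def weight (l : Fin n → ℝ) (ℓ : ℕ → ℝ) : ℝ :=
  1 / x.cardAut *
    (∏ i : Fin n, l i ^ (Nat.card ↥(x.T (.inl i)) - 1) /
      ((Nat.card ↥(x.T (.inl i)) - 1).factorial : ℝ)) *
    ∏ B : x.FreeB, x.freeLength ℓ B ^ x.surface.ordB B.1 /
      ((x.surface.ordB B.1 - 1).factorial : ℝ)

/-- A summand of the spreaded image. -/
noncomputable def summand (z : ℝ) (l : Fin n → ℝ) (ℓ : ℕ → ℝ) : Measure (HalfRestaurant n × ℝ) :=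
  ENNReal.ofReal (x.weight l ℓ) •
    ((x.newLengths l ℓ).map (x.replace ℓ)).prod (Measure.dirac (z ^ x.exponent))

end Decorated

/-- The spreaded image of the point with the data `τ, l, ℓ` under the chip with the data
`σ, φ, k`. -/
noncomputable def spreadedImage (z : ℝ) {n p : ℕ} (σ : Equiv.Perm (Fin n)) (φ : Fin n → ℕ)
    (k : Fin p → ℕ) (τ : Equiv.Perm (Fin n)) (l : Fin n → ℝ) (ℓ : ℕ → ℝ) :
    Measure (HalfRestaurant n × ℝ) :=
  ((∏ j, k j) * ∏ m ∈ Finset.univ.image k, (Nat.card {j // k j = m}).factorial : ℕ) •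
    Measure.sum fun X : Decorated.Classes (n + ∑ i, φ i + ∑ j, k j) τ σ φ k =>
      (Quotient.out X).1.summand z l ℓ

/-- The data of a point of the space of half-occupied restaurants: positive lengths of total
sum `1`. -/
def IsRestaurant {n : ℕ} (l : Fin n → ℝ) (ℓ : ℕ → ℝ) : Prop :=
  (∀ i, 0 < l i) ∧ (∀ ν, 0 < ℓ ν) ∧ HasSum ℓ (1 - ∑ i, l i)

end Chips

namespace Chips

open Equiv Function
open ENNReal (mul_right_inj ofReal ofReal_eq_zero ofReal_mul ofReal_ne_top ofReal_pow
  ofReal_prod_of_nonneg toReal_ofReal tsum_sigma')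
open Fin (castLEEmb val)
open Finset (card_filter card_univ filter_insert measurable_prod measurable_sum mem_erase
  mem_filter mem_image mem_range mem_univ mul_sum prod_congr prod_eq_zero prod_mul_distrib
  prod_nonneg prod_subtype range range_add_one sum_congr sum_const sum_div sum_filter sum_range_succ
  sum_subtype univ)
open HalfRestaurant (ofData)
open MeasurableEquiv (measurableEmbedding)
open MeasureTheory.Measure (dirac dirac_apply' map_map measurable_coe)
open Nat (card card_congr card_eq_fintype_card card_pos_iff find find_spec sInf_mem)
open Quotient (exists_rep inductionOn out_eq sound)
open Set (Icc Ici Ico Iic Iio Ioc Ioi Ioo indicator_apply indicator_of_mem indicator_of_notMem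
  mem_Ico mem_Ioi mem_Ioo mem_ofPred_eq mem_preimage mem_univ_pi)

noncomputable section

/-! ## The action on virtual permutations -/

lemma IsTranslate.unique {h : Perm ℕ × Perm ℕ} {u v w : VirtualPerm}
    (hv : IsTranslate h u v) (hw : IsTranslate h u w) : v = w := by
  ext1
  funext n
  obtain ⟨N, h1, h2⟩ := ((hv n).and (hw n)).exists
  obtain ⟨k, h3, h4⟩ := (h1.and h2).exists
  grind

lemma act_eq {h : bisymmetricGroup} {u v : VirtualPerm}
    (hv : IsTranslate (h : Perm ℕ × Perm ℕ) u v) : act h u = v :=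
  (act_spec h u).unique hv

lemma reduce_perm (u : VirtualPerm) {n k N : ℕ} (h1 : n ≤ N) (h2 : N ≤ n + k) :
    reduce n k (u.perm N) = u.perm n := by
  obtain ⟨d, rfl⟩ := Nat.exists_eq_add_of_le h1
  clear h1
  have key : ∀ d, reduce n d (u.perm (n + d)) = u.perm n := by
    intro d
    induction d with
    | zero => rfl
    | succ d ih => rw [reduce, ← add_assoc, u.compat, ih]
  rw [← key d]
  have h3 : d ≤ k := by omega
  clear h2
  induction k, h3 using Nat.le_induction with
  | base => rfl
  | succ k hk ih => rw [reduce, removePoint_of_fixed (u.fixes _ _ (by omega)), ih]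

lemma removePoint_conj {x y w : Perm ℕ} {a b : ℕ} (hx : x a = b) (hy : y a = b) :
    removePoint a (x⁻¹ * w * y) = x⁻¹ * removePoint b w * y := by
  have hx' : x⁻¹ b = a := by rw [← hx]; simp
  have : (x⁻¹ * w * y) a = x⁻¹ (w b) := by simp [hy]
  rw [removePoint, this, removePoint, ← hx', swap_apply_apply]
  simp [mul_assoc]

lemma reduce_conj {x y w : Perm ℕ} {K n : ℕ} (hK : K ≤ n) (hx : ∀ i, K ≤ i → x i = i)
    (hy : ∀ i, K ≤ i → y i = i) (k : ℕ) :
    reduce n k (x⁻¹ * w * y) = x⁻¹ * reduce n k w * y := by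
  induction k generalizing w with
  | zero => rfl
  | succ k ih => rw [reduce, reduce, removePoint_conj (hx _ (by omega)) (hy _ (by omega)), ih]

lemma act_perm_of_fixes {h : bisymmetricGroup} {K : ℕ}
    (h1 : ∀ i, K ≤ i → (h : Perm ℕ × Perm ℕ).1 i = i)
    (h2 : ∀ i, K ≤ i → (h : Perm ℕ × Perm ℕ).2 i = i) (u : VirtualPerm) {M : ℕ}
    (hM : K ≤ M) : (act h u).perm M =
      (h : Perm ℕ × Perm ℕ).1⁻¹ * u.perm M * (h : Perm ℕ × Perm ℕ).2 := by
  obtain ⟨N, hN, hN'⟩ := ((act_spec h u M).and (eventually_ge_atTop M)).exists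
  obtain ⟨k, hk, hk'⟩ := (hN.and (eventually_ge_atTop N)).exists
  rw [← hk, reduce_conj hM h1 h2, reduce_perm u hN' (by omega)]

lemma exists_forall_inv_eq (h : bisymmetricGroup) (n : ℕ) : ∃ N, ∀ b, N ≤ b →
    (h : Perm ℕ × Perm ℕ).2 ((h : Perm ℕ × Perm ℕ).1⁻¹ b) = b ∧
      n ≤ (h : Perm ℕ × Perm ℕ).1⁻¹ b := by
  obtain ⟨⟨h1, h2⟩, hh⟩ := h
  have hh' : {i | (h1 * h2⁻¹) i ≠ i}.Finite := hh
  obtain ⟨A, hA⟩ := hh'.bddAbove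
  obtain ⟨B, hB⟩ := ((Set.finite_Iio n).image h1).bddAbove
  refine ⟨A + B + 1, fun b hb => ⟨?_, ?_⟩⟩
  · by_contra hc
    have : b ∈ {i | (h1 * h2⁻¹) i ≠ i} := by
      intro e
      apply hc
      have e' : h1⁻¹ b = h2⁻¹ b := by rw [Perm.inv_eq_iff_eq]; exact e.symm
      simp [e']
    have := hA this
    omega
  · by_contra hc
    have := hB (Set.mem_image_of_mem h1 (show h1⁻¹ b ∈ Iio n by simpa using hc))
    simp at this
    omega

lemma act_mul (g h : bisymmetricGroup) (u : VirtualPerm) : act (g * h) u = act h (act g u) := by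
  refine act_eq fun n => ?_
  obtain ⟨N₀, hN₀⟩ := exists_forall_inv_eq h n
  obtain ⟨N, hN, hN'⟩ := ((act_spec h (act g u) n).and (eventually_ge_atTop N₀)).exists
  filter_upwards [act_spec g u N] with K hK
  obtain ⟨k', hk'⟩ := hK.exists
  have key : ∀ k' X, ∀ᶠ k in atTop, reduce n k ((h : Perm ℕ × Perm ℕ).1⁻¹ * reduce N k' X *
        (h : Perm ℕ × Perm ℕ).2) =
      reduce n k ((h : Perm ℕ × Perm ℕ).1⁻¹ * X * (h : Perm ℕ × Perm ℕ).2) := by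
    intro k'
    induction k' with
    | zero => intro X; exact Eventually.of_forall fun _ => rfl
    | succ k' ih =>
      intro X
      obtain ⟨h1, h2⟩ := hN₀ (N + k') (by omega)
      filter_upwards [ih (removePoint (N + k') X), eventually_gt_atTop
        ((h : Perm ℕ × Perm ℕ).1⁻¹ (N + k'))] with k hk hk2
      rw [reduce, hk, ← removePoint_conj (a := (h : Perm ℕ × Perm ℕ).1⁻¹ (N + k'))
        (by simp) h1, reduce_absorb h2 (by omega)]
  filter_upwards [hN, key k' _] with k h1 h2
  rw [hk'] at h2
  rw [← h1, h2]
  simp [mul_assoc]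

lemma act_one (u : VirtualPerm) : act 1 u = u := by
  ext1
  funext M
  simpa using act_perm_of_fixes (h := 1) (K := 0) (by simp) (by simp) u (Nat.zero_le M)

lemma measurableSet_perm_eq (n : ℕ) (g : Perm ℕ) : MeasurableSet {u : VirtualPerm | u.perm n = g} :=
  MeasurableSpace.measurableSet_generateFrom ⟨n, g, rfl⟩

lemma finite_setOf_fixes (n : ℕ) : {w : Perm ℕ | ∀ i, n ≤ i → w i = i}.Finite := by
  let f : {w : Perm ℕ | ∀ i, n ≤ i → w i = i} → Perm (Fin n) := fun w => toFinPerm n w.1 w.2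
  have hf : Injective f := by
    rintro ⟨w, hw⟩ ⟨w', hw'⟩ h
    ext i
    by_cases hi : n ≤ i
    · simp [hw i hi, hw' i hi]
    · have := congrArg (fun g : Perm (Fin n) => (g ⟨i, by omega⟩ : ℕ)) h
      simpa [f, toFinPerm, Fin.equivSubtype] using this
  exact Set.finite_coe_iff.1 (Finite.of_injective f hf)

lemma measurableSet_perm (n : ℕ) (S : Set (Perm ℕ)) :
    MeasurableSet {u : VirtualPerm | u.perm n ∈ S} := by
  have : {u : VirtualPerm | u.perm n ∈ S} =
      ⋃ g ∈ {w : Perm ℕ | ∀ i, n ≤ i → w i = i} ∩ S, {u : VirtualPerm | u.perm n = g} := by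
    ext u
    simp only [mem_ofPred_eq, Set.mem_iUnion, Set.mem_inter_iff, exists_prop]
    exact ⟨fun h => ⟨_, ⟨u.fixes n, h⟩, rfl⟩, by rintro ⟨g, ⟨_, h⟩, rfl⟩; exact h⟩
  rw [this]
  exact MeasurableSet.biUnion ((finite_setOf_fixes n).subset Set.inter_subset_left).countable
    fun g _ => measurableSet_perm_eq n g

lemma measurable_perm_comp {β : Type*} [MeasurableSpace β] (n : ℕ) (f : Perm ℕ → β) :
    Measurable fun u : VirtualPerm => f (u.perm n) :=
  fun S _ => measurableSet_perm n (f ⁻¹' S)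

lemma measurable_act (h : bisymmetricGroup) : Measurable (act h) := by
  refine measurable_generateFrom ?_
  rintro _ ⟨n, g, rfl⟩
  have : act h ⁻¹' {u | u.perm n = g} = {u | ∀ᶠ N in atTop, ∀ᶠ k in atTop,
      reduce n k ((h : Perm ℕ × Perm ℕ).1⁻¹ * u.perm N * (h : Perm ℕ × Perm ℕ).2) = g} := by
    ext u
    simp only [mem_preimage, mem_ofPred_eq]
    constructor
    · rintro rfl
      exact act_spec h u n
    · intro H
      obtain ⟨N, h1, h2⟩ := (H.and (act_spec h u n)).exists
      obtain ⟨k, h3, h4⟩ := (h1.and h2).exists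
      grind
  rw [this]
  simp only [eventually_atTop, Set.ofPred_exists, Set.ofPred_forall]
  refine MeasurableSet.iUnion fun a => MeasurableSet.iInter fun b => MeasurableSet.iInter fun _ =>
    MeasurableSet.iUnion fun c => MeasurableSet.iInter fun d => MeasurableSet.iInter fun _ => ?_
  exact measurableSet_perm b {w | reduce n d ((h : Perm ℕ × Perm ℕ).1⁻¹ * w *
        (h : Perm ℕ × Perm ℕ).2) = g}

/-! ## First returns -/

/-- The path `i, g i, g² i, …` returns to `{0, …, n - 1}` for the first time after `p + 1` steps,
at the point `j`. -/
def FirstReturn (n : ℕ) (g : Perm ℕ) (i p j : ℕ) : Prop :=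
  (∀ q < p, n ≤ (g ^ (q + 1)) i) ∧ (g ^ (p + 1)) i = j ∧ j < n

lemma FirstReturn.sInf_eq {n i p j : ℕ} {g : Perm ℕ} (h : FirstReturn n g i p j) :
    sInf {p | (g ^ (p + 1)) i < n} = p := by
  have hp : p ∈ {p | (g ^ (p + 1)) i < n} := by have := h.2.2; rw [← h.2.1] at this; exact this
  refine le_antisymm (Nat.sInf_le hp) ?_
  by_contra hc
  have h1 := h.1 _ (not_le.1 hc)
  have h2 : sInf {p | (g ^ (p + 1)) i < n} ∈ {p | (g ^ (p + 1)) i < n} := sInf_mem ⟨p, hp⟩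
  simp only [mem_ofPred_eq] at h2
  omega

lemma FirstReturn.cons {n i p r j : ℕ} {g : Perm ℕ}
    (h1 : ∀ q < p, n ≤ (g ^ (q + 1)) i) (h2 : n ≤ (g ^ (p + 1)) i)
    (h3 : FirstReturn n g ((g ^ (p + 1)) i) r j) : FirstReturn n g i (p + 1 + r) j := by
  obtain ⟨ha, hb, hc⟩ := h3
  refine ⟨fun q hq => ?_, ?_, hc⟩
  · rcases lt_trichotomy q p with h | rfl | h
    · exact h1 q h
    · exact h2
    · have := ha (q - p - 1) (by omega)
      rwa [← Perm.mul_apply, ← pow_add, show q - p - 1 + 1 + (p + 1) = q + 1 by omega] at this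
  · rw [← hb, ← Perm.mul_apply, ← pow_add]
    grind

lemma FirstReturn.comp {n N : ℕ} (hn : n ≤ N) {g w : Perm ℕ} {p : ℕ → ℕ}
    (h : ∀ x < N, FirstReturn N g x (p x) (w x)) (r : ℕ) : ∀ i < N, ∀ j, FirstReturn n w i r j →
    ∃ P, FirstReturn n g i P j ∧ P + 1 = ∑ m ∈ range (r + 1), (p ((w ^ m) i) + 1) := by
  induction r with
  | zero =>
    intro i hi j hj
    obtain ⟨h1, h2, h3⟩ := h i hi
    obtain ⟨_, h5, h6⟩ := hj
    refine ⟨p i, ⟨fun q hq => hn.trans (h1 q hq), ?_, h6⟩, by simp⟩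
    rw [h2, ← h5]; simp
  | succ r ih =>
    intro i hi j ⟨ha, hb, hc⟩
    obtain ⟨h1, h2, h3⟩ := h i hi
    obtain ⟨P, hP, hP'⟩ := ih (w i) h3 j ⟨fun q hq => by
        have := ha (q + 1) (by omega)
        rwa [pow_succ, Perm.mul_apply] at this,
       by rwa [pow_succ, Perm.mul_apply] at hb, hc⟩
    rw [← h2] at hP
    refine ⟨p i + 1 + P, FirstReturn.cons (fun q hq => hn.trans (h1 q hq)) ?_ hP, ?_⟩
    · rw [h2]; simpa using ha 0 (by omega)
    · rw [Finset.sum_range_succ', add_assoc, hP', add_comm]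
      simp [pow_succ]

lemma firstReturn_removePoint (M : ℕ) (g : Perm ℕ) (hg : ∀ i, M + 1 ≤ i → g i = i)
    (x : ℕ) (hx : x < M) : ∃ p, FirstReturn M g x p (removePoint M g x) := by
  have hlt : ∀ y, y < M → g y ≤ M := by
    intro y hy
    by_contra hc
    have := g.injective (hg (g y) (by omega))
    omega
  by_cases h : g x = M
  · have hne : g M ≠ M := fun e => hx.ne (g.injective (h.trans e.symm))
    have hle : g M ≤ M := by
      by_contra hc
      have := g.injective (hg (g M) (by omega))
      omega
    refine ⟨1, ?_, ?_, ?_⟩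
    · intro q hq
      obtain rfl : q = 0 := by omega
      simp [h]
    · simp [removePoint, pow_succ, h]
    · simp [removePoint, h]; omega
  · have hne : g x ≠ g M := fun e => hx.ne (g.injective e)
    have e : removePoint M g x = g x := by simp [removePoint, swap_apply_of_ne_of_ne h hne]
    refine ⟨0, by simp, by simp [e], ?_⟩
    grind

lemma VirtualPerm.perm_lt (v : VirtualPerm) {n i : ℕ} (h : i < n) : v.perm n i < n := by
  by_contra hc
  have := (v.perm n).injective (v.fixes n _ (not_lt.1 hc))
  omega

lemma VirtualPerm.pow_lt (v : VirtualPerm) {n i : ℕ} (h : i < n) (m : ℕ) :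
    (v.perm n ^ m) i < n := by
  induction m with
  | zero => simpa
  | succ m ih => rw [pow_succ', Perm.mul_apply]; exact v.perm_lt ih

lemma firstReturn_perm (v : VirtualPerm) {n M : ℕ} (h : n ≤ M) : ∀ i < n,
    FirstReturn n (v.perm M) i (gap v n M i) (v.perm n i) := by
  suffices H : ∀ i < n, ∃ p, FirstReturn n (v.perm M) i p (v.perm n i) by
    intro i hi
    obtain ⟨p, hp⟩ := H i hi
    rw [gap, hp.sInf_eq]
    exact hp
  induction M, h using Nat.le_induction with
  | base => exact fun i hi => ⟨0, by simp, by simp, v.perm_lt hi⟩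
  | succ M hM ih =>
    intro i hi
    obtain ⟨r, hr⟩ := ih i hi
    have := fun x hx => firstReturn_removePoint M (v.perm (M + 1)) (v.fixes _) x hx
    choose! p hp using this
    rw [v.compat M] at hp
    obtain ⟨P, hP, _⟩ := FirstReturn.comp hM hp r i (by omega) _ hr
    exact ⟨P, hP⟩

lemma gap_eq_sum (v : VirtualPerm) {n N M i : ℕ} (h1 : n ≤ N) (h2 : N ≤ M) (hi : i < n) :
    gap v n M i + 1 = ∑ m ∈ range (gap v n N i + 1), (gap v N M ((v.perm N ^ m) i) + 1) := by
  obtain ⟨P, hP, hP'⟩ := FirstReturn.comp h1 (firstReturn_perm v h2) _ i (by omega) _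
    (firstReturn_perm v h1 i hi)
  rw [← hP', gap, hP.sInf_eq]

lemma pow_sum_gap (v : VirtualPerm) {N M i : ℕ} (h : N ≤ M) (hi : i < N) (r : ℕ) :
    (v.perm M ^ ∑ m ∈ range r, (gap v N M ((v.perm N ^ m) i) + 1)) i = (v.perm N ^ r) i ∧
    ∀ t, t < ∑ m ∈ range r, (gap v N M ((v.perm N ^ m) i) + 1) →
      N ≤ (v.perm M ^ t) i ∨ ∃ m < r, (v.perm M ^ t) i = (v.perm N ^ m) i ∧ (m = 0 → t = 0) := by
  induction r with
  | zero => simp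
  | succ r ih =>
    set S := ∑ m ∈ range r, (gap v N M ((v.perm N ^ m) i) + 1) with hS
    obtain ⟨h1, h2⟩ := ih
    set x := (v.perm N ^ r) i with hx
    obtain ⟨ha, hb, _⟩ := firstReturn_perm v h x (v.pow_lt hi r)
    have hz : r = 0 → S = 0 := by rintro rfl; simp [hS]
    rw [sum_range_succ, ← hS, ← hx]
    constructor
    · rw [add_comm, pow_add, Perm.mul_apply, h1, hb, hx, pow_succ', Perm.mul_apply]
    · intro t ht
      rcases lt_trichotomy t S with h3 | h3 | h3
      · obtain h4 | ⟨m, hm, h4⟩ := h2 t h3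
        · exact Or.inl h4
        · exact Or.inr ⟨m, by omega, h4⟩
      · exact Or.inr ⟨r, by omega, by rw [h3, h1], fun e => by rw [h3, hz e]⟩
      · left
        have := ha (t - S - 1) (by omega)
        rwa [← h1, ← Perm.mul_apply, ← pow_add, show t - S - 1 + 1 + S = t by omega] at this

lemma VirtualPerm.exists_pow_eq (v : VirtualPerm) (N i : ℕ) : 0 < minimalPeriod (v.perm N) i := by
  apply minimalPeriod_pos_of_mem_periodicPts
  by_cases hi : i < N
  · have hinj : ¬ Injective fun m : ℕ => (⟨(v.perm N ^ m) i, v.pow_lt hi m⟩ : Fin N) :=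
      not_injective_infinite_finite _
    simp only [Injective, not_forall] at hinj
    obtain ⟨a, b, hab, hne⟩ := hinj
    simp only [Fin.mk.injEq] at hab
    wlog hlt : a < b generalizing a b
    · grind
    refine ⟨b - a, by omega, ?_⟩
    rw [IsPeriodicPt, IsFixedPt, Perm.iterate_eq_pow]
    apply (v.perm N ^ a).injective
    rw [← Perm.mul_apply, ← pow_add, hab]
    grind
  · exact ⟨1, one_pos, v.fixes N i (by omega)⟩

lemma minimalPeriod_eq_sum (v : VirtualPerm) {N M i : ℕ} (h : N ≤ M) (hi : i < N) :
    minimalPeriod (v.perm M) i = ∑ m ∈ range (minimalPeriod (v.perm N) i),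
        (gap v N M ((v.perm N ^ m) i) + 1) := by
  set r := minimalPeriod (v.perm N) i with hr
  have hr0 : 0 < r := v.exists_pow_eq N i
  obtain ⟨h1, h2⟩ := pow_sum_gap v h hi r
  have hper : ∀ m, (v.perm N ^ m) i = i → r ∣ m := by
    intro m hm
    apply IsPeriodicPt.minimalPeriod_dvd
    rw [IsPeriodicPt, IsFixedPt, Perm.iterate_eq_pow, hm]
  have hri : (v.perm N ^ r) i = i := by
    have := isPeriodicPt_minimalPeriod (v.perm N) i
    rwa [IsPeriodicPt, IsFixedPt, Perm.iterate_eq_pow] at this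
  rw [hri] at h1
  refine le_antisymm ?_ ?_
  · refine IsPeriodicPt.minimalPeriod_le (Finset.sum_pos (fun _ _ => by omega)
      ⟨0, by simpa using hr0⟩) ?_
    rw [IsPeriodicPt, IsFixedPt, Perm.iterate_eq_pow, h1]
  · by_contra hc
    have hq : (v.perm M ^ minimalPeriod (v.perm M) i) i = i := by
      have := isPeriodicPt_minimalPeriod (v.perm M) i
      rwa [IsPeriodicPt, IsFixedPt, Perm.iterate_eq_pow] at this
    have hp := v.exists_pow_eq M i
    rcases h2 _ (not_le.1 hc) with h3 | ⟨m, hm, h3, h4⟩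
    · omega
    · rw [hq] at h3
      have h5 := hper m h3.symm
      rcases Nat.eq_zero_or_pos m with h6 | h6
      · grind
      · have := Nat.le_of_dvd h6 h5; omega

lemma sameCycle_perm (v : VirtualPerm) {N M i j : ℕ} (h : N ≤ M) (hi : i < N) (hj : j < N) :
    (v.perm N).SameCycle i j ↔ (v.perm M).SameCycle i j := by
  induction M, h using Nat.le_induction with
  | base => rfl
  | succ M hM ih => rw [ih, ← v.compat M, sameCycle_removePoint _ (by omega) (by omega)]

lemma opener_iff (v : VirtualPerm) {N m : ℕ} (h : m < N) :
    v.perm (m + 1) m = m ↔ ∀ j, (v.perm N).SameCycle m j → m ≤ j := by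
  constructor
  · intro e j hj
    by_contra hc
    rw [← sameCycle_perm v h (by omega) (by omega)] at hj
    have := Perm.SameCycle.eq_of_left hj e
    omega
  · intro H
    have h1 := v.perm_lt (n := m + 1) (i := m) (by omega)
    have := H (v.perm (m + 1) m) (by
      rw [← sameCycle_perm v h (by omega) h1]
      exact Perm.sameCycle_apply_right.2 (Perm.SameCycle.refl _ _))
    omega

/-! ## Segments of cycles -/

section Segments

variable {N n : ℕ} (r : Perm (Fin N)) (F : Fin n ↪ Fin N)

/-- The cycles without labels. -/
abbrev FreeCycles : Type := {C : Cycles r // ∀ i, (Quotient.mk _ (F i) : Cycles r) ≠ C}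

instance : Fintype (FreeCycles r F) := Fintype.ofFinite _

/-- The pieces into which the labels cut the cycles of `r`. -/
def segment : Fin n ⊕ FreeCycles r F → Set (Fin N)
  | .inl i => {w | ∃ m < returnTime r F i, w = (r ^ m) (F i)}
  | .inr C => {w | (Quotient.mk _ w : Cycles r) = C.1}

variable {r F}

lemma notMem_range_of_lt_returnTime {i : Fin n} {m : ℕ} (h0 : 0 < m)
    (h : m < returnTime r F i) : (r ^ m) (F i) ∉ Set.range F := fun hc =>
  absurd (Nat.sInf_le (s := {m | 0 < m ∧ (r ^ m) (F i) ∈ Set.range F}) ⟨h0, hc⟩)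
    (not_le.2 h)

lemma returnTime_eq {i : Fin n} {t : ℕ} (h0 : 0 < t) (ht : (r ^ t) (F i) ∈ Set.range F)
    (h : ∀ m, 0 < m → m < t → (r ^ m) (F i) ∉ Set.range F) : returnTime r F i = t := by
  refine le_antisymm (Nat.sInf_le ⟨h0, ht⟩) ?_
  by_contra hc
  exact h _ (returnTime_spec r F i).1 (not_le.1 hc) (returnTime_spec r F i).2

lemma pow_eq_pow_of_lt_returnTime {i j : Fin n} {m m' : ℕ} (hm : m < returnTime r F i)
    (hm' : m' < returnTime r F j) (h : (r ^ m) (F i) = (r ^ m') (F j)) : i = j ∧ m = m' := by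
  wlog hle : m ≤ m' generalizing i j m m'
  · grind
  obtain ⟨d, rfl⟩ := Nat.exists_eq_add_of_le hle
  rw [pow_add, Perm.mul_apply] at h
  have h' := (r ^ m).injective h
  rcases Nat.eq_zero_or_pos d with rfl | hd
  · exact ⟨F.injective (by simpa using h'), rfl⟩
  · exact absurd ⟨i, h'⟩ (notMem_range_of_lt_returnTime hd (by omega))

lemma mk_pow_apply (x : Fin N) (m : ℕ) : (Quotient.mk _ ((r ^ m) x) : Cycles r) = Quotient.mk _ x :=
  sound (s := Perm.SameCycle.setoid r) (Perm.sameCycle_pow_left.2 (Perm.SameCycle.refl r x))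

lemma mk_eq_mk_iff {x y : Fin N} :
    (Quotient.mk _ x : Cycles r) = Quotient.mk _ y ↔ r.SameCycle x y :=
  ⟨fun h => Quotient.exact (s := Perm.SameCycle.setoid r) h,
    fun h => sound (s := Perm.SameCycle.setoid r) h⟩

lemma exists_pow_eq_of_mk_eq {x y : Fin N} (h : (Quotient.mk _ x : Cycles r) = Quotient.mk _ y) :
    ∃ m : ℕ, (r ^ m) x = y := by
  obtain ⟨m, _, h⟩ := (mk_eq_mk_iff.1 h).exists_pow_eq'
  grind

variable (r F)

lemma existsUnique_segment (w : Fin N) : ∃! t, w ∈ segment r F t := by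
  refine existsUnique_of_exists_of_unique ?_ ?_
  · by_cases h : ∃ i, (Quotient.mk _ (F i) : Cycles r) = Quotient.mk _ w
    · have hex : ∃ a : ℕ, ∃ i, (r ^ a) (F i) = w := by
        obtain ⟨i, hi⟩ := h
        obtain ⟨a, ha⟩ := exists_pow_eq_of_mk_eq hi
        grind
      classical
      obtain ⟨i, hi⟩ := find_spec hex
      refine ⟨.inl i, find hex, ?_, hi.symm⟩
      by_contra hc
      have h1 := nextLabel_spec r F i
      refine Nat.find_min hex (m := find hex - returnTime r F i) ?_ ⟨nextLabel r F i, ?_⟩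
      · have := (returnTime_spec r F i).1; omega
      · rw [h1, ← Perm.mul_apply, ← pow_add, Nat.sub_add_cancel (not_lt.1 hc), hi]
    · push Not at h
      exact ⟨.inr ⟨_, h⟩, rfl⟩
  · rintro (i | C) (j | D) h1 h2
    · obtain ⟨m, hm, h1⟩ := h1
      obtain ⟨m', hm', h2⟩ := h2
      rw [(pow_eq_pow_of_lt_returnTime hm hm' (h1.symm.trans h2)).1]
    · obtain ⟨m, hm, rfl⟩ := h1
      exact absurd ((mk_pow_apply (F i) m).symm.trans h2) (D.2 i)
    · obtain ⟨m, hm, rfl⟩ := h2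
      exact absurd ((mk_pow_apply (F j) m).symm.trans h1) (C.2 j)
    · congr 1
      exact Subtype.ext (h1.symm.trans h2)

/-- The segment that contains a given point. -/
def seg (w : Fin N) : Fin n ⊕ FreeCycles r F := (existsUnique_segment r F w).choose

variable {r F}

lemma seg_eq_iff {w : Fin N} {t : Fin n ⊕ FreeCycles r F} : seg r F w = t ↔ w ∈ segment r F t :=
  ⟨fun h => h ▸ (existsUnique_segment r F w).choose_spec.1,
    fun h => ((existsUnique_segment r F w).choose_spec.2 t h).symm⟩

open Classical in
lemma sum_seg_inl {M : Type*} [AddCommMonoid M] (f : Fin N → M) (j : Fin n) :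
    ∑ k with seg r F k = .inl j, f k = ∑ m ∈ range (returnTime r F j), f ((r ^ m) (F j)) := by
  symm
  refine Finset.sum_bij (fun m _ => (r ^ m) (F j)) ?_ ?_ ?_ fun _ _ => rfl
  · intro m hm
    simp only [mem_filter, mem_univ, true_and, seg_eq_iff]
    exact ⟨m, mem_range.1 hm, rfl⟩
  · intro m hm m' hm' h
    exact (pow_eq_pow_of_lt_returnTime (mem_range.1 hm) (mem_range.1 hm') h).2
  · intro k hk
    simp only [mem_filter, mem_univ, true_and, seg_eq_iff] at hk
    obtain ⟨m, hm, rfl⟩ := hk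
    grind

open Classical in
lemma sum_seg_inr {M : Type*} [AddCommMonoid M] (f : Fin N → M) (C : FreeCycles r F) (x : Fin N)
    (hx : Quotient.mk _ x = C.1) :
    ∑ k with seg r F k = .inr C, f k = ∑ m ∈ range (minimalPeriod r x), f ((r ^ m) x) := by
  have hpos : 0 < minimalPeriod r x := by
    apply minimalPeriod_pos_of_mem_periodicPts
    exact ⟨orderOf r, orderOf_pos r, by
      rw [IsPeriodicPt, IsFixedPt, Perm.iterate_eq_pow, pow_orderOf_eq_one]
      rfl⟩
  symm
  refine Finset.sum_bij (fun m _ => (r ^ m) x) ?_ ?_ ?_ fun _ _ => rfl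
  · intro m hm
    simp only [mem_filter, mem_univ, true_and, seg_eq_iff]
    exact (mk_pow_apply x m).trans hx
  · intro m hm m' hm' h
    simp only [← Perm.iterate_eq_pow] at h
    exact iterate_injOn_Iio_minimalPeriod (mem_range.1 hm) (mem_range.1 hm') h
  · intro k hk
    simp only [mem_filter, mem_univ, true_and, seg_eq_iff] at hk
    obtain ⟨m, hm⟩ := exists_pow_eq_of_mk_eq (hx.trans hk.symm)
    refine ⟨m % minimalPeriod r x, mem_range.2 (Nat.mod_lt _ hpos), ?_⟩
    rw [← hm, ← Perm.iterate_eq_pow, ← Perm.iterate_eq_pow, iterate_mod_minimalPeriod_eq]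

end Segments

/-! ## Forgetting guests -/

lemma toFinPerm_apply (n : ℕ) (w : Perm ℕ) (hw : ∀ i, n ≤ i → w i = i) (i : Fin n) :
    (toFinPerm n w hw i : ℕ) = w i := by
  simp [toFinPerm, Fin.equivSubtype]

lemma toFinPerm_pow_apply (n : ℕ) (w : Perm ℕ) (hw : ∀ i, n ≤ i → w i = i) (i : Fin n)
    (m : ℕ) : ((toFinPerm n w hw ^ m) i : ℕ) = (w ^ m) i := by
  induction m with
  | zero => rfl
  | succ m ih => rw [pow_succ', pow_succ', Perm.mul_apply, Perm.mul_apply, toFinPerm_apply, ih]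

/-- The restriction of `v.perm n` to `Fin n`. -/
def VirtualPerm.fin (v : VirtualPerm) (n : ℕ) : Perm (Fin n) :=
  toFinPerm n (v.perm n) (v.fixes n)

section Forget

variable {n N : ℕ} (h : n ≤ N) (v : VirtualPerm)

lemma mem_range_castLEEmb {h : n ≤ N} {x : Fin N} : x ∈ Set.range (castLEEmb h) ↔ (x : ℕ) < n :=
  ⟨by rintro ⟨i, rfl⟩; exact i.2, fun hx => ⟨⟨x, hx⟩, rfl⟩⟩

lemma returnTime_castLEEmb (i : Fin n) :
    returnTime (v.fin N) (castLEEmb h) i = gap v n N i + 1 := by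
  obtain ⟨h1, h2, h3⟩ := firstReturn_perm v h i i.2
  refine returnTime_eq (by omega) ?_ fun m hm hm' => ?_
  · rw [mem_range_castLEEmb, VirtualPerm.fin, toFinPerm_pow_apply]
    exact h2 ▸ h3
  · rw [mem_range_castLEEmb, VirtualPerm.fin, toFinPerm_pow_apply]
    have := h1 (m - 1) (by omega)
    rw [Nat.sub_add_cancel hm] at this
    exact not_lt.2 this

lemma nextLabel_castLEEmb : nextLabel (v.fin N) (castLEEmb h) = v.fin n := by
  ext i
  have h1 := congrArg val (nextLabel_spec (v.fin N) (castLEEmb h) i)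
  rw [returnTime_castLEEmb h v, VirtualPerm.fin, toFinPerm_pow_apply] at h1
  exact h1.trans ((firstReturn_perm v h i i.2).2.1.trans (toFinPerm_apply _ _ _ _).symm)

lemma sameCycle_fin_iff (x y : Fin N) : (v.fin N).SameCycle x y ↔ (v.perm N).SameCycle x y := by
  constructor
  · intro hxy
    obtain ⟨m, _, e⟩ := hxy.exists_pow_eq'
    refine ⟨m, ?_⟩
    rw [zpow_natCast, ← e, VirtualPerm.fin, toFinPerm_pow_apply]
  · intro hxy
    obtain ⟨m, e | e⟩ := exists_pow_of_sameCycle hxy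
    · exact ⟨m, by ext; rw [zpow_natCast, VirtualPerm.fin, toFinPerm_pow_apply, e]⟩
    · exact Perm.SameCycle.symm
        ⟨m, by ext; rw [zpow_natCast, VirtualPerm.fin, toFinPerm_pow_apply, e]⟩

lemma minimalPeriod_fin (x : Fin N) : minimalPeriod (v.fin N) x = minimalPeriod (v.perm N) x := by
  refine minimalPeriod_eq_minimalPeriod_iff.2 fun m => ?_
  simp only [IsPeriodicPt, IsFixedPt, Perm.iterate_eq_pow]
  rw [Fin.ext_iff, VirtualPerm.fin, toFinPerm_pow_apply]

lemma HalfRestaurant.ofData_comp_equiv {ι κ : Type} (e : ι ≃ κ) (τ : Perm (Fin n))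
    (l : Fin n → ℝ) (ℓ : κ → ℝ) :
    ofData τ l (fun i => ℓ (e i)) = ofData τ l ℓ := by
  simp only [ofData]
  congr 2
  ext s hs
  rw [Measure.sum_apply _ hs, Measure.sum_apply _ hs]
  exact e.tsum_eq fun i => (dirac (ℓ i)) s

lemma bijective_openers : ∃ f : {m : ℕ // n ≤ m ∧ v.perm (m + 1) m = m} ≃
    FreeCycles (v.fin N) (castLEEmb h) ⊕ {m : ℕ // N ≤ m ∧ v.perm (m + 1) m = m},
    (∀ m, ∀ hm : m.1 < N, ∃ C, f m = .inl C ∧ Quotient.mk _ ⟨m.1, hm⟩ = C.1) ∧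
    ∀ m, ∀ hm : N ≤ m.1, f m = .inr ⟨m.1, hm, m.2.2⟩ := by
  have hfree : ∀ m : {m : ℕ // n ≤ m ∧ v.perm (m + 1) m = m}, ∀ hm : m.1 < N, ∀ i,
      (Quotient.mk _ (castLEEmb h i) : Cycles (v.fin N)) ≠ Quotient.mk _ ⟨m.1, hm⟩ := by
    intro m hm i hc
    have h1 := (sameCycle_fin_iff v _ _).1 (mk_eq_mk_iff.1 hc)
    have h2 := (opener_iff v hm).1 m.2.2 _ h1.symm
    have h3 := m.2.1
    have h4 := i.2
    simp at h2
    omega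
  let f : {m : ℕ // n ≤ m ∧ v.perm (m + 1) m = m} →
    FreeCycles (v.fin N) (castLEEmb h) ⊕ {m : ℕ // N ≤ m ∧ v.perm (m + 1) m = m} := fun m =>
    if hm : m.1 < N then .inl ⟨Quotient.mk _ ⟨m.1, hm⟩, hfree m hm⟩
    else .inr ⟨m.1, not_lt.1 hm, m.2.2⟩
  have hf : Bijective f := by
    constructor
    · intro m m' e
      by_cases hm : m.1 < N <;> by_cases hm' : m'.1 < N
      · simp only [f, hm, hm', dite_true, Sum.inl.injEq, Subtype.mk.injEq] at e
        have h1 := (sameCycle_fin_iff v _ _).1 (mk_eq_mk_iff.1 e)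
        exact Subtype.ext (le_antisymm ((opener_iff v hm).1 m.2.2 _ h1)
          ((opener_iff v hm').1 m'.2.2 _ h1.symm))
      all_goals grind
    · rintro (C | m)
      · classical
        obtain ⟨x, hx⟩ := exists_rep C.1
        obtain ⟨y, hy, hmin⟩ := Finset.exists_min_image
          (univ.filter fun y : Fin N => (Quotient.mk _ y : Cycles (v.fin N)) = C.1)
          (fun y => y) ⟨x, by simpa using hx⟩
        simp only [mem_filter, mem_univ, true_and] at hy hmin
        have h1 : v.perm (y + 1) y = y := by
          rw [opener_iff v y.2]
          intro j hj
          by_contra hc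
          have := hmin ⟨j, by omega⟩ (by
            rw [← hy, mk_eq_mk_iff, sameCycle_fin_iff]
            exact hj.symm)
          grind
        have h2 : n ≤ (y : ℕ) := by
          by_contra hc
          exact C.2 ⟨y, by omega⟩ hy
        refine ⟨⟨y, h2, h1⟩, ?_⟩
        simp only [f, y.2, dite_true, Sum.inl.injEq]
        grind
      · exact ⟨⟨m.1, h.trans m.2.1, m.2.2⟩, by simp [f, m.2.1]⟩
  refine ⟨ofBijective f hf, fun m hm => ⟨⟨_, hfree m hm⟩, ?_, rfl⟩, fun m hm => ?_⟩
  all_goals grind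

open Classical in
/-- The half-occupied restaurant of a virtual permutation is determined by the lengths of the arcs
at a level `N`. -/
lemma forget_eq {L t : ℕ → ℝ}
    (hL : ∀ i < N, Tendsto (fun M : ℕ => (gap v N M i : ℝ) / M) atTop (𝓝 (L i)))
    (ht : ∀ m, N ≤ m → v.perm (m + 1) m = m → tableLength v m = t m) :
    forget n v = ofData
      (ι := FreeCycles (v.fin N) (castLEEmb h) ⊕ {m : ℕ // N ≤ m ∧ v.perm (m + 1) m = m})
      (nextLabel (v.fin N) (castLEEmb h))
      (fun j => ∑ k with seg (v.fin N) (castLEEmb h) k = .inl j, L k)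
      (Sum.elim (fun C => ∑ k with seg (v.fin N) (castLEEmb h) k = .inr C, L k) fun m => t m) := by
  have h0 : Tendsto (fun M : ℕ => (1 : ℝ) / M) atTop (𝓝 0) :=
    tendsto_const_div_atTop_nhds_zero_nat 1
  have hsum : ∀ (i R : ℕ), i < N → Tendsto (fun M : ℕ =>
      ((∑ m ∈ range R, (gap v N M ((v.perm N ^ m) i) + 1) : ℕ) : ℝ) / M) atTop
      (𝓝 (∑ m ∈ range R, L ((v.perm N ^ m) i))) := by
    intro i R hi
    have : Tendsto (fun M : ℕ => ∑ m ∈ range R,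
        ((gap v N M ((v.perm N ^ m) i) : ℝ) / M + 1 / M)) atTop
        (𝓝 (∑ m ∈ range R, (L ((v.perm N ^ m) i) + 0))) :=
      tendsto_finsetSum _ fun m _ => (hL _ (v.pow_lt hi m)).add h0
    simp only [add_zero] at this
    refine this.congr fun M => ?_
    push_cast
    rw [sum_div]
    grind
  obtain ⟨f, hf1, hf2⟩ := bijective_openers h v
  rw [forget, nextLabel_castLEEmb h v, ← HalfRestaurant.ofData_comp_equiv f]
  have e1 : (fun i : Fin n => arcLength v n i) =
      fun j => ∑ k with seg (v.fin N) (castLEEmb h) k = .inl j, L k := by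
    funext j
    rw [sum_seg_inl (fun k : Fin N => L k), returnTime_castLEEmb]
    apply Tendsto.limUnder_eq
    have h1 := (hsum j (gap v n N j + 1) (by omega)).sub h0
    rw [sub_zero] at h1
    simp only [VirtualPerm.fin, toFinPerm_pow_apply]
    refine h1.congr' ?_
    filter_upwards [eventually_ge_atTop N] with M hM
    rw [← gap_eq_sum v h hM j.2]
    grind
  have e2 : (fun m : {m : ℕ // n ≤ m ∧ v.perm (m + 1) m = m} => tableLength v m) =
      fun m => Sum.elim (fun C => ∑ k with seg (v.fin N) (castLEEmb h) k = .inr C, L k)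
        (fun m : {m : ℕ // N ≤ m ∧ v.perm (m + 1) m = m} => t m) (f m) := by
    funext m
    by_cases hm : m.1 < N
    · obtain ⟨C, hC, hC'⟩ := hf1 m hm
      rw [hC, Sum.elim_inl, sum_seg_inr (fun k : Fin N => L k) C _ hC', minimalPeriod_fin]
      apply Tendsto.limUnder_eq
      simp only [VirtualPerm.fin, toFinPerm_pow_apply]
      refine (hsum m.1 _ hm).congr' ?_
      filter_upwards [eventually_ge_atTop N] with M hM
      rw [← minimalPeriod_eq_sum v hM hm]
    grind
  rw [e1, e2]
  rfl

end Forget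

/-! ## Relabelling of the guests -/

lemma minimalPeriod_conj (q w : Perm ℕ) (m : ℕ) :
    minimalPeriod (q⁻¹ * w * q : Perm ℕ) m = minimalPeriod w (q m) := by
  refine minimalPeriod_eq_minimalPeriod_iff.2 fun k => ?_
  simp only [IsPeriodicPt, IsFixedPt, Perm.iterate_eq_pow]
  have : (q⁻¹ * w * q) ^ k = q⁻¹ * w ^ k * q := by
    have := conj_pow (i := k) (a := q⁻¹) (b := w)
    rwa [inv_inv] at this
  rw [this, Perm.mul_apply, Perm.mul_apply, Perm.inv_eq_iff_eq]

lemma minimalPeriod_of_sameCycle {w : Perm ℕ} {x y : ℕ} (h : w.SameCycle x y) :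
    minimalPeriod w x = minimalPeriod w y := by
  refine minimalPeriod_eq_minimalPeriod_iff.2 fun k => ?_
  simp only [IsPeriodicPt, IsFixedPt, Perm.iterate_eq_pow]
  obtain ⟨m, rfl⟩ := h
  rw [← Perm.mul_apply, ← zpow_natCast, ← zpow_add, add_comm, zpow_add,
    Perm.mul_apply, EmbeddingLike.apply_eq_iff_eq]

lemma tableLength_congr {u v : VirtualPerm} {m m' : ℕ} (h : ∀ᶠ M in atTop,
    minimalPeriod (u.perm M) m = minimalPeriod (v.perm M) m') :
    tableLength u m = tableLength v m' := by
  rw [tableLength, tableLength, limUnder, limUnder]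
  congr 1
  exact Filter.map_congr (h.mono fun M hM => by simp only [hM])

lemma forget_conj {n K : ℕ} (hn : n ≤ K) {q : Perm ℕ} (hq : ∀ i, K ≤ i → q i = i)
    (hq' : ∀ i < n, q i = i) {u v : VirtualPerm} (h : ∀ M, K ≤ M → v.perm M = q⁻¹ * u.perm M * q) :
    forget n v = forget n u := by
  have hqlt : ∀ i, i < n ↔ q i < n := by
    intro i
    constructor
    · intro hi; rwa [hq' i hi]
    · intro hi
      have := q.injective (hq' _ hi)
      grind
  have hinv : ∀ i < n, q⁻¹ i = i := fun i hi => by rw [Perm.inv_eq_iff_eq, hq' i hi]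
  have hpow : ∀ M, K ≤ M → ∀ p, (v.perm M) ^ p = q⁻¹ * u.perm M ^ p * q := by
    intro M hM p
    have := conj_pow (i := p) (a := q⁻¹) (b := u.perm M)
    rw [h M hM]
    rwa [inv_inv] at this
  have hgap : ∀ M, K ≤ M → ∀ i < n, gap v n M i = gap u n M i := by
    intro M hM i hi
    rw [gap, gap]
    congr 1
    ext p
    simp only [mem_ofPred_eq]
    rw [hpow M hM, Perm.mul_apply, Perm.mul_apply, hq' i hi, hqlt]
    simp
  have e1 : v.fin n = u.fin n := by
    ext i
    have h1 := (firstReturn_perm v hn i i.2).2.1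
    have h2 := (firstReturn_perm u hn i i.2).2
    rw [hpow K le_rfl, hgap K le_rfl i i.2, Perm.mul_apply, Perm.mul_apply,
      hq' i i.2, h2.1, hinv _ h2.2] at h1
    rw [VirtualPerm.fin, VirtualPerm.fin, toFinPerm_apply, toFinPerm_apply, h1]
  have e2 : (fun i : Fin n => arcLength v n i) = fun i : Fin n => arcLength u n i := by
    funext i
    rw [arcLength, arcLength, limUnder, limUnder]
    congr 1
    exact Filter.map_congr ((eventually_ge_atTop K).mono fun M hM => by simp only [hgap M hM i i.2])
  let q' : Perm (Fin K) := toFinPerm K q hq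
  have hq'v : ∀ x, (q' x : ℕ) = q x := toFinPerm_apply K q hq
  have hsame : ∀ x y : Fin K, (v.fin K).SameCycle x y ↔ (u.fin K).SameCycle (q' x) (q' y) := by
    intro x y
    rw [sameCycle_fin_iff, sameCycle_fin_iff, h K le_rfl, hq'v, hq'v]
    have := Perm.sameCycle_conj (f := u.perm K) (g := q⁻¹) (x := (x : ℕ)) (y := (y : ℕ))
    simpa using this
  let Q : Cycles (v.fin K) ≃ Cycles (u.fin K) := Quotient.congr q' hsame
  have hQ : ∀ x : Fin K, Q (Quotient.mk _ x) = Quotient.mk _ (q' x) := fun x => rfl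
  let e : FreeCycles (v.fin K) (castLEEmb hn) ≃ FreeCycles (u.fin K) (castLEEmb hn) :=
    Q.subtypeEquiv fun C => by
      refine forall_congr' fun i => not_congr ?_
      rw [← Q.injective.eq_iff, hQ]
      have : q' (castLEEmb hn i) = castLEEmb hn i := by ext; rw [hq'v]; exact hq' i i.2
      rw [this]
  let e' : {m : ℕ // K ≤ m ∧ v.perm (m + 1) m = m} ≃ {m : ℕ // K ≤ m ∧ u.perm (m + 1) m = m} :=
    subtypeEquivRight fun m => by
      refine and_congr_right fun hm => ?_
      rw [h (m + 1) (by omega), Perm.mul_apply, Perm.mul_apply, hq m hm,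
        Perm.inv_eq_iff_eq, hq m hm]
  obtain ⟨f, hf1, hf2⟩ := bijective_openers hn v
  obtain ⟨g, hg1, hg2⟩ := bijective_openers hn u
  let E := f.trans ((sumCongr e e').trans g.symm)
  have e3 : (fun m : {m : ℕ // n ≤ m ∧ v.perm (m + 1) m = m} => tableLength v m) =
      fun m => tableLength u (E m) := by
    funext m
    by_cases hm : m.1 < K
    · obtain ⟨C, hC, hC'⟩ := hf1 m hm
      have hE : g (E m) = .inl (e C) := by simp [E, hC]
      have hlt : (E m).1 < K := by
        grind
      obtain ⟨D, hD, hD'⟩ := hg1 _ hlt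
      rw [hE, Sum.inl.injEq] at hD
      have h3 : Quotient.mk _ (⟨(E m).1, hlt⟩ : Fin K) = (Quotient.mk _ (q' ⟨m.1, hm⟩) :
          Cycles (u.fin K)) := by
        rw [hD', ← hQ, hC', ← hD]; rfl
      have h4 := (sameCycle_fin_iff u _ _).1 (mk_eq_mk_iff.1 h3)
      rw [hq'v] at h4
      have hql : q m.1 < K := by rw [← hq'v ⟨m.1, hm⟩]; exact Fin.is_lt _
      refine tableLength_congr ((eventually_ge_atTop K).mono fun M hM => ?_)
      rw [h M hM, minimalPeriod_conj]
      rw [sameCycle_perm u hM hlt hql] at h4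
      exact (minimalPeriod_of_sameCycle h4).symm
    · have hm' := not_lt.1 hm
      have hE : (E m).1 = m.1 := by
        have : g (E m) = .inr (e' ⟨m.1, hm', m.2.2⟩) := by simp [E, hf2 m hm']
        have hge : K ≤ (E m).1 := by
          grind
        rw [hg2 _ hge, Sum.inr.injEq] at this
        exact congrArg Subtype.val this
      rw [hE]
      refine tableLength_congr ((eventually_ge_atTop K).mono fun M hM => ?_)
      rw [h M hM, minimalPeriod_conj, hq _ hm']
  rw [forget, forget, e2, e3]
  have := HalfRestaurant.ofData_comp_equiv E (v.fin n) (fun i => arcLength u n i)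
    (fun m => tableLength u m)
  rw [e1] at this
  simp only [VirtualPerm.fin] at this e1
  grind

/-! ## Guests on circles -/

/-- Positions of the guests on a family of circles: `tab i` is the circle of the guest `i`, and
`D i j` is the length of the arc from `i` to `j`. -/
structure Seating where
  tab : ℕ → ℕ
  D : ℕ → ℕ → ℝ
  pos : ∀ i j, tab i = tab j → 0 < D i j
  inj : ∀ i j k, tab i = tab j → tab i = tab k → D i j = D i k → j = k
  chain : ∀ i a j, tab i = tab a → tab i = tab j → D i a < D i j → D i j = D i a + D a j
  total : ∀ i a, tab i = tab a → i ≠ a → D i a + D a i = D i i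
  self : ∀ i j, tab i = tab j → D i i = D j j

namespace Seating

variable (S : Seating)

/-- `w` sends each guest from `I` to the next one at its table. -/
def IsNext (I : Finset ℕ) (w : Perm ℕ) : Prop :=
  (∀ i ∈ I, w i ∈ I ∧ S.tab i = S.tab (w i) ∧ ∀ j ∈ I, S.tab i = S.tab j → S.D i (w i) ≤ S.D i j) ∧
    ∀ i, i ∉ I → w i = i

variable {S}

lemma lt_self {i a : ℕ} (h : S.tab i = S.tab a) (hne : i ≠ a) : S.D i a < S.D i i := by
  have := S.total i a h hne
  have := S.pos a i h.symm
  linarith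

lemma IsNext.unique {I : Finset ℕ} {w w' : Perm ℕ} (h : S.IsNext I w)
    (h' : S.IsNext I w') : w = w' := by
  ext i
  by_cases hi : i ∈ I
  · obtain ⟨h1, h2, h3⟩ := h.1 i hi
    obtain ⟨h1', h2', h3'⟩ := h'.1 i hi
    exact S.inj i _ _ h2 h2' (le_antisymm (h3 _ h1' h2') (h3' _ h1 h2))
  · rw [h.2 i hi, h'.2 i hi]

variable (S)

lemma exists_isNext (I : Finset ℕ) : ∃ w, S.IsNext I w := by
  have : ∀ i : I, ∃ j : I, S.tab i = S.tab j ∧ ∀ k ∈ I, S.tab i = S.tab k → S.D i j ≤ S.D i k := by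
    intro i
    obtain ⟨j, hj, hmin⟩ := Finset.exists_min_image (I.filter fun j => S.tab i = S.tab j)
      (fun j => S.D i j) ⟨i, by simp⟩
    simp only [mem_filter] at hj hmin
    exact ⟨⟨j, hj.1⟩, hj.2, fun k hk hk' => hmin k ⟨hk, hk'⟩⟩
  choose f hf1 hf2 using this
  have hinj : Injective f := by
    intro i i' e
    by_contra hne
    have hne' : (i : ℕ) ≠ i' := fun h => hne (Subtype.ext h)
    have t1 := hf1 i
    have t2 := hf1 i'
    have m1 := hf2 i i' i'.2 (by rw [t1, e, ← t2])
    have m2 := hf2 i' i i.2 (by rw [t1, e, ← t2])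
    rw [← e] at m2 t2
    set j := f i
    have htt : S.tab i = S.tab i' := t1.trans t2.symm
    have hj1 : (j : ℕ) ≠ i' := by
      intro h
      rw [h] at m2
      exact absurd (lt_self htt.symm (Ne.symm hne')) (not_lt.2 m2)
    have hj2 : (j : ℕ) ≠ i := by
      intro h
      rw [h] at m1
      exact absurd (lt_self htt hne') (not_lt.2 m1)
    have l1 : S.D i j < S.D i i' := lt_of_le_of_ne m1 fun h => hj1 (S.inj _ _ _ t1 htt h)
    have l2 : S.D i' j < S.D i' i := lt_of_le_of_ne m2 fun h => hj2 (S.inj _ _ _ t2 htt.symm h)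
    have c1 := S.chain _ _ _ t1 htt l1
    have c2 := S.chain _ _ _ t2 htt.symm l2
    have s1 := S.total _ _ t1 (Ne.symm hj2)
    have s2 := S.total _ _ t2 (Ne.symm hj1)
    have s3 := S.total _ _ htt hne'
    have s4 := S.self _ _ htt
    have := S.pos _ _ t1
    grind
  refine ⟨Perm.ofSubtype (ofBijective f (Finite.injective_iff_bijective.1 hinj)), ?_, ?_⟩
  · intro i hi
    rw [Perm.ofSubtype_apply_of_mem _ hi]
    grind
  · intro i hi
    exact Perm.ofSubtype_apply_of_not_mem _ hi

/-- The permutation that sends each guest from `I` to the next one at its table. -/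
def nextPerm (I : Finset ℕ) : Perm ℕ := (S.exists_isNext I).choose

lemma isNext_nextPerm (I : Finset ℕ) : S.IsNext I (S.nextPerm I) := (S.exists_isNext I).choose_spec

variable {S}

lemma IsNext.removePoint {I : Finset ℕ} {w : Perm ℕ} (h : S.IsNext I w) (a : ℕ) :
    S.IsNext (I.erase a) (removePoint a w) := by
  by_cases ha : a ∈ I
  swap
  · rw [Finset.erase_eq_of_notMem ha, removePoint_of_fixed (h.2 a ha)]; exact h
  constructor
  · intro i hi
    obtain ⟨hne, hi⟩ := mem_erase.1 hi
    obtain ⟨h1, h2, h3⟩ := h.1 i hi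
    by_cases e : w i = a
    · have e' : Chips.removePoint a w i = w a := by simp [Chips.removePoint, e]
      obtain ⟨h1', h2', h3'⟩ := h.1 a ha
      have hwa : w a ≠ a := fun h' => hne (w.injective (e.trans h'.symm))
      rw [e']
      rw [e] at h2 h3
      refine ⟨mem_erase.2 ⟨hwa, h1'⟩, h2.trans h2', fun j hj hj' => ?_⟩
      obtain ⟨hj1, hj⟩ := mem_erase.1 hj
      have l1 : S.D i a < S.D i j :=
        lt_of_le_of_ne (h3 j hj hj') fun h => hj1 (S.inj _ _ _ h2 hj' h).symm
      have l2 : S.D i a < S.D i (w a) :=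
        lt_of_le_of_ne (h3 _ h1' (h2.trans h2')) fun h => hwa (S.inj _ _ _ h2 (h2.trans h2') h).symm
      rw [S.chain _ _ _ h2 hj' l1, S.chain _ _ _ h2 (h2.trans h2') l2]
      grind
    · have hne' : w i ≠ w a := fun h' => hne (w.injective h')
      have e' : Chips.removePoint a w i = w i := by
        simp [Chips.removePoint, swap_apply_of_ne_of_ne e hne']
      grind
  · intro i hi
    by_cases hia : i = a
    · rw [hia]; exact removePoint_self _ _
    · exact removePoint_apply_fixed (h.2 i fun hc => hi (mem_erase.2 ⟨hia, hc⟩))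

variable (S)

lemma removePoint_nextPerm (I : Finset ℕ) (a : ℕ) :
    removePoint a (S.nextPerm I) = S.nextPerm (I.erase a) :=
  ((S.isNext_nextPerm I).removePoint a).unique (S.isNext_nextPerm _)

lemma reduce_nextPerm (I : Finset ℕ) (n k : ℕ) :
    reduce n k (S.nextPerm I) = S.nextPerm (I.filter fun i => i < n ∨ n + k ≤ i) := by
  induction k generalizing I with
  | zero =>
    rw [reduce]
    congr 1
    ext i
    simp; omega
  | succ k ih =>
    rw [reduce, removePoint_nextPerm, ih]
    congr 1
    ext i
    simp only [mem_filter, mem_erase]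
    constructor
    · rintro ⟨⟨h1, h2⟩, h3⟩
      exact ⟨h2, by omega⟩
    · rintro ⟨h1, h2⟩
      exact ⟨⟨by omega, h1⟩, by omega⟩

/-- The virtual permutation of the guests. -/
def virt : VirtualPerm where
  perm N := S.nextPerm (range N)
  fixes n i hi := (S.isNext_nextPerm _).2 i (by simpa using hi)
  compat n := by
    rw [removePoint_nextPerm]
    congr 1
    grind

/-- Relabelling of the guests. -/
def comap (a : Perm ℕ) : Seating where
  tab i := S.tab (a i)
  D i j := S.D (a i) (a j)
  pos _ _ := S.pos _ _
  inj _ _ _ h1 h2 h3 := a.injective (S.inj _ _ _ h1 h2 h3)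
  chain _ _ _ := S.chain _ _ _
  total _ _ h1 h2 := S.total _ _ h1 fun h => h2 (a.injective h)
  self _ _ := S.self _ _

lemma comap_nextPerm (a : Perm ℕ) (I : Finset ℕ) :
    a⁻¹ * S.nextPerm I * a = (S.comap a).nextPerm (I.map (a⁻¹ : Perm ℕ).toEmbedding) := by
  refine IsNext.unique (S := S.comap a) ?_ (isNext_nextPerm _ _)
  have h := S.isNext_nextPerm I
  have hmem : ∀ i, i ∈ I.map (a⁻¹ : Perm ℕ).toEmbedding ↔ a i ∈ I := by
    intro i
    rw [Finset.mem_map_equiv]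
    rfl
  constructor
  · intro i hi
    rw [hmem] at hi
    obtain ⟨h1, h2, h3⟩ := h.1 _ hi
    refine ⟨?_, ?_, ?_⟩
    · rw [hmem]; simpa using h1
    · simpa [comap] using h2
    · intro j hj hj'
      rw [hmem] at hj
      simpa [comap] using h3 _ hj hj'
  · intro i hi
    rw [hmem] at hi
    simp [h.2 _ hi]

/-- The element `(h, h)` of the bisymmetric group. -/
def diag (a : Perm ℕ) : bisymmetricGroup := ⟨(a, a), show {i | (a * a⁻¹) i ≠ i}.Finite by simp⟩

lemma act_diag_virt (a : Perm ℕ) : act (diag a) S.virt = (S.comap a).virt := by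
  refine act_eq fun n => ?_
  obtain ⟨B, hB⟩ := ((Set.finite_Iio n).image a).bddAbove
  filter_upwards [eventually_gt_atTop B] with N hN
  obtain ⟨C, hC⟩ := ((Set.finite_Iio N).image (a⁻¹ : Perm ℕ)).bddAbove
  filter_upwards [eventually_gt_atTop C] with k hk
  change reduce n k (a⁻¹ * S.nextPerm (range N) * a) = (S.comap a).nextPerm (range n)
  rw [comap_nextPerm, reduce_nextPerm]
  congr 1
  ext i
  simp only [mem_filter, Finset.mem_map_equiv, mem_range]
  have e : (Equiv.symm (a⁻¹ : Perm ℕ)) i = a i := rfl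
  rw [e]
  constructor
  · rintro ⟨h1, h2 | h2⟩
    · exact h2
    · have : i ≤ C := hC ⟨a i, h1, by simp⟩
      omega
  · intro h
    have : a i ≤ B := hB ⟨i, h, rfl⟩
    grind

/-! ### Arcs -/

/-- The length of the arc from the guest `i` to the next guest `< N`. -/
def arc (N i : ℕ) : ℝ := S.D i (S.virt.perm N i)

lemma isNext_virt (N : ℕ) : S.IsNext (range N) (S.virt.perm N) := S.isNext_nextPerm _

lemma tab_virt {N i : ℕ} (h : i < N) : S.tab i = S.tab (S.virt.perm N i) :=
  ((S.isNext_virt N).1 i (by simpa)).2.1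

lemma arc_le {N i j : ℕ} (hi : i < N) (hj : j < N) (h : S.tab i = S.tab j) : S.arc N i ≤ S.D i j :=
  ((S.isNext_virt N).1 i (by simpa)).2.2 j (by simpa) h

lemma arc_pos {N i : ℕ} (hi : i < N) : 0 < S.arc N i := S.pos _ _ (S.tab_virt hi)

lemma virt_succ_self_iff (N : ℕ) : S.virt.perm (N + 1) N = N ↔ ∀ i < N, S.tab i ≠ S.tab N := by
  constructor
  · intro h i hi ht
    have h1 := S.arc_le (N := N + 1) (i := N) (j := i) (by omega) (by omega) ht.symm
    rw [arc, h] at h1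
    exact absurd (lt_self ht.symm (by omega)) (not_lt.2 h1)
  · intro h
    have h1 := S.virt.perm_lt (n := N + 1) (i := N) (by omega)
    by_contra hc
    exact h _ (by omega) (S.tab_virt (N := N + 1) (by omega)).symm

lemma virt_of_succ_ne {N i : ℕ} (hi : i < N) (h : S.virt.perm (N + 1) i ≠ N) :
    S.virt.perm N i = S.virt.perm (N + 1) i := by
  have hne : S.virt.perm (N + 1) i ≠ S.virt.perm (N + 1) N :=
    fun e => hi.ne ((S.virt.perm (N + 1)).injective e)
  rw [← S.virt.compat N, removePoint, Perm.mul_apply, swap_apply_of_ne_of_ne h hne]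

lemma virt_of_succ_eq {N j : ℕ} (h : S.virt.perm (N + 1) j = N) :
    S.virt.perm N j = S.virt.perm (N + 1) N := by
  rw [← S.virt.compat N, removePoint, Perm.mul_apply, h, swap_apply_left]

lemma virt_succ_eq_iff {N j : ℕ} (hj : j < N) :
    S.virt.perm (N + 1) j = N ↔ S.tab j = S.tab N ∧ S.D j N < S.arc N j := by
  constructor
  · intro h
    have ht : S.tab j = S.tab N := by
      have := S.tab_virt (N := N + 1) (i := j) (by omega); rwa [h] at this
    refine ⟨ht, ?_⟩
    have h1 := S.virt.perm_lt (n := N) hj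
    have h2 := S.arc_le (N := N + 1) (i := j) (j := S.virt.perm N j) (by omega) (by omega)
      (S.tab_virt hj)
    rw [arc, h] at h2
    exact lt_of_le_of_ne h2 fun e => h1.ne (S.inj _ _ _ ht (S.tab_virt hj) e).symm
  · rintro ⟨ht, hlt⟩
    by_contra hc
    have h1 := S.arc_le (N := N + 1) (i := j) (j := N) (by omega) (by omega) ht
    rw [arc, virt_of_succ_ne S hj hc] at hlt
    rw [arc] at h1
    linarith

lemma arc_succ_of_ne {N i : ℕ} (hi : i < N) (h : S.virt.perm (N + 1) i ≠ N) :
    S.arc (N + 1) i = S.arc N i := by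
  rw [arc, arc, virt_of_succ_ne S hi h]

lemma arc_succ_of_eq {N j : ℕ} (h : S.virt.perm (N + 1) j = N) : S.arc (N + 1) j = S.D j N := by
  rw [arc, h]

lemma arc_succ_last {N j : ℕ} (hj : j < N) (h : S.virt.perm (N + 1) j = N) :
    S.arc (N + 1) N = S.arc N j - S.D j N := by
  obtain ⟨h1, h2⟩ := (S.virt_succ_eq_iff hj).1 h
  rw [arc] at h2
  rw [arc, arc, S.chain _ _ _ h1 (S.tab_virt hj) h2, virt_of_succ_eq S h]
  ring

lemma tab_pow {N i : ℕ} (hi : i < N) (m : ℕ) : S.tab i = S.tab ((S.virt.perm N ^ m) i) := by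
  induction m with
  | zero => rfl
  | succ m ih =>
    rw [pow_succ', Perm.mul_apply, ← S.tab_virt (S.virt.pow_lt hi m)]
    exact ih

lemma sameCycle_virt_iff {N i j : ℕ} (hi : i < N) (hj : j < N) :
    (S.virt.perm N).SameCycle i j ↔ S.tab i = S.tab j := by
  constructor
  · intro h
    obtain ⟨k, e | e⟩ := exists_pow_of_sameCycle h
    · rw [← e]; exact S.tab_pow hi k
    · rw [← e]; exact (S.tab_pow hj k).symm
  · intro h
    classical
    by_contra hc
    obtain ⟨x, hx, hmin⟩ := Finset.exists_min_image
      ((range N).filter fun x => (S.virt.perm N).SameCycle i x) (fun x => S.D x j)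
      ⟨i, by simp [hi, Perm.SameCycle.refl]⟩
    simp only [mem_filter, mem_range] at hx hmin
    have htx : S.tab x = S.tab j := by
      obtain ⟨k, e | e⟩ := exists_pow_of_sameCycle hx.2
      · rw [← h, ← e]; exact (S.tab_pow hi k).symm
      · rw [← h, ← e]; exact S.tab_pow hx.1 k
    set y := S.virt.perm N x with hy
    have hxy : S.tab x = S.tab y := S.tab_virt hx.1
    have hiy : (S.virt.perm N).SameCycle i y := Perm.sameCycle_apply_right.2 hx.2
    have l1 : S.D x y < S.D x j := lt_of_le_of_ne (S.arc_le hx.1 hj htx) fun e => by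
      have := S.inj _ _ _ hxy htx e
      grind
    have := hmin y ⟨S.virt.perm_lt hx.1, hiy⟩
    have := S.chain _ _ _ hxy htx l1
    have := S.pos _ _ hxy
    linarith

lemma gap_virt {n M i : ℕ} (hn : n ≤ M) (hi : i < n) : gap S.virt n M i =
    ((range M).filter fun k => S.tab i = S.tab k ∧ S.D i k < S.arc n i).card := by
  obtain ⟨h1, h2, h3⟩ := firstReturn_perm S.virt hn i hi
  have hiM : i < M := by omega
  set w := S.virt.perm M with hw
  have key : ∀ p ≤ gap S.virt n M i, ((range M).filter fun k =>
      S.tab i = S.tab k ∧ S.D i k < S.D i ((w ^ (p + 1)) i)).card = p := by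
    intro p
    induction p with
    | zero =>
      intro _
      rw [Finset.card_eq_zero, Finset.filter_eq_empty_iff]
      rintro k hk ⟨ht, hlt⟩
      exact absurd (S.arc_le hiM (mem_range.1 hk) ht) (not_le.2 (by simpa [arc] using hlt))
    | succ p ih =>
      intro hp
      have hxn := h1 p (by omega)
      set x := (w ^ (p + 1)) i with hx
      have hxM : x < M := S.virt.pow_lt hiM _
      have htx : S.tab i = S.tab x := S.tab_pow hiM _
      have hix : i ≠ x := by omega
      have e : (w ^ (p + 1 + 1)) i = w x := by rw [pow_succ', Perm.mul_apply]
      rw [e]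
      set y := w x with hy
      have hxy : S.tab x = S.tab y := S.tab_virt hxM
      have hne : y ≠ x := by
        intro h
        have : w ((w ^ p) i) = (w ^ (p + 1)) i := by rw [pow_succ', Perm.mul_apply]
        have hfix : ∀ m, (w ^ m) x = x := by
          intro m
          induction m with
          | zero => rfl
          | succ m ih => rw [pow_succ, Perm.mul_apply, show w x = x from h, ih]
        exact hix ((w ^ (p + 1)).injective ((hx.symm.trans (hfix _).symm)))
      have lt1 : S.D i x < S.D i i := lt_self htx hix
      have lt2 : S.D i x < S.D i y := by
        by_contra hc
        have lt3 : S.D i y < S.D i x := lt_of_le_of_ne (not_lt.1 hc) fun h =>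
          hne (S.inj _ _ _ (htx.trans hxy) htx h)
        have c1 := S.chain _ _ _ (htx.trans hxy) htx lt3
        have c2 := S.chain _ _ _ htx rfl lt1
        have c3 := S.total _ _ hxy (Ne.symm hne)
        have c4 := S.self _ _ htx
        have c5 : S.D x y ≤ S.D x i := S.arc_le hxM hiM htx.symm
        have := S.pos _ _ (htx.trans hxy)
        linarith
      have : ((range M).filter fun k => S.tab i = S.tab k ∧ S.D i k < S.D i y) =
          insert x ((range M).filter fun k => S.tab i = S.tab k ∧ S.D i k < S.D i x) := by
        ext k
        simp only [mem_filter, Finset.mem_insert, mem_range]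
        constructor
        · rintro ⟨hk, ht, hlt⟩
          rcases lt_trichotomy (S.D i k) (S.D i x) with h | h | h
          · grind
          · exact Or.inl (S.inj _ _ _ ht htx h)
          · have c1 := S.chain _ _ _ htx ht h
            have c2 := S.chain _ _ _ htx (htx.trans hxy) lt2
            have c3 : S.D x y ≤ S.D x k := S.arc_le hxM hk (htx.symm.trans ht)
            linarith
        all_goals grind
      rw [this, Finset.card_insert_of_notMem (by simp), ih (by omega)]
  have := key _ le_rfl
  rw [h2] at this
  exact this.symm

/-- The proportion of guests in each arc converges to the length of the arc. -/
def Equidistributed : Prop := ∀ i r, 0 < r → r ≤ S.D i i →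
  Tendsto (fun M : ℕ => (((range M).filter fun k =>
    S.tab i = S.tab k ∧ S.D i k < r).card : ℝ) / M) atTop (𝓝 r)

variable {S}

lemma Equidistributed.tendsto_gap (hS : S.Equidistributed) {n i : ℕ} (hi : i < n) :
    Tendsto (fun M : ℕ => (gap S.virt n M i : ℝ) / M) atTop (𝓝 (S.arc n i)) := by
  refine (hS i _ (S.arc_pos hi) (S.arc_le hi hi rfl)).congr' ?_
  filter_upwards [eventually_ge_atTop n] with M hM
  rw [S.gap_virt hM hi]

lemma Equidistributed.tableLength (hS : S.Equidistributed) {m : ℕ}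
    (hm : S.virt.perm (m + 1) m = m) : tableLength S.virt m = S.D m m := by
  have h0 : Tendsto (fun M : ℕ => (1 : ℝ) / M) atTop (𝓝 0) :=
    tendsto_const_div_atTop_nhds_zero_nat 1
  have h1 := (hS.tendsto_gap (n := m + 1) (i := m) (by omega)).add h0
  rw [arc, hm, add_zero] at h1
  apply Tendsto.limUnder_eq
  refine h1.congr' ?_
  filter_upwards [eventually_ge_atTop (m + 1)] with M hM
  rw [minimalPeriod_eq_sum S.virt hM (by omega), minimalPeriod_eq_one_iff_isFixedPt.2 hm]
  simp
  ring

end Seating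

/-! ## Tables as consecutive intervals -/

/-- The left end of the `ν`-th interval. -/
def cum (ℓ : ℕ → ℝ) (ν : ℕ) : ℝ := ∑ i ∈ range ν, ℓ i

/-- The interval that contains `x`. -/
def tabOf (ℓ : ℕ → ℝ) (x : ℝ) : ℕ := sInf {ν | x < cum ℓ (ν + 1)}

/-- The distance from `x` to `y` in the positive direction of the circle obtained from the interval
of `x`. -/
def cdist (ℓ : ℕ → ℝ) (x y : ℝ) : ℝ := if x < y then y - x else y - x + ℓ (tabOf ℓ x)

/-- Sequences of positive lengths of total sum one. -/
def GoodSticks (ℓ : ℕ → ℝ) : Prop := (∀ ν, 0 < ℓ ν) ∧ HasSum ℓ 1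

/-- Sequences of distinct points of the unit interval. -/
def GoodPoints (U : ℕ → ℝ) : Prop := (∀ i, U i ∈ Ico (0 : ℝ) 1) ∧ Injective U

section Tables

variable {ℓ : ℕ → ℝ}

lemma cum_succ (ℓ : ℕ → ℝ) (ν : ℕ) : cum ℓ (ν + 1) = cum ℓ ν + ℓ ν := sum_range_succ _ _

lemma GoodSticks.cum_mono (hℓ : GoodSticks ℓ) : Monotone (cum ℓ) :=
  monotone_nat_of_le_succ fun ν => by rw [cum_succ]; linarith [hℓ.1 ν]

lemma GoodSticks.tendsto_cum (hℓ : GoodSticks ℓ) : Tendsto (cum ℓ) atTop (𝓝 1) :=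
  hℓ.2.tendsto_sum_nat

lemma GoodSticks.cum_le_one (hℓ : GoodSticks ℓ) (ν : ℕ) : cum ℓ ν ≤ 1 :=
  hℓ.cum_mono.ge_of_tendsto hℓ.tendsto_cum ν

lemma GoodSticks.cum_nonneg (hℓ : GoodSticks ℓ) (ν : ℕ) : 0 ≤ cum ℓ ν :=
  Finset.sum_nonneg fun i _ => (hℓ.1 i).le

lemma tabOf_eq (hℓ : GoodSticks ℓ) {x : ℝ} {ν : ℕ} (h1 : cum ℓ ν ≤ x) (h2 : x < cum ℓ (ν + 1)) :
    tabOf ℓ x = ν := by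
  refine le_antisymm (Nat.sInf_le h2) ?_
  by_contra hc
  have h3 : x < cum ℓ (tabOf ℓ x + 1) := sInf_mem (s := {ν | x < cum ℓ (ν + 1)}) ⟨ν, h2⟩
  have h4 : cum ℓ (tabOf ℓ x + 1) ≤ cum ℓ ν := hℓ.cum_mono (by omega)
  linarith

lemma tabOf_spec (hℓ : GoodSticks ℓ) {x : ℝ} (hx : x ∈ Ico (0 : ℝ) 1) :
    cum ℓ (tabOf ℓ x) ≤ x ∧ x < cum ℓ (tabOf ℓ x) + ℓ (tabOf ℓ x) := by
  have hne : {ν | x < cum ℓ (ν + 1)}.Nonempty := by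
    have := ((tendsto_add_atTop_iff_nat 1).2 hℓ.tendsto_cum).eventually (lt_mem_nhds hx.2)
    exact this.exists
  rw [← cum_succ]
  refine ⟨?_, sInf_mem hne⟩
  by_contra hc
  rcases h : tabOf ℓ x with _ | ν
  · rw [h] at hc
    exact hc (by simpa [cum] using hx.1)
  · rw [h, not_le] at hc
    have : tabOf ℓ x ≤ ν := Nat.sInf_le hc
    omega

lemma tabOf_eq_iff (hℓ : GoodSticks ℓ) {x : ℝ} (hx : x ∈ Ico (0 : ℝ) 1) (ν : ℕ) :
    tabOf ℓ x = ν ↔ cum ℓ ν ≤ x ∧ x < cum ℓ ν + ℓ ν := by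
  constructor
  · rintro rfl; exact tabOf_spec hℓ hx
  · rintro ⟨h1, h2⟩; exact tabOf_eq hℓ h1 (by rwa [cum_succ])

/-- The guests at the points `U i`. -/
def seating (hℓ : GoodSticks ℓ) {U : ℕ → ℝ} (hU : GoodPoints U) : Seating where
  tab i := tabOf ℓ (U i)
  D i j := cdist ℓ (U i) (U j)
  pos i j h := by
    have h1 := tabOf_spec hℓ (hU.1 i)
    have h2 := tabOf_spec hℓ (hU.1 j)
    rw [← h] at h2
    rw [cdist]
    split_ifs <;> linarith
  inj i j k h h' e := by
    have h1 := tabOf_spec hℓ (hU.1 i)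
    have h2 := tabOf_spec hℓ (hU.1 j)
    have h3 := tabOf_spec hℓ (hU.1 k)
    rw [← h] at h2
    rw [← h'] at h3
    simp only [cdist] at e
    apply hU.2
    split_ifs at e <;> linarith
  chain i a j h h' e := by
    have h1 := tabOf_spec hℓ (hU.1 i)
    have h2 := tabOf_spec hℓ (hU.1 a)
    have h3 := tabOf_spec hℓ (hU.1 j)
    rw [← h] at h2
    rw [← h'] at h3
    simp only [cdist, ← h] at e ⊢
    split_ifs at e ⊢ <;> linarith
  total i a h hne := by
    have h1 := tabOf_spec hℓ (hU.1 i)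
    have h2 := tabOf_spec hℓ (hU.1 a)
    rw [← h] at h2
    have : U i ≠ U a := fun e => hne (hU.2 e)
    simp only [cdist, ← h, lt_irrefl, if_false]
    rcases lt_or_gt_of_ne this with h3 | h3
    · rw [if_pos h3, if_neg (by linarith)]; ring
    · rw [if_neg (by linarith), if_pos h3]; ring
  self i j h := by simp [cdist, h]

lemma seating_D_self (hℓ : GoodSticks ℓ) {U : ℕ → ℝ} (hU : GoodPoints U) (i : ℕ) :
    (seating hℓ hU).D i i = ℓ (tabOf ℓ (U i)) := by
  simp [seating, cdist]

lemma GoodPoints.comp {U : ℕ → ℝ} (hU : GoodPoints U) (a : Perm ℕ) : GoodPoints (U ∘ a) :=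
  ⟨fun i => hU.1 (a i), hU.2.comp a.injective⟩

lemma seating_comap (hℓ : GoodSticks ℓ) {U : ℕ → ℝ} (hU : GoodPoints U) (a : Perm ℕ) :
    (seating hℓ hU).comap a = seating hℓ (hU.comp a) := rfl

/-- The empirical distribution function of the points converges to the identity. -/
def EquiPoints (U : ℕ → ℝ) : Prop := ∀ y ∈ Icc (0 : ℝ) 1,
  Tendsto (fun M : ℕ => (((range M).filter fun k => U k < y).card : ℝ) / M) atTop (𝓝 y) ∧
  Tendsto (fun M : ℕ => (((range M).filter fun k => U k ≤ y).card : ℝ) / M) atTop (𝓝 y)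

lemma EquiPoints.seating (hℓ : GoodSticks ℓ) {U : ℕ → ℝ} (hU : GoodPoints U)
    (hE : EquiPoints U) : (seating hℓ hU).Equidistributed := by
  intro i r hr0 hr
  rw [seating_D_self] at hr
  obtain ⟨h1, h2⟩ := tabOf_spec hℓ (hU.1 i)
  set x := U i with hx
  set ν := tabOf ℓ x with hν
  set s := cum ℓ ν with hs
  have hs0 : 0 ≤ s := hℓ.cum_nonneg ν
  have hs1 : s + ℓ ν ≤ 1 := by rw [hs, ← cum_succ]; exact hℓ.cum_le_one _
  have a1 := (hE (min (x + r) (s + ℓ ν)) ⟨by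
    rw [le_min_iff]; constructor <;> linarith, by
    rw [min_le_iff]; right; linarith⟩).1
  have a2 := (hE x ⟨by linarith, by linarith⟩).2
  have a3 := (hE (max (x + r - ℓ ν) s) ⟨by
    rw [le_max_iff]; right; linarith, by
    rw [max_le_iff]; constructor <;> linarith⟩).1
  have a4 := (hE s ⟨by linarith, by linarith⟩).1
  have hlim := (a1.sub a2).add (a3.sub a4)
  have e : min (x + r) (s + ℓ ν) - x + (max (x + r - ℓ ν) s - s) = r := by
    rcases le_total (x + r) (s + ℓ ν) with h | h
    · rw [min_eq_left h, max_eq_right (by linarith)]; ring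
    · rw [min_eq_right h, max_eq_left (by linarith)]; ring
  rw [e] at hlim
  refine hlim.congr fun M => ?_
  rw [← sub_div, ← sub_div, ← add_div]
  congr 1
  simp only [card_filter]
  push_cast
  rw [← Finset.sum_sub_distrib, ← Finset.sum_sub_distrib, ← Finset.sum_add_distrib]
  refine sum_congr rfl fun k _ => ?_
  have hk : ((Chips.seating hℓ hU).tab i = (Chips.seating hℓ hU).tab k) ↔
      s ≤ U k ∧ U k < s + ℓ ν := by
    change tabOf ℓ x = tabOf ℓ (U k) ↔ _
    rw [eq_comm, tabOf_eq_iff hℓ (hU.1 k)]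
  have hD : (Chips.seating hℓ hU).D i k = if x < U k then U k - x else U k - x + ℓ ν := rfl
  simp only [hk, hD, lt_min_iff, lt_max_iff]
  have := hℓ.1 ν
  by_cases c1 : x < U k
  · have c2 : ¬ U k ≤ x := by linarith
    have c3 : ¬ U k < s := by linarith
    have c4 : ¬ U k < x + r - ℓ ν := by linarith
    have c5 : U k - x < r ↔ U k < x + r := by constructor <;> intro h <;> linarith
    have c6 : s ≤ U k := by linarith
    simp [c1, c2, c3, c4, c5, c6, and_comm]
  · have c2 : U k ≤ x := by linarith
    have c4 : U k < x + r := by linarith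
    have c5 : U k < s + ℓ ν := by linarith
    have c6 : U k - x + ℓ ν < r ↔ U k < x + r - ℓ ν := by constructor <;> intro h <;> linarith
    by_cases c3 : U k < s
    · simp [c1, c2, c3, c4, c5, not_le.2 c3]
    · simp [c1, c2, c3, c4, c5, c6, not_lt.1 c3]

end Tables

/-- The virtual permutation of the guests at the points `U i`. -/
def paint (p : (ℕ → ℝ) × (ℕ → ℝ)) : VirtualPerm := open Classical in
  if h : GoodSticks p.1 ∧ GoodPoints p.2 then (seating h.1 h.2).virt
  else ⟨fun _ => 1, fun _ _ _ => rfl, fun _ => removePoint_of_fixed rfl⟩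

lemma paint_eq {ℓ U : ℕ → ℝ} (hℓ : GoodSticks ℓ) (hU : GoodPoints U) :
    paint (ℓ, U) = (seating hℓ hU).virt := by
  rw [paint, dif_pos ⟨hℓ, hU⟩]

/-! ## Independent uniform points -/

/-- The uniform distribution on the unit interval. -/
def unif : Measure ℝ := volume.restrict (Ico (0 : ℝ) 1)

instance : IsProbabilityMeasure unif := ⟨by simp [unif]⟩

instance : NullSingletonClass unif := by unfold unif; infer_instance

/-- The law of a sequence of independent uniform points. -/
def pointsLaw : Measure (ℕ → ℝ) := Measure.infinitePi fun _ => unif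

instance : IsProbabilityMeasure pointsLaw := by unfold pointsLaw; infer_instance

lemma pointsLaw_resample (N : ℕ) :
    (pointsLaw.prod unif).map (fun p => update p.1 N p.2) = pointsLaw := by
  have hm : Measurable fun p : (ℕ → ℝ) × ℝ => update p.1 N p.2 := measurable_update'
  refine Measure.eq_infinitePi _ fun s t ht => ?_
  rw [Measure.map_apply hm (.pi s.countable_toSet fun _ _ => ht _)]
  by_cases hN : N ∈ s
  · have : (fun p : (ℕ → ℝ) × ℝ => update p.1 N p.2) ⁻¹' (s : Set ℕ).pi t =
        ((s.erase N : Finset ℕ) : Set ℕ).pi t ×ˢ t N := by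
      all_goals grind
    rw [this, Measure.prod_prod, pointsLaw, Measure.infinitePi_pi _ fun _ _ => ht _,
      ← Finset.prod_erase_mul s _ hN]
  · have : (fun p : (ℕ → ℝ) × ℝ => update p.1 N p.2) ⁻¹' (s : Set ℕ).pi t =
        (s : Set ℕ).pi t ×ˢ Set.univ := by
      grind
    rw [this, Measure.prod_prod, pointsLaw, Measure.infinitePi_pi _ fun _ _ => ht _]
    simp

lemma lintegral_pointsLaw_resample (N : ℕ) {f : (ℕ → ℝ) → ℝ≥0∞} (hf : Measurable f) :
    ∫⁻ U, f U ∂pointsLaw = ∫⁻ U, ∫⁻ y, f (update U N y) ∂unif ∂pointsLaw := by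
  conv_lhs => rw [← pointsLaw_resample N]
  rw [lintegral_map hf measurable_update', lintegral_prod]
  fun_prop

lemma pointsLaw_map_perm (a : Perm ℕ) : pointsLaw.map (fun U i => U (a i)) = pointsLaw :=
  Measure.map_infinitePi_infinitePi_of_inj a.injective

lemma ae_pointsLaw_mem (i : ℕ) : ∀ᵐ U ∂pointsLaw, U i ∈ Ico (0 : ℝ) 1 := by
  have h : ∀ᵐ x ∂unif, x ∈ Ico (0 : ℝ) 1 := ae_restrict_mem measurableSet_Ico
  have := Measure.infinitePi_map_eval (fun _ : ℕ => unif) i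
  rw [← this] at h
  exact ae_of_ae_map (measurable_pi_apply i).aemeasurable h

lemma ae_pointsLaw_ne {i j : ℕ} (hij : i ≠ j) : ∀ᵐ U ∂pointsLaw, U i ≠ U j := by
  have h := Measure.infinitePi_map_eval_prod (P := fun _ : ℕ => unif) hij
  have h2 : ∀ᵐ p ∂(unif.prod unif), p.1 ≠ p.2 := by
    have hs : MeasurableSet {p : ℝ × ℝ | p.1 = p.2} :=
      measurableSet_eq_fun measurable_fst measurable_snd
    rw [ae_iff]
    simp only [ne_eq, not_not]
    rw [Measure.measure_prod_null hs]
    refine Eventually.of_forall fun x => ?_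
    simp
  rw [← h] at h2
  exact ae_of_ae_map (f := fun ω : ℕ → ℝ => (ω i, ω j)) (by fun_prop) h2

lemma ae_goodPoints : ∀ᵐ U ∂pointsLaw, GoodPoints U := by
  have h1 := ae_all_iff.2 ae_pointsLaw_mem
  have h2 : ∀ᵐ U ∂pointsLaw, ∀ p : {p : ℕ × ℕ // p.1 ≠ p.2}, U p.1.1 ≠ U p.1.2 :=
    ae_all_iff.2 fun p => ae_pointsLaw_ne p.2
  filter_upwards [h1, h2] with U hU1 hU2
  refine ⟨hU1, fun i j e => ?_⟩
  by_contra hne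
  exact hU2 ⟨(i, j), hne⟩ e

lemma tendsto_card_filter {s : Set ℝ} (hs : MeasurableSet s) [DecidablePred (· ∈ s)] :
    ∀ᵐ U ∂pointsLaw, Tendsto (fun M : ℕ => (((range M).filter fun k => U k ∈ s).card : ℝ) / M) atTop
      (𝓝 (unif s).toReal) := by
  have hm : Measurable (s.indicator (1 : ℝ → ℝ)) := measurable_one.indicator hs
  have hint : Integrable (s.indicator (1 : ℝ → ℝ)) unif := (integrable_const (1 : ℝ)).indicator hs
  have hlaw : ∀ i, Measure.map (fun U : ℕ → ℝ => U i) pointsLaw = unif :=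
    Measure.infinitePi_map_eval (fun _ : ℕ => unif)
  have h := strong_law_ae_real (μ := pointsLaw) (fun i U => s.indicator (1 : ℝ → ℝ) (U i)) ?_ ?_ ?_
  · filter_upwards [h] with U hU
    have e : ∫ U, s.indicator (1 : ℝ → ℝ) (U 0) ∂pointsLaw = (unif s).toReal := by
      rw [← integral_map (φ := fun U : ℕ → ℝ => U 0) (measurable_pi_apply 0).aemeasurable
        (by rw [hlaw]; exact hm.aestronglyMeasurable), hlaw, integral_indicator_one hs]
      rfl
    rw [e] at hU
    refine hU.congr fun M => ?_
    rw [card_filter]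
    push_cast
    congr 1
    refine sum_congr rfl fun k _ => ?_
    simp [indicator_apply]
  · have := hlaw 0
    rw [← this] at hint
    exact hint.comp_measurable (measurable_pi_apply 0)
  · intro i j hij
    exact (iIndepFun_infinitePi (P := fun _ : ℕ => unif)
      (X := fun _ => s.indicator (1 : ℝ → ℝ)) fun _ => hm).indepFun hij
  · intro i
    have hmap : ∀ i, Measure.map (fun U : ℕ → ℝ => s.indicator (1 : ℝ → ℝ) (U i)) pointsLaw =
        Measure.map (s.indicator (1 : ℝ → ℝ)) unif := fun i => by
      rw [← hlaw i, map_map hm (measurable_pi_apply i)]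
      rfl
    exact ⟨(hm.comp (measurable_pi_apply i)).aemeasurable,
      (hm.comp (measurable_pi_apply 0)).aemeasurable, by rw [hmap, hmap]⟩

lemma unif_Iio {y : ℝ} (hy : y ∈ Icc (0 : ℝ) 1) : (unif (Iio y)).toReal = y := by
  have : Iio y ∩ Ico 0 1 = Ico 0 y := by
    all_goals grind
  rw [unif, Measure.restrict_apply measurableSet_Iio, this, Real.volume_Ico]
  simp [hy.1]

lemma ae_equiPoints : ∀ᵐ U ∂pointsLaw, EquiPoints U := by
  have h1 : ∀ᵐ U ∂pointsLaw, ∀ q : {q : ℚ // (q : ℝ) ∈ Icc (0 : ℝ) 1},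
      Tendsto (fun M : ℕ => (((range M).filter fun k => U k ∈ Iio (q : ℝ)).card : ℝ) / M)
        atTop (𝓝 (q : ℝ)) := by
    rw [ae_all_iff]
    intro q
    have := tendsto_card_filter (measurableSet_Iio (a := (q : ℝ)))
    rwa [unif_Iio q.2] at this
  filter_upwards [h1, ae_goodPoints] with U hU hG y hy
  have mono : ∀ M : ℕ, ∀ p q : ℕ → Prop, ∀ [DecidablePred p] [DecidablePred q],
      (∀ k, p k → q k) → (((range M).filter p).card : ℝ) / M ≤
        (((range M).filter q).card : ℝ) / M := by
    intro M p q _ _ h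
    gcongr with k
    exact h k
  have lower : ∀ a < y, ∀ᶠ M : ℕ in atTop,
      a < (((range M).filter fun k => U k < y).card : ℝ) / M := by
    intro a ha
    by_cases ha0 : a < 0
    · exact Eventually.of_forall fun M => ha0.trans_le (by positivity)
    · obtain ⟨q, hq1, hq2⟩ := exists_rat_btwn ha
      have := (hU ⟨q, by constructor <;> linarith [hy.2]⟩).eventually (lt_mem_nhds hq1)
      filter_upwards [this] with M hM
      exact hM.trans_le (mono _ _ _ fun k hk => (Set.mem_Iio.1 hk).trans hq2)
  have upper : ∀ b > y, ∀ᶠ M : ℕ in atTop,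
      (((range M).filter fun k => U k ≤ y).card : ℝ) / M < b := by
    intro b hb
    by_cases hb1 : 1 < b
    · refine Eventually.of_forall fun M => lt_of_le_of_lt ?_ hb1
      refine div_le_one_of_le₀ ?_ (by positivity)
      exact_mod_cast (Finset.card_filter_le _ _).trans (Finset.card_range M).le
    · obtain ⟨q, hq1, hq2⟩ := exists_rat_btwn hb
      have := (hU ⟨q, by constructor <;> linarith [hy.1]⟩).eventually (gt_mem_nhds hq2)
      filter_upwards [this] with M hM
      exact lt_of_le_of_lt (mono _ _ _ fun k hk => lt_of_le_of_lt hk hq1) hM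
  constructor
  · rw [tendsto_order]
    refine ⟨lower, fun b hb => (upper b hb).mono fun M hM => lt_of_le_of_lt (mono _ _ _ ?_) hM⟩
    grind
  · rw [tendsto_order]
    refine ⟨fun a ha => (lower a ha).mono fun M hM => hM.trans_le (mono _ _ _ ?_), upper⟩
    grind

/-! ## Measurability of the virtual permutation -/

lemma measurable_cum (ν : ℕ) : Measurable fun ℓ : ℕ → ℝ => cum ℓ ν := by unfold cum; fun_prop

lemma measurable_prop_lt {α : Type*} [MeasurableSpace α] {f g : α → ℝ} (hf : Measurable f)
    (hg : Measurable g) : Measurable fun a => f a < g a :=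
  measurableSet_setOfPred.1 (measurableSet_lt hf hg)

lemma measurable_prop_le {α : Type*} [MeasurableSpace α] {f g : α → ℝ} (hf : Measurable f)
    (hg : Measurable g) : Measurable fun a => f a ≤ g a :=
  measurableSet_setOfPred.1 (measurableSet_le hf hg)

lemma measurable_prop_eq {α : Type*} [MeasurableSpace α] {f g : α → ℕ} (hf : Measurable f)
    (hg : Measurable g) : Measurable fun a => f a = g a :=
  measurableSet_setOfPred.1 (measurableSet_eq_fun hf hg)

lemma measurable_tabOf : Measurable fun p : (ℕ → ℝ) × ℝ => tabOf p.1 p.2 := by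
  have hlt : ∀ ν, Measurable fun p : (ℕ → ℝ) × ℝ => p.2 < cum p.1 (ν + 1) := fun ν =>
    measurable_prop_lt measurable_snd ((measurable_cum _).comp measurable_fst)
  refine measurable_to_countable' fun ν => ?_
  have : (fun p : (ℕ → ℝ) × ℝ => tabOf p.1 p.2) ⁻¹' {ν} =
      {p | (p.2 < cum p.1 (ν + 1) ∧ ∀ μ : Fin ν, ¬ p.2 < cum p.1 ((μ : ℕ) + 1)) ∨
        (ν = 0 ∧ ∀ μ, ¬ p.2 < cum p.1 (μ + 1))} := by
    ext ⟨ℓ, x⟩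
    simp only [mem_preimage, Set.mem_singleton_iff, mem_ofPred_eq]
    constructor
    · rintro rfl
      by_cases h : {ν | x < cum ℓ (ν + 1)}.Nonempty
      · exact Or.inl ⟨sInf_mem h, fun μ hμ => absurd (Nat.sInf_le hμ) (not_le.2 μ.2)⟩
      · rw [Set.not_nonempty_iff_eq_empty] at h
        refine Or.inr ⟨by rw [tabOf, h, Nat.sInf_empty], fun μ hμ => ?_⟩
        have : μ ∈ {ν | x < cum ℓ (ν + 1)} := hμ
        grind
    · rintro (⟨h1, h2⟩ | ⟨rfl, h⟩)
      · refine le_antisymm (Nat.sInf_le h1) ?_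
        by_contra hc
        exact h2 ⟨_, not_le.1 hc⟩ (sInf_mem (s := {ν | x < cum ℓ (ν + 1)}) ⟨ν, h1⟩)
      · have : {ν | x < cum ℓ (ν + 1)} = ∅ := by ext μ; simpa using h μ
        rw [tabOf, this, Nat.sInf_empty]
  rw [this, measurableSet_setOfPred]
  fun_prop

lemma measurable_cdist : Measurable fun p : (ℕ → ℝ) × ℝ × ℝ => cdist p.1 p.2.1 p.2.2 := by
  have h1 : Measurable fun p : (ℕ → ℝ) × ℝ × ℝ => p.1 (tabOf p.1 p.2.1) := by
    have h2 : Measurable fun p : (ℕ → ℝ) × ℕ => p.1 p.2 :=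
      measurable_from_prod_countable_left fun n => measurable_pi_apply n
    have h3 : Measurable fun p : (ℕ → ℝ) × ℝ × ℝ => (p.1, tabOf p.1 p.2.1) :=
      measurable_fst.prodMk (measurable_tabOf.comp
        (measurable_fst.prodMk (measurable_fst.comp measurable_snd)))
    exact h2.comp h3
  unfold cdist
  refine Measurable.ite (measurableSet_lt (by fun_prop) (by fun_prop)) (by fun_prop) ?_
  fun_prop

lemma measurable_goodSticks : Measurable GoodSticks := by
  have h2 : Measurable fun ℓ : ℕ → ℝ => Tendsto (cum ℓ) atTop (𝓝 1) :=
    measurableSet_setOfPred.1 (measurableSet_tendsto (𝓝 1) fun ν => measurable_cum ν)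
  have h3 : GoodSticks = fun ℓ => (∀ ν, 0 < ℓ ν) ∧ Tendsto (cum ℓ) atTop (𝓝 1) := by
    funext ℓ
    refine propext (and_congr_right fun h => ?_)
    exact hasSum_iff_tendsto_nat_of_nonneg (fun i => (h i).le) 1
  rw [h3]
  fun_prop

lemma measurable_goodPoints : Measurable GoodPoints := by
  have : GoodPoints = fun U => (∀ i, 0 ≤ U i ∧ U i < 1) ∧ ∀ i j, U i = U j → i = j := rfl
  rw [this]
  fun_prop

lemma measurable_tabOf_apply (i : ℕ) : Measurable fun p : (ℕ → ℝ) × (ℕ → ℝ) => tabOf p.1 (p.2 i) :=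
  measurable_tabOf.comp (measurable_fst.prodMk ((measurable_pi_apply i).comp measurable_snd))

lemma measurable_cdist_apply (i j : ℕ) :
    Measurable fun p : (ℕ → ℝ) × (ℕ → ℝ) => cdist p.1 (p.2 i) (p.2 j) :=
  measurable_cdist.comp (g := fun p : (ℕ → ℝ) × ℝ × ℝ => cdist p.1 p.2.1 p.2.2)
    (f := fun p : (ℕ → ℝ) × (ℕ → ℝ) => (p.1, p.2 i, p.2 j))
    (measurable_fst.prodMk (((measurable_pi_apply i).comp measurable_snd).prodMk
    ((measurable_pi_apply j).comp measurable_snd)))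

lemma measurable_paint : Measurable paint := by
  refine measurable_generateFrom ?_
  rintro _ ⟨N, g, rfl⟩
  have hgood : Measurable fun p : (ℕ → ℝ) × (ℕ → ℝ) => GoodSticks p.1 ∧ GoodPoints p.2 :=
    (measurable_goodSticks.comp measurable_fst).and (measurable_goodPoints.comp measurable_snd)
  have : paint ⁻¹' {u | u.perm N = g} = {p | ((GoodSticks p.1 ∧ GoodPoints p.2) ∧
      (∀ i ∈ range N, g i ∈ range N ∧ tabOf p.1 (p.2 i) = tabOf p.1 (p.2 (g i)) ∧
        ∀ j ∈ range N, tabOf p.1 (p.2 i) = tabOf p.1 (p.2 j) →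
          cdist p.1 (p.2 i) (p.2 (g i)) ≤ cdist p.1 (p.2 i) (p.2 j)) ∧
      ∀ i, i ∉ range N → g i = i) ∨ (¬ (GoodSticks p.1 ∧ GoodPoints p.2) ∧ 1 = g)} := by
    ext ⟨ℓ, U⟩
    simp only [mem_preimage, mem_ofPred_eq]
    by_cases h : GoodSticks ℓ ∧ GoodPoints U
    · rw [paint_eq h.1 h.2]
      simp only [h, not_true, false_and, or_false, true_and]
      constructor
      · rintro rfl
        exact (seating h.1 h.2).isNext_virt N
      · intro hN
        exact ((seating h.1 h.2).isNext_virt N).unique hN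
    · rw [paint, dif_neg h]
      simp [h]
  rw [this, measurableSet_setOfPred]
  refine (hgood.and (Measurable.and ?_ measurable_const)).or (hgood.not.and measurable_const)
  refine Measurable.forall fun i => measurable_const.imp (measurable_const.and
    (Measurable.and ?_ ?_))
  · exact measurable_prop_eq (measurable_tabOf_apply i) (measurable_tabOf_apply _)
  · refine Measurable.forall fun j => measurable_const.imp (Measurable.imp ?_ ?_)
    · exact measurable_prop_eq (measurable_tabOf_apply i) (measurable_tabOf_apply _)
    · exact measurable_prop_le (measurable_cdist_apply _ _) (measurable_cdist_apply _ _)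

/-! ## Successive splitting of arcs -/

/-- Average over the position of the new guest `N` on the arc `j`. -/
def splitArc (j N : ℕ) (H : (ℕ → ℝ) → ℝ≥0∞) (L : ℕ → ℝ) : ℝ≥0∞ :=
  ∫⁻ x in Ioo 0 (L j), H (update (update L j x) N (L j - x))

/-- The guests `0, …, N - 1` arrive one after another. The guest `k` splits the arc of the guest
`p k` if `p k < k`, and opens a circle of length `tot k` otherwise. The result is the integral of
`H` over all positions of the guests that split arcs. -/
def arrivals (p : ℕ → ℕ) : ℕ → ((ℕ → ℝ) → ℝ≥0∞) → (ℕ → ℝ) → ℝ≥0∞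
  | 0, H, tot => H tot
  | N + 1, H, tot =>
    if p N < N then arrivals p N (splitArc (p N) N H) tot
    else arrivals p N (fun L => H (update L N (tot N))) tot

/-- The guest who opened the circle of the guest `k`. -/
def rootOf (p : ℕ → ℕ) (k : ℕ) : ℕ := if _h : p k < k then rootOf p (p k) else k

lemma rootOf_of_lt {p : ℕ → ℕ} {k : ℕ} (h : p k < k) : rootOf p k = rootOf p (p k) := by
  rw [rootOf, dif_pos h]

lemma rootOf_of_not_lt {p : ℕ → ℕ} {k : ℕ} (h : ¬ p k < k) : rootOf p k = k := by
  rw [rootOf, dif_neg h]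

lemma rootOf_le (p : ℕ → ℕ) (k : ℕ) : rootOf p k ≤ k := by
  induction k using Nat.strong_induction_on with
  | _ k ih =>
    by_cases h : p k < k
    · rw [rootOf_of_lt h]; exact (ih _ h).trans h.le
    · rw [rootOf_of_not_lt h]

lemma not_lt_rootOf (p : ℕ → ℕ) (k : ℕ) : ¬ p (rootOf p k) < rootOf p k := by
  induction k using Nat.strong_induction_on with
  | _ k ih =>
    by_cases h : p k < k
    · rw [rootOf_of_lt h]; exact ih _ h
    · rwa [rootOf_of_not_lt h]

section Measurability

variable {α : Type*} [MeasurableSpace α]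

lemma measurable_splitArc (j N : ℕ) {H : α → (ℕ → ℝ) → ℝ≥0∞} (hH : Measurable (uncurry H)) :
    Measurable (uncurry fun a => splitArc j N (H a)) := by
  have : (uncurry fun a => splitArc j N (H a)) = fun q : α × (ℕ → ℝ) =>
      ∫⁻ x : ℝ, {y : (α × (ℕ → ℝ)) × ℝ | y.2 ∈ Ioo 0 (y.1.2 j)}.indicator
        (fun y => H y.1.1 (update (update y.1.2 j y.2) N (y.1.2 j - y.2)))
        (q, x) := by
    funext q
    rw [uncurry, splitArc, ← lintegral_indicator measurableSet_Ioo]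
    rfl
  rw [this]
  refine Measurable.lintegral_prod_right' (Measurable.indicator ?_ ?_)
  · fun_prop
  · have e : {y : (α × (ℕ → ℝ)) × ℝ | y.2 ∈ Ioo 0 (y.1.2 j)} =
      {y | 0 < y.2} ∩ {y | y.2 < y.1.2 j} := rfl
    rw [e]
    exact (measurableSet_lt (by fun_prop) (by fun_prop)).inter
      (measurableSet_lt (by fun_prop) (by fun_prop))

lemma measurable_arrivals (p : ℕ → ℕ) (N : ℕ) {H : α → (ℕ → ℝ) → ℝ≥0∞} {tot : α → ℕ → ℝ}
    (hH : Measurable (uncurry H)) (ht : Measurable tot) :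
    Measurable fun a => arrivals p N (H a) (tot a) := by
  induction N generalizing H with
  | zero => exact hH.comp (measurable_id.prodMk ht)
  | succ N ih =>
    simp only [arrivals]
    split_ifs
    · exact ih (measurable_splitArc _ _ hH)
    · refine ih (H := fun a L => H a (update L N (tot a N))) ?_
      have h1 : Measurable fun q : α × (ℕ → ℝ) => update q.2 N (tot q.1 N) := by
        refine measurable_pi_lambda _ fun i => ?_
        simp only [update_apply]
        split_ifs
        · fun_prop
        · fun_prop
      exact hH.comp (measurable_fst.prodMk h1)

end Measurability

lemma measurable_splitArc' (j N : ℕ) {H : (ℕ → ℝ) → ℝ≥0∞} (hH : Measurable H) :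
    Measurable (splitArc j N H) :=
  (measurable_splitArc (α := Unit) j N (H := fun _ => H) (hH.comp measurable_snd)).comp
    (measurable_const.prodMk measurable_id : Measurable fun L : ℕ → ℝ => (Unit.unit, L))

lemma splitArc_lintegral {β : Type*} [MeasurableSpace β] (ν : Measure β) [SFinite ν] (j N : ℕ)
    {G : (ℕ → ℝ) → β → ℝ≥0∞} (hG : Measurable (uncurry G)) (L : ℕ → ℝ) :
    splitArc j N (fun L => ∫⁻ y, G L y ∂ν) L = ∫⁻ y, splitArc j N (fun L => G L y) L ∂ν := by
  unfold splitArc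
  rw [lintegral_lintegral_swap]
  fun_prop

lemma arrivals_lintegral {β : Type*} [MeasurableSpace β] (ν : Measure β) [SFinite ν] (p : ℕ → ℕ)
    (N : ℕ) {G : (ℕ → ℝ) → β → ℝ≥0∞} (hG : Measurable (uncurry G)) (tot : ℕ → ℝ) :
    arrivals p N (fun L => ∫⁻ y, G L y ∂ν) tot = ∫⁻ y, arrivals p N (fun L => G L y) tot ∂ν := by
  induction N generalizing G with
  | zero => rfl
  | succ N ih =>
    simp only [arrivals]
    split_ifs
    · have e : splitArc (p N) N (fun L => ∫⁻ y, G L y ∂ν) =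
          fun L => ∫⁻ y, splitArc (p N) N (fun L => G L y) L ∂ν :=
        funext fun L => splitArc_lintegral ν _ _ hG L
      rw [e, ih]
      have := measurable_splitArc (p N) N (H := fun y L => G L y) (hG.comp measurable_swap)
      exact this.comp measurable_swap
    · refine ih (G := fun L y => G (update L N (tot N)) y) ?_
      have h1 : Measurable fun q : (ℕ → ℝ) × β => (update q.1 N (tot N), q.2) := by
        fun_prop
      exact hG.comp h1

lemma arrivals_const_mul (p : ℕ → ℕ) (N : ℕ) {H : (ℕ → ℝ) → ℝ≥0∞} (hH : Measurable H)
    (c : ℝ≥0∞) (tot : ℕ → ℝ) :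
    arrivals p N (fun L => c * H L) tot = c * arrivals p N H tot := by
  induction N generalizing H with
  | zero => rfl
  | succ N ih =>
    simp only [arrivals]
    split_ifs
    · rw [← ih (measurable_splitArc' _ _ hH)]
      congr 1
      funext L
      rw [splitArc, splitArc, lintegral_const_mul]
      refine hH.comp (measurable_pi_lambda _ fun i => ?_)
      simp only [update_apply]
      split_ifs <;> fun_prop
    · refine ih (H := fun L => H (update L N (tot N))) (hH.comp ?_)
      refine measurable_pi_lambda _ fun i => ?_
      simp only [update_apply]
      split_ifs <;> fun_prop

lemma arrivals_update (p : ℕ → ℕ) (N : ℕ) (H : (ℕ → ℝ) → ℝ≥0∞) (tot : ℕ → ℝ) {k : ℕ}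
    (hk : N ≤ k) (y : ℝ) : arrivals p N H (update tot k y) =
      arrivals p N (fun L => H (update L k y)) tot := by
  induction N generalizing H with
  | zero => rfl
  | succ N ih =>
    simp only [arrivals]
    split_ifs with h
    · rw [ih _ (by omega)]
      congr 1
      funext L
      rw [splitArc, splitArc, update_of_ne (by omega : p N ≠ k)]
      refine lintegral_congr fun x => ?_
      rw [update_comm (by omega : k ≠ p N), update_comm (by omega : k ≠ N)]
    · rw [ih _ (by omega), update_of_ne (by omega : N ≠ k)]
      congr 1
      funext L
      rw [update_comm (by omega : k ≠ N)]

lemma arrivals_congr_tot (p : ℕ → ℕ) (N : ℕ) {H H' : (ℕ → ℝ) → ℝ≥0∞} {tot tot' : ℕ → ℝ}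
    (ht : ∀ k < N, ¬ p k < k → tot k = tot' k)
    (hH : ∀ L L' : ℕ → ℝ, (∀ k < N, L k = L' k) → H L = H' L') :
    arrivals p N H tot = arrivals p N H' tot' := by
  induction N generalizing H H' with
  | zero => exact hH _ _ (by simp)
  | succ N ih =>
    simp only [arrivals]
    split_ifs with h
    · refine ih (fun k hk => ht k (by omega)) fun L L' hL => ?_
      rw [splitArc, splitArc, hL _ h]
      refine lintegral_congr fun x => hH _ _ fun k hk => ?_
      simp only [update_apply]
      split_ifs <;> first | rfl | exact hL k (by omega)
    · refine ih (fun k hk => ht k (by omega)) fun L L' hL => hH _ _ fun k hk => ?_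
      simp only [update_apply]
      split_ifs
      · exact ht N (by omega) h
      · exact hL k (by omega)

/-- The total length of the arcs of the circle opened by the guest `b`. -/
def circleTotal (p : ℕ → ℕ) (N : ℕ) (L : ℕ → ℝ) (b : ℕ) : ℝ :=
  ∑ k ∈ range N, if rootOf p k = b then L k else 0

lemma arrivals_congr (p : ℕ → ℕ) (N : ℕ) {H H' : (ℕ → ℝ) → ℝ≥0∞} {tot : ℕ → ℝ}
    (hH : ∀ L : ℕ → ℝ, (∀ b < N, ¬ p b < b → circleTotal p N L b = tot b) → H L = H' L) :
    arrivals p N H tot = arrivals p N H' tot := by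
  induction N generalizing H H' with
  | zero => exact hH _ (by simp)
  | succ N ih =>
    simp only [arrivals]
    split_ifs with h
    · refine ih fun L hL => ?_
      rw [splitArc, splitArc]
      refine lintegral_congr fun x => hH _ fun b hb hb' => ?_
      have hbN : b < N := by
        all_goals grind
      rw [← hL b hbN hb', circleTotal, circleTotal, sum_range_succ]
      simp only [update_self]
      rw [rootOf_of_lt h, ← Finset.sum_erase_add _ _ (mem_range.2 h),
        ← Finset.sum_erase_add (range N) _ (mem_range.2 h), add_assoc]
      congr 1
      · refine sum_congr rfl fun k hk => ?_
        obtain ⟨h1, h2⟩ := mem_erase.1 hk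
        have := mem_range.1 h2
        rw [update_of_ne (by omega), update_of_ne h1]
      · rw [update_of_ne (by omega), update_self]
        split_ifs <;> ring
    · refine ih fun L hL => hH _ fun b hb hb' => ?_
      rw [circleTotal, sum_range_succ, update_self, rootOf_of_not_lt h]
      have e : ∑ k ∈ range N, (if rootOf p k = b then update L N (tot N) k else 0) =
          circleTotal p N L b := by
        refine sum_congr rfl fun k hk => ?_
        grind
      rw [e]
      rcases Nat.lt_succ_iff_lt_or_eq.1 hb with h' | rfl
      · rw [hL b h' hb', if_neg (by omega), add_zero]
      · rw [if_pos rfl, circleTotal, Finset.sum_eq_zero, zero_add]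
        intro k hk
        have := rootOf_le p k
        have := mem_range.1 hk
        rw [if_neg (by omega)]

/-! ### Integration over the lengths of the circles -/

/-- Lebesgue measure on the positive half-line. -/
abbrev posVol : Measure ℝ := volume.restrict (Ioi 0)

lemma lintegral_split_pos {f : ℝ → ℝ → ℝ≥0∞} (hf : Measurable (uncurry f)) :
    ∫⁻ u, (∫⁻ t in Ioo 0 u, f t (u - t)) ∂posVol = ∫⁻ t, ∫⁻ v, f t v ∂posVol ∂posVol := by
  have h1 : ∀ u, u ∈ Ioi (0 : ℝ) → ∫⁻ t in Ioo 0 u, f t (u - t) =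
      ∫⁻ t, (Ioi (0 : ℝ)).indicator (fun v => f t v) (u - t) ∂posVol := by
    intro u hu
    rw [← lintegral_indicator measurableSet_Ioo, ← lintegral_indicator measurableSet_Ioi]
    refine lintegral_congr fun t => ?_
    simp only [indicator_apply, mem_Ioo, mem_Ioi, sub_pos]
    grind
  have hm : Measurable fun q : ℝ × ℝ => (Ioi (0 : ℝ)).indicator (fun v => f q.2 v) (q.1 - q.2) := by
    have : (fun q : ℝ × ℝ => (Ioi (0 : ℝ)).indicator (fun v => f q.2 v) (q.1 - q.2)) =
        {q : ℝ × ℝ | 0 < q.1 - q.2}.indicator fun q => f q.2 (q.1 - q.2) := by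
      funext q; simp only [indicator_apply, mem_Ioi, mem_ofPred_eq]
    rw [this]
    refine Measurable.indicator (hf.comp (f := fun q : ℝ × ℝ => (q.2, q.1 - q.2)) (by fun_prop)) ?_
    exact measurableSet_lt measurable_const (by fun_prop)
  rw [setLIntegral_congr_fun measurableSet_Ioi h1, lintegral_lintegral_swap hm.aemeasurable]
  refine setLIntegral_congr_fun measurableSet_Ioi fun t ht => ?_
  simp only [posVol]
  rw [← lintegral_indicator measurableSet_Ioi, ← lintegral_indicator measurableSet_Ioi]
  refine Eq.trans (lintegral_congr fun u => ?_)
    (lintegral_sub_right_eq_self ((Ioi (0 : ℝ)).indicator fun v => f t v) t)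
  simp only [indicator_apply, mem_Ioi, sub_pos]
  all_goals grind

lemma measurable_update₂ (x : ℕ → ℝ) (j N : ℕ) :
    Measurable fun q : ℝ × ℝ => update (update x j q.1) N q.2 := by
  fun_prop

/-- The guests who opened circles. -/
def openers (p : ℕ → ℕ) (N : ℕ) : Finset ℕ := (range N).filter fun k => ¬ p k < k

lemma lmarginal_arrivals (p : ℕ → ℕ) (N : ℕ) {H : (ℕ → ℝ) → ℝ≥0∞} (hH : Measurable H) :
    ∫⋯∫⁻_openers p N, arrivals p N H ∂(fun _ => posVol) =
      ∫⋯∫⁻_Finset.range N, H ∂(fun _ => posVol) := by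
  induction N generalizing H with
  | zero => rfl
  | succ N ih =>
    have hup : Measurable fun q : (ℕ → ℝ) × ℝ => update q.1 N q.2 := measurable_update'
    by_cases h : p N < N
    · have e1 : openers p (N + 1) = openers p N := by
        rw [openers, range_add_one, filter_insert, if_neg (by simpa using h)]; rfl
      have e2 : arrivals p (N + 1) H = arrivals p N (splitArc (p N) N H) := by
        funext tot; simp only [arrivals, if_pos h]
      have hj : p N ∈ range N := mem_range.2 h
      have hsm := measurable_splitArc' (p N) N hH
      rw [e1, e2, ih hsm, range_add_one, lmarginal_insert' _ hH Finset.notMem_range_self]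
      have hm2 : Measurable fun x : ℕ → ℝ => ∫⁻ v, H (update x N v) ∂posVol :=
        Measurable.lintegral_prod_right' (f := fun q : (ℕ → ℝ) × ℝ => H (update q.1 N q.2))
          (hH.comp hup)
      rw [lmarginal_erase' _ hsm hj, lmarginal_erase' _ hm2 hj]
      congr 1
      funext x
      rw [← lintegral_split_pos (f := fun t v =>
        H (update (update x (p N) t) N v)) (hH.comp (measurable_update₂ x _ _))]
      refine lintegral_congr fun u => ?_
      rw [splitArc]
      simp
    · have e1 : openers p (N + 1) = insert N (openers p N) := by
        rw [openers, range_add_one, filter_insert, if_pos h]; rfl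
      have e2 : arrivals p (N + 1) H =
          fun tot => arrivals p N (fun L => H (update L N (tot N))) tot := by
        funext tot; simp only [arrivals, if_neg h]
      have hmm : Measurable fun tot : ℕ → ℝ =>
          arrivals p N (fun L => H (update L N (tot N))) tot := by
        refine measurable_arrivals p N (tot := id)
          (H := fun tot L => H (update L N (tot N))) (hH.comp ?_) measurable_id
        fun_prop
      rw [e1, e2, lmarginal_insert' _ hmm (by simp [openers]), range_add_one,
        lmarginal_insert' _ hH Finset.notMem_range_self, ← ih]
      · congr 1
        funext tot
        rw [arrivals_lintegral (G := fun L y => H (update L N y)) _ _ _ (hH.comp hup)]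
        refine lintegral_congr fun y => ?_
        rw [arrivals_update _ _ _ _ le_rfl]
        simp
      · exact Measurable.lintegral_prod_right'
          (f := fun q : (ℕ → ℝ) × ℝ => H (update q.1 N q.2)) (hH.comp hup)

/-! ## Product measures -/

lemma lintegral_pi_prod {ι : Type*} [Fintype ι] {E : ι → Type*} [∀ i, MeasurableSpace (E i)]
    (μ : ∀ i, Measure (E i)) [∀ i, SigmaFinite (μ i)] {f : ∀ i, E i → ℝ≥0∞}
    (hf : ∀ i, Measurable (f i)) :
    ∫⁻ x, ∏ i, f i (x i) ∂Measure.pi μ = ∏ i, ∫⁻ y, f i y ∂μ i := by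
  have key : ∀ (n : ℕ) (E : Fin n → Type _) [∀ i, MeasurableSpace (E i)]
      (μ : ∀ i, Measure (E i)) [∀ i, SigmaFinite (μ i)] (f : ∀ i, E i → ℝ≥0∞),
      (∀ i, Measurable (f i)) →
      ∫⁻ x, ∏ i, f i (x i) ∂Measure.pi μ = ∏ i, ∫⁻ y, f i y ∂μ i := by
    intro n
    induction n with
    | zero => intro E _ μ _ f _; simp
    | succ n ih =>
      intro E _ μ _ f hf
      have := ((measurePreserving_piFinSuccAbove μ 0).symm)
      rw [← this.lintegral_comp_emb (measurableEmbedding _)]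
      simp_rw [MeasurableEquiv.piFinSuccAbove_symm_apply, Fin.insertNthEquiv, Fin.prod_univ_succ]
      have hg : Measurable fun x : ∀ j : Fin n, E j.succ => ∏ j : Fin n, f j.succ (x j) :=
        measurable_prod _ fun j _ => (hf _).comp (measurable_pi_apply j)
      have e := lintegral_prod_mul (μ := μ 0) (ν := Measure.pi fun j : Fin n => μ j.succ)
        (hf 0).aemeasurable hg.aemeasurable
      rw [ih (fun j => E j.succ) (fun j => μ j.succ) (fun j => f j.succ) (fun j => hf _)] at e
      exact e
  let e := (Fintype.equivFin ι).symm
  rw [← (measurePreserving_piCongrLeft _ e).lintegral_comp_emb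
    (measurableEmbedding _), ← e.prod_comp]
  simp_rw [← e.prod_comp, MeasurableEquiv.coe_piCongrLeft, piCongrLeft_apply_apply]
  exact key _ (fun i => E (e i)) (fun i => μ (e i)) (fun i => f (e i)) fun i => hf _

lemma pi_withDensity {ι : Type*} [Fintype ι] {E : ι → Type*} [∀ i, MeasurableSpace (E i)]
    (μ : ∀ i, Measure (E i)) [∀ i, SigmaFinite (μ i)] {f : ∀ i, E i → ℝ≥0∞}
    (hf : ∀ i, Measurable (f i)) [∀ i, SigmaFinite ((μ i).withDensity (f i))] :
    Measure.pi (fun i => (μ i).withDensity (f i)) =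
      (Measure.pi μ).withDensity fun x => ∏ i, f i (x i) := by
  refine Measure.pi_eq fun s hs => ?_
  rw [withDensity_apply _ (MeasurableSet.univ_pi hs), ← lintegral_indicator (MeasurableSet.univ_pi hs)]
  have : (Set.univ.pi s).indicator (fun x : ∀ i, E i => ∏ i, f i (x i)) =
      fun x => ∏ i, (s i).indicator (f i) (x i) := by
    funext x
    by_cases h : x ∈ Set.univ.pi s
    · rw [indicator_of_mem h]
      exact prod_congr rfl fun i _ => (indicator_of_mem (h i trivial) _).symm
    · rw [indicator_of_notMem h]
      simp only [mem_univ_pi, not_forall] at h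
      obtain ⟨i, hi⟩ := h
      exact (prod_eq_zero (mem_univ i) (indicator_of_notMem hi _)).symm
  rw [this, lintegral_pi_prod μ fun i => (hf i).indicator (hs i)]
  exact prod_congr rfl fun i _ => by rw [withDensity_apply _ (hs i), lintegral_indicator (hs i)]

open Classical in
lemma pi_map_fibers {K B : Type*} [Fintype K] [Fintype B] {E : Type*} [MeasurableSpace E]
    (r : K → B) (μ : K → Measure E) [∀ k, SigmaFinite (μ k)] :
    (Measure.pi μ).map (fun (L : K → E) (b : B) (k : {k // r k = b}) => L k) =
      Measure.pi fun b => Measure.pi fun k : {k // r k = b} => μ k := by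
  have hm : Measurable fun (M : ∀ b : B, {k // r k = b} → E) (k : K) => M (r k) ⟨k, rfl⟩ := by
    fun_prop
  have e : Measure.pi μ = (Measure.pi fun b => Measure.pi fun k : {k // r k = b} => μ k).map
      fun (M : ∀ b : B, {k // r k = b} → E) (k : K) => M (r k) ⟨k, rfl⟩ := by
    refine Measure.pi_eq fun s hs => ?_
    rw [Measure.map_apply hm (MeasurableSet.univ_pi hs)]
    have : (fun (M : ∀ b : B, {k // r k = b} → E) (k : K) => M (r k) ⟨k, rfl⟩) ⁻¹'
        (Set.univ.pi s) = Set.univ.pi fun b => Set.univ.pi fun k : {k // r k = b} => s k := by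
      ext M
      simp only [mem_preimage, mem_univ_pi]
      constructor
      all_goals grind
    rw [this, Measure.pi_pi]
    simp_rw [Measure.pi_pi]
    exact Fintype.prod_fiberwise r fun k => μ k (s k)
  rw [e, map_map (by fun_prop) hm]
  have : (fun (L : K → E) (b : B) (k : {k // r k = b}) => L k) ∘
      (fun (M : ∀ b : B, {k // r k = b} → E) (k : K) => M (r k) ⟨k, rfl⟩) = id := by
    funext M b k
    obtain ⟨k, rfl⟩ := k
    rfl
  rw [this, Measure.map_id]

/-! ## Sums of positive lengths -/

/-- The density of the sum of `c` positive lengths. -/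
def powDensity (c : ℕ) (x : ℝ) : ℝ≥0∞ :=
  if 0 ≤ x then ofReal (x ^ (c - 1) / (c - 1).factorial) else 0

lemma measurable_powDensity (c : ℕ) : Measurable (powDensity c) :=
  Measurable.ite measurableSet_Ici (by fun_prop) measurable_const

/-- The law of the sum of `c` positive lengths. -/
def powLaw (c : ℕ) : Measure ℝ :=
  if c = 0 then dirac 0 else volume.withDensity (powDensity c)

lemma powDensity_ne_top (c : ℕ) (x : ℝ) : powDensity c x ≠ ∞ := by
  rw [powDensity]; split_ifs <;> simp

instance (c : ℕ) : SigmaFinite (volume.withDensity (powDensity c)) :=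
  SigmaFinite.withDensity_of_ne_top (ae_of_all _ fun x => powDensity_ne_top c x)

instance (c : ℕ) : SigmaFinite (powLaw c) := by rw [powLaw]; split_ifs <;> infer_instance

lemma posVol_eq : posVol = volume.restrict (Ici 0) := restrict_Ioi_eq_restrict_Ici

lemma powLaw_one : powLaw 1 = posVol := by
  rw [powLaw, if_neg one_ne_zero, posVol_eq, ← withDensity_indicator_one measurableSet_Ici]
  congr 1
  funext x
  simp [powDensity, indicator_apply]

lemma lintegral_powLaw_succ (c : ℕ) {f : ℝ → ℝ≥0∞} (hf : Measurable f) : ∫⁻ x, f x ∂powLaw (c + 1) =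
      ∫⁻ x, ofReal (x ^ c / c.factorial) * f x ∂posVol := by
  rw [powLaw, if_neg c.succ_ne_zero, lintegral_withDensity_eq_lintegral_mul _
    (measurable_powDensity _) hf, posVol_eq, ← lintegral_indicator measurableSet_Ici]
  refine lintegral_congr fun x => ?_
  by_cases h : 0 ≤ x <;> simp [powDensity, h]

lemma lintegral_Ioo_pow (c : ℕ) {u : ℝ} (hu : 0 < u) :
    ∫⁻ t in Ioo 0 u, ofReal ((u - t) ^ c / c.factorial) =
      ofReal (u ^ (c + 1) / (c + 1).factorial) := by
  have h1 : ∫ t in (0 : ℝ)..u, (u - t) ^ c / c.factorial = u ^ (c + 1) / (c + 1).factorial := by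
    rw [intervalIntegral.integral_div, intervalIntegral.integral_comp_sub_left (fun x => x ^ c) u]
    simp [Nat.factorial_succ]
    field_simp
  rw [setLIntegral_congr Ioo_ae_eq_Ioc, ← ofReal_integral_eq_lintegral_ofReal,
    ← intervalIntegral.integral_of_le hu.le, h1]
  · exact (intervalIntegrable_iff_integrableOn_Ioc_of_le hu.le).1
      (Continuous.intervalIntegrable (by fun_prop) _ _)
  · refine (ae_restrict_iff' measurableSet_Ioc).2 (ae_of_all _ fun t ht => ?_)
    have : 0 ≤ u - t := sub_nonneg.2 ht.2
    positivity

lemma lintegral_powLaw_add (c : ℕ) {f : ℝ → ℝ≥0∞} (hf : Measurable f) :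
    ∫⁻ x, ∫⁻ y, f (x + y) ∂powLaw c ∂posVol = ∫⁻ x, f x ∂powLaw (c + 1) := by
  cases c with
  | zero =>
    rw [zero_add, powLaw_one]
    refine lintegral_congr fun x => ?_
    have : Measurable fun y => f (x + y) := hf.comp (measurable_const_add x)
    rw [powLaw, if_pos rfl, lintegral_dirac' _ this, add_zero]
  | succ c =>
    have h : ∀ x, ∫⁻ y, f (x + y) ∂powLaw (c + 1) =
        ∫⁻ y, ofReal (y ^ c / c.factorial) * f (x + y) ∂posVol :=
      fun x => lintegral_powLaw_succ c (hf.comp (measurable_const_add x))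
    simp_rw [h]
    rw [← lintegral_split_pos (f := fun x y => ofReal (y ^ c / c.factorial) * f (x + y)) (by
        have : Measurable fun q : ℝ × ℝ => f (q.1 + q.2) := hf.comp (by fun_prop)
        simp only [uncurry_def]
        fun_prop), lintegral_powLaw_succ _ hf]
    refine setLIntegral_congr_fun measurableSet_Ioi fun u hu => ?_
    simp only [add_sub_cancel]
    rw [lintegral_mul_const _ (by fun_prop), lintegral_Ioo_pow c hu]

lemma pi_map_sum {K : Type*} [Fintype K] :
    (Measure.pi fun _ : K => posVol).map (fun x => ∑ k, x k) = powLaw (Fintype.card K) := by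
  have key : ∀ (n : ℕ) (f : ℝ → ℝ≥0∞), Measurable f →
      ∫⁻ x, f (∑ i, x i) ∂(Measure.pi fun _ : Fin n => posVol) = ∫⁻ x, f x ∂powLaw n := by
    intro n
    induction n with
    | zero => intro f hf; simp [powLaw, lintegral_dirac' _ hf]
    | succ n ih =>
      intro f hf
      have := ((measurePreserving_piFinSuccAbove (fun _ : Fin (n + 1) => posVol) 0).symm)
      rw [← this.lintegral_comp_emb (measurableEmbedding _)]
      simp_rw [MeasurableEquiv.piFinSuccAbove_symm_apply, Fin.insertNthEquiv, Fin.sum_univ_succ]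
      rw [← lintegral_powLaw_add n hf]
      have hm : Measurable fun q : ℝ × (Fin n → ℝ) => f (q.1 + ∑ i, q.2 i) := hf.comp (by fun_prop)
      refine Eq.trans (lintegral_prod _ hm.aemeasurable) (lintegral_congr fun x => ?_)
      exact ih _ (hf.comp (measurable_const_add x))
  refine Measure.ext_of_lintegral _ fun f hf => ?_
  rw [lintegral_map hf (by fun_prop), ← key _ f hf]
  let e := Fintype.equivFin K
  rw [← (measurePreserving_piCongrLeft (fun _ => posVol) e).lintegral_comp_emb
    (measurableEmbedding _)]
  simp_rw [← e.sum_comp, MeasurableEquiv.coe_piCongrLeft, piCongrLeft_apply_apply]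

open Classical in
lemma pi_map_groups {K S : Type*} [Fintype K] [Fintype S] (γ : K → S) :
    (Measure.pi fun _ : K => posVol).map (fun L s => ∑ k, if γ k = s then L k else 0) =
      Measure.pi fun s => powLaw (Fintype.card {k // γ k = s}) := by
  have h1 : (fun (L : K → ℝ) s => ∑ k, if γ k = s then L k else 0) =
      (fun (M : ∀ s : S, {k // γ k = s} → ℝ) s => ∑ k, M s k) ∘
        fun (L : K → ℝ) (s : S) (k : {k // γ k = s}) => L k := by
    funext L s
    simp only [comp_apply]
    rw [← sum_filter, sum_subtype (p := fun k => γ k = s) _ (by simp)]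
  rw [h1, ← map_map (by fun_prop) (by fun_prop), pi_map_fibers γ fun _ => posVol]
  have h2 : ∀ s, (Measure.pi fun _ : {k // γ k = s} => posVol).map (fun x => ∑ k, x k) =
    powLaw (Fintype.card {k // γ k = s}) := fun s => pi_map_sum
  have : ∀ s, SigmaFinite ((Measure.pi fun _ : {k // γ k = s} => posVol).map
      (fun x => ∑ k, x k)) := fun s => by rw [h2]; infer_instance
  rw [Measure.pi_map_pi (μ := fun s => Measure.pi fun _ : {k // γ k = s} => posVol)
    (f := fun s x => ∑ k, x k) fun s => Measurable.aemeasurable (by fun_prop)]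
  simp_rw [h2]

/-! ## Dirichlet distributions as laws of normalized lengths -/

section Normalized

variable {S : Type} [Fintype S] (m : S → ℕ) (j : S)

/-- The indices of the free coordinates on the face of the simplex. -/
abbrev FreeCoord : Type := {i // 0 < (m i : ℝ) ∧ i ≠ j}

open Classical in
/-- The vector with the coordinate `t` at `j` and the free coordinates `y`. -/
def facePoint (t : ℝ) (y : FreeCoord m j → ℝ) (i : S) : ℝ :=
  if i = j then t else if h : 0 < (m i : ℝ) ∧ i ≠ j then y ⟨i, h⟩ else 0

open Classical in
/-- The product of the densities of the positive coordinates. -/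
def faceDensity (t : ℝ) (y : FreeCoord m j → ℝ) : ℝ≥0∞ :=
  powDensity (m j) t * ∏ i : FreeCoord m j, powDensity (m i) (y i)

variable {m j}

open Classical in
lemma prod_coords {M : Type*} [CommMonoid M] (f : S → M)
    (hf : ∀ i, m i = 0 → f i = 1) : ∏ i, f i = f j * ∏ i : FreeCoord m j, f i := by
  have h1 : ∏ i : FreeCoord m j, f i = ∏ i with (0 < (m i : ℝ) ∧ i ≠ j), f i :=
    (prod_subtype (p := fun i => 0 < (m i : ℝ) ∧ i ≠ j) _ (by simp) _).symm
  rw [h1, ← Finset.mul_prod_erase _ _ (mem_univ j)]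
  congr 1
  symm
  refine Finset.prod_subset (fun i => by simp) fun i h2 h3 => hf i ?_
  have h4 : i ≠ j := (mem_erase.1 h2).1
  by_contra h5
  exact h3 (mem_filter.2 ⟨mem_univ _, by exact_mod_cast Nat.pos_of_ne_zero h5, h4⟩)

open Classical in
lemma sum_coords {M : Type*} [AddCommMonoid M] (f : S → M)
    (hf : ∀ i, m i = 0 → f i = 0) : ∑ i, f i = f j + ∑ i : FreeCoord m j, f i :=
  prod_coords (M := Multiplicative M) f hf

omit [Fintype S] in
lemma facePoint_self (t : ℝ) (y : FreeCoord m j → ℝ) : facePoint m j t y j = t := by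
  simp [facePoint]

omit [Fintype S] in
lemma facePoint_free (t : ℝ) (y : FreeCoord m j → ℝ) (i : FreeCoord m j) :
    facePoint m j t y i = y i := by
  rw [facePoint, if_neg i.2.2, dif_pos i.2]

omit [Fintype S] in
lemma facePoint_zero (hj : 0 < m j) (t : ℝ) (y : FreeCoord m j → ℝ) {i : S} (hi : m i = 0) :
    facePoint m j t y i = 0 := by
  rw [facePoint, if_neg (by rintro rfl; omega), dif_neg (by simp [hi])]

open Classical in
lemma sum_facePoint (hj : 0 < m j) (t : ℝ) (y : FreeCoord m j → ℝ) :
    ∑ i, facePoint m j t y i = t + ∑ i, y i := by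
  rw [sum_coords _ fun i hi => facePoint_zero hj t y hi, facePoint_self]
  simp_rw [facePoint_free]

omit [Fintype S] in
lemma measurable_facePoint :
    Measurable fun q : ℝ × (FreeCoord m j → ℝ) => facePoint m j q.1 q.2 := by
  refine measurable_pi_lambda _ fun i => ?_
  unfold facePoint
  split_ifs <;> fun_prop

lemma measurable_faceDensity :
    Measurable fun q : ℝ × (FreeCoord m j → ℝ) => faceDensity m j q.1 q.2 := by
  unfold faceDensity
  refine ((measurable_powDensity _).comp measurable_fst).mul
    (measurable_prod _ fun i _ => (measurable_powDensity _).comp (by fun_prop))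

lemma powDensity_smul (c : ℕ) {r : ℝ} (hr : 0 < r) (x : ℝ) :
    powDensity c (r * x) = ofReal (r ^ (c - 1)) * powDensity c x := by
  simp only [powDensity, mul_nonneg_iff_of_pos_left hr]
  split_ifs
  · rw [← ofReal_mul (by positivity), mul_pow]; congr 1; ring
  · simp

open Classical in
lemma faceDensity_smul (hj : 0 < m j) {r : ℝ} (hr : 0 < r) (t : ℝ) (y : FreeCoord m j → ℝ) :
    ofReal (r ^ Fintype.card (FreeCoord m j)) * faceDensity m j (r * t) (r • y) =
      ofReal (r ^ (∑ i, m i - 1)) * faceDensity m j t y := by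
  have h1 : ∑ i, m i - 1 = Fintype.card (FreeCoord m j) +
      ((m j - 1) + ∑ i : FreeCoord m j, (m i - 1)) := by
    rw [sum_coords (m := m) (j := j) m fun i hi => hi]
    have : ∑ i : FreeCoord m j, m i = ∑ i : FreeCoord m j, (m i - 1) +
        Fintype.card (FreeCoord m j) := by
      rw [← card_univ, Finset.card_eq_sum_ones, ← Finset.sum_add_distrib]
      refine sum_congr rfl fun i _ => ?_
      have : 0 < m i := by exact_mod_cast i.2.1
      omega
    omega
  simp only [faceDensity, Pi.smul_apply, smul_eq_mul, powDensity_smul _ hr]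
  rw [prod_mul_distrib, h1, pow_add, pow_add, ← Finset.prod_pow_eq_pow_sum,
    ofReal_mul (by positivity), ofReal_mul (by positivity),
    ofReal_prod_of_nonneg fun i _ => by positivity]
  ring

open Classical in
lemma pi_powLaw (hj : 0 < m j) : (Measure.pi fun i => powLaw (m i)) =
    ((volume : Measure (ℝ × (FreeCoord m j → ℝ))).withDensity
      fun q => faceDensity m j q.1 q.2).map fun q => facePoint m j q.1 q.2 := by
  have h1 : (volume : Measure (ℝ × (FreeCoord m j → ℝ))).withDensity
      (fun q => faceDensity m j q.1 q.2) = (powLaw (m j)).prod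
        (Measure.pi fun i : FreeCoord m j => powLaw (m i)) := by
    have h2 : (fun i : FreeCoord m j => powLaw (m i)) =
        fun i : FreeCoord m j => volume.withDensity (powDensity (m i)) := by
      funext i
      rw [powLaw, if_neg]
      have : 0 < m i := by exact_mod_cast i.2.1
      omega
    have h3 : Measurable fun y : FreeCoord m j → ℝ => ∏ i : FreeCoord m j, powDensity (m i) (y i) :=
      measurable_prod _ fun i _ => (measurable_powDensity _).comp (measurable_pi_apply i)
    rw [h2, pi_withDensity _ fun i => measurable_powDensity _, powLaw, if_neg hj.ne',
      prod_withDensity (measurable_powDensity _) h3]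
    rfl
  rw [h1]
  refine Measure.pi_eq fun s hs => ?_
  rw [Measure.map_apply measurable_facePoint (MeasurableSet.univ_pi hs)]
  by_cases h0 : ∀ i, m i = 0 → (0 : ℝ) ∈ s i
  · have : (fun q : ℝ × (FreeCoord m j → ℝ) => facePoint m j q.1 q.2) ⁻¹' Set.univ.pi s =
        s j ×ˢ Set.univ.pi fun i : FreeCoord m j => s i := by
      ext ⟨t, y⟩
      simp only [mem_preimage, mem_univ_pi, Set.mem_prod]
      constructor
      · intro h
        refine ⟨?_, fun i => ?_⟩
        · have := h j; rwa [facePoint_self] at this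
        · have := h i; rwa [facePoint_free] at this
      · rintro ⟨h2, h3⟩ i
        by_cases hi : m i = 0
        · rw [facePoint_zero hj t y hi]; exact h0 i hi
        · by_cases hij : i = j
          · subst hij; rwa [facePoint_self]
          · have := h3 ⟨i, by exact_mod_cast Nat.pos_of_ne_zero hi, hij⟩
            rwa [← facePoint_free (m := m) t y] at this
    rw [this, Measure.prod_prod, Measure.pi_pi]
    symm
    refine prod_coords _ fun i hi => ?_
    rw [powLaw, if_pos hi, dirac_apply' _ (hs i), indicator_of_mem (h0 i hi)]
    rfl
  · push Not at h0
    obtain ⟨i, hi, hi'⟩ := h0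
    rw [prod_eq_zero (mem_univ i)]
    · refine Eq.trans (congrArg _ ?_) measure_empty
      ext ⟨t, y⟩
      simp only [mem_preimage, mem_univ_pi, Set.mem_empty_iff_false, iff_false, not_forall]
      exact ⟨i, by rwa [facePoint_zero hj t y hi]⟩
    · rw [powLaw, if_pos hi, dirac_apply' _ (hs i), indicator_of_notMem hi']

open Classical in
lemma faceDensity_eq_zero {t : ℝ} {y : FreeCoord m j → ℝ} (h : t + ∑ i, y i < 0) :
    faceDensity m j t y = 0 := by
  by_cases ht : t < 0
  · simp [faceDensity, powDensity, ht.not_ge]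
  · obtain ⟨i, _, hi⟩ : ∃ i ∈ univ, y i < 0 := by
      by_contra! hc
      have := Finset.sum_nonneg hc
      linarith
    rw [faceDensity, prod_eq_zero (mem_univ i), mul_zero]
    simp [powDensity, hi.not_ge]

lemma lintegral_Ioc_pow (c : ℕ) {s : ℝ} (hs : 0 < s) : ∫⁻ u in Ioc 0 1, ofReal ((u / s) ^ c) =
      ofReal (1 / (s ^ c * (c + 1 : ℕ))) := by
  have h1 : ∫ u in (0 : ℝ)..1, (u / s) ^ c = 1 / (s ^ c * (c + 1 : ℕ)) := by
    simp_rw [div_pow]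
    rw [intervalIntegral.integral_div, integral_pow]
    simp
    field_simp
  rw [← ofReal_integral_eq_lintegral_ofReal, ← intervalIntegral.integral_of_le zero_le_one, h1]
  · exact (intervalIntegrable_iff_integrableOn_Ioc_of_le zero_le_one).1
      (Continuous.intervalIntegrable (by fun_prop) _ _)
  · refine (ae_restrict_iff' measurableSet_Ioc).2 (ae_of_all _ fun t ht => ?_)
    have := ht.1
    positivity

open Classical in
lemma lintegral_facePoint (hj : 0 < m j) {s : ℝ} (hs : 0 < s) {f : (S → ℝ) → ℝ≥0∞}
    (hf : Measurable f) :
    ∫⁻ x, (if ∑ i, x i ≤ 1 then f (fun i => s * x i / ∑ i, x i) else 0)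
        ∂(Measure.pi fun i => powLaw (m i)) =
      ofReal (1 / (s ^ (∑ i, m i - 1) * (∑ i, m i : ℕ))) *
        ∫⁻ y : FreeCoord m j → ℝ, faceDensity m j (s - ∑ i, y i) y *
          f (facePoint m j (s - ∑ i, y i) y) := by
  have hg : Measurable fun x : S → ℝ =>
      (if ∑ i, x i ≤ 1 then f (fun i => s * x i / ∑ i, x i) else 0) := by
    refine Measurable.ite ?_ (hf.comp (by fun_prop)) measurable_const
    exact measurableSet_le (by fun_prop) measurable_const
  set g := fun x : S → ℝ => (if ∑ i, x i ≤ 1 then f (fun i => s * x i / ∑ i, x i) else 0) with hgd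
  have hfd := measurable_faceDensity (m := m) (j := j)
  have hfp := measurable_facePoint (m := m) (j := j)
  have hsh : Measurable fun q : ℝ × (FreeCoord m j → ℝ) => (q.1 - ∑ i, q.2 i, q.2) := by fun_prop
  have hM : 1 ≤ ∑ i, m i := hj.trans_le (Finset.single_le_sum (fun _ _ => Nat.zero_le _)
    (mem_univ j))
  rw [pi_powLaw hj, lintegral_map hg hfp]
  refine Eq.trans (lintegral_withDensity_eq_lintegral_mul _ hfd (hg.comp hfp)) ?_
  rw [Measure.volume_eq_prod]
  refine Eq.trans (lintegral_prod_symm' _ (hfd.mul (hg.comp hfp))) ?_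
  have h1 : ∀ y : FreeCoord m j → ℝ, ∫⁻ t, ((fun q : ℝ × (FreeCoord m j → ℝ) =>
      faceDensity m j q.1 q.2) * (g ∘ fun q : ℝ × (FreeCoord m j → ℝ) =>
        facePoint m j q.1 q.2)) (t, y) =
      ∫⁻ u, faceDensity m j (u - ∑ i, y i) y * g (facePoint m j (u - ∑ i, y i) y) := fun y =>
    (lintegral_sub_right_eq_self (fun t => faceDensity m j t y * g (facePoint m j t y))
      (∑ i, y i)).symm
  refine Eq.trans (lintegral_congr h1) ?_
  refine Eq.trans (lintegral_lintegral_swap (f := fun (y : FreeCoord m j → ℝ) u =>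
    faceDensity m j (u - ∑ i, y i) y * g (facePoint m j (u - ∑ i, y i) y))
    (((hfd.mul (hg.comp hfp)).comp (hsh.comp measurable_swap)).aemeasurable)) ?_
  have h2 : ∀ᵐ u : ℝ, ∫⁻ y : FreeCoord m j → ℝ,
      faceDensity m j (u - ∑ i, y i) y * g (facePoint m j (u - ∑ i, y i) y) =
      (Ioc (0 : ℝ) 1).indicator (fun u => ofReal ((u / s) ^ (∑ i, m i - 1)) *
        ∫⁻ y : FreeCoord m j → ℝ, faceDensity m j (s - ∑ i, y i) y *
          f (facePoint m j (s - ∑ i, y i) y)) u := by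
    filter_upwards [compl_mem_ae_iff.2 (measure_singleton (0 : ℝ))] with u hu
    have hu0 : u ≠ 0 := hu
    have hsum : ∀ y : FreeCoord m j → ℝ, ∑ i, facePoint m j (u - ∑ i, y i) y i = u := fun y => by
      rw [sum_facePoint hj]; ring
    by_cases hu1 : u ∈ Ioc (0 : ℝ) 1
    · rw [indicator_of_mem hu1]
      have hr : 0 < u / s := div_pos hu1.1 hs
      have hmap := Measure.map_addHaar_smul (volume : Measure (FreeCoord m j → ℝ)) hr.ne'
      have hF : Measurable fun y : FreeCoord m j → ℝ => faceDensity m j (u - ∑ i, y i) y *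
          g (facePoint m j (u - ∑ i, y i) y) :=
        (hfd.mul (hg.comp hfp)).comp (hsh.comp (measurable_const.prodMk measurable_id))
      have e1 : (volume : Measure (FreeCoord m j → ℝ)) = ofReal
          ((u / s) ^ Fintype.card (FreeCoord m j)) • volume.map ((u / s) • ·) := by
        rw [hmap, smul_smul, Module.finrank_fintype_fun_eq_card, abs_of_pos (by positivity),
          ← ofReal_mul (by positivity), mul_inv_cancel₀ (by positivity)]
        simp
      rw [e1, lintegral_smul_measure, lintegral_map hF (by fun_prop), ← e1, smul_eq_mul]
      have hF2 := hF.comp (measurable_const_smul (α := FreeCoord m j → ℝ) (u / s))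
      have hG : Measurable fun y : FreeCoord m j → ℝ => faceDensity m j (s - ∑ i, y i) y *
          f (facePoint m j (s - ∑ i, y i) y) :=
        (hfd.mul (hf.comp hfp)).comp (hsh.comp (measurable_const.prodMk measurable_id))
      rw [← lintegral_const_mul _ hG]
      refine Eq.trans (lintegral_const_mul _ hF2).symm (lintegral_congr fun y => ?_)
      simp only [comp_apply]
      have e2 : u - ∑ i, ((u / s) • y) i = (u / s) * (s - ∑ i, y i) := by
        simp only [Pi.smul_apply, smul_eq_mul, ← mul_sum]
        field_simp
      have e3 : g (facePoint m j (u - ∑ i, ((u / s) • y) i) ((u / s) • y)) =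
          f (facePoint m j (s - ∑ i, y i) y) := by
        rw [hgd]
        simp only
        rw [hsum, if_pos hu1.2, e2]
        congr 1
        funext i
        have hu' := hu1.1.ne'
        unfold facePoint
        split_ifs
        · field_simp
        · simp only [Pi.smul_apply, smul_eq_mul]; field_simp
        · simp
      rw [e3, e2, ← mul_assoc, faceDensity_smul hj hr, mul_assoc]
    · rw [indicator_of_notMem hu1, lintegral_eq_zero_of_ae_eq_zero]
      refine ae_of_all _ fun y => ?_
      simp only [Pi.zero_apply]
      rcases lt_or_ge u 0 with h | h
      · rw [faceDensity_eq_zero (by linarith [show u - ∑ i, y i + ∑ i, y i = u by ring])]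
        simp
      all_goals grind
  rw [lintegral_congr_ae h2, lintegral_indicator measurableSet_Ioc, lintegral_mul_const _
    (by fun_prop), lintegral_Ioc_pow _ hs, Nat.sub_add_cancel hM]

end Normalized

section

variable {S : Type} [Fintype S]

lemma lintegral_dirichlet {m : S → ℕ} (hm : ∃ j, 0 < m j) {s : ℝ} (hs : 0 < s)
    {f : (S → ℝ) → ℝ≥0∞} (hf : Measurable f) :
    ∫⁻ x, (if ∑ i, x i ≤ 1 then f (fun i => s * x i / ∑ i, x i) else 0)
        ∂(Measure.pi fun i => powLaw (m i)) =
      ofReal (1 / (∑ i, m i).factorial) * ∫⁻ x, f x ∂dirichlet (fun i => (m i : ℝ)) s := by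
  classical
  have h : ∃ j, 0 < (m j : ℝ) := by simpa using hm
  have hj : 0 < m h.choose := by exact_mod_cast h.choose_spec
  have hM : 1 ≤ ∑ i, m i := hj.trans_le (Finset.single_le_sum (fun _ _ => Nat.zero_le _)
    (mem_univ _))
  rw [lintegral_facePoint hj hs hf, dirichlet, dif_pos h]
  set j := h.choose
  have hpt : simplexPoint (fun i => (m i : ℝ)) s j = fun y => facePoint m j (s - ∑ i, y i) y := by
    funext y i
    rfl
  have hmeas : Measurable fun y : FreeCoord m j → ℝ => (s - ∑ i, y i, y) := by fun_prop
  have hden : (fun y : FreeCoord m j → ℝ =>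
      if ∀ i, 0 ≤ simplexPoint (fun i => (m i : ℝ)) s j y i then
        ofReal (Real.Gamma (∑ i, (m i : ℝ)) * s ^ (1 - ∑ i, (m i : ℝ)) *
          ∏ i with 0 < (m i : ℝ), simplexPoint (fun i => (m i : ℝ)) s j y i ^ ((m i : ℝ) - 1) /
            Real.Gamma (m i))
      else 0) = fun y => ofReal ((∑ i, m i - 1).factorial / s ^ (∑ i, m i - 1)) *
        faceDensity m j (s - ∑ i, y i) y := by
    funext y
    have hfd : faceDensity m j (s - ∑ i, y i) y =
        ∏ i, if m i = 0 then 1 else powDensity (m i) (facePoint m j (s - ∑ i, y i) y i) := by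
      rw [prod_coords (m := m) (j := j) _ fun i hi => if_pos hi, if_neg hj.ne', facePoint_self,
        faceDensity]
      congr 1
      refine prod_congr rfl fun i _ => ?_
      have : m i ≠ 0 := by have := i.2.1; simp at this; omega
      rw [if_neg this, facePoint_free]
    rw [hpt, hfd]
    simp only
    set x := facePoint m j (s - ∑ i, y i) y with hx
    split_ifs with hpos
    · have e1 : ∀ i, (if m i = 0 then 1 else powDensity (m i) (x i)) =
          ofReal (if 0 < (m i : ℝ) then x i ^ ((m i : ℝ) - 1) / Real.Gamma (m i) else 1) := by
        intro i
        by_cases hi : m i = 0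
        · simp [hi]
        · obtain ⟨c, hc⟩ := Nat.exists_eq_succ_of_ne_zero hi
          rw [if_neg hi, if_pos (by exact_mod_cast Nat.pos_of_ne_zero hi), powDensity,
            if_pos (hpos i), hc]
          simp [Real.Gamma_nat_eq_factorial]
      simp_rw [e1]
      rw [← ofReal_prod_of_nonneg, ← ofReal_mul (by positivity),
        ← Finset.prod_filter]
      · congr 2
        obtain ⟨c, hc⟩ := Nat.exists_eq_succ_of_ne_zero (by omega : ∑ i, m i ≠ 0)
        have hc' : ∑ i, (m i : ℝ) = c + 1 := by exact_mod_cast hc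
        rw [hc', hc, Real.Gamma_nat_eq_factorial]
        rw [show (1 : ℝ) - (c + 1) = -(c : ℝ) by ring, Real.rpow_neg hs.le, Real.rpow_natCast]
        simp [div_eq_mul_inv]
      · intro i _
        have := hpos i
        split_ifs with h0
        · have := Real.Gamma_pos_of_pos h0
          positivity
        · norm_num
    · push Not at hpos
      obtain ⟨i, hi⟩ := hpos
      have hmi : m i ≠ 0 := fun h0 => by
        rw [hx, facePoint_zero hj _ _ h0] at hi
        grind
      rw [prod_eq_zero (mem_univ i), mul_zero]
      rw [if_neg hmi, powDensity, if_neg hi.not_ge]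
  have hfd : Measurable fun y : FreeCoord m j → ℝ => faceDensity m j (s - ∑ i, y i) y :=
    (measurable_faceDensity (m := m) (j := j)).comp hmeas
  have hfp : Measurable fun y : FreeCoord m j → ℝ => facePoint m j (s - ∑ i, y i) y :=
    (measurable_facePoint (m := m) (j := j)).comp hmeas
  have hG : Measurable fun y : FreeCoord m j → ℝ =>
      faceDensity m j (s - ∑ i, y i) y * f (facePoint m j (s - ∑ i, y i) y) :=
    hfd.mul (hf.comp hfp)
  rw [hden, hpt, lintegral_map hf hfp]
  refine Eq.trans ?_ (congrArg _
    (lintegral_withDensity_eq_lintegral_mul _ (hfd.const_mul _) (hf.comp hfp)).symm)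
  simp only [Pi.mul_apply, comp_apply, mul_assoc]
  rw [lintegral_const_mul _ hG, ← mul_assoc, ← ofReal_mul (by positivity)]
  congr 2
  obtain ⟨c, hc⟩ := Nat.exists_eq_succ_of_ne_zero (by omega : ∑ i, m i ≠ 0)
  rw [hc, Nat.factorial_succ]
  simp only [Nat.add_sub_cancel, Nat.succ_eq_add_one]
  push_cast
  field_simp

variable {K : Type*} [Fintype K]

lemma sum_card_fiber (γ : K → S) : ∑ i, card {k // γ k = i} = Fintype.card K := by
  classical
  rw [← card_eq_fintype_card, ← card_congr (sigmaFiberEquiv γ), Nat.card_sigma]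

open Classical in
lemma lintegral_normalized [Nonempty K] (γ : K → S) {s : ℝ} (hs : 0 < s)
    {f : (S → ℝ) → ℝ≥0∞} (hf : Measurable f) :
    ∫⁻ L in {L : K → ℝ | ∑ k, L k ≤ 1}, f (fun i => ∑ k, if γ k = i then s * L k / ∑ k, L k else 0)
        ∂(Measure.pi fun _ => posVol) =
      ofReal (1 / (Fintype.card K).factorial) *
        ∫⁻ x, f x ∂dirichlet (fun i => (card {k // γ k = i} : ℝ)) s := by
  have hm : ∃ i, 0 < card {k // γ k = i} := by
    obtain ⟨k⟩ := ‹Nonempty K›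
    exact ⟨γ k, card_pos_iff.2 ⟨⟨⟨k, rfl⟩⟩, inferInstance⟩⟩
  have hT : MeasurableSet {L : K → ℝ | ∑ k, L k ≤ 1} :=
    measurableSet_le (by fun_prop) measurable_const
  have hg : Measurable fun x : S → ℝ =>
      (if ∑ i, x i ≤ 1 then f (fun i => s * x i / ∑ i, x i) else 0) := by
    refine Measurable.ite ?_ (hf.comp (by fun_prop)) measurable_const
    exact measurableSet_le (by fun_prop) measurable_const
  have hagg : Measurable fun (L : K → ℝ) (i : S) => ∑ k, if γ k = i then L k else 0 := by
    refine measurable_pi_lambda _ fun i => measurable_sum _ fun k _ => ?_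
    split_ifs <;> fun_prop
  rw [← sum_card_fiber γ, ← lintegral_dirichlet hm hs hf]
  simp_rw [card_eq_fintype_card]
  rw [← pi_map_groups γ, lintegral_map hg hagg, ← lintegral_indicator hT]
  refine lintegral_congr fun L => ?_
  have e : ∑ i, ∑ k, (if γ k = i then L k else 0) = ∑ k, L k := by rw [Finset.sum_comm]; simp
  simp only [indicator_apply, mem_ofPred_eq, e]
  congr 2
  funext i
  rw [mul_sum, sum_div]
  grind

lemma isProbabilityMeasure_dirichlet [Nonempty K] (γ : K → S) {s : ℝ} (hs : 0 < s) :
    IsProbabilityMeasure (dirichlet (fun i => (card {k // γ k = i} : ℝ)) s) := by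
  classical
  have h := lintegral_normalized γ hs (f := fun _ => 1) measurable_const
  obtain ⟨c, hc⟩ := Nat.exists_eq_succ_of_ne_zero (Fintype.card_ne_zero (α := K))
  have h1 : (Measure.pi fun _ : K => posVol) {L : K → ℝ | ∑ k, L k ≤ 1} =
      ofReal (1 / (Fintype.card K).factorial) := by
    have e : {L : K → ℝ | ∑ k, L k ≤ 1} = (fun L => ∑ k, L k) ⁻¹' Iic 1 := rfl
    rw [e, ← Measure.map_apply (by fun_prop) measurableSet_Iic, pi_map_sum, hc,
      ← lintegral_indicator_one measurableSet_Iic,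
      lintegral_powLaw_succ c (measurable_one.indicator measurableSet_Iic)]
    have := lintegral_Ioo_pow c one_pos
    have e2 : ∀ x : ℝ, ofReal (x ^ c / c.factorial) * (Iic (1 : ℝ)).indicator 1 x =
        (Iic (1 : ℝ)).indicator (fun x => ofReal (x ^ c / c.factorial)) x := by
      intro x; simp [indicator_apply]
    simp_rw [e2]
    rw [lintegral_indicator measurableSet_Iic, Measure.restrict_restrict measurableSet_Iic,
      Set.inter_comm, Set.Ioi_inter_Iic]
    have e3 := lintegral_Ioc_pow c one_pos
    simp only [div_one, one_pow, one_mul] at e3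
    simp_rw [div_eq_mul_inv (_ ^ c : ℝ)]
    rw [lintegral_congr_ae (g := fun x => ofReal ((c.factorial : ℝ)⁻¹) *
      ofReal (x ^ c)), lintegral_const_mul _ (by fun_prop), e3,
      ← ofReal_mul (by positivity)]
    · congr 1
      rw [Nat.succ_eq_add_one, Nat.factorial_succ]
      grind
    · refine ae_of_all _ fun x => ?_
      simp only
      rw [← ofReal_mul (by positivity), mul_comm]
  rw [setLIntegral_const, one_mul, lintegral_one, h1] at h
  refine ⟨?_⟩
  have h2 : ofReal (1 / (Fintype.card K).factorial) ≠ 0 := by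
    rw [ne_eq, ofReal_eq_zero, not_le]; positivity
  exact ((mul_right_inj h2 ofReal_ne_top).1 (by rw [← h, mul_one])).symm

end

/-! ## The integral over the positions of the arriving guests -/

lemma lintegral_Ioo_mul {c : ℝ} (hc : 0 < c) (a : ℝ) {F : ℝ → ℝ≥0∞} (hF : Measurable F) :
    ∫⁻ x in Ioo 0 (c * a), F x = ofReal c * ∫⁻ x in Ioo 0 a, F (c * x) := by
  rw [← lintegral_indicator measurableSet_Ioo, ← lintegral_indicator measurableSet_Ioo]
  nth_rw 1 [← Real.smul_map_volume_mul_left hc.ne']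
  rw [lintegral_smul_measure, abs_of_pos hc, smul_eq_mul,
    lintegral_map (hF.indicator measurableSet_Ioo) (by fun_prop)]
  congr 1
  refine lintegral_congr fun x => ?_
  simp [indicator_apply, hc]

lemma arrivals_scale (p : ℕ → ℕ) (N : ℕ) {H : (ℕ → ℝ) → ℝ≥0∞} (hH : Measurable H) {c : ℕ → ℝ}
    (hc : ∀ k, 0 < c k) (tot : ℕ → ℝ) :
    arrivals p N H (fun k => c (rootOf p k) * tot k) =
      (∏ k ∈ range N with p k < k, ofReal (c (rootOf p k))) *
        arrivals p N (fun L => H fun k => c (rootOf p k) * L k) tot := by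
  induction N generalizing H with
  | zero => simp [arrivals]
  | succ N ih =>
    have hsc : Measurable fun (L : ℕ → ℝ) k => c (rootOf p k) * L k := by fun_prop
    simp only [arrivals]
    rw [range_add_one, filter_insert]
    split_ifs with h
    · rw [ih (measurable_splitArc' _ _ hH), Finset.prod_insert (by simp), mul_assoc,
        mul_left_comm]
      congr 1
      have hH' : Measurable fun L : ℕ → ℝ => H fun k => c (rootOf p k) * L k := hH.comp hsc
      rw [← arrivals_const_mul _ _ (measurable_splitArc' _ _ hH')]
      congr 1
      funext L
      rw [splitArc, splitArc, rootOf_of_lt h, lintegral_Ioo_mul (hc _)]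
      · congr 1
        refine lintegral_congr fun x => ?_
        congr 1
        funext k
        simp only [update_apply]
        split_ifs with h1 h2
        · rw [h1, rootOf_of_lt h]; ring
        · rw [h2]
        · rfl
      · refine hH.comp (measurable_pi_lambda _ fun i => ?_)
        simp only [update_apply]
        split_ifs <;> fun_prop
    · have hup : Measurable fun L : ℕ → ℝ => update L N (c (rootOf p N) * tot N) := by
        fun_prop
      have hH' : Measurable fun L : ℕ → ℝ => H (update L N (c (rootOf p N) * tot N)) := hH.comp hup
      rw [ih hH']
      congr 2
      funext L
      congr 1
      funext k
      simp only [update_apply]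
      split_ifs with h1
      · rw [h1]
      · rfl

lemma arrivals_zero (p : ℕ → ℕ) (N : ℕ) (tot : ℕ → ℝ) : arrivals p N (fun _ => 0) tot = 0 := by
  have := arrivals_const_mul p N (H := fun _ => 0) measurable_const 0 tot
  grind

/-- The number of guests on the circle opened by `b`. -/
def circleCard (p : ℕ → ℕ) (N b : ℕ) : ℕ :=
  ((range N).filter fun k => rootOf p k = b).card

lemma mem_openers {p : ℕ → ℕ} {N b : ℕ} : b ∈ openers p N ↔ b < N ∧ ¬ p b < b := by simp [openers]

lemma rootOf_mem_openers {p : ℕ → ℕ} {N k : ℕ} (hk : k < N) : rootOf p k ∈ openers p N :=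
  mem_openers.2 ⟨(rootOf_le p k).trans_lt hk, not_lt_rootOf p k⟩

lemma rootOf_of_mem_openers {p : ℕ → ℕ} {N b : ℕ} (hb : b ∈ openers p N) : rootOf p b = b :=
  rootOf_of_not_lt (mem_openers.1 hb).2

lemma circleCard_pos {p : ℕ → ℕ} {N b : ℕ} (hb : b ∈ openers p N) : 0 < circleCard p N b :=
  Finset.card_pos.2 ⟨b, mem_filter.2 ⟨mem_range.2 (mem_openers.1 hb).1, rootOf_of_mem_openers hb⟩⟩

lemma prod_non_openers (p : ℕ → ℕ) (N : ℕ) (f : ℕ → ℝ≥0∞) :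
    ∏ k ∈ range N with p k < k, f (rootOf p k) =
      ∏ b ∈ openers p N, f b ^ (circleCard p N b - 1) := by
  rw [← Finset.prod_fiberwise_of_maps_to (t := openers p N) (g := rootOf p)
    fun k hk => rootOf_mem_openers (mem_range.1 (mem_filter.1 hk).1)]
  refine prod_congr rfl fun b hb => ?_
  have e : ((range N).filter fun k => rootOf p k = b).erase b =
      ((range N).filter fun k => p k < k).filter fun k => rootOf p k = b := by
    ext k
    simp only [mem_erase, mem_filter, mem_range]
    constructor
    · rintro ⟨h1, h2, h3⟩
      refine ⟨⟨h2, ?_⟩, h3⟩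
      by_contra h4
      rw [rootOf_of_not_lt h4] at h3
      exact h1 h3
    · rintro ⟨⟨h1, h2⟩, h3⟩
      refine ⟨?_, h1, h3⟩
      rintro rfl
      exact (mem_openers.1 hb).2 h2
  have hb' : b ∈ (range N).filter fun k => rootOf p k = b :=
    mem_filter.2 ⟨mem_range.2 (mem_openers.1 hb).1, rootOf_of_mem_openers hb⟩
  rw [prod_congr rfl (g := fun _ => f b) fun k hk => by rw [(mem_filter.1 hk).2],
    Finset.prod_const, ← e, Finset.card_erase_of_mem hb']
  rfl

open Classical in
lemma arrivals_eq_lmarginal (p : ℕ → ℕ) (N : ℕ) {H : (ℕ → ℝ) → ℝ≥0∞} (hH : Measurable H)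
    (hloc : ∀ L L' : ℕ → ℝ, (∀ k < N, L k = L' k) → H L = H L') {tot : ℕ → ℝ}
    (ht : ∀ k, 0 < tot k) :
    (∏ b ∈ openers p N, ofReal (1 / (tot b ^ (circleCard p N b - 1) * circleCard p N b))) *
      arrivals p N H tot =
    (∫⋯∫⁻_Finset.range N, (fun L => if ∀ b ∈ openers p N, circleTotal p N L b ≤ 1 then
        H fun k => tot (rootOf p k) * L k / circleTotal p N L (rootOf p k) else 0)
      ∂(fun _ => posVol)) tot := by
  have hct : ∀ b, Measurable fun L : ℕ → ℝ => circleTotal p N L b := by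
    intro b
    unfold circleTotal
    refine measurable_sum _ fun k _ => ?_
    split_ifs <;> fun_prop
  have hset : MeasurableSet {L : ℕ → ℝ | ∀ b ∈ openers p N, circleTotal p N L b ≤ 1} := by
    have : {L : ℕ → ℝ | ∀ b ∈ openers p N, circleTotal p N L b ≤ 1} =
        ⋂ b ∈ openers p N, {L : ℕ → ℝ | circleTotal p N L b ≤ 1} := by ext; simp
    rw [this]
    exact Finset.measurableSet_biInter _ fun b _ => measurableSet_le (hct b) measurable_const
  have hH₁ : Measurable fun L : ℕ → ℝ => if ∀ b ∈ openers p N, circleTotal p N L b ≤ 1 then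
        H fun k => tot (rootOf p k) * L k / circleTotal p N L (rootOf p k) else 0 := by
    refine Measurable.ite hset (hH.comp (measurable_pi_lambda _ fun k => ?_)) measurable_const
    fun_prop
  rw [← lmarginal_arrivals p N hH₁, lmarginal]
  set f : ∀ b : openers p N, ℝ → ℝ≥0∞ := fun b t =>
    (Iic (1 : ℝ)).indicator (fun t => ofReal ((t / tot b) ^ (circleCard p N b - 1))) t
    with hf
  have hfm : ∀ b, Measurable (f b) := fun b => Measurable.indicator (by fun_prop) measurableSet_Iic
  have h1 : ∀ᵐ y : openers p N → ℝ ∂Measure.pi fun _ => posVol,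
      arrivals p N (fun L => if ∀ b ∈ openers p N, circleTotal p N L b ≤ 1 then
        H fun k => tot (rootOf p k) * L k / circleTotal p N L (rootOf p k) else 0)
        (updateFinset tot (openers p N) y) = (∏ b, f b (y b)) * arrivals p N H tot := by
    have hpos : ∀ᵐ y : openers p N → ℝ ∂Measure.pi fun _ => posVol, ∀ b, 0 < y b := by
      refine ae_all_iff.2 fun b => ?_
      exact (Measure.quasiMeasurePreserving_eval (μ := fun _ : openers p N => posVol) b).ae
        (ae_restrict_mem measurableSet_Ioi)
    filter_upwards [hpos] with y hy
    set t := updateFinset tot (openers p N) y with htd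
    have htb : ∀ b (hb : b ∈ openers p N), t b = y ⟨b, hb⟩ := fun b hb => by
      simp [htd, updateFinset, hb]
    have htpos : ∀ k, 0 < t k := by
      intro k
      by_cases hk : k ∈ openers p N
      · grind
      · simp only [htd, updateFinset, hk, dif_neg, not_false_eq_true]; exact ht k
    have e1 : arrivals p N (fun L => if ∀ b ∈ openers p N, circleTotal p N L b ≤ 1 then
        H fun k => tot (rootOf p k) * L k / circleTotal p N L (rootOf p k) else 0) t =
        arrivals p N (fun L => if ∀ b ∈ openers p N, t b ≤ 1 then
        H fun k => tot (rootOf p k) * L k / t (rootOf p k) else 0) t := by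
      refine arrivals_congr p N fun L hL => ?_
      have h2 : ∀ b ∈ openers p N, circleTotal p N L b = t b := fun b hb =>
        hL b (mem_openers.1 hb).1 (mem_openers.1 hb).2
      have h3 : (∀ b ∈ openers p N, circleTotal p N L b ≤ 1) ↔ ∀ b ∈ openers p N, t b ≤ 1 :=
        forall₂_congr fun b hb => by rw [h2 b hb]
      simp only [h3]
      split_ifs
      · refine hloc _ _ fun k hk => ?_
        rw [h2 _ (rootOf_mem_openers hk)]
      · rfl
    rw [e1]
    by_cases hle : ∀ b ∈ openers p N, t b ≤ 1
    · simp only [if_pos hle]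
      have hdm : Measurable fun (L : ℕ → ℝ) k => tot (rootOf p k) * L k / t (rootOf p k) := by
        fun_prop
      have e2 : arrivals p N (fun L => H fun k => tot (rootOf p k) * L k / t (rootOf p k)) t =
          arrivals p N (fun L => H fun k => tot (rootOf p k) * L k / t (rootOf p k))
            (fun k => (t (rootOf p k) / tot (rootOf p k)) * tot k) := by
        refine arrivals_congr_tot p N (fun k _ hk' => ?_) fun L L' hL => hloc _ _ fun k hk => ?_
        · rw [rootOf_of_not_lt hk', div_mul_cancel₀ _ (ht k).ne']
        · rw [hL k hk]
      have hH' : Measurable fun L : ℕ → ℝ =>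
          H fun k => tot (rootOf p k) * L k / t (rootOf p k) := hH.comp hdm
      rw [e2, arrivals_scale p N hH' (c := fun k => t k / tot k) fun k => div_pos (htpos k) (ht k)]
      rw [prod_non_openers p N fun b => ofReal (t b / tot b)]
      congr 1
      · rw [← Finset.prod_coe_sort]
        refine prod_congr rfl fun b _ => ?_
        rw [hf, htb b.1 b.2]
        simp only
        have : y b ∈ Iic (1 : ℝ) := by rw [← htb b.1 b.2]; exact hle b.1 b.2
        rw [indicator_of_mem this, ofReal_pow]
        exact (div_pos (hy _) (ht _)).le
      · congr 1
        grind
    · simp only [if_neg hle]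
      rw [arrivals_zero]
      push Not at hle
      obtain ⟨b, hb, hb'⟩ := hle
      rw [prod_eq_zero (mem_univ ⟨b, hb⟩), zero_mul]
      rw [hf]
      simp only
      rw [indicator_of_notMem]
      grind
  have hfp : Measurable fun y : openers p N → ℝ => ∏ b, f b (y b) :=
    measurable_prod _ fun b _ => (hfm b).comp (measurable_pi_apply b)
  rw [lintegral_congr_ae h1, lintegral_mul_const _ hfp, lintegral_pi_prod _ hfm]
  congr 1
  rw [← Finset.prod_coe_sort]
  refine prod_congr rfl fun b _ => ?_
  rw [hf]
  simp only
  rw [lintegral_indicator measurableSet_Iic, Measure.restrict_restrict measurableSet_Iic,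
      Set.inter_comm, Set.Ioi_inter_Iic, lintegral_Ioc_pow _ (ht b),
      Nat.sub_add_cancel (circleCard_pos b.2)]

lemma pi_smul_measure {ι : Type*} [Fintype ι] {E : ι → Type*} [∀ i, MeasurableSpace (E i)]
    (μ : ∀ i, Measure (E i)) [∀ i, IsFiniteMeasure (μ i)] {c : ι → ℝ≥0∞} (hc : ∀ i, c i ≠ ∞) :
    Measure.pi (fun i => c i • μ i) = (∏ i, c i) • Measure.pi μ := by
  have : ∀ i, IsFiniteMeasure (c i • μ i) := fun i => Measure.smul_finite _ (hc i)
  refine Measure.pi_eq fun s _ => ?_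
  simp [Measure.pi_pi, prod_mul_distrib]

open Classical in
lemma lintegral_normalized_pi {K B S : Type} [Fintype K] [Fintype B] [Fintype S] (blk : K → B)
    (hblk : Surjective blk) (γ : K → S) {t : B → ℝ} (ht : ∀ b, 0 < t b)
    {h : (S → ℝ) → ℝ≥0∞} (hh : Measurable h) :
    ∫⁻ L : K → ℝ, (if ∀ b, (∑ k, if blk k = b then L k else 0) ≤ 1 then
        h fun s => ∑ k, if γ k = s then
          t (blk k) * L k / (∑ k', if blk k' = blk k then L k' else 0) else 0 else 0)
        ∂(Measure.pi fun _ => posVol) =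
      (∏ b, ofReal (1 / (card {k // blk k = b}).factorial)) * ∫⁻ x, h x ∂convolution fun b =>
          dirichlet (fun s => (card {k // blk k = b ∧ γ k = s} : ℝ)) (t b) := by
  set T : ∀ b, Set ({k // blk k = b} → ℝ) := fun b => {L | ∑ k, L k ≤ 1} with hT
  have hTm : ∀ b, MeasurableSet (T b) := fun b => measurableSet_le (by fun_prop) measurable_const
  set norm : ∀ b, ({k // blk k = b} → ℝ) → S → ℝ := fun b L s =>
    ∑ k : {k // blk k = b}, if γ k = s then t b * L k / ∑ k, L k else 0 with hnorm
  have hnm : ∀ b, Measurable (norm b) := fun b => by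
    refine measurable_pi_lambda _ fun s => measurable_sum _ fun k _ => ?_
    split_ifs
    · fun_prop
    · simp
  have hne : ∀ b, Nonempty {k // blk k = b} := fun b => by obtain ⟨k, hk⟩ := hblk b; exact ⟨⟨k, hk⟩⟩
  have hcard : ∀ b s, card {k : {k // blk k = b} // γ k = s} =
      card {k // blk k = b ∧ γ k = s} := fun b s =>
    card_congr (subtypeSubtypeEquivSubtypeInter (fun k => blk k = b) (fun k => γ k = s))
  have hprob : ∀ b, IsProbabilityMeasure
      (dirichlet (fun s => (card {k // blk k = b ∧ γ k = s} : ℝ)) (t b)) := fun b => by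
    have := isProbabilityMeasure_dirichlet (fun k : {k // blk k = b} => γ k) (ht b)
    simpa only [hcard] using this
  have hmap : ∀ b, ((Measure.pi fun _ : {k // blk k = b} => posVol).restrict (T b)).map (norm b) =
      ofReal (1 / (card {k // blk k = b}).factorial) •
        dirichlet (fun s => (card {k // blk k = b ∧ γ k = s} : ℝ)) (t b) := fun b => by
    refine Measure.ext_of_lintegral _ fun f hf => ?_
    rw [lintegral_map hf (hnm b), lintegral_smul_measure]
    have := lintegral_normalized (fun k : {k // blk k = b} => γ k) (ht b) hf
    simp only [hcard] at this
    rw [card_eq_fintype_card]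
    exact this
  have hsm : Measurable fun x : B → S → ℝ => ∑ b, x b := by fun_prop
  have hσ : ∀ b, SigmaFinite
      (((Measure.pi fun _ : {k // blk k = b} => posVol).restrict (T b)).map (norm b)) := fun b => by
    rw [hmap]
    have := Measure.smul_finite (dirichlet (fun s => (card {k // blk k = b ∧ γ k = s} : ℝ)) (t b))
      (c := ofReal (1 / (card {k // blk k = b}).factorial)) ofReal_ne_top
    infer_instance
  have hhsm : Measurable fun x : B → S → ℝ => h (∑ b, x b) := hh.comp hsm
  have hnp : Measurable fun (M : ∀ b, {k // blk k = b} → ℝ) b => norm b (M b) :=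
    measurable_pi_lambda _ fun b => (hnm b).comp (measurable_pi_apply b)
  rw [convolution, lintegral_map hh hsm, ← smul_eq_mul, ← lintegral_smul_measure,
    ← pi_smul_measure _ fun b => ofReal_ne_top]
  simp_rw [← hmap]
  rw [← Measure.pi_map_pi (fun b => (hnm b).aemeasurable), lintegral_map hhsm hnp,
    ← Measure.restrict_pi_pi (fun b => Measure.pi fun _ : {k // blk k = b} => posVol) T, ← lintegral_indicator (MeasurableSet.univ_pi hTm),
    ← pi_map_fibers blk fun _ => posVol]
  have hΦ : Measurable ((Set.univ.pi T).indicator fun M : ∀ b, {k // blk k = b} → ℝ =>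
      h (∑ b, norm b (M b))) :=
    Measurable.indicator (hh.comp (hsm.comp hnp)) (MeasurableSet.univ_pi hTm)
  refine Eq.trans ?_ (lintegral_map hΦ (by fun_prop)).symm
  refine lintegral_congr fun L => ?_
  have hsum : ∀ b, ∑ k : {k // blk k = b}, L k = ∑ k, if blk k = b then L k else 0 := fun b => by
    rw [← sum_filter, sum_subtype (p := fun k => blk k = b) _ (by simp)]
  have hiff : (fun (b : B) (k : {k // blk k = b}) => L k) ∈ Set.univ.pi T ↔
      ∀ b, (∑ k, if blk k = b then L k else 0) ≤ 1 := by
    simp only [mem_univ_pi, hT, mem_ofPred_eq, hsum]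
  rw [indicator_apply, if_congr hiff rfl rfl]
  congr 2
  funext s
  rw [Finset.sum_apply]
  simp only [hnorm, hsum]
  have h2 : ∀ b, ∑ k : {k // blk k = b}, (if γ k = s then t b * L k /
      (∑ k, if blk k = b then L k else 0) else 0) = ∑ k : {k // blk k = b}, (fun k => if γ k = s then
      t (blk k) * L k / (∑ k', if blk k' = blk k then L k' else 0) else 0) k.1 := fun b => by
    grind
  simp_rw [h2]
  exact (Fintype.sum_fiberwise blk fun k => if γ k = s then
      t (blk k) * L k / (∑ k', if blk k' = blk k then L k' else 0) else 0).symm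

open Classical in
lemma arrivals_closed {B S : Type} [Fintype B] [Fintype S] {p : ℕ → ℕ} {N : ℕ} {opener : B → ℕ}
    (hinj : Injective opener) (hop : ∀ b, opener b ∈ openers p N) {blk : Fin N → B}
    (hblk : ∀ k : Fin N, rootOf p k = opener (blk k)) (γ : Fin N → S) {tot : ℕ → ℝ}
    (ht : ∀ k, 0 < tot k) {h : (S → ℝ) → ℝ≥0∞} (hh : Measurable h) :
    arrivals p N (fun L => h fun s => ∑ k : Fin N, if γ k = s then L k else 0) tot =
      (∏ b, ofReal (tot (opener b) ^ (card {k // blk k = b} - 1) /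
        (card {k // blk k = b} - 1).factorial)) *
        ∫⁻ x, h x ∂convolution fun b =>
          dirichlet (fun s => (card {k // blk k = b ∧ γ k = s} : ℝ)) (tot (opener b)) := by
  have hblk' : ∀ b, blk ⟨opener b, (mem_openers.1 (hop b)).1⟩ = b := fun b => by
    apply hinj
    rw [← hblk]
    exact rootOf_of_mem_openers (hop b)
  have hcard : ∀ b, circleCard p N (opener b) = card {k // blk k = b} := fun b => by
    rw [circleCard, card_filter, Finset.sum_range, card_eq_fintype_card,
      Fintype.card_subtype, card_filter]
    grind
  have hop' : openers p N = univ.image opener := by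
    ext k
    simp only [mem_image, mem_univ, true_and]
    constructor
    · intro hk
      refine ⟨blk ⟨k, (mem_openers.1 hk).1⟩, ?_⟩
      rw [← hblk]
      exact rootOf_of_mem_openers hk
    all_goals grind
  have hct : ∀ L b, circleTotal p N L (opener b) = ∑ k : Fin N, if blk k = b then L k else 0 := by
    intro L b
    rw [circleTotal, Finset.sum_range]
    grind
  have hagg : Measurable fun (L : ℕ → ℝ) (s : S) => ∑ k : Fin N, if γ k = s then L k else 0 := by
    refine measurable_pi_lambda _ fun s => measurable_sum _ fun k _ => ?_
    split_ifs <;> fun_prop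
  have hH : Measurable fun L : ℕ → ℝ => h fun s => ∑ k : Fin N, if γ k = s then L k else 0 :=
    hh.comp hagg
  have key := arrivals_eq_lmarginal p N hH (fun L L' hL => by
    congr 1; funext s; exact sum_congr rfl fun k _ => by rw [hL k k.2]) ht
  let e : Fin N ≃ range N := ⟨fun k => ⟨k, mem_range.2 k.2⟩, fun k => ⟨k, mem_range.1 k.2⟩,
      fun k => rfl, fun k => rfl⟩
  have key2 := lintegral_normalized_pi blk (fun b => ⟨_, hblk' b⟩) γ (fun b => ht (opener b)) hh
  rw [lmarginal, ← (measurePreserving_piCongrLeft (fun _ => posVol) e).lintegral_comp_emb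
    (measurableEmbedding _)] at key
  have hval : ∀ (L : Fin N → ℝ) (k : Fin N), updateFinset tot (range N)
      (MeasurableEquiv.piCongrLeft (fun _ => ℝ) e L) k = L k := by
    intro L k
    have : (k : ℕ) ∈ range N := mem_range.2 k.2
    simp only [updateFinset, this, dif_pos]
    exact piCongrLeft_apply_apply (fun _ => ℝ) e L k
  simp only [hop', Finset.forall_mem_image, mem_univ, forall_const, hct, hval, hblk] at key
  rw [key2, Finset.prod_image fun _ _ _ _ h => hinj h] at key
  simp only [hcard] at key
  have hpos : ∀ b, 0 < card {k // blk k = b} := fun b => card_pos_iff.2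
    ⟨⟨⟨_, hblk' b⟩⟩, inferInstance⟩
  have hprod : (∏ b, ofReal (tot (opener b) ^ (card {k // blk k = b} - 1) *
      card {k // blk k = b})) * (∏ b, ofReal (1 / (tot (opener b) ^
        (card {k // blk k = b} - 1) * card {k // blk k = b}))) = 1 := by
    rw [← prod_mul_distrib]
    refine Finset.prod_eq_one fun b _ => ?_
    have h1 := ht (opener b)
    have h2 : (0 : ℝ) < card {k // blk k = b} := by exact_mod_cast hpos b
    rw [← ofReal_mul (by positivity), mul_one_div_cancel (by positivity),
      ENNReal.ofReal_one]
  have := congrArg (fun x => (∏ b, ofReal (tot (opener b) ^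
    (card {k // blk k = b} - 1) * card {k // blk k = b})) * x) key
  simp only [← mul_assoc, hprod, one_mul] at this
  rw [this, ← prod_mul_distrib]
  congr 1
  refine prod_congr rfl fun b _ => ?_
  have h1 := ht (opener b)
  rw [← ofReal_mul (by positivity)]
  congr 1
  obtain ⟨c, hc⟩ := Nat.exists_eq_succ_of_ne_zero (hpos b).ne'
  rw [hc, Nat.factorial_succ]
  simp only [Nat.succ_eq_add_one, Nat.add_sub_cancel]
  push_cast
  field_simp

/-! ## Arrivals of guests at a painted restaurant -/

variable {ℓ : ℕ → ℝ}

lemma paint_perm_congr (hℓ : GoodSticks ℓ) {U U' : ℕ → ℝ} (hU : GoodPoints U)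
    (hU' : GoodPoints U') {N : ℕ} (h : ∀ i < N, U i = U' i) :
    (paint (ℓ, U)).perm N = (paint (ℓ, U')).perm N := by
  rw [paint_eq hℓ hU, paint_eq hℓ hU']
  refine ((seating hℓ hU).isNext_virt N).unique ?_
  have h' := (seating hℓ hU').isNext_virt N
  generalize (seating hℓ hU').virt.perm N = w at h' ⊢
  refine ⟨fun i hi => ?_, h'.2⟩
  obtain ⟨h1, h2, h3⟩ := h'.1 i hi
  have e : ∀ j ∈ range N, U j = U' j := fun j hj => h j (mem_range.1 hj)
  refine ⟨h1, ?_, fun j hj hij => ?_⟩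
  · simp only [seating] at h2 ⊢
    grind
  · have h4 := h3 j hj
    simp only [seating] at h4 hij ⊢
    grind

lemma lintegral_cdist (hℓ : GoodSticks ℓ) {x : ℝ} (hx : x ∈ Ico (0 : ℝ) 1) {a : ℝ}
    (ha : a ≤ ℓ (tabOf ℓ x)) {F : ℝ → ℝ≥0∞} (hF : Measurable F) :
    ∫⁻ y, (if tabOf ℓ x = tabOf ℓ y ∧ cdist ℓ x y < a then F (cdist ℓ x y) else 0) ∂unif =
      ∫⁻ r in Ioo 0 a, F r := by
  obtain ⟨h1, h2⟩ := tabOf_spec hℓ hx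
  set ν := tabOf ℓ x with hν
  set s := cum ℓ ν with hs
  have hs0 : 0 ≤ s := hℓ.cum_nonneg ν
  have hs1 : s + ℓ ν ≤ 1 := by rw [hs, ← cum_succ]; exact hℓ.cum_le_one _
  set g1 : ℝ → ℝ≥0∞ := (Ioo 0 (min a (s + ℓ ν - x))).indicator F with hg1
  set g2 : ℝ → ℝ≥0∞ := (Ico (s + ℓ ν - x) a).indicator F with hg2
  have hm1 : Measurable g1 := hF.indicator measurableSet_Ioo
  have hm2 : Measurable g2 := hF.indicator measurableSet_Ico
  rw [unif, ← lintegral_indicator measurableSet_Ico, ← lintegral_indicator measurableSet_Ioo]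
  have e1 : ∀ y, (Ico (0 : ℝ) 1).indicator
      (fun y => if ν = tabOf ℓ y ∧ cdist ℓ x y < a then F (cdist ℓ x y) else 0) y =
      g1 (y - x) + g2 (y - (x - ℓ ν)) := by
    intro y
    by_cases hy : y ∈ Ico (0 : ℝ) 1
    · rw [indicator_of_mem hy]
      have hk : ν = tabOf ℓ y ↔ s ≤ y ∧ y < s + ℓ ν := by rw [eq_comm, tabOf_eq_iff hℓ hy]
      simp only [hk, cdist, ← hν, hg1, hg2, indicator_apply, mem_Ioo, mem_Ico, lt_min_iff]
      by_cases c1 : x < y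
      · have c3 : ¬ (y - (x - ℓ ν) < a) := by linarith
        simp only [c1, if_true, c3, and_false, if_false, add_zero]
        all_goals grind
      · have c3 : ¬ (0 < y - x) := by linarith
        simp only [c1, if_false, c3, false_and, zero_add]
        all_goals grind
    · rw [indicator_of_notMem hy]
      have hy' : y < 0 ∨ 1 ≤ y := by
        grind
      simp only [hg1, hg2, indicator_apply, mem_Ioo, mem_Ico, lt_min_iff]
      rw [if_neg, if_neg, add_zero]
      all_goals grind
  simp_rw [e1]
  have hm1' : Measurable fun y => g1 (y - x) := hm1.comp (measurable_id.sub_const x)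
  rw [lintegral_add_left hm1',
    lintegral_sub_right_eq_self g1 x, lintegral_sub_right_eq_self g2 (x - ℓ ν),
    ← lintegral_add_left hm1]
  refine lintegral_congr fun r => ?_
  simp only [hg1, hg2, indicator_apply, mem_Ioo, mem_Ico, lt_min_iff]
  by_cases c1 : r < s + ℓ ν - x
  · have c2 : ¬ s + ℓ ν - x ≤ r := by linarith
    simp [c1, c2]
  · have c2 : s + ℓ ν - x ≤ r := by linarith
    have c3 : 0 < r := by linarith
    simp [c1, c2, c3]

lemma lintegral_tabOf (hℓ : GoodSticks ℓ) (ν : ℕ) (c : ℝ≥0∞) :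
    ∫⁻ y, (if tabOf ℓ y = ν then c else 0) ∂unif = c * ofReal (ℓ ν) := by
  have hs0 : 0 ≤ cum ℓ ν := hℓ.cum_nonneg ν
  have hs1 : cum ℓ ν + ℓ ν ≤ 1 := by rw [← cum_succ]; exact hℓ.cum_le_one _
  have hsub : Ico (cum ℓ ν) (cum ℓ ν + ℓ ν) ⊆ Ico 0 1 := Set.Ico_subset_Ico hs0 hs1
  have e : ∀ y, (Ico (0 : ℝ) 1).indicator (fun y => if tabOf ℓ y = ν then c else 0) y =
      (Ico (cum ℓ ν) (cum ℓ ν + ℓ ν)).indicator (fun _ => c) y := by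
    intro y
    by_cases hy : y ∈ Ico (0 : ℝ) 1
    · rw [indicator_of_mem hy, indicator_apply]
      exact if_congr (tabOf_eq_iff hℓ hy ν) rfl rfl
    · rw [indicator_of_notMem hy, indicator_of_notMem fun h => hy (hsub h)]
  rw [unif, ← lintegral_indicator measurableSet_Ico]
  simp_rw [e]
  simp

/-- The lengths of the arcs between the first `N` guests, if their permutation is `v.perm N`. -/
def arcVec (ℓ : ℕ → ℝ) (κ : ℕ → ℕ) (v : VirtualPerm) (N : ℕ) (U : ℕ → ℝ) (k : ℕ) : ℝ :=
  if k < N then cdist ℓ (U k) (U (v.perm N k)) else ℓ (κ k)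

/-- The first `N` guests form the permutation `v.perm N` and sit at the tables `κ`. -/
def Arrived (ℓ : ℕ → ℝ) (κ : ℕ → ℕ) (v : VirtualPerm) (N : ℕ) (U : ℕ → ℝ) : Prop :=
  (paint (ℓ, U)).perm N = v.perm N ∧ ∀ i < N, tabOf ℓ (U i) = κ i

/-- The guest split by the arrival of `k`; the first `n` guests are regarded as openers. -/
def splitter (n : ℕ) (v : VirtualPerm) (k : ℕ) : ℕ := if k < n then k else (v.perm (k + 1))⁻¹ k

lemma measurable_arcVec (κ : ℕ → ℕ) (v : VirtualPerm) (N : ℕ) : Measurable (arcVec ℓ κ v N) := by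
  refine measurable_pi_lambda _ fun k => ?_
  unfold arcVec
  split_ifs
  · exact (measurable_cdist_apply k (v.perm N k)).comp (measurable_const.prodMk measurable_id)
  · simp

lemma measurableSet_arrived (κ : ℕ → ℕ) (v : VirtualPerm) (N : ℕ) :
    MeasurableSet {U | Arrived ℓ κ v N U} := by
  have h1 : Measurable fun U : ℕ → ℝ => (ℓ, U) := measurable_const.prodMk measurable_id
  have e : {U | Arrived ℓ κ v N U} = ((fun U => paint (ℓ, U)) ⁻¹' {u | u.perm N = v.perm N}) ∩
      ⋂ i ∈ range N, {U | tabOf ℓ (U i) = κ i} := by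
    ext U; simp [Arrived]
  rw [e]
  refine ((measurable_paint.comp h1) (measurableSet_perm_eq N _)).inter
    (Finset.measurableSet_biInter _ fun i _ => ?_)
  exact ((measurable_tabOf_apply i).comp h1) (measurableSet_singleton (κ i))

lemma arrivals_of_self {p : ℕ → ℕ} {n : ℕ} (h : ∀ k < n, p k = k) (H : (ℕ → ℝ) → ℝ≥0∞)
    (tot : ℕ → ℝ) : arrivals p n H tot = H tot := by
  induction n generalizing H with
  | zero => rfl
  | succ n ih =>
    rw [arrivals, if_neg (by rw [h n (by omega)]; omega), ih fun k hk => h k (by omega)]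
    simp

lemma eq_of_removePoint_eq {N j : ℕ} {w w' : Perm ℕ}
    (h : removePoint N w = removePoint N w') (hw : w j = N) (hw' : w' j = N) : w = w' := by
  have h1 : w N = w' N := by
    have := congrArg (fun g : Perm ℕ => g j) h
    simpa [removePoint, hw, hw'] using this
  rw [removePoint, removePoint, h1] at h
  exact mul_left_cancel h

section Step

variable {κ : ℕ → ℕ} {v : VirtualPerm} {N : ℕ}

lemma arcVec_eq (hℓ : GoodSticks ℓ) {U : ℕ → ℝ} (hU : GoodPoints U) (h : Arrived ℓ κ v N U)
    {k : ℕ} (hk : k < N) : arcVec ℓ κ v N U k = (seating hℓ hU).arc N k := by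
  rw [arcVec, if_pos hk, ← h.1, paint_eq hℓ hU]
  rfl

lemma Arrived.of_succ (hℓ : GoodSticks ℓ) {U U' : ℕ → ℝ} (hU : GoodPoints U)
    (hU' : GoodPoints U') (hUU : ∀ i < N, U i = U' i) (h : Arrived ℓ κ v (N + 1) U') :
    Arrived ℓ κ v N U := by
  refine ⟨?_, fun i hi => ?_⟩
  · rw [paint_perm_congr hℓ hU hU' hUU, ← (paint (ℓ, U')).compat, h.1, v.compat]
  · rw [hUU i hi]; exact h.2 i (by omega)

lemma arrived_succ_opener (hℓ : GoodSticks ℓ) {U U' : ℕ → ℝ} (hU : GoodPoints U)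
    (hU' : GoodPoints U') (hUU : ∀ i < N, U i = U' i) (hv : v.perm (N + 1) N = N)
    (hκ : ∀ i < N, κ i ≠ κ N) :
    Arrived ℓ κ v (N + 1) U' ↔ Arrived ℓ κ v N U ∧ tabOf ℓ (U' N) = κ N := by
  constructor
  · intro h
    exact ⟨h.of_succ hℓ hU hU' hUU, h.2 N (by omega)⟩
  · rintro ⟨h1, h2⟩
    have ht : ∀ i < N + 1, tabOf ℓ (U' i) = κ i := fun i hi => by
      rcases Nat.lt_succ_iff_lt_or_eq.1 hi with hi | rfl
      · rw [← hUU i hi]; exact h1.2 i hi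
      · exact h2
    refine ⟨eq_of_removePoint_eq (N := N) (j := N) ?_ ?_ hv, ht⟩
    · rw [VirtualPerm.compat, VirtualPerm.compat, ← h1.1, paint_perm_congr hℓ hU hU' hUU]
    · rw [paint_eq hℓ hU', Seating.virt_succ_self_iff]
      intro i hi
      change tabOf ℓ (U' i) ≠ tabOf ℓ (U' N)
      grind

lemma arrived_succ_split (hℓ : GoodSticks ℓ) {U U' : ℕ → ℝ} (hU : GoodPoints U)
    (hU' : GoodPoints U') (hUU : ∀ i < N, U i = U' i) {j : ℕ} (hj : j < N)
    (hv : v.perm (N + 1) j = N) (hκ : κ j = κ N) :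
    Arrived ℓ κ v (N + 1) U' ↔ Arrived ℓ κ v N U ∧
      (tabOf ℓ (U j) = tabOf ℓ (U' N) ∧ cdist ℓ (U j) (U' N) < arcVec ℓ κ v N U j) := by
  have harc : Arrived ℓ κ v N U → (seating hℓ hU').arc N j = arcVec ℓ κ v N U j := fun h => by
    have e : (seating hℓ hU').virt.perm N j = v.perm N j := by
      rw [← paint_eq hℓ hU', ← paint_perm_congr hℓ hU hU' hUU, h.1]
    rw [arcVec, if_pos hj, Seating.arc, e]
    change cdist ℓ (U' j) (U' _) = _
    rw [hUU j hj, hUU _ (v.perm_lt hj)]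
  constructor
  · intro h
    have h0 := h.of_succ hℓ hU hU' hUU
    refine ⟨h0, ?_⟩
    have h1 : (seating hℓ hU').virt.perm (N + 1) j = N := by rw [← paint_eq hℓ hU', h.1, hv]
    have h2 := (Seating.virt_succ_eq_iff _ hj).1 h1
    rw [harc h0] at h2
    rw [hUU j hj]
    exact h2
  · rintro ⟨h0, h2⟩
    have h1 : (seating hℓ hU').virt.perm (N + 1) j = N := by
      rw [Seating.virt_succ_eq_iff _ hj, harc h0]
      rw [hUU j hj] at h2
      exact h2
    refine ⟨eq_of_removePoint_eq (N := N) (j := j) ?_ ?_ hv, fun i hi => ?_⟩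
    · rw [VirtualPerm.compat, VirtualPerm.compat, ← h0.1, paint_perm_congr hℓ hU hU' hUU]
    · rw [paint_eq hℓ hU', h1]
    · rcases Nat.lt_succ_iff_lt_or_eq.1 hi with hi | rfl
      · rw [← hUU i hi]; exact h0.2 i hi
      · rw [← h2.1, h0.2 j hj, hκ]

lemma arcVec_succ_opener {U U' : ℕ → ℝ} (hUU : ∀ i < N, U i = U' i) (hv : v.perm (N + 1) N = N)
    (h : Arrived ℓ κ v (N + 1) U') :
    arcVec ℓ κ v (N + 1) U' = update (arcVec ℓ κ v N U) N (ℓ (κ N)) := by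
  funext k
  rcases lt_trichotomy k N with hk | rfl | hk
  · have e : v.perm N k = v.perm (N + 1) k := by rw [← v.compat, removePoint_of_fixed hv]
    rw [update_of_ne hk.ne, arcVec, arcVec, if_pos (by omega), if_pos hk, ← e,
      hUU k hk, hUU _ (v.perm_lt hk)]
  · rw [update_self, arcVec, if_pos (by omega), hv, cdist, if_neg (lt_irrefl _), sub_self,
      zero_add, h.2 k (by omega)]
  · rw [update_of_ne hk.ne', arcVec, arcVec, if_neg (by omega), if_neg (by omega)]

lemma arcVec_succ_split (hℓ : GoodSticks ℓ) {U U' : ℕ → ℝ}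
    (hU' : GoodPoints U') (hUU : ∀ i < N, U i = U' i) {j : ℕ} (hj : j < N)
    (hv : v.perm (N + 1) j = N) (h : Arrived ℓ κ v (N + 1) U') :
    arcVec ℓ κ v (N + 1) U' = update (update (arcVec ℓ κ v N U) j
      (cdist ℓ (U j) (U' N))) N (arcVec ℓ κ v N U j - cdist ℓ (U j) (U' N)) := by
  have h' : Arrived ℓ κ v N U' := h.of_succ hℓ hU' hU' fun _ _ => rfl
  have e : ∀ k < N, arcVec ℓ κ v N U k = arcVec ℓ κ v N U' k := fun k hk => by
    rw [arcVec, arcVec, if_pos hk, if_pos hk, hUU k hk, hUU _ (v.perm_lt hk)]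
  have h1 : (seating hℓ hU').virt.perm (N + 1) j = N := by rw [← paint_eq hℓ hU', h.1, hv]
  have hd : cdist ℓ (U j) (U' N) = (seating hℓ hU').D j N := by rw [hUU j hj]; rfl
  funext k
  rcases lt_trichotomy k N with hk | rfl | hk
  · rw [update_of_ne hk.ne, arcVec_eq hℓ hU' h (by omega)]
    by_cases hkj : k = j
    · subst hkj
      rw [update_self, Seating.arc_succ_of_eq _ h1, hd]
    · have h2 : (seating hℓ hU').virt.perm (N + 1) k ≠ N := fun h3 =>
        hkj (((seating hℓ hU').virt.perm (N + 1)).injective (h3.trans h1.symm))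
      rw [update_of_ne hkj, Seating.arc_succ_of_ne _ hk h2, e k hk, arcVec_eq hℓ hU' h' hk]
  · rw [update_self, arcVec_eq hℓ hU' h (by omega), Seating.arc_succ_last _ hj h1, hd,
      e j hj, arcVec_eq hℓ hU' h' hj]
  · rw [update_of_ne hk.ne', update_of_ne (by omega), arcVec, arcVec,
      if_neg (by omega), if_neg (by omega)]

end Step

variable {ℓ : ℕ → ℝ}

lemma ae_goodPoints_update (N : ℕ) {U : ℕ → ℝ} (hU : GoodPoints U) :
    ∀ᵐ y ∂unif, GoodPoints (update U N y) := by
  have h1 : ∀ᵐ y ∂unif, y ∈ Ico (0 : ℝ) 1 := ae_restrict_mem measurableSet_Ico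
  have h2 : ∀ᵐ y ∂unif, y ∉ Set.range U := (Set.countable_range U).ae_notMem unif
  filter_upwards [h1, h2] with y h1 h2
  refine ⟨fun i => ?_, fun i j hij => ?_⟩
  · by_cases hi : i = N
    · grind
    · rw [update_of_ne hi]; exact hU.1 i
  · by_cases hi : i = N <;> by_cases hj : j = N
    · rw [hi, hj]
    · grind
    · grind
    · rw [update_of_ne hi, update_of_ne hj] at hij
      exact hU.2 hij

lemma splitter_succ_lt {n N : ℕ} (h : n ≤ N) (v : VirtualPerm) :
    v.perm (N + 1) (splitter n v N) = N := by
  simp [splitter, h.not_gt]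

lemma splitter_le {n N : ℕ} (h : n ≤ N) (v : VirtualPerm) : splitter n v N ≤ N := by
  by_contra hc
  have h1 := splitter_succ_lt h v
  rw [v.fixes _ _ (by omega)] at h1
  omega

lemma splitter_lt_iff {n N : ℕ} (h : n ≤ N) (v : VirtualPerm) :
    splitter n v N < N ↔ v.perm (N + 1) N ≠ N := by
  have h1 := splitter_succ_lt h v
  have h2 := splitter_le h v
  constructor
  · intro h3 h4
    have := (v.perm (N + 1)).injective (h1.trans h4.symm)
    omega
  all_goals grind

lemma sameCycle_succ_of_opener {v : VirtualPerm} {N : ℕ} (hv : v.perm (N + 1) N = N) {i : ℕ}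
    (h : (v.perm (N + 1)).SameCycle i N) : i = N := by
  obtain ⟨m, hm⟩ := h.symm
  rw [← hm]
  exact Perm.zpow_apply_eq_self_of_apply_eq_self hv m

lemma lintegral_arrived_succ (hℓ : GoodSticks ℓ) (v : VirtualPerm) (κ : ℕ → ℕ) {n N : ℕ}
    (hn : n ≤ N) (hκ : ∀ i < N + 1, ∀ j < N + 1, κ i = κ j ↔ (v.perm (N + 1)).SameCycle i j)
    {G : (ℕ → ℝ) → ℝ≥0∞} (hG : Measurable G)
    (hGloc : ∀ U U' : ℕ → ℝ, (∀ i < n, U i = U' i) → G U = G U')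
    {H : (ℕ → ℝ) → ℝ≥0∞} (hH : Measurable H) :
    ∫⁻ U, G U * {U | Arrived ℓ κ v (N + 1) U}.indicator (fun U => H (arcVec ℓ κ v (N + 1) U)) U
        ∂pointsLaw =
      (if v.perm (N + 1) N = N then ofReal (ℓ (κ N)) else 1) *
      ∫⁻ U, G U * {U | Arrived ℓ κ v N U}.indicator (fun U =>
        (if splitter n v N < N then splitArc (splitter n v N) N H
          else fun L => H (update L N (ℓ (κ N)))) (arcVec ℓ κ v N U)) U ∂pointsLaw := by
  classical
  have hm : Measurable fun U => G U * {U | Arrived ℓ κ v (N + 1) U}.indicator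
      (fun U => H (arcVec ℓ κ v (N + 1) U)) U :=
    hG.mul ((hH.comp (measurable_arcVec κ v (N + 1))).indicator (measurableSet_arrived κ v (N + 1)))
  have hupm : Measurable fun L : ℕ → ℝ => update L N (ℓ (κ N)) := by
    fun_prop
  have hm2 : Measurable fun U => G U * {U | Arrived ℓ κ v N U}.indicator (fun U =>
        (if splitter n v N < N then splitArc (splitter n v N) N H
          else fun L => H (update L N (ℓ (κ N)))) (arcVec ℓ κ v N U)) U := by
    have hst : Measurable (if splitter n v N < N then splitArc (splitter n v N) N H
          else fun L => H (update L N (ℓ (κ N)))) := by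
      split_ifs
      · exact measurable_splitArc' _ _ hH
      · fun_prop
    exact hG.mul (Measurable.indicator (hst.comp (measurable_arcVec κ v N))
      (measurableSet_arrived κ v N))
  rw [lintegral_pointsLaw_resample N hm, ← lintegral_const_mul _ hm2]
  refine lintegral_congr_ae ?_
  filter_upwards [ae_goodPoints] with U hU
  have hUU : ∀ y, ∀ i < N, U i = update U N y i := fun y i hi => by rw [update_of_ne hi.ne]
  have hGy : ∀ y, G (update U N y) = G U := fun y => hGloc _ _ fun i hi => (hUU y i (by omega)).symm
  simp_rw [hGy]
  set j := splitter n v N with hj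
  by_cases hlt : j < N
  · have hv : v.perm (N + 1) N ≠ N := (splitter_lt_iff hn v).1 hlt
    have hvj : v.perm (N + 1) j = N := splitter_succ_lt hn v
    have hκj : κ j = κ N := (hκ j (by omega) N (by omega)).2 ⟨1, by simpa using hvj⟩
    rw [if_neg hv, if_pos hlt, one_mul]
    have e : ∀ᵐ y ∂unif, G U * {U | Arrived ℓ κ v (N + 1) U}.indicator
        (fun U => H (arcVec ℓ κ v (N + 1) U)) (update U N y) =
        G U * {U | Arrived ℓ κ v N U}.indicator (fun U =>
          if tabOf ℓ (U j) = tabOf ℓ y ∧ cdist ℓ (U j) y < arcVec ℓ κ v N U j then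
            H (update (update (arcVec ℓ κ v N U) j (cdist ℓ (U j) y)) N
              (arcVec ℓ κ v N U j - cdist ℓ (U j) y)) else 0) U := by
      filter_upwards [ae_goodPoints_update N hU] with y hy
      have hiff := arrived_succ_split (κ := κ) (v := v) hℓ hU hy (hUU y) hlt hvj hκj
      simp only [indicator_apply, mem_ofPred_eq, hiff, update_self]
      by_cases h0 : Arrived ℓ κ v N U
      · by_cases h1 : tabOf ℓ (U j) = tabOf ℓ y ∧ cdist ℓ (U j) y < arcVec ℓ κ v N U j
        · have h2 := hiff.2 ⟨h0, by simpa using h1⟩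
          rw [if_pos ⟨h0, h1⟩, if_pos h0, if_pos h1, arcVec_succ_split hℓ hy (hUU y) hlt hvj h2]
          simp
        all_goals grind
      all_goals grind
    rw [lintegral_congr_ae e]
    by_cases h0 : Arrived ℓ κ v N U
    · simp only [indicator_apply, mem_ofPred_eq, if_pos h0]
      have hFm : Measurable fun r => H (update (update (arcVec ℓ κ v N U) j r) N
              (arcVec ℓ κ v N U j - r)) := by
        fun_prop
      have hle : arcVec ℓ κ v N U j ≤ ℓ (tabOf ℓ (U j)) := by
        rw [arcVec_eq hℓ hU h0 hlt, ← seating_D_self hℓ hU j]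
        exact (seating hℓ hU).arc_le hlt hlt rfl
      have hcd : Measurable fun y => cdist ℓ (U j) y :=
        measurable_cdist.comp (measurable_const.prodMk (measurable_const.prodMk measurable_id))
      have htb : Measurable fun y => tabOf ℓ y :=
        measurable_tabOf.comp (measurable_const.prodMk measurable_id)
      have hset : MeasurableSet {y | tabOf ℓ (U j) = tabOf ℓ y ∧
          cdist ℓ (U j) y < arcVec ℓ κ v N U j} :=
        (measurableSet_eq_fun measurable_const htb).inter (measurableSet_lt hcd measurable_const)
      have hint : Measurable fun y =>
          if tabOf ℓ (U j) = tabOf ℓ y ∧ cdist ℓ (U j) y < arcVec ℓ κ v N U j then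
            H (update (update (arcVec ℓ κ v N U) j (cdist ℓ (U j) y)) N
              (arcVec ℓ κ v N U j - cdist ℓ (U j) y)) else 0 :=
        Measurable.ite hset (hFm.comp hcd) measurable_const
      rw [lintegral_const_mul _ hint]
      have := lintegral_cdist hℓ (hU.1 j) hle hFm
      rw [this]
      rfl
    · simp [h0]
  · have hv : v.perm (N + 1) N = N := by by_contra h; exact hlt ((splitter_lt_iff hn v).2 h)
    have hκN : ∀ i < N, κ i ≠ κ N := fun i hi h => by
      have := sameCycle_succ_of_opener hv ((hκ i (by omega) N (by omega)).1 h)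
      omega
    rw [if_pos hv, if_neg hlt]
    have e : ∀ᵐ y ∂unif, G U * {U | Arrived ℓ κ v (N + 1) U}.indicator
        (fun U => H (arcVec ℓ κ v (N + 1) U)) (update U N y) =
        if tabOf ℓ y = κ N then G U * {U | Arrived ℓ κ v N U}.indicator (fun U =>
            H (update (arcVec ℓ κ v N U) N (ℓ (κ N)))) U else 0 := by
      filter_upwards [ae_goodPoints_update N hU] with y hy
      have hiff := arrived_succ_opener (κ := κ) (v := v) hℓ hU hy (hUU y) hv hκN
      simp only [indicator_apply, mem_ofPred_eq, hiff, update_self]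
      by_cases h1 : tabOf ℓ y = κ N
      · by_cases h0 : Arrived ℓ κ v N U
        · have h2 := hiff.2 ⟨h0, by simpa using h1⟩
          rw [if_pos ⟨h0, h1⟩, if_pos h0, if_pos h1, arcVec_succ_opener (hUU y) hv h2]
        all_goals grind
      all_goals grind
    rw [lintegral_congr_ae e, lintegral_tabOf hℓ, mul_comm]

lemma lintegral_arrived (hℓ : GoodSticks ℓ) (v : VirtualPerm) (κ : ℕ → ℕ) {n N : ℕ}
    (hn : n ≤ N) (hκ : ∀ i < N, ∀ j < N, κ i = κ j ↔ (v.perm N).SameCycle i j)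
    {G : (ℕ → ℝ) → ℝ≥0∞} (hG : Measurable G)
    (hGloc : ∀ U U' : ℕ → ℝ, (∀ i < n, U i = U' i) → G U = G U')
    {H : (ℕ → ℝ) → ℝ≥0∞} (hH : Measurable H) :
    ∫⁻ U, G U * {U | Arrived ℓ κ v N U}.indicator (fun U => H (arcVec ℓ κ v N U)) U ∂pointsLaw =
      (∏ k ∈ Finset.Ico n N with v.perm (k + 1) k = k, ofReal (ℓ (κ k))) *
      ∫⁻ U, G U * {U | Arrived ℓ κ v n U}.indicator (fun U =>
        arrivals (splitter n v) N H (arcVec ℓ κ v n U)) U ∂pointsLaw := by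
  induction N, hn using Nat.le_induction generalizing H with
  | base =>
    have : ∀ k < n, splitter n v k = k := fun k hk => by simp [splitter, hk]
    simp [arrivals_of_self this]
  | succ N hn ih =>
    have hκ' : ∀ i < N, ∀ j < N, κ i = κ j ↔ (v.perm N).SameCycle i j := fun i hi j hj => by
      rw [hκ i (by omega) j (by omega), sameCycle_perm v (Nat.le_succ N) hi hj]
    have hupm : Measurable fun L : ℕ → ℝ => update L N (ℓ (κ N)) := by
      fun_prop
    rw [lintegral_arrived_succ hℓ v κ hn hκ hG hGloc hH, ih hκ', ← mul_assoc]
    · congr 1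
      · rw [← Finset.insert_Ico_right_eq_Ico_add_one hn, filter_insert]
        split_ifs
        · rw [Finset.prod_insert (by simp)]
        · rw [one_mul]
      · refine lintegral_congr fun U => ?_
        congr 1
        refine congrFun (congrArg _ (funext fun U => ?_)) U
        rw [arrivals]
        have : arcVec ℓ κ v n U N = ℓ (κ N) := by rw [arcVec, if_neg (by omega)]
        rw [this]
        split_ifs <;> rfl
    · by_cases h : splitter n v N < N
      · rw [if_pos h]; exact measurable_splitArc' _ _ hH
      · rw [if_neg h]; exact hH.comp hupm

/-! ## Stick breaking -/

/-- The `k`-th piece broken off the unit stick. -/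
def stick (z : ℝ) (V : ℕ → ℝ) (k : ℕ) : ℝ :=
  (1 - V k ^ (1 / z)) * ∏ i ∈ range k, V i ^ (1 / z)

/-- The sequence with the first term `v` and the other terms `V`. -/
def consSeq (v : ℝ) (V : ℕ → ℝ) : ℕ → ℝ
  | 0 => v
  | k + 1 => V k

/-- The rising factorial `x (x + 1) ⋯ (x + k - 1)`. -/
def rising (x : ℝ) (k : ℕ) : ℝ := ∏ i ∈ range k, (x + i)

lemma rising_pos {x : ℝ} (hx : 0 < x) (k : ℕ) : 0 < rising x k :=
  Finset.prod_pos fun i _ => by positivity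

lemma rising_succ (x : ℝ) (k : ℕ) : rising x (k + 1) = rising x k * (x + k) :=
  Finset.prod_range_succ _ _

lemma rising_succ' (x : ℝ) (k : ℕ) : rising x (k + 1) = x * rising (x + 1) k := by
  rw [rising, Finset.prod_range_succ', mul_comm, rising]
  all_goals grind

lemma rising_add (x : ℝ) (a b : ℕ) : rising x (a + b) = rising x a * rising (x + a) b := by
  rw [rising, Finset.prod_range_add, rising, rising]
  grind

lemma measurable_consSeq : Measurable fun q : (ℕ → ℝ) × ℝ => consSeq q.2 q.1 := by
  refine measurable_pi_lambda _ fun k => ?_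
  cases k
  · exact measurable_snd
  · exact (measurable_pi_apply _).comp measurable_fst

lemma lintegral_pointsLaw_cons {f : (ℕ → ℝ) → ℝ≥0∞} (hf : Measurable f) :
    ∫⁻ V, f V ∂pointsLaw = ∫⁻ V, ∫⁻ v, f (consSeq v V) ∂unif ∂pointsLaw := by
  have hs : Measurable fun (V : ℕ → ℝ) (k : ℕ) => V (k + 1) := by fun_prop
  have h1 : pointsLaw.map (fun (V : ℕ → ℝ) (k : ℕ) => V (k + 1)) = pointsLaw :=
    Measure.map_infinitePi_infinitePi_of_inj (f := fun k : ℕ => k + 1) (add_left_injective 1)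
  have hg : Measurable fun V : ℕ → ℝ => ∫⁻ v, f (consSeq v V) ∂unif :=
    Measurable.lintegral_prod_right' (f := fun q : (ℕ → ℝ) × ℝ => f (consSeq q.2 q.1)) (hf.comp measurable_consSeq)
  rw [lintegral_pointsLaw_resample 0 hf]
  nth_rw 2 [← h1]
  rw [lintegral_map hg hs]
  refine lintegral_congr fun V => lintegral_congr fun v => ?_
  congr 1
  funext k
  cases k <;> rfl

lemma stick_cons_zero (z v : ℝ) (V : ℕ → ℝ) : stick z (consSeq v V) 0 = 1 - v ^ (1 / z) := by
  simp [stick, consSeq]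

lemma stick_cons_succ (z v : ℝ) (V : ℕ → ℝ) (k : ℕ) :
    stick z (consSeq v V) (k + 1) = v ^ (1 / z) * stick z V k := by
  rw [stick, stick, Finset.prod_range_succ']
  simp only [consSeq]
  ring

variable {z : ℝ}

lemma integral_stick (hz : 0 < z) (a b : ℕ) :
    ∫ v in (0 : ℝ)..1, (1 - v ^ (1 / z)) ^ a * (v ^ (1 / z)) ^ b =
      z * a.factorial / rising (b + z) (a + 1) := by
  have hcont : Continuous fun v : ℝ => v ^ (1 / z) := Real.continuous_rpow_const (by positivity)
  induction a generalizing b with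
  | zero =>
    have : ∫ v in (0 : ℝ)..1, (1 - v ^ (1 / z)) ^ 0 * (v ^ (1 / z)) ^ b =
        ∫ v in (0 : ℝ)..1, v ^ (b / z) := by
      refine intervalIntegral.integral_congr fun v hv => ?_
      rw [Set.uIcc_of_le zero_le_one] at hv
      simp only [pow_zero, one_mul]
      rw [← Real.rpow_natCast, ← Real.rpow_mul hv.1]
      grind
    have hb : (0 : ℝ) < b / z + 1 := by positivity
    rw [this, integral_rpow (Or.inl (by linarith))]
    simp [rising, Real.zero_rpow hb.ne']
    field_simp
  | succ a ih =>
    have e : ∀ v : ℝ, (1 - v ^ (1 / z)) ^ (a + 1) * (v ^ (1 / z)) ^ b =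
        (1 - v ^ (1 / z)) ^ a * (v ^ (1 / z)) ^ b -
          (1 - v ^ (1 / z)) ^ a * (v ^ (1 / z)) ^ (b + 1) := fun v => by ring
    simp_rw [e]
    rw [intervalIntegral.integral_sub (Continuous.intervalIntegrable (by fun_prop) _ _)
      (Continuous.intervalIntegrable (by fun_prop) _ _), ih, ih]
    have hbz : (0 : ℝ) < b + z := by positivity
    have h1 := rising_pos (show (0 : ℝ) < b + z + 1 by positivity) a
    have e1 : rising (b + z) (a + 1) = (b + z) * rising (b + z + 1) a := rising_succ' _ _
    have e2 : rising ((b + 1 : ℕ) + z) (a + 1) = rising (b + z + 1) a * (b + z + 1 + a) := by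
      rw [show ((b + 1 : ℕ) : ℝ) + z = b + z + 1 by push_cast; ring, rising_succ]
    have e3 : rising (b + z) (a + 1 + 1) = (b + z) * (rising (b + z + 1) a * (b + z + 1 + a)) := by
      rw [rising_succ', rising_succ]
    rw [e1, e2, e3, Nat.factorial_succ]
    have h2 : (0 : ℝ) < b + z + 1 + a := by positivity
    push_cast
    field_simp
    ring

lemma ae_unif_mem : ∀ᵐ v ∂unif, v ∈ Ico (0 : ℝ) 1 := ae_restrict_mem measurableSet_Ico

lemma rpow_mem_Icc (hz : 0 < z) {v : ℝ} (hv : v ∈ Ico (0 : ℝ) 1) : v ^ (1 / z) ∈ Icc (0 : ℝ) 1 :=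
  ⟨Real.rpow_nonneg hv.1 _, Real.rpow_le_one hv.1 hv.2.le (by positivity)⟩

lemma lintegral_stick (hz : 0 < z) (a b : ℕ) :
    ∫⁻ v, ofReal (1 - v ^ (1 / z)) ^ a * ofReal (v ^ (1 / z)) ^ b ∂unif =
      ofReal (z * a.factorial / rising (b + z) (a + 1)) := by
  have hcont : Continuous fun v : ℝ => v ^ (1 / z) := Real.continuous_rpow_const (by positivity)
  have e : ∀ᵐ v ∂unif, ofReal (1 - v ^ (1 / z)) ^ a * ofReal (v ^ (1 / z)) ^ b =
      ofReal ((1 - v ^ (1 / z)) ^ a * (v ^ (1 / z)) ^ b) := by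
    filter_upwards [ae_unif_mem] with v hv
    obtain ⟨h1, h2⟩ := rpow_mem_Icc hz hv
    rw [ofReal_mul (pow_nonneg (sub_nonneg.2 h2) _), ofReal_pow h1, ofReal_pow (sub_nonneg.2 h2)]
  rw [lintegral_congr_ae e, unif, ← integral_stick hz a b, intervalIntegral.integral_of_le zero_le_one,
    ← ofReal_integral_eq_lintegral_ofReal]
  · rw [setIntegral_congr_set Ico_ae_eq_Ioc]
  · refine IntegrableOn.congr_set_ae (t := Ioc (0 : ℝ) 1) ?_ Ico_ae_eq_Ioc
    exact (intervalIntegrable_iff_integrableOn_Ioc_of_le zero_le_one).1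
      (Continuous.intervalIntegrable (by fun_prop) _ _)
  · filter_upwards [ae_unif_mem] with v hv
    obtain ⟨h1, h2⟩ := rpow_mem_Icc hz hv
    have := sub_nonneg.2 h2
    simp only [Pi.zero_apply]
    positivity

lemma sum_stick (z : ℝ) (V : ℕ → ℝ) (K : ℕ) :
    ∑ k ∈ range K, stick z V k = 1 - ∏ i ∈ range K, V i ^ (1 / z) := by
  induction K with
  | zero => simp
  | succ K ih => rw [sum_range_succ, ih, stick, Finset.prod_range_succ]; ring

lemma stick_nonneg (hz : 0 < z) {V : ℕ → ℝ} (hV : ∀ i, V i ∈ Ico (0 : ℝ) 1) (k : ℕ) :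
    0 ≤ stick z V k :=
  mul_nonneg (sub_nonneg.2 (rpow_mem_Icc hz (hV k)).2)
    (prod_nonneg fun i _ => (rpow_mem_Icc hz (hV i)).1)

lemma tsum_stick_le (hz : 0 < z) {V : ℕ → ℝ} (hV : ∀ i, V i ∈ Ico (0 : ℝ) 1) :
    ∑' k, ofReal (stick z V k) ≤ 1 := by
  refine ENNReal.tsum_le_of_sum_range_le fun K => ?_
  rw [← ENNReal.ofReal_sum_of_nonneg fun k _ => stick_nonneg hz hV k, sum_stick]
  refine ENNReal.ofReal_le_one.2 ?_
  have : 0 ≤ ∏ i ∈ range K, V i ^ (1 / z) := prod_nonneg fun i _ => (rpow_mem_Icc hz (hV i)).1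
  linarith

lemma measurable_stick (z : ℝ) : Measurable (stick z) := by
  refine measurable_pi_lambda _ fun k => ?_
  unfold stick
  fun_prop

/-- The embeddings that avoid `0`, and those that send `i` to `0`. -/
def shiftEmbedding {α : Type} [DecidableEq α] : (α ↪ ℕ) ⊕ (Σ i : α, {j // j ≠ i} ↪ ℕ) → (α ↪ ℕ)
  | .inl κ => ⟨fun i => κ i + 1, fun i j h => κ.injective (Nat.succ_injective h)⟩
  | .inr ⟨i, κ⟩ => ⟨fun j => if h : j = i then 0 else κ ⟨j, h⟩ + 1, fun j j' h => by
      dsimp only at h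
      split_ifs at h with h1 h2 h2
      · rw [h1, h2]
      · have := κ.injective (Nat.succ_injective h)
        simpa using this⟩

section Shift

variable {α : Type} [DecidableEq α]

lemma shiftEmbedding_inl (κ : α ↪ ℕ) (j : α) : shiftEmbedding (.inl κ) j = κ j + 1 := rfl

lemma shiftEmbedding_inr_self (i : α) (κ : {j // j ≠ i} ↪ ℕ) :
    shiftEmbedding (.inr ⟨i, κ⟩) i = 0 := dif_pos rfl

lemma shiftEmbedding_inr {i : α} (κ : {j // j ≠ i} ↪ ℕ) {j : α} (hj : j ≠ i) :
    shiftEmbedding (.inr ⟨i, κ⟩) j = κ ⟨j, hj⟩ + 1 := dif_neg hj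

lemma bijective_shiftEmbedding : Bijective (shiftEmbedding (α := α)) := by
  constructor
  · rintro (κ | ⟨i, κ⟩) (κ' | ⟨i', κ'⟩) h
    · congr 1
      ext x
      have := DFunLike.congr_fun h x
      rw [shiftEmbedding_inl, shiftEmbedding_inl] at this
      omega
    · have := DFunLike.congr_fun h i'
      rw [shiftEmbedding_inl, shiftEmbedding_inr_self] at this
      omega
    · have := DFunLike.congr_fun h i
      rw [shiftEmbedding_inl, shiftEmbedding_inr_self] at this
      omega
    · have h1 : i = i' := by
        by_contra hne
        have := DFunLike.congr_fun h i
        rw [shiftEmbedding_inr_self, shiftEmbedding_inr _ hne] at this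
        omega
      subst h1
      congr 2
      ext ⟨x, hx⟩
      have := DFunLike.congr_fun h x
      rw [shiftEmbedding_inr _ hx, shiftEmbedding_inr _ hx] at this
      omega
  · intro κ
    by_cases h : ∃ i, κ i = 0
    · obtain ⟨i, hi⟩ := h
      have hpos : ∀ j, j ≠ i → κ j ≠ 0 := fun j hj h0 => hj (κ.injective (h0.trans hi.symm))
      refine ⟨.inr ⟨i, ⟨fun j => κ j - 1, fun j j' h => ?_⟩⟩, ?_⟩
      · grind
      · ext j
        by_cases hj : j = i
        · subst hj; rw [shiftEmbedding_inr_self, hi]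
        · rw [shiftEmbedding_inr _ hj]
          exact Nat.sub_add_cancel (Nat.pos_of_ne_zero (hpos j hj))
    · push Not at h
      refine ⟨.inl ⟨fun j => κ j - 1, fun j j' h' => ?_⟩, ?_⟩
      · grind
      · ext j
        have hj : κ j ≠ 0 := h j
        rw [shiftEmbedding_inl]
        exact Nat.sub_add_cancel (Nat.pos_of_ne_zero hj)

end Shift

/-- The sum over all choices of distinct pieces of the products of powers of their lengths. -/
def powerSum (α : Type) [Fintype α] (m : α → ℕ) (ℓ : ℕ → ℝ) : ℝ≥0∞ :=
  ∑' κ : α ↪ ℕ, ∏ i, ofReal (ℓ (κ i)) ^ m i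

instance (α : Type) [Finite α] : Countable (α ↪ ℕ) :=
  Injective.countable (f := fun κ : α ↪ ℕ => (κ : α → ℕ)) DFunLike.coe_injective

lemma measurable_powerSum (α : Type) [Fintype α] (m : α → ℕ) : Measurable (powerSum α m) :=
  Measurable.tsum fun κ => measurable_prod _ fun i _ =>
    ((measurable_pi_apply (κ i)).ennreal_ofReal).pow_const _

lemma powerSum_le (α : Type) [Fintype α] {m : α → ℕ} (hm : ∀ i, 1 ≤ m i) {ℓ : ℕ → ℝ}
    (hℓ : ∑' k, ofReal (ℓ k) ≤ 1) : powerSum α m ℓ ≤ 1 := by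
  have h1 : powerSum α m ℓ ≤ ∑' κ : α → ℕ, ∏ i, ofReal (ℓ (κ i)) ^ m i :=
    ENNReal.tsum_comp_le_tsum_of_injective (f := fun κ : α ↪ ℕ => (κ : α → ℕ))
      DFunLike.coe_injective fun κ : α → ℕ => ∏ i, ofReal (ℓ (κ i)) ^ m i
  refine h1.trans ?_
  have h2 : ∑' κ : α → ℕ, ∏ i, ofReal (ℓ (κ i)) ^ m i = ∏ i, ∑' k, ofReal (ℓ k) ^ m i := by
    have := lintegral_pi_prod (fun _ : α => (Measure.count : Measure ℕ))
      (f := fun i k => ofReal (ℓ k) ^ m i) fun i => measurable_of_countable _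
    simp_rw [lintegral_count] at this
    rw [← this, lintegral_countable']
    simp
  rw [h2]
  refine Finset.prod_le_one' fun i _ => le_trans (ENNReal.tsum_le_tsum fun k => ?_) hℓ
  have : ofReal (ℓ k) ≤ 1 := (ENNReal.le_tsum k).trans hℓ
  exact pow_le_of_le_one (zero_le) this (by have := hm i; omega)

lemma powerSum_cons (hz : 0 < z) (α : Type) [Fintype α] [DecidableEq α] (m : α → ℕ) {v : ℝ}
    (hv : v ∈ Ico (0 : ℝ) 1) (V : ℕ → ℝ) :
    powerSum α m (stick z (consSeq v V)) =
      ofReal (v ^ (1 / z)) ^ (∑ i, m i) * powerSum α m (stick z V) +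
      ∑ i, ofReal (1 - v ^ (1 / z)) ^ m i * ofReal (v ^ (1 / z)) ^
        (∑ j : {j // j ≠ i}, m j) * powerSum {j // j ≠ i} (fun j => m j) (stick z V) := by
  have h0 := (rpow_mem_Icc hz hv).1
  rw [powerSum, ← (ofBijective _ (bijective_shiftEmbedding (α := α))).tsum_eq,
    ENNReal.summable.tsum_sum ENNReal.summable]
  simp only [ofBijective_apply]
  congr 1
  · rw [powerSum, ← ENNReal.tsum_mul_left]
    refine tsum_congr fun κ => ?_
    simp only [shiftEmbedding_inl, stick_cons_succ, ofReal_mul h0, mul_pow,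
      prod_mul_distrib, Finset.prod_pow_eq_pow_sum]
  · rw [tsum_sigma', tsum_fintype]
    refine sum_congr rfl fun i _ => ?_
    rw [powerSum, ← ENNReal.tsum_mul_left]
    refine tsum_congr fun κ => ?_
    rw [← Finset.mul_prod_erase _ _ (mem_univ i), shiftEmbedding_inr_self, stick_cons_zero,
      mul_assoc]
    congr 1
    rw [prod_subtype (p := fun j => j ≠ i) (F := inferInstance) (univ.erase i) (by simp)]
    have : ∀ j : {j // j ≠ i}, shiftEmbedding (.inr ⟨i, κ⟩) (j : α) = κ j + 1 := fun j =>
      shiftEmbedding_inr κ j.2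
    simp only [this, stick_cons_succ, ofReal_mul h0, mul_pow,
      prod_mul_distrib, Finset.prod_pow_eq_pow_sum]

lemma sum_subtype_ne {α : Type} [Fintype α] [DecidableEq α] (m : α → ℕ) (i : α) :
    m i + ∑ j : {j // j ≠ i}, m j = ∑ j, m j := by
  rw [← Finset.add_sum_erase _ _ (mem_univ i),
    sum_subtype (p := fun j => j ≠ i) (F := inferInstance) (univ.erase i) (by simp)]

lemma prod_subtype_ne {α : Type} [Fintype α] [DecidableEq α] (f : α → ℝ) (i : α) :
    f i * ∏ j : {j // j ≠ i}, f j = ∏ j, f j := by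
  rw [← Finset.mul_prod_erase _ _ (mem_univ i),
    prod_subtype (p := fun j => j ≠ i) (F := inferInstance) (univ.erase i) (by simp)]

lemma lintegral_powerSum (hz : 0 < z) : ∀ (c : ℕ) (α : Type) [Fintype α], Fintype.card α = c →
    ∀ m : α → ℕ, (∀ i, 1 ≤ m i) → ∫⁻ V, powerSum α m (stick z V) ∂pointsLaw =
      ofReal (z ^ c * (∏ i, ((m i - 1).factorial : ℝ)) / rising z (∑ i, m i)) := by
  intro c
  induction c with
  | zero =>
    intro α _ hα m hm
    have : IsEmpty α := Fintype.card_eq_zero_iff.1 hα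
    have e : ∀ ℓ, powerSum α m ℓ = 1 := fun ℓ => by
      have : Unique (α ↪ ℕ) := ⟨⟨⟨isEmptyElim, fun i => isEmptyElim i⟩⟩, fun κ => by
        ext i; exact isEmptyElim i⟩
      rw [powerSum, tsum_eq_single default fun κ hκ => absurd (Subsingleton.elim _ _) hκ]
      simp
    simp [e, rising]
  | succ c ih =>
    intro α _ hα m hm
    classical
    have hne : Nonempty α := Fintype.card_pos_iff.1 (by omega)
    set X := ∫⁻ V, powerSum α m (stick z V) ∂pointsLaw with hX
    set M := ∑ i, m i with hM
    set P := ∏ i, ((m i - 1).factorial : ℝ) with hP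
    have hMpos : 1 ≤ M := by
      obtain ⟨i⟩ := hne
      exact (hm i).trans (Finset.single_le_sum (fun _ _ => Nat.zero_le _) (mem_univ i))
    have hms : ∀ (β : Type) [Fintype β] (m : β → ℕ),
        Measurable fun V => powerSum β m (stick z V) := fun β _ m =>
      (measurable_powerSum β m).comp (measurable_stick z)
    have hXfin : X ≤ 1 := by
      have : ∀ᵐ V ∂pointsLaw, powerSum α m (stick z V) ≤ 1 := by
        filter_upwards [ae_goodPoints] with V hV
        exact powerSum_le α hm (tsum_stick_le hz hV.1)
      calc X ≤ ∫⁻ _, 1 ∂pointsLaw := lintegral_mono_ae this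
        _ = 1 := by simp
    have hzM : 0 < M + z := by positivity
    have hR := rising_pos hz M
    have hM' : ∀ i, m i + ∑ j : {j // j ≠ i}, m j = M := sum_subtype_ne m
    have hmi : ∀ i (e : ℕ), Measurable fun v : ℝ =>
        ofReal (1 - v ^ (1 / z)) ^ m i * ofReal (v ^ (1 / z)) ^ e := fun i e =>
      ((measurable_const.sub (measurable_id.pow_const _)).ennreal_ofReal.pow_const _).mul
        ((measurable_id.pow_const _).ennreal_ofReal.pow_const _)
    have hrec : X = ofReal (z / (M + z)) * X +
        ∑ i, ofReal (z ^ (c + 1) * m i * P / (rising z M * (M + z))) := by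
      have hmr : Measurable fun v : ℝ => ofReal (v ^ (1 / z)) :=
        (measurable_id.pow_const _).ennreal_ofReal
      refine Eq.trans (lintegral_pointsLaw_cons (hms α m)) ?_
      have h1 : ∀ᵐ v ∂unif, ∫⁻ V, powerSum α m (stick z (consSeq v V)) ∂pointsLaw =
          ofReal (v ^ (1 / z)) ^ M * X +
          ∑ i, ofReal (1 - v ^ (1 / z)) ^ m i * ofReal (v ^ (1 / z)) ^ (∑ j : {j // j ≠ i}, m j) *
            ∫⁻ V, powerSum {j // j ≠ i} (fun j => m j) (stick z V) ∂pointsLaw := by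
        filter_upwards [ae_unif_mem] with v hv
        simp_rw [powerSum_cons hz α m hv]
        rw [lintegral_add_left ((hms α m).const_mul _), lintegral_const_mul _ (hms α m),
          lintegral_finsetSum _ fun i _ => (hms {j // j ≠ i} fun j => m j).const_mul _]
        congr 1
        exact sum_congr rfl fun i _ => lintegral_const_mul _ (hms {j // j ≠ i} fun j => m j)
      refine Eq.trans (lintegral_lintegral_swap ((hms α m).comp measurable_consSeq).aemeasurable) ?_
      rw [lintegral_congr_ae h1, lintegral_add_left ((hmr.pow_const _).mul_const _),
        lintegral_finsetSum _ fun i _ => ((hmi i _).mul_const _)]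
      congr 1
      · rw [lintegral_mul_const _ (hmr.pow_const _)]
        have := lintegral_stick hz 0 M
        simp only [pow_zero, one_mul] at this
        rw [this]
        simp [rising]
      · refine sum_congr rfl fun i _ => ?_
        rw [lintegral_mul_const _ (hmi i _),
          lintegral_stick hz, ih {j // j ≠ i} (by simp [hα]) (fun j => m j) fun j => hm j]
        set M' := ∑ j : {j // j ≠ i}, m j with hM''
        have e1 := hM' i
        have e2 := prod_subtype_ne (fun j => ((m j - 1).factorial : ℝ)) i
        rw [← hP] at e2
        have hR' := rising_pos hz M'
        have hR2 := rising_pos (show 0 < (M' : ℝ) + z by positivity) (m i + 1)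
        have e3 : rising z M * (M + z) = rising z M' * rising (M' + z) (m i + 1) := by
          rw [add_comm (M' : ℝ) z, ← rising_add, ← add_assoc, add_comm M', e1, rising_succ,
            add_comm z]
        rw [← ofReal_mul (by positivity), e3, ← e2]
        congr 1
        have e4 : ((m i).factorial : ℝ) = m i * (m i - 1).factorial := by
          exact_mod_cast (Nat.mul_factorial_pred (by have := hm i; omega)).symm
        grind
    rw [← ENNReal.ofReal_sum_of_nonneg fun i _ => by positivity] at hrec
    have e5 : ∑ i, z ^ (c + 1) * m i * P / (rising z M * (M + z)) =
        z ^ (c + 1) * M * P / (rising z M * (M + z)) := by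
      rw [← sum_div, ← Finset.sum_mul, ← mul_sum, hM]
      simp
    rw [e5] at hrec
    have hfin : X ≠ ∞ := ne_top_of_le_ne_top ENNReal.one_ne_top hXfin
    have hr := congrArg ENNReal.toReal hrec
    rw [ENNReal.toReal_add (ENNReal.mul_ne_top ofReal_ne_top hfin) ofReal_ne_top,
      ENNReal.toReal_mul, toReal_ofReal (by positivity),
      toReal_ofReal (by positivity)] at hr
    rw [← ENNReal.ofReal_toReal hfin]
    congr 1
    have hM0 : (0 : ℝ) < M := by exact_mod_cast hMpos
    field_simp at hr ⊢
    nlinarith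

lemma ae_tsum_stick (hz : 0 < z) : ∀ᵐ V ∂pointsLaw, ∑' k, ofReal (stick z V k) = 1 := by
  have e : ∀ ℓ : ℕ → ℝ, powerSum Unit (fun _ => 1) ℓ = ∑' k, ofReal (ℓ k) := fun ℓ => by
    rw [powerSum, ← (ofBijective (fun k : ℕ => (⟨fun _ => k, fun _ _ _ => rfl⟩ : Unit ↪ ℕ))
      ⟨fun a b h => DFunLike.congr_fun h (), fun κ => ⟨κ (), by ext; rfl⟩⟩).tsum_eq]
    refine tsum_congr fun k => ?_
    rw [Fintype.prod_unique, pow_one]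
    rfl
  have hm : Measurable fun V => ∑' k, ofReal (stick z V k) := by
    simp_rw [← e]
    exact (measurable_powerSum _ _).comp (measurable_stick z)
  refine ae_eq_of_ae_le_of_lintegral_le (g := fun _ => 1) ?_ ?_ aemeasurable_const ?_
  · filter_upwards [ae_goodPoints] with V hV using tsum_stick_le hz hV.1
  · refine ne_top_of_le_ne_top (ENNReal.one_ne_top) (le_trans (lintegral_mono_ae (g := fun _ => 1) ?_)
      (by simp))
    filter_upwards [ae_goodPoints] with V hV using tsum_stick_le hz hV.1
  · simp_rw [← e]
    rw [lintegral_powerSum hz 1 Unit (by simp) _ fun _ => le_rfl]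
    simp [rising, hz.ne']

/-- The law of the lengths of the broken stick. -/
def stickLaw (z : ℝ) : Measure (ℕ → ℝ) := pointsLaw.map (stick z)

instance : IsProbabilityMeasure (stickLaw z) :=
  Measure.isProbabilityMeasure_map (measurable_stick z).aemeasurable

lemma ae_stickLaw (hz : 0 < z) : ∀ᵐ ℓ ∂stickLaw z, GoodSticks ℓ := by
  rw [stickLaw, ae_map_iff (measurable_stick z).aemeasurable measurable_goodSticks.setOf]
  have h0 : ∀ᵐ V ∂pointsLaw, ∀ i, V i ≠ 0 := by
    refine ae_all_iff.2 fun i => ?_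
    have h : ∀ᵐ x ∂unif, x ≠ 0 := ae_restrict_of_ae (Measure.ae_ne volume 0)
    have := Measure.infinitePi_map_eval (fun _ : ℕ => unif) i
    rw [← this] at h
    exact ae_of_ae_map (measurable_pi_apply i).aemeasurable h
  filter_upwards [ae_goodPoints, ae_tsum_stick hz, h0] with V hV h1 h2
  have hpos : ∀ i, 0 < V i := fun i => lt_of_le_of_ne (hV.1 i).1 (h2 i).symm
  refine ⟨fun k => mul_pos (sub_pos.2 (Real.rpow_lt_one (hpos k).le (hV.1 k).2 (by positivity)))
    (Finset.prod_pos fun i _ => Real.rpow_pos_of_pos (hpos i) _), ?_⟩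
  have := ENNReal.hasSum_toReal (f := fun k => ofReal (stick z V k)) (by rw [h1]; simp)
  rw [← ENNReal.tsum_toReal_eq (by simp), h1] at this
  simpa [toReal_ofReal, stick_nonneg hz hV.1] using this

lemma lintegral_powerSum_stickLaw (hz : 0 < z) (α : Type) [Fintype α] (m : α → ℕ)
    (hm : ∀ i, 1 ≤ m i) : ∫⁻ ℓ, powerSum α m ℓ ∂stickLaw z =
      ofReal (z ^ Fintype.card α * (∏ i, ((m i - 1).factorial : ℝ)) / rising z (∑ i, m i)) := by
  rw [stickLaw, lintegral_map (measurable_powerSum α m) (measurable_stick z),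
    lintegral_powerSum hz _ α rfl m hm]

/-! ## The order of arrivals and the segments of the cycles -/

section Extend

variable {N : ℕ}

/-- The extension by the identity of a permutation of `Fin N`. -/
def natPerm (w : Perm (Fin N)) : Perm ℕ := w.extendDomain Fin.equivSubtype

lemma natPerm_apply (w : Perm (Fin N)) (i : Fin N) : natPerm w i = w i :=
  w.extendDomain_apply_image Fin.equivSubtype i

lemma natPerm_fixes (w : Perm (Fin N)) (i : ℕ) (h : N ≤ i) : natPerm w i = i :=
  w.extendDomain_apply_not_subtype Fin.equivSubtype (by simpa using h)

lemma toFinPerm_natPerm (w : Perm (Fin N)) (h) : toFinPerm N (natPerm w) h = w := by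
  ext i
  rw [toFinPerm_apply, natPerm_apply]

lemma natPerm_toFinPerm (g : Perm ℕ) (h) : natPerm (toFinPerm N g h) = g := by
  ext i
  rcases Nat.lt_or_ge i N with hi | hi
  · exact (natPerm_apply _ ⟨i, hi⟩).trans (toFinPerm_apply _ _ _ _)
  · rw [natPerm_fixes _ _ hi, h i hi]

lemma reduce_of_fixes {w : Perm ℕ} (h : ∀ i, N ≤ i → w i = i) (k : ℕ) : reduce N k w = w := by
  induction k with
  | zero => rfl
  | succ k ih => rw [reduce, removePoint_of_fixed (h _ (by omega)), ih]

/-- A virtual permutation with a given permutation of `Fin N`. -/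
def ofFin (w : Perm (Fin N)) : VirtualPerm where
  perm k := reduce k N (natPerm w)
  fixes k i h := by
    rcases Nat.lt_or_ge i (k + N) with hi | hi
    · exact reduce_apply_mid h hi _
    · exact reduce_apply_fixed (natPerm_fixes w i (by omega))
  compat k := by rw [← reduce_succ_left, reduce_stable (natPerm_fixes w) (N + 1) (by omega)]

lemma ofFin_perm (w : Perm (Fin N)) : (ofFin w).perm N = natPerm w :=
  reduce_of_fixes (natPerm_fixes w) N

lemma ofFin_fin (w : Perm (Fin N)) : (ofFin w).fin N = w := by
  ext i
  rw [VirtualPerm.fin, toFinPerm_apply, ofFin_perm, natPerm_apply]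

lemma fin_eq_iff (u v : VirtualPerm) (N : ℕ) : u.fin N = v.fin N ↔ u.perm N = v.perm N := by
  constructor
  · intro h
    have := congrArg natPerm h
    rwa [VirtualPerm.fin, VirtualPerm.fin, natPerm_toFinPerm, natPerm_toFinPerm] at this
  · intro h
    ext i
    rw [VirtualPerm.fin, VirtualPerm.fin, toFinPerm_apply, toFinPerm_apply, h]

end Extend

section Opener

variable {n N : ℕ} (h : n ≤ N) (v : VirtualPerm)

local notation "FF" => castLEEmb h
local notation "SS" => seg (v.fin N) (castLEEmb h)

lemma fin_pow_apply (x : Fin N) (m : ℕ) : ((v.fin N ^ m) x : ℕ) = (v.perm N ^ m) x :=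
  toFinPerm_pow_apply _ _ _ _ _

lemma seg_label (i : Fin n) : seg (v.fin N) (castLEEmb h) (castLEEmb h i) = .inl i :=
  seg_eq_iff.2 ⟨0, (returnTime_spec _ _ i).1, rfl⟩

lemma seg_splitter {k : ℕ} (hk : k < N) (hn : n ≤ k) (hs : splitter n v k < k) :
    SS ⟨splitter n v k, hs.trans hk⟩ = SS ⟨k, hk⟩ := by
  set j := splitter n v k with hj
  have hjk : v.perm (k + 1) j = k := splitter_succ_lt hn v
  obtain ⟨h1, h2, -⟩ := firstReturn_perm v (show k + 1 ≤ N by omega) j (by omega)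
  rw [hjk] at h2
  set g := gap v (k + 1) N j
  symm
  rw [seg_eq_iff]
  have hpow : ((v.fin N) ^ (g + 1)) ⟨j, hs.trans hk⟩ = ⟨k, hk⟩ := by
    ext; rw [fin_pow_apply]; exact h2
  rcases e : SS ⟨j, hs.trans hk⟩ with i | C
  · obtain ⟨m, hm, hm'⟩ := seg_eq_iff.1 e
    refine ⟨g + 1 + m, ?_, by rw [pow_add, Perm.mul_apply, ← hm', hpow]⟩
    by_contra hc
    push Not at hc
    obtain ⟨d, hd⟩ := Nat.exists_eq_add_of_lt hm
    have hmem := (returnTime_spec (v.fin N) (castLEEmb h) i).2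
    rw [hd, show m + d + 1 = (d + 1) + m by ring, pow_add, Perm.mul_apply, ← hm',
      mem_range_castLEEmb, fin_pow_apply] at hmem
    all_goals grind
  · have hC := seg_eq_iff.1 e
    show Quotient.mk _ _ = _
    rw [← hpow, mk_pow_apply]
    exact hC

lemma seg_rootOf {k : ℕ} (hk : k < N) :
    SS ⟨rootOf (splitter n v) k, (rootOf_le _ _).trans_lt hk⟩ = SS ⟨k, hk⟩ := by
  induction k using Nat.strong_induction_on with
  | _ k ih =>
    by_cases hs : splitter n v k < k
    · have hn : n ≤ k := by
        by_contra hc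
        rw [splitter, if_pos (by omega)] at hs
        omega
      rw [← seg_splitter h v hk hn hs, ← ih _ hs (hs.trans hk)]
      congr 2
      exact rootOf_of_lt hs
    · congr 2
      exact rootOf_of_not_lt hs

lemma exists_opener : ∃ opener : Fin n ⊕ FreeCycles (v.fin N) (castLEEmb h) → ℕ,
    (∀ b, opener b ∈ openers (splitter n v) N) ∧
    (∀ i, opener (.inl i) = i) ∧ (∀ C, n ≤ opener (.inr C)) ∧
    (∀ k, ∀ hk : k ∈ openers (splitter n v) N, opener (SS ⟨k, (mem_openers.1 hk).1⟩) = k) ∧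
    ∀ b, ∀ hb : opener b < N, SS ⟨opener b, hb⟩ = b := by
  obtain ⟨f, hf1, hf2⟩ := bijective_openers h v
  have hlt : ∀ C, (f.symm (.inl C)).1 < N := fun C => by
    grind
  have hseg : ∀ C (hb : (f.symm (.inl C)).1 < N), SS ⟨(f.symm (.inl C)).1, hb⟩ = .inr C :=
    fun C hb => by
      obtain ⟨C', h1, h2⟩ := hf1 (f.symm (.inl C)) hb
      rw [apply_symm_apply, Sum.inl.injEq] at h1
      exact seg_eq_iff.2 (h2.trans (congrArg Subtype.val h1.symm))
  have hop : ∀ k, n ≤ k → (¬ splitter n v k < k ↔ v.perm (k + 1) k = k) := fun k hk => by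
    rw [splitter_lt_iff hk, not_not]
  refine ⟨Sum.elim (fun i => i) fun C => (f.symm (.inl C)).1, ?_, fun _ => rfl,
    fun C => (f.symm (.inl C)).2.1, ?_, ?_⟩
  · rintro (i | C)
    · rw [mem_openers]
      refine ⟨i.2.trans_le h, ?_⟩
      simp [splitter]
    · exact mem_openers.2 ⟨hlt C, (hop _ (f.symm (.inl C)).2.1).2 (f.symm (.inl C)).2.2⟩
  · intro k hk
    obtain ⟨h1, h2⟩ := mem_openers.1 hk
    rcases Nat.lt_or_ge k n with hkn | hkn
    · have : SS ⟨k, h1⟩ = .inl ⟨k, hkn⟩ := seg_label h v ⟨k, hkn⟩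
      grind
    · obtain ⟨C, h3, h4⟩ := hf1 ⟨k, hkn, (hop k hkn).1 h2⟩ h1
      grind
  · rintro (i | C) hb
    · exact seg_label h v i
    · grind

lemma sameCycle_iff_seg (x y : Fin N) : (v.perm N).SameCycle x y ↔
    (∃ i j, SS x = .inl i ∧ SS y = .inl j ∧ (v.perm n).SameCycle i j) ∨
      ∃ C, SS x = .inr C ∧ SS y = .inr C := by
  have key : ∀ z : Fin N, ∀ i, SS z = .inl i → (v.fin N).SameCycle z (castLEEmb h i) := by
    intro z i hz
    obtain ⟨m, -, hm⟩ := seg_eq_iff.1 hz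
    rw [hm]
    exact (mk_eq_mk_iff.1 (mk_pow_apply _ m))
  have key' : ∀ z : Fin N, ∀ C, SS z = .inr C → (Quotient.mk _ z : Cycles (v.fin N)) = C.1 :=
    fun z C hz => seg_eq_iff.1 hz
  rw [← sameCycle_fin_iff]
  rcases hx : SS x with i | C <;> rcases hy : SS y with j | D
  · have e : (v.fin N).SameCycle x y ↔ (v.fin N).SameCycle (castLEEmb h i) (castLEEmb h j) :=
      ⟨fun e => (key x i hx).symm.trans (e.trans (key y j hy)),
        fun e => (key x i hx).trans (e.trans (key y j hy).symm)⟩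
    rw [e, sameCycle_fin_iff]
    have := sameCycle_perm v h i.2 j.2
    simp only [Sum.inl.injEq, reduceCtorEq, false_and, exists_false, or_false]
    constructor
    · intro e; exact ⟨i, j, rfl, rfl, this.2 e⟩
    · rintro ⟨_, _, rfl, rfl, e⟩; exact this.1 e
  · simp only [reduceCtorEq, false_and, and_false, exists_false, or_false, iff_false]
    intro e
    exact D.2 i (((mk_eq_mk_iff.2 (e.symm.trans (key x i hx))).symm.trans (key' y D hy)))
  · simp only [reduceCtorEq, false_and, and_false, exists_false, or_false, iff_false]
    intro e
    exact C.2 j (((mk_eq_mk_iff.2 (e.trans (key y j hy))).symm.trans (key' x C hx)))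
  · rw [← mk_eq_mk_iff, key' x C hx, key' y D hy]
    simp only [reduceCtorEq, false_and, exists_false, false_or, Sum.inr.injEq, and_false]
    all_goals grind

end Opener

/-! ## The joint law of permutations, tables and arcs -/

variable {ℓ : ℕ → ℝ} {n N : ℕ}

/-- The length of the arc from `i` to the next guest. -/
def arcFin (ℓ : ℕ → ℝ) (N : ℕ) (U : ℕ → ℝ) (i : Fin N) : ℝ :=
  cdist ℓ (U i) (U ((paint (ℓ, U)).perm N i))

/-- The first `N` guests sit at the tables `κ` in the order `w`. -/
def Config (ℓ : ℕ → ℝ) (w : Perm (Fin N)) (κ : Fin N → ℕ) (U : ℕ → ℝ) : Prop :=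
  (paint (ℓ, U)).fin N = w ∧ ∀ i : Fin N, tabOf ℓ (U i) = κ i

lemma arrived_iff (v : VirtualPerm) {κ : ℕ → ℕ} {κ' : Fin N → ℕ} (hκ : ∀ i : Fin N, κ i = κ' i)
    (U : ℕ → ℝ) : Arrived ℓ κ v N U ↔ Config ℓ (v.fin N) κ' U := by
  rw [Arrived, Config, fin_eq_iff]
  refine and_congr_right fun _ => ⟨fun h i => (h i i.2).trans (hκ i),
    fun h i hi => (h ⟨i, hi⟩).trans (hκ ⟨i, hi⟩).symm⟩

lemma arcVec_eq_arcFin {v : VirtualPerm} {κ : ℕ → ℕ} {U : ℕ → ℝ} (h : Arrived ℓ κ v N U)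
    (i : Fin N) : arcVec ℓ κ v N U i = arcFin ℓ N U i := by
  rw [arcVec, if_pos i.2, arcFin, h.1]

/-- The tables of the first `N` guests, for given tables of the labels and of the cycles without
labels. -/
def tables (h : n ≤ N) (w : Perm (Fin N)) (κ : Fin n → ℕ)
    (o : FreeCycles w (castLEEmb h) → ℕ) (k : Fin N) : ℕ :=
  Sum.elim κ o (seg w (castLEEmb h) k)

lemma arcFin_pos (hℓ : GoodSticks ℓ) {U : ℕ → ℝ} (hU : GoodPoints U) (i : Fin N) :
    0 < arcFin ℓ N U i := by
  have := (seating hℓ hU).arc_pos i.2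
  rw [arcFin, paint_eq hℓ hU]
  exact this

open Classical in
lemma lintegral_config (hℓ : GoodSticks ℓ) (h : n ≤ N) (w : Perm (Fin N))
    {κ : Fin n → ℕ} {o : FreeCycles w (castLEEmb h) → ℕ}
    (hκ : ∀ i j, κ i = κ j ↔ (nextLabel w (castLEEmb h)).SameCycle i j)
    (ho : Injective o) (hoκ : ∀ b i, o b ≠ κ i)
    {G : (ℕ → ℝ) → ℝ≥0∞} (hG : Measurable G)
    (hGloc : ∀ U U' : ℕ → ℝ, (∀ i < n, U i = U' i) → G U = G U')
    {S : Type} [Fintype S] (γ : Fin N → S) {H : (S → ℝ) → ℝ≥0∞} (hH : Measurable H) :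
    ∫⁻ U, G U * {U | Config ℓ w (tables h w κ o) U}.indicator
        (fun U => H fun s => ∑ k, if γ k = s then arcFin ℓ N U k else 0) U ∂pointsLaw =
      ∫⁻ U, G U * {U | Config ℓ (nextLabel w (castLEEmb h)) κ U}.indicator
        (fun U => (∏ b, ofReal (ℓ (o b))) * ((∏ t : Fin n ⊕ FreeCycles w (castLEEmb h),
            ofReal (Sum.elim (arcFin ℓ n U) (fun b => ℓ (o b)) t ^
              (card {k // seg w (castLEEmb h) k = t} - 1) /
              (card {k // seg w (castLEEmb h) k = t} - 1).factorial)) *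
          ∫⁻ x, H x ∂convolution fun t : Fin n ⊕ FreeCycles w (castLEEmb h) =>
            dirichlet (fun s =>
              (card {k // seg w (castLEEmb h) k = t ∧ γ k = s} : ℝ))
              (Sum.elim (arcFin ℓ n U) (fun b => ℓ (o b)) t))) U ∂pointsLaw := by
  obtain ⟨v, rfl⟩ : ∃ v : VirtualPerm, v.fin N = w := ⟨ofFin w, ofFin_fin w⟩
  rw [nextLabel_castLEEmb] at hκ ⊢
  set κ' : ℕ → ℕ := fun k => if hk : k < N then tables h (v.fin N) κ o ⟨k, hk⟩ else 0 with hκ'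
  have hκN : ∀ i : Fin N, κ' i = tables h (v.fin N) κ o i := fun i => dif_pos i.2
  have hκn : ∀ i : Fin n, κ' i = κ i := fun i => by
    rw [hκ']
    simp only [dif_pos (i.2.trans_le h), tables]
    have := seg_label h v i
    rw [show (⟨(i : ℕ), i.2.trans_le h⟩ : Fin N) = castLEEmb h i from rfl, this]
    rfl
  have hcyc : ∀ i < N, ∀ j < N, κ' i = κ' j ↔ (v.perm N).SameCycle i j := by
    intro i hi j hj
    have := sameCycle_iff_seg h v ⟨i, hi⟩ ⟨j, hj⟩
    simp only at this
    rw [this, hκ']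
    simp only [dif_pos hi, dif_pos hj, tables]
    rcases seg (v.fin N) (castLEEmb h) ⟨i, hi⟩ with a | C <;>
      rcases seg (v.fin N) (castLEEmb h) ⟨j, hj⟩ with b | D
    · simp only [Sum.elim_inl, hκ, Sum.inl.injEq, reduceCtorEq, false_and, exists_false, or_false]
      rw [VirtualPerm.fin, ← VirtualPerm.fin, sameCycle_fin_iff]
      all_goals grind
    all_goals grind
  have hHm : Measurable fun L : ℕ → ℝ => H fun s => ∑ k : Fin N, if γ k = s then L k else 0 := by
    refine hH.comp (measurable_pi_lambda _ fun s => measurable_sum _ fun k _ => ?_)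
    split_ifs
    · fun_prop
    · simp
  have main := lintegral_arrived hℓ v κ' h hcyc hG hGloc hHm
  obtain ⟨opener, h1, h2, h3, h4, h5⟩ := exists_opener h v
  have hoN : ∀ b, opener b < N := fun b => (mem_openers.1 (h1 b)).1
  have hinj : Injective opener := fun a b e => by
    grind
  have hκo : ∀ C, κ' (opener (.inr C)) = o C := fun C => by
    rw [hκ']
    simp only [dif_pos (hoN (.inr C)), tables, h5 _ (hoN (.inr C)), Sum.elim_inr]
  have hprod : ∏ k ∈ Finset.Ico n N with v.perm (k + 1) k = k, ofReal (ℓ (κ' k)) =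
      ∏ b, ofReal (ℓ (o b)) := by
    symm
    refine Finset.prod_bij (fun b _ => opener (.inr b)) ?_ ?_ ?_ ?_
    · intro b _
      have := mem_openers.1 (h1 (.inr b))
      simp only [mem_filter, Finset.mem_Ico]
      refine ⟨⟨h3 b, this.1⟩, ?_⟩
      rw [splitter_lt_iff (h3 b), not_not] at this
      exact this.2
    · intro a _ b _ e
      grind
    · intro k hk
      simp only [mem_filter, Finset.mem_Ico] at hk
      have hk' : k ∈ openers (splitter n v) N := by
        rw [mem_openers, splitter_lt_iff hk.1.1, not_not]
        grind
      have := h4 k hk'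
      rcases e : seg (v.fin N) (castLEEmb h) ⟨k, hk.1.2⟩ with i | C
      all_goals grind
    all_goals grind
  rw [hprod] at main
  have hl : ∀ U, {U | Config ℓ (v.fin N) (tables h (v.fin N) κ o) U}.indicator
        (fun U => H fun s => ∑ k, if γ k = s then arcFin ℓ N U k else 0) U =
      {U | Arrived ℓ κ' v N U}.indicator (fun U => H fun s => ∑ k : Fin N,
        if γ k = s then arcVec ℓ κ' v N U k else 0) U := by
    intro U
    by_cases hc : Arrived ℓ κ' v N U
    · rw [indicator_of_mem (show U ∈ {U | Arrived ℓ κ' v N U} from hc),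
        indicator_of_mem (show U ∈ {U | Config ℓ (v.fin N) (tables h (v.fin N) κ o) U} from
          (arrived_iff v hκN U).1 hc)]
      simp_rw [arcVec_eq_arcFin hc]
    · rw [indicator_of_notMem (show U ∉ {U | Arrived ℓ κ' v N U} from hc),
        indicator_of_notMem (show U ∉ {U | Config ℓ (v.fin N) (tables h (v.fin N) κ o) U} from
          fun e => hc ((arrived_iff v hκN U).2 e))]
  simp_rw [hl]
  rw [main, ← lintegral_const_mul' _ _ (ENNReal.prod_ne_top fun _ _ => ofReal_ne_top)]
  refine lintegral_congr_ae ?_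
  filter_upwards [ae_goodPoints] with U hU
  by_cases hc : Arrived ℓ κ' v n U
  · rw [indicator_of_mem (show U ∈ {U | Arrived ℓ κ' v n U} from hc),
      indicator_of_mem (show U ∈ {U | Config ℓ (v.fin n) κ U} from (arrived_iff v hκn U).1 hc)]
    have htot : ∀ k, 0 < arcVec ℓ κ' v n U k := fun k => by
      by_cases hk : k < n
      · rw [arcVec_eq_arcFin hc ⟨k, hk⟩]
        exact arcFin_pos hℓ hU _
      · rw [arcVec, if_neg hk]
        exact hℓ.1 _
    have htot' : ∀ t, arcVec ℓ κ' v n U (opener t) =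
        Sum.elim (arcFin ℓ n U) (fun b => ℓ (o b)) t := by
      rintro (i | C)
      · rw [h2, arcVec_eq_arcFin hc i]; rfl
      · rw [arcVec, if_neg (by have := h3 C; omega), hκo]; rfl
    have hblk : ∀ k : Fin N, rootOf (splitter n v) k =
        opener (seg (v.fin N) (castLEEmb h) k) := fun k => by
      rw [← seg_rootOf h v k.2, h4 _ (rootOf_mem_openers k.2)]
    rw [arrivals_closed hinj h1 hblk γ htot hH]
    simp_rw [htot']
    grind
  · rw [indicator_of_notMem (show U ∉ {U | Arrived ℓ κ' v n U} from hc),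
      indicator_of_notMem (show U ∉ {U | Config ℓ (v.fin n) κ U} from
        fun e => hc ((arrived_iff v hκn U).2 e))]
    simp

/-- The seating of the first `N` guests, given the seating of the first `n`, is determined by a
permutation and an injective choice of the tables of the cycles without labels. -/
lemma exists_config (hℓ : GoodSticks ℓ) (h : n ≤ N) {U : ℕ → ℝ} (hU : GoodPoints U)
    {τ : Perm (Fin n)} {κ : Fin n → ℕ} (hc : Config ℓ τ κ U) :
    nextLabel ((paint (ℓ, U)).fin N) (castLEEmb h) = τ ∧
    ∃ o : FreeCycles ((paint (ℓ, U)).fin N) (castLEEmb h) → ℕ, Injective o ∧ (∀ b i, o b ≠ κ i) ∧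
      Config ℓ ((paint (ℓ, U)).fin N) (tables h ((paint (ℓ, U)).fin N) κ o) U ∧
      (∀ C, ∃ k : Fin N, o C = tabOf ℓ (U k)) ∧
      ∀ o', Config ℓ ((paint (ℓ, U)).fin N) (tables h ((paint (ℓ, U)).fin N) κ o') U → o' = o := by
  set v := paint (ℓ, U) with hv
  have hsame : ∀ i < N, ∀ j < N, (v.perm N).SameCycle i j ↔ tabOf ℓ (U i) = tabOf ℓ (U j) := by
    intro i hi j hj
    rw [hv, paint_eq hℓ hU]
    exact (seating hℓ hU).sameCycle_virt_iff hi hj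
  have hrep : ∀ C : FreeCycles (v.fin N) (castLEEmb h), ∃ k : Fin N,
      seg (v.fin N) (castLEEmb h) k = .inr C := by
    rintro ⟨C, hC⟩
    induction C using inductionOn with
    | h k => exact ⟨k, seg_eq_iff.2 rfl⟩
  choose r hr using hrep
  refine ⟨by rw [nextLabel_castLEEmb]; exact hc.1, fun C => tabOf ℓ (U (r C)), ?_, ?_, ⟨rfl, ?_⟩,
    fun C => ⟨r C, rfl⟩, ?_⟩
  · intro C D e
    rcases (sameCycle_iff_seg h v (r C) (r D)).1 ((hsame _ (r C).2 _ (r D).2).2 e) with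
      ⟨i, j, h1, -⟩ | ⟨E, h1, h2⟩
    all_goals grind
  · intro C i e
    rw [← hc.2 i] at e
    have e' := (hsame _ (r C).2 _ (i.2.trans_le h)).2 e
    rcases (sameCycle_iff_seg h v (r C) (castLEEmb h i)).1 e' with ⟨i', j, h1, -⟩ | ⟨E, h1, h2⟩
    · grind
    · rw [seg_label] at h2; cases h2
  · intro k
    rw [tables]
    rcases e : seg (v.fin N) (castLEEmb h) k with i | C
    · rw [Sum.elim_inl, ← hc.2 i]
      refine (hsame _ k.2 _ (i.2.trans_le h)).1 ((sameCycle_iff_seg h v k (castLEEmb h i)).2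
        (Or.inl ⟨i, i, e, seg_label h v i, .refl _ _⟩))
    · exact (hsame _ k.2 _ (r C).2).1 ((sameCycle_iff_seg h v k (r C)).2 (Or.inr ⟨C, e, hr C⟩))
  · intro o' ho'
    funext C
    have := ho'.2 (r C)
    rw [tables, hr, Sum.elim_inr] at this
    grind

/-! ## The conditional law of the arcs, given the seating of the labels -/

section Unit

variable {S : Type} [Fintype S]

lemma dirichlet_eq_map {m : S → ℕ} (hm : ∃ j, 0 < m j) {s : ℝ} (hs : 0 < s) :
    dirichlet (fun i => (m i : ℝ)) s =
      (dirichlet (fun i => (m i : ℝ)) 1).map fun x i => s * x i := by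
  have hmul : Measurable fun (x : S → ℝ) i => s * x i := by fun_prop
  refine Measure.ext_of_lintegral _ fun f hf => ?_
  rw [lintegral_map hf hmul]
  have h1 := lintegral_dirichlet hm hs hf
  have h2 := lintegral_dirichlet hm one_pos (hf.comp hmul)
  simp only [comp_def] at h2
  have hc : ofReal (1 / (∑ i, m i).factorial) ≠ 0 := by
    rw [ne_eq, ofReal_eq_zero, not_le]
    positivity
  rw [← mul_right_inj hc ofReal_ne_top, ← h1]
  all_goals grind

end Unit

section Piece

variable {B S : Type} [Fintype B] [Fintype S] {N : ℕ}

omit [Fintype B] [Fintype S] in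
lemma exists_card_pos {blk : Fin N → B} (hblk : Surjective blk) (γ : Fin N → S) (t : B) :
    ∃ s, 0 < card {k // blk k = t ∧ γ k = s} := by
  obtain ⟨k, hk⟩ := hblk t
  refine ⟨γ k, card_pos_iff.2 ⟨⟨⟨k, hk, rfl⟩⟩, inferInstance⟩⟩

omit [Fintype B] in
lemma isProbabilityMeasure_dirichlet_block {blk : Fin N → B} (hblk : Surjective blk)
    (γ : Fin N → S) (t : B) {s : ℝ} (hs : 0 < s) :
    IsProbabilityMeasure (dirichlet (fun j => (card {k // blk k = t ∧ γ k = j} : ℝ)) s) := by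
  obtain ⟨k, hk⟩ := hblk t
  have : Nonempty {k // blk k = t} := ⟨⟨k, hk⟩⟩
  have : Fintype {k // blk k = t} := Fintype.ofFinite _
  have h := isProbabilityMeasure_dirichlet (fun k : {k // blk k = t} => γ k) hs
  have e : ∀ j, card {k : {k // blk k = t} // γ k = j} = card {k // blk k = t ∧ γ k = j} := fun j =>
    card_congr (subtypeSubtypeEquivSubtypeInter (fun k => blk k = t) fun k => γ k = j)
  simp only [e] at h
  exact h

/-- The law of the lengths of the arcs of the new tables, when the blocks `blk` of total lengths
`tot` are split at random. -/
def splitLaw (blk : Fin N → B) (γ : Fin N → S) (tot : B → ℝ) : Measure (S → ℝ) :=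
  (Measure.pi fun t => dirichlet (fun s => (card {k // blk k = t ∧ γ k = s} : ℝ)) 1).map
    fun x s => ∑ t, tot t * x t s

omit [Fintype S] in
lemma measurable_sum_mul (tot : B → ℝ) :
    Measurable fun (x : B → S → ℝ) s => ∑ t, tot t * x t s := by
  fun_prop

lemma convolution_eq_splitLaw {blk : Fin N → B} (hblk : Surjective blk)
    (γ : Fin N → S) {tot : B → ℝ} (ht : ∀ t, 0 < tot t) :
    (convolution fun t => dirichlet (fun s => (card {k // blk k = t ∧ γ k = s} : ℝ)) (tot t)) =
      splitLaw blk γ tot := by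
  have hm : ∀ t, Measurable fun (x : S → ℝ) i => tot t * x i := fun t => by fun_prop
  have := fun t => isProbabilityMeasure_dirichlet_block hblk γ t one_pos
  have := fun t => isProbabilityMeasure_dirichlet_block hblk γ t (ht t)
  have h1 : (Measure.pi fun t =>
      dirichlet (fun s => (card {k // blk k = t ∧ γ k = s} : ℝ)) (tot t)) =
      (Measure.pi fun t => dirichlet (fun s => (card {k // blk k = t ∧ γ k = s} : ℝ)) 1).map
        fun x t i => tot t * x t i := by
    have h2 := fun t => dirichlet_eq_map (exists_card_pos hblk γ t) (ht t)
    have : ∀ t, SigmaFinite ((dirichlet (fun s => (card {k // blk k = t ∧ γ k = s} : ℝ)) 1).map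
        fun x i => tot t * x i) := fun t => by rw [← h2]; infer_instance
    rw [Measure.pi_map_pi (f := fun t (x : S → ℝ) i => tot t * x i) fun t => (hm t).aemeasurable]
    grind
  have hsum : Measurable fun x : B → S → ℝ => ∑ r, x r := by
    fun_prop
  have hmm : Measurable fun (x : B → S → ℝ) t i => tot t * x t i :=
    measurable_pi_lambda _ fun t => (hm t).comp (measurable_pi_apply t)
  rw [convolution, h1, map_map hsum hmm, splitLaw]
  congr 1
  funext x s
  simp [Finset.sum_apply]

lemma isProbabilityMeasure_splitLaw {blk : Fin N → B} (hblk : Surjective blk)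
    (γ : Fin N → S) (tot : B → ℝ) : IsProbabilityMeasure (splitLaw blk γ tot) := by
  have := fun t => isProbabilityMeasure_dirichlet_block hblk γ t one_pos
  exact Measure.isProbabilityMeasure_map (measurable_sum_mul tot).aemeasurable

lemma measurable_lintegral_splitLaw {blk : Fin N → B} (hblk : Surjective blk)
    (γ : Fin N → S) {Ω : Type*} [MeasurableSpace Ω] {tot : Ω → B → ℝ} (ht : Measurable tot)
    {H : Ω → (S → ℝ) → ℝ≥0∞} (hH : Measurable fun q : Ω × (S → ℝ) => H q.1 q.2) :
    Measurable fun a => ∫⁻ x, H a x ∂splitLaw blk γ (tot a) := by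
  have := fun t => isProbabilityMeasure_dirichlet_block hblk γ t one_pos
  have e : ∀ a, ∫⁻ x, H a x ∂splitLaw blk γ (tot a) =
      ∫⁻ x, H a (fun s => ∑ t, tot a t * x t s) ∂(Measure.pi fun t =>
        dirichlet (fun s => (card {k // blk k = t ∧ γ k = s} : ℝ)) 1) := fun a => by
    have hHa : Measurable (H a) := hH.comp (measurable_const.prodMk measurable_id)
    rw [splitLaw, lintegral_map hHa (measurable_sum_mul _)]
  simp_rw [e]
  fun_prop

end Piece

section Filling

variable {ℓ : ℕ → ℝ} {n N : ℕ} (h : n ≤ N)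

lemma surjective_seg {r : Perm (Fin N)} {F : Fin n ↪ Fin N} : Surjective (seg r F) := by
  rintro (i | ⟨C, hC⟩)
  · exact ⟨F i, seg_eq_iff.2 ⟨0, (returnTime_spec _ _ i).1, rfl⟩⟩
  · induction C using inductionOn with
    | h k => exact ⟨k, seg_eq_iff.2 rfl⟩

/-- The density of the event that the guests arrive in the order `w`, at given tables. -/
def arrivalWeight (w : Perm (Fin N)) (F : Fin n ↪ Fin N) (l : Fin n → ℝ)
    (lo : FreeCycles w F → ℝ) : ℝ≥0∞ :=
  (∏ b, ofReal (lo b)) * ∏ t : Fin n ⊕ FreeCycles w F,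
    ofReal (Sum.elim l lo t ^ (card {k // seg w F k = t} - 1) /
      (card {k // seg w F k = t} - 1).factorial)

lemma measurable_arrivalWeight (w : Perm (Fin N)) (F : Fin n ↪ Fin N) {Ω : Type*}
    [MeasurableSpace Ω] {l : Ω → Fin n → ℝ} (hl : Measurable l) {lo : Ω → FreeCycles w F → ℝ}
    (hlo : Measurable lo) : Measurable fun a => arrivalWeight w F (l a) (lo a) := by
  refine Measurable.mul ?_ ?_
  · fun_prop
  · refine measurable_prod _ fun t _ => Measurable.ennreal_ofReal ?_
    refine Measurable.div_const (Measurable.pow_const ?_ _) _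
    rcases t with i | b
    · exact (measurable_pi_apply i).comp hl
    · exact (measurable_pi_apply b).comp hlo

lemma measurable_sumElim {α β : Type} {Ω : Type*}
    [MeasurableSpace Ω] {l : Ω → α → ℝ} (hl : Measurable l) {lo : Ω → β → ℝ}
    (hlo : Measurable lo) : Measurable fun a => (Sum.elim (l a) (lo a) : α ⊕ β → ℝ) := by
  refine measurable_pi_lambda _ fun t => ?_
  rcases t with i | b
  · exact (measurable_pi_apply i).comp hl
  · exact (measurable_pi_apply b).comp hlo

/-- The ways to seat the guests `n, …, N - 1`, given the seating of the first `n` guests. -/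
abbrev Filling (τ : Perm (Fin n)) (κ : Fin n → ℕ) : Type :=
  Σ w : {w : Perm (Fin N) // nextLabel w (castLEEmb h) = τ},
    {o : FreeCycles w.1 (castLEEmb h) ↪ ℕ // ∀ b i, o b ≠ κ i}

variable {h} in
/-- The first `N` guests are seated according to the filling. -/
def Filling.Holds {τ : Perm (Fin n)} {κ : Fin n → ℕ} (x : Filling h τ κ) (ℓ : ℕ → ℝ)
    (U : ℕ → ℝ) : Prop := Config ℓ x.1.1 (tables h x.1.1 κ x.2.1) U

lemma existsUnique_filling (hℓ : GoodSticks ℓ) {U : ℕ → ℝ} (hU : GoodPoints U)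
    {τ : Perm (Fin n)} {κ : Fin n → ℕ} (hc : Config ℓ τ κ U) :
    ∃! x : Filling h τ κ, x.Holds ℓ U := by
  obtain ⟨h1, o, h2, h3, h4, -, h5⟩ := exists_config hℓ h hU hc
  refine ⟨⟨⟨_, h1⟩, ⟨⟨o, h2⟩, h3⟩⟩, h4, ?_⟩
  rintro ⟨⟨w, hw⟩, ⟨o', ho'⟩⟩ hx
  obtain rfl : (paint (ℓ, U)).fin N = w := hx.1
  have : (o' : _ → ℕ) = o := h5 o' hx
  subst this
  rfl

lemma measurable_arcFin : Measurable fun q : (ℕ → ℝ) × (ℕ → ℝ) => arcFin q.1 N q.2 := by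
  refine measurable_pi_lambda _ fun i => ?_
  have h1 : Measurable fun q : (ℕ → ℝ) × (ℕ → ℝ) => (paint q).perm N i :=
    (measurable_perm_comp N fun g => g i).comp measurable_paint
  have h2 : Measurable fun q : ((ℕ → ℝ) × (ℕ → ℝ)) × ℕ => cdist q.1.1 (q.1.2 i) (q.1.2 q.2) :=
    measurable_from_prod_countable_left fun j => measurable_cdist_apply i j
  exact h2.comp (measurable_id.prodMk h1)

lemma measurableSet_config (w : Perm (Fin N)) (κ : Fin N → ℕ) :
    MeasurableSet {q : (ℕ → ℝ) × (ℕ → ℝ) | Config q.1 w κ q.2} := by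
  have h1 : Measurable fun q : (ℕ → ℝ) × (ℕ → ℝ) => (paint q).fin N = w := by
    have := (measurable_perm_comp N fun g => g = natPerm w).comp measurable_paint
    convert this using 2 with q
    rw [comp_apply, ← ofFin_perm w, ← fin_eq_iff, ofFin_fin]
  exact (h1.and (Measurable.forall fun i : Fin N =>
    measurable_prop_eq (measurable_tabOf_apply i) measurable_const)).setOf

lemma measurableSet_config_right (w : Perm (Fin N)) (κ : Fin N → ℕ) :
    MeasurableSet {U | Config ℓ w κ U} :=
  (measurable_const.prodMk measurable_id : Measurable fun U : ℕ → ℝ => (ℓ, U))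
    (measurableSet_config w κ)

variable {h} in
lemma lintegral_filling (hℓ : GoodSticks ℓ) {τ : Perm (Fin n)} {κ : Fin n → ℕ}
    (hκ : ∀ i j, κ i = κ j ↔ τ.SameCycle i j) (x : Filling h τ κ)
    {G : (ℕ → ℝ) → ℝ≥0∞} (hG : Measurable G)
    (hGloc : ∀ U U' : ℕ → ℝ, (∀ i < n, U i = U' i) → G U = G U')
    {S : Type} [Fintype S] (γ : Fin N → S) {H : (S → ℝ) → ℝ≥0∞} (hH : Measurable H) :
    ∫⁻ U, G U * {U | x.Holds ℓ U}.indicator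
        (fun U => H fun s => ∑ k, {k | γ k = s}.indicator (arcFin ℓ N U) k) U ∂pointsLaw =
      ∫⁻ U, G U * {U | Config ℓ τ κ U}.indicator
        (fun U => arrivalWeight x.1.1 (castLEEmb h) (arcFin ℓ n U) (fun b => ℓ (x.2.1 b)) *
          ∫⁻ y, H y ∂splitLaw (seg x.1.1 (castLEEmb h)) γ
            (Sum.elim (arcFin ℓ n U) fun b => ℓ (x.2.1 b))) U ∂pointsLaw := by
  obtain ⟨⟨w, rfl⟩, o, ho⟩ := x
  have := lintegral_config hℓ h w hκ o.injective ho hG hGloc γ hH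
  simp only [Filling.Holds]
  refine Eq.trans ?_ (this.trans (lintegral_congr_ae ?_))
  · rfl
  · filter_upwards [ae_goodPoints] with U hU
    congr 1
    by_cases hc : Config ℓ (nextLabel w (castLEEmb h)) κ U
    · rw [indicator_of_mem (show U ∈ {U | Config ℓ _ κ U} from hc),
        indicator_of_mem (show U ∈ {U | Config ℓ _ κ U} from hc), arrivalWeight, mul_assoc,
        convolution_eq_splitLaw surjective_seg]
      rintro (i | b)
      · exact arcFin_pos hℓ hU i
      · exact hℓ.1 _
    · rw [indicator_of_notMem (show U ∉ {U | Config ℓ _ κ U} from hc),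
        indicator_of_notMem (show U ∉ {U | Config ℓ _ κ U} from hc)]

/-- The law of the seating of `N` guests is a mixture over the fillings. -/
lemma lintegral_eq_tsum_filling (hℓ : GoodSticks ℓ) {τ : Perm (Fin n)} {κ : Fin n → ℕ}
    (hκ : ∀ i j, κ i = κ j ↔ τ.SameCycle i j)
    {G : (ℕ → ℝ) → ℝ≥0∞} (hG : Measurable G)
    (hGloc : ∀ U U' : ℕ → ℝ, (∀ i < n, U i = U' i) → G U = G U')
    {S : Filling h τ κ → Type} [∀ x, Fintype (S x)] (γ : ∀ x, Fin N → S x)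
    {H : ∀ x, (S x → ℝ) → ℝ≥0∞} (hH : ∀ x, Measurable (H x)) {f : (ℕ → ℝ) → ℝ≥0∞}
    (hf : ∀ x : Filling h τ κ, ∀ U, GoodPoints U → x.Holds ℓ U →
      f U = H x fun s => ∑ k, {k | γ x k = s}.indicator (arcFin ℓ N U) k) :
    ∫⁻ U, G U * {U | Config ℓ τ κ U}.indicator f U ∂pointsLaw =
      ∫⁻ U, G U * {U | Config ℓ τ κ U}.indicator (fun U => ∑' x : Filling h τ κ,
          arrivalWeight x.1.1 (castLEEmb h) (arcFin ℓ n U) (fun b => ℓ (x.2.1 b)) *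
          ∫⁻ y, H x y ∂splitLaw (seg x.1.1 (castLEEmb h)) (γ x)
            (Sum.elim (arcFin ℓ n U) fun b => ℓ (x.2.1 b))) U ∂pointsLaw := by
  have harc : ∀ M, Measurable fun U => arcFin ℓ M U := fun M =>
    measurable_arcFin.comp (measurable_const.prodMk measurable_id : Measurable fun U : ℕ → ℝ => (ℓ, U))
  have h1 : ∀ᵐ U ∂pointsLaw, G U * {U | Config ℓ τ κ U}.indicator f U =
      ∑' x : Filling h τ κ, G U * {U | x.Holds ℓ U}.indicator
        (fun U => H x fun s => ∑ k, {k | γ x k = s}.indicator (arcFin ℓ N U) k) U := by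
    filter_upwards [ae_goodPoints] with U hU
    rw [ENNReal.tsum_mul_left]
    congr 1
    by_cases hc : Config ℓ τ κ U
    · rw [indicator_of_mem (show U ∈ {U | Config ℓ τ κ U} from hc)]
      obtain ⟨x, hx, hx'⟩ := existsUnique_filling h hℓ hU hc
      rw [tsum_eq_single x, indicator_of_mem (show U ∈ {U | x.Holds ℓ U} from hx)]
      · grind
      · intro y hy
        exact indicator_of_notMem (s := {U | y.Holds ℓ U}) (fun e => hy (hx' y e)) _
    · rw [indicator_of_notMem (show U ∉ {U | Config ℓ τ κ U} from hc)]
      symm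
      rw [ENNReal.tsum_eq_zero]
      intro x
      refine indicator_of_notMem (s := {U | x.Holds ℓ U}) (fun e : x.Holds ℓ U => hc ?_) _
      obtain ⟨⟨w, rfl⟩, o, ho⟩ := x
      obtain ⟨rfl, h2⟩ := e
      refine ⟨(nextLabel_castLEEmb h _).symm, fun i => ?_⟩
      have := h2 (castLEEmb h i)
      rwa [tables, seg_label] at this
  rw [lintegral_congr_ae h1, lintegral_tsum]
  · simp_rw [lintegral_filling hℓ hκ _ hG hGloc (γ _) (hH _)]
    rw [← lintegral_tsum]
    · refine lintegral_congr fun U => ?_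
      rw [ENNReal.tsum_mul_left]
      congr 1
      by_cases hc : Config ℓ τ κ U
      · simp [indicator_of_mem (show U ∈ {U | Config ℓ τ κ U} from hc)]
      · simp [indicator_of_notMem (show U ∉ {U | Config ℓ τ κ U} from hc)]
    · intro x
      refine (hG.mul (Measurable.indicator ?_ (measurableSet_config_right τ κ))).aemeasurable
      refine (measurable_arrivalWeight _ _ (harc n) measurable_const).mul
        (measurable_lintegral_splitLaw surjective_seg (γ x)
          (measurable_sumElim (harc n) measurable_const) ?_)
      fun_prop
  · intro x
    refine (hG.mul (Measurable.indicator ((hH x).comp ?_)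
      (measurableSet_config_right _ _))).aemeasurable
    refine measurable_pi_lambda _ fun s => measurable_sum _ fun k _ => ?_
    by_cases hk : γ x k = s
    · simp only [indicator_of_mem (show k ∈ {k | γ x k = s} from hk)]
      fun_prop
    · simp [indicator_of_notMem (show k ∉ {k | γ x k = s} from hk)]

end Filling

/-! ## The law of the painted permutations -/

variable {N : ℕ}

instance (w : Perm (Fin N)) : Fintype (Cycles w) := Fintype.ofFinite _

lemma sameCycle_natPerm (w : Perm (Fin N)) (x y : Fin N) :
    (natPerm w).SameCycle x y ↔ w.SameCycle x y := by
  rw [← ofFin_perm, ← sameCycle_fin_iff, ofFin_fin]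

lemma lt_of_sameCycle_natPerm (w : Perm (Fin N)) {i j : ℕ} (hi : i < N)
    (h : (natPerm w).SameCycle i j) : j < N := by
  by_contra hc
  have hj : IsFixedPt (natPerm w) j := natPerm_fixes w j (by omega)
  obtain ⟨k, hk⟩ := h.symm
  have := hj.perm_zpow k
  rw [IsFixedPt, hk] at this
  omega

lemma cycleCount_natPerm (w : Perm (Fin N)) : cycleCount N (natPerm w) = card (Cycles w) := by
  rw [cycleCount, ← Nat.card_coe_set_eq]
  refine Nat.card_eq_of_bijective (fun i => Quotient.mk _ ⟨i.1, i.2.1⟩) ⟨?_, ?_⟩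
  · rintro ⟨i, hi, hi'⟩ ⟨j, hj, hj'⟩ e
    have e1 : w.SameCycle ⟨i, hi⟩ ⟨j, hj⟩ := Quotient.exact (s := Perm.SameCycle.setoid w) e
    have e2 := (sameCycle_natPerm w _ _).2 e1
    exact Subtype.ext (le_antisymm (hi' j e2) (hj' i e2.symm))
  · intro C
    induction C using inductionOn with
    | h k =>
      classical
      have hex : ∃ i, (natPerm w).SameCycle k i := ⟨k, .refl _ _⟩
      have h1 := find_spec hex
      have hlt := lt_of_sameCycle_natPerm w k.2 h1
      refine ⟨⟨find hex, hlt, fun j hj => Nat.find_min' hex (h1.trans hj)⟩, ?_⟩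
      exact mk_eq_mk_iff.2 ((sameCycle_natPerm w ⟨_, hlt⟩ k).1 h1.symm)

lemma isPiSystem_cylinders : IsPiSystem {s | ∃ n g, s = {u : VirtualPerm | u.perm n = g}} := by
  have key : ∀ n m : ℕ, n ≤ m → ∀ g g', ({u : VirtualPerm | u.perm n = g} ∩ {u | u.perm m = g'}).Nonempty →
      {u : VirtualPerm | u.perm n = g} ∩ {u | u.perm m = g'} = {u | u.perm m = g'} := by
    intro n m hnm g g' ⟨u, hu1, hu2⟩
    refine Set.inter_eq_right.2 fun v hv => ?_
    have hu1' : u.perm n = g := hu1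
    have hu2' : u.perm m = g' := hu2
    have hv' : v.perm m = g' := hv
    show v.perm n = g
    rw [← hu1', ← reduce_perm v (k := m) hnm (by omega), ← reduce_perm u (k := m) hnm (by omega),
      hu2', hv']
  rintro _ ⟨n, g, rfl⟩ _ ⟨m, g', rfl⟩ hne
  rcases le_total n m with h | h
  · exact ⟨m, g', key n m h g g' hne⟩
  · rw [Set.inter_comm] at hne ⊢
    exact ⟨n, g, key m n h g' g hne⟩

lemma rising_eq_prod (z : ℝ) (N : ℕ) : rising z N = ∏ i ∈ range N, (z + i) := rfl

lemma lintegral_paint_eq {ℓ : ℕ → ℝ} (hℓ : GoodSticks ℓ) (w : Perm (Fin N)) :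
    pointsLaw {U | (paint (ℓ, U)).fin N = w} = ofReal (∏ C : Cycles w,
        (1 / ((card {k // Quotient.mk _ k = C} - 1).factorial : ℝ))) *
      powerSum (Cycles w) (fun C => card {k // Quotient.mk _ k = C}) ℓ := by
  classical
  set F := castLEEmb (Nat.zero_le N)
  have hms : MeasurableSet {U | (paint (ℓ, U)).fin N = w} := by
    have h1 : Measurable fun q : (ℕ → ℝ) × (ℕ → ℝ) => (paint q).fin N = w := by
      have := (measurable_perm_comp N fun g => g = natPerm w).comp measurable_paint
      convert this using 2 with q
      rw [comp_apply, ← ofFin_perm w, ← fin_eq_iff, ofFin_fin]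
    exact (measurable_const.prodMk measurable_id : Measurable fun U : ℕ → ℝ => (ℓ, U)) h1.setOf
  have hτ : ∀ τ : Perm (Fin 0), ∀ U, Config ℓ τ (fun i => i.elim0) U := fun τ U =>
    ⟨Subsingleton.elim _ _, fun i => i.elim0⟩
  have main := lintegral_eq_tsum_filling (ℓ := ℓ) (n := 0) (N := N) (Nat.zero_le N) hℓ (τ := 1)
    (κ := fun i => i.elim0) (fun i => i.elim0) (G := fun _ => 1) measurable_const
    (fun _ _ _ => rfl) (S := fun _ => Unit) (fun _ _ => ())
    (H := fun x _ => if x.1.1 = w then 1 else 0) (fun x => measurable_const)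
    (f := {U | (paint (ℓ, U)).fin N = w}.indicator fun _ => 1) (by
      intro x U _ hx
      have e : (paint (ℓ, U)).fin N = x.1.1 := hx.1
      simp [indicator_apply, e])
  have hu : {U | Config ℓ (1 : Perm (Fin 0)) (fun i => i.elim0) U} = Set.univ :=
    Set.eq_univ_of_forall fun U => hτ 1 U
  simp only [hu, Set.indicator_univ, one_mul] at main
  rw [lintegral_indicator_const hms, one_mul] at main
  rw [main]
  have hprob : ∀ (x : Filling (N := N) (Nat.zero_le N) 1 fun i => i.elim0) (tot), IsProbabilityMeasure
      (splitLaw (seg x.1.1 F) (fun _ : Fin N => ()) tot) := fun x tot =>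
    isProbabilityMeasure_splitLaw surjective_seg _ _
  simp only [lintegral_const, measure_univ, mul_one]
  let e : FreeCycles w F ≃ Cycles w := subtypeUnivEquiv fun C i => i.elim0
  let x0 : (Cycles w ↪ ℕ) → Filling (N := N) (Nat.zero_le N) 1 fun i => i.elim0 := fun o =>
    ⟨⟨w, Subsingleton.elim _ _⟩, ⟨e.toEmbedding.trans o, fun b i => i.elim0⟩⟩
  have hx0 : Injective x0 := by
    intro o o' h
    have h2 := eq_of_heq (Sigma.mk.inj h).2
    ext C
    have h3 := DFunLike.congr_fun (congrArg Subtype.val h2) (e.symm C)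
    simpa using h3
  have hpt : ∀ U, ∑' x : Filling (N := N) (Nat.zero_le N) 1 fun i => i.elim0,
      arrivalWeight x.1.1 F (arcFin ℓ 0 U) (fun b => ℓ (x.2.1 b)) * (if x.1.1 = w then 1 else 0) =
      ofReal (∏ C : Cycles w, (1 / ((card {k // Quotient.mk _ k = C} - 1).factorial : ℝ))) *
      powerSum (Cycles w) (fun C => card {k // Quotient.mk _ k = C}) ℓ := by
    intro U
    rw [powerSum, ← ENNReal.tsum_mul_left, ← hx0.tsum_eq]
    · refine tsum_congr fun o => ?_
      have hpos : ∀ C : Cycles w, 0 < card {k // Quotient.mk _ k = C} := fun C => by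
        induction C using inductionOn with
        | h k => exact card_pos_iff.2 ⟨⟨⟨k, rfl⟩⟩, inferInstance⟩
      rw [if_pos rfl, mul_one, arrivalWeight, Fintype.prod_sum_type]
      have h0 : ∀ f : Fin 0 → ℝ≥0∞, ∏ i, f i = 1 := fun f => Fintype.prod_empty f
      have hseg : ∀ b : FreeCycles w F, card {k // seg w F k = .inr b} =
          card {k // Quotient.mk _ k = e b} := fun b =>
        card_congr (subtypeEquivRight fun k => seg_eq_iff)
      have h1 : ∏ b : FreeCycles w F, ofReal (ℓ ((x0 o).2.1 b)) =
          ∏ C, ofReal (ℓ (o C)) := Fintype.prod_equiv e _ _ fun b => rfl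
      have h2 : ∏ b : FreeCycles w F, ofReal
          (Sum.elim (arcFin ℓ 0 U) (fun b => ℓ ((x0 o).2.1 b)) (.inr b) ^
            (card {k // seg w F k = .inr b} - 1) /
            (card {k // seg w F k = .inr b} - 1).factorial) =
          ∏ C : Cycles w, ofReal (ℓ (o C) ^ (card {k // Quotient.mk _ k = C} - 1) /
            (card {k // Quotient.mk _ k = C} - 1).factorial) :=
        Fintype.prod_equiv e _ _ fun b => by rw [hseg]; rfl
      refine (congrArg₂ (· * ·) h1 (congrArg₂ (· * ·) (h0 _) h2)).trans ?_
      rw [one_mul]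
      rw [← prod_mul_distrib, ofReal_prod_of_nonneg fun C _ => by positivity,
        ← prod_mul_distrib]
      refine prod_congr rfl fun C _ => ?_
      have hl := (hℓ.1 (o C)).le
      rw [← ofReal_pow hl, ← ofReal_mul hl, ← ofReal_mul (by positivity)]
      congr 1
      obtain ⟨m, hm⟩ := Nat.exists_eq_add_of_lt (hpos C)
      grind
    · rintro ⟨⟨w', hw'⟩, o, ho⟩ hx
      simp only [mem_support, ne_eq, mul_eq_zero, not_or, ite_eq_right_iff,
        one_ne_zero, imp_false, not_not] at hx
      obtain rfl := hx.2
      refine ⟨e.symm.toEmbedding.trans o, ?_⟩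
      have : e.toEmbedding.trans (e.symm.toEmbedding.trans o) = o := by ext; simp
      simp only [x0, this]
  rw [lintegral_congr hpt]
  simp

lemma map_paint (z : ℝ) (hz : 0 < z) :
    ((stickLaw z).prod pointsLaw).map paint = virtualMeasure z hz := by
  have := Measure.isProbabilityMeasure_map (μ := (stickLaw z).prod pointsLaw)
    measurable_paint.aemeasurable
  refine ext_of_generate_finite _ rfl isPiSystem_cylinders ?_ (by simp)
  rintro _ ⟨N, g, rfl⟩
  have hmeas := measurableSet_perm_eq N g
  by_cases hg : ∀ i, N ≤ i → g i = i
  · obtain ⟨w, rfl⟩ : ∃ w : Perm (Fin N), natPerm w = g := ⟨toFinPerm N g hg, natPerm_toFinPerm g hg⟩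
    rw [virtualMeasure_apply z hz N _ hg, Measure.map_apply measurable_paint hmeas,
      Measure.prod_apply (measurable_paint hmeas)]
    have h1 : ∀ᵐ ℓ ∂stickLaw z, pointsLaw (Prod.mk ℓ ⁻¹' (paint ⁻¹' {u | u.perm N = natPerm w})) =
        ofReal (∏ C : Cycles w, (1 / ((card {k // Quotient.mk _ k = C} - 1).factorial : ℝ))) *
        powerSum (Cycles w) (fun C => card {k // Quotient.mk _ k = C}) ℓ := by
      filter_upwards [ae_stickLaw hz] with ℓ hℓ
      rw [← lintegral_paint_eq hℓ w]
      congr 1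
      ext U
      show (paint (ℓ, U)).perm N = natPerm w ↔ (paint (ℓ, U)).fin N = w
      rw [← ofFin_perm w, ← fin_eq_iff, ofFin_fin]
    have hsum : ∑ C : Cycles w, card {k // Quotient.mk _ k = C} = N := by
      have := sum_card_fiber (S := Cycles w) fun k : Fin N => Quotient.mk _ k
      rwa [Fintype.card_fin] at this
    have hpos : ∀ C : Cycles w, 1 ≤ card {k // Quotient.mk _ k = C} := fun C => by
      induction C using inductionOn with
      | h k => exact card_pos_iff.2 ⟨⟨⟨k, rfl⟩⟩, inferInstance⟩
    rw [lintegral_congr_ae h1, lintegral_const_mul _ (measurable_powerSum _ _),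
      lintegral_powerSum_stickLaw hz _ _ hpos, ← ofReal_mul (by positivity),
      cycleCount_natPerm, hsum, rising_eq_prod, card_eq_fintype_card]
    congr 1
    have : ∏ C : Cycles w, (((card {k // Quotient.mk _ k = C} - 1).factorial : ℕ) : ℝ) ≠ 0 :=
      Finset.prod_ne_zero_iff.2 fun C _ => by positivity
    rw [Finset.prod_div_distrib, Finset.prod_const_one]
    field_simp
  · have : {u : VirtualPerm | u.perm N = g} = ∅ := by
      ext u
      simp only [mem_ofPred_eq, Set.mem_empty_iff_false, iff_false]
      rintro rfl
      exact hg (u.fixes N)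
    rw [this]
    simp

/-! ## Right multiplication by a finite permutation -/

section Mul

variable {u v : VirtualPerm} {s : Perm ℕ} {N : ℕ}

lemma lt_iff_of_fixes (hs : ∀ i, N ≤ i → s i = i) (i : ℕ) : s i < N ↔ i < N := by
  constructor
  · intro h
    grind
  · intro h
    by_contra hc
    have := s.injective (hs (s i) (by omega))
    omega

lemma gap_mul (hs : ∀ i, N ≤ i → s i = i) (hv : ∀ M, N ≤ M → v.perm M = u.perm M * s) {M i : ℕ}
    (hM : N ≤ M) (hi : i < N) : gap v N M i = gap u N M (s i) := by
  have hsi : s i < N := (lt_iff_of_fixes hs i).2 hi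
  obtain ⟨h1, h2, h3⟩ := firstReturn_perm u hM (s i) hsi
  have key : ∀ q ≤ gap u N M (s i), (v.perm M ^ (q + 1)) i = (u.perm M ^ (q + 1)) (s i) := by
    intro q hq
    induction q with
    | zero => simp [hv M hM]
    | succ q ih =>
      rw [pow_succ', Perm.mul_apply, ih (by omega), hv M hM, Perm.mul_apply,
        hs _ (h1 q (by omega)), ← Perm.mul_apply, ← pow_succ']
  have : FirstReturn N (v.perm M) i (gap u N M (s i)) (u.perm N (s i)) :=
    ⟨fun q hq => by rw [key q hq.le]; exact h1 q hq, by rw [key _ le_rfl]; exact h2, h3⟩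
  exact this.sInf_eq

lemma perm_succ_self_mul (hs : ∀ i, N ≤ i → s i = i)
    (hv : ∀ M, N ≤ M → v.perm M = u.perm M * s) {m : ℕ} (hm : N ≤ m) :
    v.perm (m + 1) m = m ↔ u.perm (m + 1) m = m := by
  rw [hv (m + 1) (by omega), Perm.mul_apply, hs m hm]

lemma tableLength_mul (hs : ∀ i, N ≤ i → s i = i) (hv : ∀ M, N ≤ M → v.perm M = u.perm M * s)
    {m : ℕ} (hm : N ≤ m) (ho : u.perm (m + 1) m = m) : tableLength v m = tableLength u m := by
  refine tableLength_congr ((eventually_ge_atTop (m + 1)).mono fun M hM => ?_)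
  have hmin := (opener_iff u (show m < M by omega)).1 ho
  have key : ∀ q : ℕ, (v.perm M ^ q) m = (u.perm M ^ q) m := by
    intro q
    induction q with
    | zero => rfl
    | succ q ih =>
      have : m ≤ (u.perm M ^ q) m := hmin _ ⟨q, by simp⟩
      rw [pow_succ', Perm.mul_apply, ih, hv M (by omega), Perm.mul_apply,
        hs _ (hm.trans this), ← Perm.mul_apply, ← pow_succ']
  refine minimalPeriod_eq_minimalPeriod_iff.2 fun q => ?_
  simp only [IsPeriodicPt, IsFixedPt, Perm.iterate_eq_pow, key]

end Mul

section Paint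

variable {ℓ U : ℕ → ℝ} {n N : ℕ}

lemma exists_tabOf_eq (hℓ : GoodSticks ℓ) (hE : EquiPoints U) (ν : ℕ) : ∃ k, tabOf ℓ (U k) = ν := by
  by_contra hc
  push Not at hc
  have h1 := (hE (cum ℓ ν) ⟨hℓ.cum_nonneg _, hℓ.cum_le_one _⟩).1
  have h2 := (hE (cum ℓ (ν + 1)) ⟨hℓ.cum_nonneg _, hℓ.cum_le_one _⟩).1
  have h3 : ∀ k, U k < cum ℓ ν ↔ U k < cum ℓ (ν + 1) := by
    intro k
    constructor
    · intro h; exact h.trans_le (hℓ.cum_mono (Nat.le_succ ν))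
    · intro h
      by_contra h'
      exact hc k (tabOf_eq hℓ (not_lt.1 h') h)
  simp only [← h3] at h2
  have := tendsto_nhds_unique h1 h2
  rw [cum_succ] at this
  linarith [hℓ.1 ν]

open Classical in
/-- The half-occupied restaurant obtained from the configuration of `N` guests after right
multiplication by `s`. -/
def coarsen (h : n ≤ N) (s w : Perm (Fin N)) (ℓ : ℕ → ℝ) (κ : Fin N → ℕ)
    (L : Fin N → ℝ) : HalfRestaurant n :=
  ofData (ι := FreeCycles (w * s) (castLEEmb h) ⊕ {ν // ∀ i, κ i ≠ ν})
    (nextLabel (w * s) (castLEEmb h))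
    (fun j => ∑ k with seg (w * s) (castLEEmb h) k = .inl j, L (s k))
    (Sum.elim (fun C => ∑ k with seg (w * s) (castLEEmb h) k = .inr C, L (s k)) fun ν => ℓ ν)

lemma forget_eq_coarsen (hℓ : GoodSticks ℓ) (hU : GoodPoints U) (hE : EquiPoints U)
    (h : n ≤ N) (s : Perm (Fin N)) {v : VirtualPerm}
    (hv : ∀ M, N ≤ M → v.perm M = (paint (ℓ, U)).perm M * natPerm s) :
    forget n v = coarsen h s ((paint (ℓ, U)).fin N) ℓ (fun i => tabOf ℓ (U i)) (arcFin ℓ N U) := by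
  classical
  have hfix := natPerm_fixes s
  have hE' := hE.seating hℓ hU
  have hp := paint_eq hℓ hU
  have hvN : v.fin N = (paint (ℓ, U)).fin N * s := by
    ext i
    rw [VirtualPerm.fin, toFinPerm_apply, hv N le_rfl, Perm.mul_apply, Perm.mul_apply,
      natPerm_apply, VirtualPerm.fin, toFinPerm_apply]
  have hL : ∀ i < N, Tendsto (fun M : ℕ => (gap v N M i : ℝ) / M) atTop
      (𝓝 ((seating hℓ hU).arc N (natPerm s i))) := by
    intro i hi
    refine (hE'.tendsto_gap ((lt_iff_of_fixes hfix i).2 hi)).congr'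
      ((eventually_ge_atTop N).mono fun M hM => ?_)
    simp only [gap_mul hfix hv hM hi, hp]
  have ht : ∀ m, N ≤ m → v.perm (m + 1) m = m → tableLength v m = ℓ (tabOf ℓ (U m)) := by
    intro m hm ho
    rw [perm_succ_self_mul hfix hv hm] at ho
    rw [tableLength_mul hfix hv hm ho, ← seating_D_self hℓ hU, ← hE'.tableLength (by rwa [← hp]), hp]
  rw [forget_eq h v hL ht, hvN, coarsen]
  have harc : ∀ k : Fin N, (seating hℓ hU).arc N (natPerm s k) = arcFin ℓ N U (s k) := fun k => by
    rw [natPerm_apply, arcFin, hp]; rfl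
  simp_rw [harc]
  have hop : ∀ m, N ≤ m → (v.perm (m + 1) m = m ↔ ∀ i < m, tabOf ℓ (U i) ≠ tabOf ℓ (U m)) := by
    intro m hm
    rw [perm_succ_self_mul hfix hv hm, hp]
    exact (seating hℓ hU).virt_succ_self_iff m
  let f : {m : ℕ // N ≤ m ∧ v.perm (m + 1) m = m} → {ν // ∀ i : Fin N, tabOf ℓ (U i) ≠ ν} :=
    fun m => ⟨tabOf ℓ (U m), fun i => (hop m m.2.1).1 m.2.2 i (i.2.trans_le m.2.1)⟩
  have hf : Bijective f := by
    constructor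
    · intro m m' e
      all_goals grind
    · rintro ⟨ν, hν⟩
      have hex := exists_tabOf_eq hℓ hE ν
      have h1 := find_spec hex
      have hN : N ≤ find hex := by
        by_contra hc
        exact hν ⟨_, not_le.1 hc⟩ h1
      refine ⟨⟨find hex, hN, (hop _ hN).2 fun i hi e => ?_⟩, Subtype.ext h1⟩
      exact Nat.find_min hex hi (e.trans h1)
  have := HalfRestaurant.ofData_comp_equiv
    (sumCongr (Equiv.refl (FreeCycles ((paint (ℓ, U)).fin N * s) (castLEEmb h)))
      (ofBijective f hf)) (nextLabel ((paint (ℓ, U)).fin N * s) (castLEEmb h))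
    (fun j => ∑ k with seg ((paint (ℓ, U)).fin N * s) (castLEEmb h) k = .inl j, arcFin ℓ N U (s k))
    (Sum.elim (fun C => ∑ k with seg ((paint (ℓ, U)).fin N * s) (castLEEmb h) k = .inr C,
      arcFin ℓ N U (s k)) fun ν => ℓ ν)
  rw [← this]
  congr 1
  grind

lemma forget_paint (hℓ : GoodSticks ℓ) (hU : GoodPoints U) (hE : EquiPoints U) (n : ℕ) :
    forget n (paint (ℓ, U)) = ofData (ι := {ν // ∀ i : Fin n, tabOf ℓ (U i) ≠ ν})
      ((paint (ℓ, U)).fin n) (arcFin ℓ n U) (fun ν => ℓ ν) := by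
  have hE' := hE.seating hℓ hU
  have hp := paint_eq hℓ hU
  have h1 : natPerm (1 : Perm (Fin n)) = 1 := Perm.extendDomain_one _
  rw [forget_eq_coarsen hℓ hU hE le_rfl 1 (v := paint (ℓ, U)) fun M _ => by rw [h1, mul_one],
    coarsen, mul_one]
  have hc : castLEEmb (le_refl n) = Embedding.refl _ := by ext; rfl
  rw [hc]
  set w := (paint (ℓ, U)).fin n
  have hret : ∀ i, returnTime w (.refl _) i = 1 := fun i =>
    returnTime_eq one_pos ⟨_, rfl⟩ fun m h0 h1 => by omega
  have hnext : nextLabel w (.refl _) = w := by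
    ext i
    have := nextLabel_spec w (.refl _) i
    rw [hret, pow_one] at this
    exact congrArg val this
  have hseg : ∀ k : Fin n, seg w (.refl _) k = .inl k := fun k =>
    seg_eq_iff.2 ⟨0, by rw [hret]; exact one_pos, rfl⟩
  have hemp : IsEmpty (FreeCycles w (.refl _)) := ⟨fun ⟨C, hC⟩ => by
    induction C using inductionOn with
    | h k => exact hC k rfl⟩
  rw [hnext]
  have := HalfRestaurant.ofData_comp_equiv (emptySum (FreeCycles w (.refl _)) _).symm w
    (arcFin ℓ n U) (Sum.elim (fun C => ∑ k with seg w (.refl _) k = .inr C,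
      arcFin ℓ n U ((1 : Perm (Fin n)) k)) fun ν : {ν // ∀ i : Fin n, tabOf ℓ (U i) ≠ ν} => ℓ ν)
  refine Eq.trans ?_ this.symm
  congr 1
  · funext j
    simp [hseg, Finset.filter_eq']
  all_goals grind

end Paint

/-! ## Measurability of the half-occupied restaurant -/

lemma measurable_fin (n : ℕ) : Measurable fun u : VirtualPerm => u.fin n := by
  intro S _
  have : (fun u : VirtualPerm => u.fin n) ⁻¹' S = {u | u.perm n ∈ natPerm '' S} := by
    ext u
    simp only [mem_preimage, mem_ofPred_eq, Set.mem_image]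
    constructor
    · intro h
      exact ⟨_, h, natPerm_toFinPerm _ _⟩
    · rintro ⟨w, hw, e⟩
      rwa [VirtualPerm.fin, show toFinPerm n (u.perm n) (u.fixes n) = w from by
        rw [← toFinPerm_natPerm w (natPerm_fixes w)]; congr 1; exact e.symm]
  rw [this]
  exact measurableSet_perm n _

lemma measurable_sum_dirac {Ω ι : Type*} [MeasurableSpace Ω] [Countable ι] {p : Ω → ι → Prop}
    (hp : ∀ i, MeasurableSet {a | p a i}) {f : Ω → ι → ℝ} (hf : ∀ i, Measurable fun a => f a i) :
    Measurable fun a => Measure.sum fun i : {i // p a i} => dirac (f a i) := by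
  refine Measure.measurable_of_measurable_coe _ fun B hB => ?_
  have e : ∀ a, (Measure.sum fun i : {i // p a i} => dirac (f a i)) B =
      ∑' i, {a | p a i}.indicator (fun a => B.indicator 1 (f a i)) a := fun a => by
    rw [Measure.sum_apply _ hB]
    simp_rw [dirac_apply' _ hB]
    exact tsum_subtype {i | p a i} fun i => B.indicator (1 : ℝ → ℝ≥0∞) (f a i)
  simp_rw [e]
  exact Measurable.tsum fun i => ((measurable_one.indicator hB).comp (hf i)).indicator (hp i)

lemma measurable_forget (n : ℕ) : Measurable (forget n) := by
  have hlim : ∀ {f : ℕ → VirtualPerm → ℝ}, (∀ M, Measurable (f M)) →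
      Measurable fun u => limUnder atTop fun M => f M u := fun hf =>
    (StronglyMeasurable.limUnder fun M => (hf M).stronglyMeasurable).measurable
  refine (measurable_fin n).prodMk (Measurable.prodMk ?_ ?_)
  · refine measurable_pi_lambda _ fun i => hlim fun M => ?_
    exact measurable_perm_comp M fun w => ((sInf {p | (w ^ (p + 1)) (i : ℕ) < n} : ℕ) : ℝ) / M
  · refine measurable_sum_dirac (fun m => ?_) fun m => hlim fun M => ?_
    · by_cases h : n ≤ m
      · simp only [h, true_and]
        exact measurableSet_perm (m + 1) {w | w m = m}
      · simp [h]
    · exact measurable_perm_comp M fun w => (minimalPeriod w m : ℝ) / M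

/-! ## The transformations of the space of virtual permutations -/

variable (z : ℝ) (hz : 0 < z)

lemma measurable_relabel (a : Perm ℕ) : Measurable fun q : (ℕ → ℝ) × (ℕ → ℝ) => (q.1, q.2 ∘ a) :=
  measurable_fst.prodMk (measurable_pi_lambda _ fun i =>
    (measurable_pi_apply (a i)).comp measurable_snd)

lemma map_relabel (a : Perm ℕ) :
    ((stickLaw z).prod pointsLaw).map (fun q => (q.1, q.2 ∘ a)) = (stickLaw z).prod pointsLaw := by
  have hm : Measurable fun U : ℕ → ℝ => U ∘ a :=
    measurable_pi_lambda _ fun i => measurable_pi_apply (a i)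
  have := Measure.map_prod_map (stickLaw z) pointsLaw measurable_id hm
  rw [Measure.map_id, show pointsLaw.map (fun U => U ∘ a) = pointsLaw from
    pointsLaw_map_perm a] at this
  exact this.symm

lemma act_diag_paint {ℓ U : ℕ → ℝ} (hℓ : GoodSticks ℓ) (hU : GoodPoints U) (a : Perm ℕ) :
    act (Seating.diag a) (paint (ℓ, U)) = paint (ℓ, U ∘ a) := by
  rw [paint_eq hℓ hU, paint_eq hℓ (hU.comp a), Seating.act_diag_virt, seating_comap]

lemma ae_good (z : ℝ) (hz : 0 < z) : ∀ᵐ q ∂(stickLaw z).prod pointsLaw,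
    GoodSticks q.1 ∧ GoodPoints q.2 ∧ EquiPoints q.2 :=
  (Measure.quasiMeasurePreserving_fst.ae (ae_stickLaw hz)).and
    ((Measure.quasiMeasurePreserving_snd.ae ae_goodPoints).and
      (Measure.quasiMeasurePreserving_snd.ae ae_equiPoints))

lemma map_act_diag (a : Perm ℕ) :
    (virtualMeasure z hz).map (act (Seating.diag a)) = virtualMeasure z hz := by
  have h3 : (((stickLaw z).prod pointsLaw).map (fun q => (q.1, q.2 ∘ a))).map paint =
      virtualMeasure z hz := by
    rw [map_relabel, map_paint z hz]
  rw [map_map measurable_paint (measurable_relabel a)] at h3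
  nth_rw 1 [← map_paint z hz]
  rw [map_map (measurable_act _) measurable_paint, ← h3]
  refine Measure.map_congr ?_
  filter_upwards [ae_good z hz] with q hq
  exact act_diag_paint hq.1 hq.2.1 a

section Right

variable {N : ℕ} (s : Perm (Fin N))

/-- Right multiplication by a finite permutation. -/
def rightMul : bisymmetricGroup := ⟨(1, natPerm s), by
  show {i | (1 * (natPerm s)⁻¹) i ≠ i}.Finite
  refine (Set.finite_lt_nat N).subset fun i hi => ?_
  by_contra hc
  refine hi ?_
  rw [one_mul, Perm.inv_eq_iff_eq, natPerm_fixes s i (not_lt.1 hc)]⟩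

lemma act_rightMul_perm (u : VirtualPerm) {M : ℕ} (hM : N ≤ M) :
    (act (rightMul s) u).perm M = u.perm M * natPerm s := by
  rw [act_perm_of_fixes (K := N) (fun _ _ => rfl) (natPerm_fixes s) u hM]
  simp [rightMul]

lemma act_rightMul_fin (u : VirtualPerm) : (act (rightMul s) u).fin N = u.fin N * s := by
  have := act_rightMul_perm s u le_rfl
  ext i
  rw [VirtualPerm.fin, toFinPerm_apply, this, Perm.mul_apply, Perm.mul_apply,
    natPerm_apply, VirtualPerm.fin, toFinPerm_apply]

lemma act_rightMul_inv (u v : VirtualPerm) : act (rightMul s)⁻¹ u = v ↔ u = act (rightMul s) v := by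
  constructor
  · rintro rfl
    rw [← act_mul, inv_mul_cancel, act_one]
  · rintro rfl
    rw [← act_mul, mul_inv_cancel, act_one]

/-- The Radon–Nikodym derivative of the right multiplication. -/
def cycleRatio (z : ℝ) (w s : Perm (Fin N)) : ℝ :=
  z ^ ((card (Cycles (w * s)) : ℤ) - card (Cycles w))

lemma cycleRatio_nonneg {z : ℝ} (hz : 0 < z) {N : ℕ} (w s : Perm (Fin N)) :
    0 ≤ cycleRatio z w s := zpow_nonneg hz.le _

lemma cycleCount_fin (u : VirtualPerm) : cycleCount N (u.perm N) = card (Cycles (u.fin N)) := by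
  rw [← cycleCount_natPerm, VirtualPerm.fin, natPerm_toFinPerm]

lemma pow_cycleCount_mul (z : ℝ) (hz : 0 < z) {N : ℕ} (s : Perm (Fin N)) (u : VirtualPerm) {M : ℕ} (hM : N ≤ M) :
    z ^ cycleCount M ((act (rightMul s) u).perm M) =
      cycleRatio z (u.fin N) s * z ^ cycleCount M (u.perm M) := by
  induction M, hM using Nat.le_induction with
  | base =>
    rw [cycleCount_fin, cycleCount_fin, act_rightMul_fin, cycleRatio, ← zpow_natCast,
      ← zpow_natCast, ← zpow_add₀ hz.ne']
    congr 1
    ring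
  | succ M hM ih =>
    rw [cycleCount_succ (VirtualPerm.fixes _ _), cycleCount_succ (VirtualPerm.fixes _ _),
      VirtualPerm.compat, VirtualPerm.compat, pow_add, ih, pow_add, mul_assoc]
    simp only [perm_succ_self_mul (natPerm_fixes s) (fun M hM => act_rightMul_perm s u hM) hM]

lemma measurable_cycleRatio : Measurable fun u : VirtualPerm => cycleRatio z (u.fin N) s :=
  (measurable_of_finite fun w : Perm (Fin N) => cycleRatio z w s).comp (measurable_fin N)

lemma map_act_rightMul : (virtualMeasure z hz).map (act (rightMul s)⁻¹) =
      (virtualMeasure z hz).withDensity fun u => ofReal (cycleRatio z (u.fin N) s) := by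
  have hmeas : Measurable fun u : VirtualPerm => ofReal (cycleRatio z (u.fin N) s) :=
    (measurable_cycleRatio z s).ennreal_ofReal
  have hmap := measurable_act (rightMul s)⁻¹
  have key : ∀ M, N ≤ M → ∀ g : Perm ℕ,
      (virtualMeasure z hz).map (act (rightMul s)⁻¹) {u | u.perm M = g} =
      (virtualMeasure z hz).withDensity (fun u => ofReal (cycleRatio z (u.fin N) s))
        {u | u.perm M = g} := by
    intro M hM g
    rw [Measure.map_apply hmap (measurableSet_perm_eq M g),
      withDensity_apply _ (measurableSet_perm_eq M g)]
    by_cases hex : ∃ u : VirtualPerm, u.perm M = g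
    · obtain ⟨u, hu⟩ := hex
      have h1 : act (rightMul s)⁻¹ ⁻¹' {u | u.perm M = g} =
          {v | v.perm M = (act (rightMul s) u).perm M} := by
        ext v
        obtain ⟨v', rfl⟩ : ∃ v', v = act (rightMul s) v' := ⟨_, (act_rightMul_inv s v _).1 rfl⟩
        have h2 := (act_rightMul_inv s (act (rightMul s) v') v').2 rfl
        rw [mem_preimage, h2, mem_ofPred_eq, mem_ofPred_eq, act_rightMul_perm s _ hM,
          act_rightMul_perm s _ hM, mul_left_inj, hu]
      have h2 : ∀ v ∈ {v : VirtualPerm | v.perm M = g},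
          ofReal (cycleRatio z (v.fin N) s) = ofReal (cycleRatio z (u.fin N) s) := by
        intro v hv
        have hv' : v.perm M = u.perm M := by rw [hu]; exact hv
        rw [(fin_eq_iff v u N).2]
        rw [← reduce_perm v (k := M) hM (by omega), ← reduce_perm u (k := M) hM (by omega), hv']
      rw [h1, setLIntegral_congr_fun (measurableSet_perm_eq M g) h2, setLIntegral_const, ← hu,
        virtualMeasure_apply z hz M _ (VirtualPerm.fixes _ _),
        virtualMeasure_apply z hz M _ (VirtualPerm.fixes _ _), pow_cycleCount_mul z hz s u hM,
        ← ofReal_mul (cycleRatio_nonneg hz _ _), mul_div_assoc]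
    · have h1 : {u : VirtualPerm | u.perm M = g} = ∅ := by
        grind
      simp [h1]
  have := Measure.isProbabilityMeasure_map (μ := virtualMeasure z hz) hmap.aemeasurable
  have keyS : ∀ M, N ≤ M → ∀ S : Set (Perm ℕ),
      (virtualMeasure z hz).map (act (rightMul s)⁻¹) {u | u.perm M ∈ S} =
      (virtualMeasure z hz).withDensity (fun u => ofReal (cycleRatio z (u.fin N) s))
        {u | u.perm M ∈ S} := by
    intro M hM S
    have hfin : {w : Perm ℕ | (∀ i, M ≤ i → w i = i) ∧ w ∈ S}.Finite :=
      (finite_setOf_fixes M).subset fun w hw => hw.1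
    have e : {u : VirtualPerm | u.perm M ∈ S} =
        ⋃ w ∈ hfin.toFinset, {u : VirtualPerm | u.perm M = w} := by
      ext u
      simp only [mem_ofPred_eq, Set.Finite.mem_toFinset, Set.mem_iUnion, exists_prop]
      exact ⟨fun h => ⟨_, ⟨u.fixes M, h⟩, rfl⟩, by rintro ⟨w, ⟨-, hw⟩, rfl⟩; exact hw⟩
    have hd : Set.PairwiseDisjoint (hfin.toFinset : Set (Perm ℕ))
        fun w => {u : VirtualPerm | u.perm M = w} := by
      intro w _ w' _ hne
      grind
    rw [e, measure_biUnion_finset hd fun w _ => measurableSet_perm_eq M w,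
      measure_biUnion_finset hd fun w _ => measurableSet_perm_eq M w]
    exact sum_congr rfl fun w _ => key M hM w
  refine ext_of_generate_finite _ rfl isPiSystem_cylinders ?_ ?_
  · rintro _ ⟨n, g, rfl⟩
    have e : {u : VirtualPerm | u.perm n = g} =
        {u | u.perm (max n N) ∈ {w | reduce n (max n N) w = g}} := by
      ext u
      simp only [mem_ofPred_eq]
      rw [reduce_perm u (le_max_left n N) (by omega)]
    rw [e]
    exact keyS _ (le_max_right _ _) _
  · simpa using keyS N le_rfl Set.univ

end Right

section Polymorphism

variable {N n : ℕ} (s : Perm (Fin N))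

lemma map_act_inv {g : bisymmetricGroup} {a q : Perm ℕ}
    (hg : g = Seating.diag a * rightMul s * Seating.diag q) :
    (virtualMeasure z hz).map (act g⁻¹) = (virtualMeasure z hz).withDensity fun u =>
      ofReal (cycleRatio z ((act (Seating.diag a) u).fin N) s) := by
  have hinv : ∀ b, (Seating.diag b)⁻¹ = Seating.diag b⁻¹ := fun b => rfl
  have hact : act g⁻¹ = act (Seating.diag a⁻¹) ∘ act (rightMul s)⁻¹ ∘ act (Seating.diag q⁻¹) := by
    funext u
    rw [hg, mul_inv_rev, mul_inv_rev, hinv, hinv, act_mul, act_mul]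
    rfl
  have hm := measurable_act
  rw [hact, ← map_map (hm _) ((hm _).comp (hm _)), ← map_map (hm _) (hm _),
    map_act_diag, map_act_rightMul]
  have hdens : Measurable fun u : VirtualPerm => ofReal (cycleRatio z (u.fin N) s) :=
    (measurable_cycleRatio z s).ennreal_ofReal
  have hinvol : ∀ u, act (Seating.diag a) (act (Seating.diag a⁻¹) u) = u := fun u => by
    rw [← act_mul, ← hinv, inv_mul_cancel, act_one]
  ext A hA
  rw [Measure.map_apply (hm _) hA, withDensity_apply _ (hm _ hA), withDensity_apply _ hA]
  nth_rw 2 [← map_act_diag z hz a⁻¹]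
  have hdens' : Measurable fun u : VirtualPerm =>
      ofReal (cycleRatio z ((act (Seating.diag a) u).fin N) s) := hdens.comp (hm _)
  rw [setLIntegral_map hA hdens' (hm _)]
  simp only [hinvol]

lemma polymorphism_eq {g : bisymmetricGroup} {a q : Perm ℕ}
    (hg : g = Seating.diag a * rightMul s * Seating.diag q) (ha : ∀ i < n, a i = i)
    {K : ℕ} (hq : ∀ i, K ≤ i → q i = i) (hq' : ∀ i < n, q i = i) :
    polymorphism z hz n g = ((stickLaw z).prod pointsLaw).map fun p =>
      (forget n (paint p), forget n (act (rightMul s) (paint p)),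
        cycleRatio z ((paint p).fin N) s) := by
  set Λ := (stickLaw z).prod pointsLaw
  set F : VirtualPerm → HalfRestaurant n × HalfRestaurant n × ℝ := fun u =>
    (forget n u, forget n (act (rightMul s) u), cycleRatio z (u.fin N) s)
  have hF : Measurable F := (measurable_forget n).prodMk
    (((measurable_forget n).comp (measurable_act _)).prodMk (measurable_cycleRatio z s))
  have hrn : ∀ᵐ u ∂virtualMeasure z hz, radonNikodym z hz g u =
      cycleRatio z ((act (Seating.diag a) u).fin N) s := by
    have hdens : Measurable fun u : VirtualPerm =>
        ofReal (cycleRatio z ((act (Seating.diag a) u).fin N) s) :=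
      ((measurable_cycleRatio z s).comp (measurable_act _)).ennreal_ofReal
    have := Measure.rnDeriv_withDensity (virtualMeasure z hz) hdens
    rw [← map_act_inv z hz s hg] at this
    filter_upwards [this] with u hu
    rw [radonNikodym, hu, toReal_ofReal (cycleRatio_nonneg hz _ _)]
  have hG : Measurable fun u => (forget n u, forget n (act g u), radonNikodym z hz g u) :=
    (measurable_forget n).prodMk (((measurable_forget n).comp (measurable_act _)).prodMk
      (Measure.measurable_rnDeriv _ _).ennreal_toReal)
  have h1 : Λ.map (F ∘ paint) = (Λ.map (fun p => (p.1, p.2 ∘ a))).map (F ∘ paint) := by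
    rw [map_relabel]
  rw [map_map (hF.comp measurable_paint) (measurable_relabel a)] at h1
  refine Eq.trans ?_ h1.symm
  rw [polymorphism, ← map_paint z hz, map_map hG measurable_paint]
  refine Measure.map_congr ?_
  rw [← map_paint z hz] at hrn
  have h2 : ∀ᵐ p ∂Λ, EquiPoints (p.2 ∘ a) := by
    have := ae_good z hz
    rw [← map_relabel z a] at this
    filter_upwards [ae_of_ae_map (measurable_relabel a).aemeasurable this] with p hp using hp.2.2
  filter_upwards [ae_good z hz, ae_of_ae_map measurable_paint.aemeasurable hrn, h2] with p hp hr hE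
  obtain ⟨ℓ, U⟩ := p
  obtain ⟨hℓ, hU, hEU⟩ := hp
  have e1 : act (Seating.diag a) (paint (ℓ, U)) = paint (ℓ, U ∘ a) := act_diag_paint hℓ hU a
  have e2 : forget n (paint (ℓ, U)) = forget n (paint (ℓ, U ∘ a)) := by
    have hU' := hU.comp a
    have hagree : ∀ i < n, U i = (U ∘ a) i := fun i hi => by rw [comp_apply, ha i hi]
    have hperm := paint_perm_congr hℓ hU hU' hagree
    rw [forget_paint hℓ hU hEU, forget_paint hℓ hU' hE, (fin_eq_iff _ _ _).2 hperm]
    have h3 : arcFin ℓ n U = arcFin ℓ n (U ∘ a) := by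
      funext i
      rw [arcFin, arcFin, ← hperm, ← hagree i i.2, ← hagree _ (VirtualPerm.perm_lt _ i.2)]
    have h4 : (fun i : Fin n => tabOf ℓ (U i)) = fun i : Fin n => tabOf ℓ ((U ∘ a) i) :=
      funext fun i => by rw [hagree i i.2]
    have key : ∀ κ κ' : Fin n → ℕ, κ = κ' → ∀ τ (l : Fin n → ℝ),
        ofData (ι := {ν // ∀ i, κ i ≠ ν}) τ l (fun ν => ℓ ν) =
        ofData (ι := {ν // ∀ i, κ' i ≠ ν}) τ l (fun ν => ℓ ν) := by
      simp
    rw [h3]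
    exact key _ _ h4 _ _
  show (forget n (paint (ℓ, U)), forget n (act g (paint (ℓ, U))), _) =
    (forget n (paint (ℓ, U ∘ a)), forget n (act (rightMul s) (paint (ℓ, U ∘ a))),
      cycleRatio z ((paint (ℓ, U ∘ a)).fin N) s)
  rw [hr, e1, ← e2, hg, act_mul, act_mul, e1]
  congr 2
  refine forget_conj (le_max_left n K) (fun i hi => hq i (le_of_max_le_right hi)) hq' fun M hM => ?_
  exact act_perm_of_fixes (K := K) hq hq _ (le_of_max_le_right hM)

end Polymorphism

/-! ## Permutations with the cycles prescribed by a chip -/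

section Model

variable {X : Type} {n p : ℕ}

/-- The permutation `r` has the arcs of lengths `φ i + 1` from the labels `f i` to the labels
`f (σ i)`, and different label-free cycles of lengths `k j` through the points `f' j`. -/
structure Model (r : Perm X) (f : Fin n → X) (f' : Fin p → X) (σ : Perm (Fin n))
    (φ : Fin n → ℕ) (k : Fin p → ℕ) : Prop where
  inj : Injective f
  ret : ∀ i, (r ^ (φ i + 1)) (f i) = f (σ i)
  notMem : ∀ i m, 0 < m → m ≤ φ i → (r ^ m) (f i) ∉ Set.range f
  period : ∀ j, minimalPeriod r (f' j) = k j
  disj : ∀ j j', r.SameCycle (f' j) (f' j') → j = j'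
  disj' : ∀ i j, ¬ r.SameCycle (f i) (f' j)

/-- The points of the arcs and the circles of a chip. -/
abbrev ModelType (φ : Fin n → ℕ) (k : Fin p → ℕ) : Type := (Σ i, Fin (φ i + 1)) ⊕ Σ j, Fin (k j)

/-- The number of points of the arcs and the circles of a chip. -/
abbrev chipSize (φ : Fin n → ℕ) (k : Fin p → ℕ) : ℕ := n + ∑ i, φ i + ∑ j, k j

/-- The parametrization of the points of the arcs and the circles. -/
def modelMap {φ : Fin n → ℕ} {k : Fin p → ℕ} (r : Perm X) (f : Fin n → X)
    (f' : Fin p → X) : ModelType φ k → X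
  | .inl ⟨i, m⟩ => (r ^ (m : ℕ)) (f i)
  | .inr ⟨j, m⟩ => (r ^ (m : ℕ)) (f' j)

/-- The next point of the same arc or circle. -/
def modelSucc {φ : Fin n → ℕ} {k : Fin p → ℕ} (σ : Perm (Fin n)) : ModelType φ k → ModelType φ k
  | .inl ⟨i, m⟩ => if h : m < φ i then .inl ⟨i, ⟨m + 1, by omega⟩⟩ else .inl ⟨σ i, 0⟩
  | .inr ⟨j, m⟩ => if h : m + 1 < k j then .inr ⟨j, ⟨m + 1, h⟩⟩ else
      .inr ⟨j, ⟨0, by have := m.2; omega⟩⟩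

variable {r : Perm X} {f : Fin n → X} {f' : Fin p → X} {σ : Perm (Fin n)}
  {φ : Fin n → ℕ} {k : Fin p → ℕ}

lemma Model.injective (h : Model r f f' σ φ k) :
    Injective (modelMap r f f' : ModelType φ k → X) := by
  have key : ∀ i i' (m m' : ℕ), m ≤ m' → m' ≤ φ i' → (r ^ m) (f i) = (r ^ m') (f i') →
      i = i' ∧ m = m' := by
    intro i i' m m' hle hm' e
    obtain ⟨d, rfl⟩ := Nat.exists_eq_add_of_le hle
    rw [pow_add, Perm.mul_apply] at e
    have e' := (r ^ m).injective e
    rcases Nat.eq_zero_or_pos d with rfl | hd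
    · exact ⟨h.inj e', rfl⟩
    · exact absurd ⟨i, e'⟩ (h.notMem i' d hd (by omega))
  have hpow : ∀ x (m : ℕ), r.SameCycle ((r ^ m) x) x := fun x m =>
    Perm.sameCycle_pow_left.2 (.refl _ _)
  rintro (⟨i, m⟩ | ⟨j, m⟩) (⟨i', m'⟩ | ⟨j', m'⟩) e
  · have h1 : (r ^ (m : ℕ)) (f i) = (r ^ (m' : ℕ)) (f i') := e
    rcases le_total (m : ℕ) m' with hle | hle
    · obtain ⟨rfl, h2⟩ := key i i' m m' hle (by omega) h1
      grind
    · obtain ⟨rfl, h2⟩ := key i' i m' m hle (by omega) h1.symm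
      grind
  · have h1 : (r ^ (m : ℕ)) (f i) = (r ^ (m' : ℕ)) (f' j') := e
    exact absurd ((hpow _ m).symm.trans (h1 ▸ hpow _ m')) (h.disj' i j')
  · have h1 : (r ^ (m : ℕ)) (f' j) = (r ^ (m' : ℕ)) (f i') := e
    exact absurd ((hpow _ m').symm.trans (h1 ▸ hpow _ m)) (h.disj' i' j)
  · have h1 : (r ^ (m : ℕ)) (f' j) = (r ^ (m' : ℕ)) (f' j') := e
    obtain rfl := h.disj j j' ((hpow _ m).symm.trans (h1 ▸ hpow _ m'))
    have h2 := iterate_injOn_Iio_minimalPeriod (f := r) (x := f' j)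
      (x₁ := m) (x₂ := m') (by rw [h.period]; exact m.2) (by rw [h.period]; exact m'.2)
      (by simpa [Perm.iterate_eq_pow] using h1)
    grind

lemma Model.apply_modelMap (h : Model r f f' σ φ k) (x : ModelType φ k) :
    r (modelMap r f f' x) = modelMap r f f' (modelSucc σ x) := by
  rcases x with ⟨i, m⟩ | ⟨j, m⟩
  · show r ((r ^ (m : ℕ)) (f i)) = _
    rw [← Perm.mul_apply, ← pow_succ', modelSucc]
    split_ifs with hm
    · rfl
    · rw [show (m : ℕ) = φ i by omega, h.ret]
      rfl
  · show r ((r ^ (m : ℕ)) (f' j)) = _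
    rw [← Perm.mul_apply, ← pow_succ', modelSucc]
    split_ifs with hm
    · rfl
    · have hm' : (m : ℕ) + 1 = minimalPeriod r (f' j) := by rw [h.period]; omega
      have := iterate_minimalPeriod (f := r) (x := f' j)
      rw [Perm.iterate_eq_pow] at this
      rw [hm', this]
      rfl

lemma Model.comp {Y : Type} (h : Model r f f' σ φ k) (c : X ≃ Y) {r' : Perm Y}
    (hc : ∀ x, c (r x) = r' (c x)) : Model r' (c ∘ f) (c ∘ f') σ φ k := by
  have hpow : ∀ (m : ℕ) x, c ((r ^ m) x) = (r' ^ m) (c x) := by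
    intro m x
    induction m with
    | zero => rfl
    | succ m ih => rw [pow_succ', pow_succ', Perm.mul_apply, Perm.mul_apply, hc, ih]
  have hr' : r' = c.symm.trans (r.trans c) := by ext y; simp [hc]
  have hsame : ∀ x y, r'.SameCycle (c x) (c y) → r.SameCycle x y := by
    rintro x y ⟨m, hm⟩
    have hz : ∀ m : ℤ, c ((r ^ m) x) = (r' ^ m) (c x) := by
      intro m
      obtain ⟨d, rfl | rfl⟩ := m.eq_nat_or_neg
      · simpa using hpow d x
      · rw [zpow_neg, zpow_neg, zpow_natCast, zpow_natCast, Perm.eq_inv_iff_eq, ← hpow]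
        simp
    exact ⟨m, c.injective ((hz m).trans hm)⟩
  refine ⟨c.injective.comp h.inj, fun i => ?_, fun i m h1 h2 => ?_, fun j => ?_,
    fun j j' e => h.disj j j' (hsame _ _ e), fun i j e => h.disj' i j (hsame _ _ e)⟩
  · rw [comp_apply, ← hpow, h.ret]; rfl
  · rintro ⟨i', hi'⟩
    rw [comp_apply, comp_apply, ← hpow] at hi'
    exact h.notMem i m h1 h2 ⟨i', c.injective hi'⟩
  · rw [← h.period j]
    refine minimalPeriod_eq_minimalPeriod_iff.2 fun m => ?_
    simp only [IsPeriodicPt, IsFixedPt, Perm.iterate_eq_pow, comp_apply, ← hpow, c.injective.eq_iff]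

lemma card_modelType (φ : Fin n → ℕ) (k : Fin p → ℕ) :
    Fintype.card (ModelType φ k) = chipSize φ k := by
  simp [Finset.sum_add_distrib, add_comm]

end Model

section Fin

variable {n p : ℕ} {φ : Fin n → ℕ} {k : Fin p → ℕ} {σ : Perm (Fin n)}

variable {r r' : Perm (Fin (chipSize φ k))} {f g : Fin n → Fin (chipSize φ k)} {f' g' : Fin p → Fin (chipSize φ k)}

lemma Model.bijective (h : Model r f f' σ φ k) :
    Bijective (modelMap r f f' : ModelType φ k → Fin (chipSize φ k)) :=
  (Fintype.bijective_iff_injective_and_card _).2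
    ⟨h.injective, by rw [card_modelType, Fintype.card_fin]⟩

/-- Two permutations with the same arcs and circles are conjugate. -/
lemma Model.exists_conj (h : Model r f f' σ φ k) (h' : Model r' g g' σ φ k) (hk : ∀ j, 0 < k j) :
    ∃ c : Perm (Fin (chipSize φ k)), (∀ x, c (r x) = r' (c x)) ∧ (∀ i, c (f i) = g i) ∧
      ∀ j, c (f' j) = g' j := by
  let E := ofBijective _ h.bijective
  let E' := ofBijective _ h'.bijective
  have hE : ∀ x, E.symm (modelMap r f f' x) = x := E.symm_apply_apply
  refine ⟨E.symm.trans E', fun x => ?_, fun i => ?_, fun j => ?_⟩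
  · obtain ⟨y, rfl⟩ := h.bijective.2 x
    simp only [trans_apply]
    rw [h.apply_modelMap, hE, hE]
    exact (h'.apply_modelMap y).symm
  · have := hE (.inl ⟨i, 0⟩)
    simp only [trans_apply]
    rw [show modelMap r f f' (.inl ⟨i, 0⟩ : ModelType φ k) = f i from rfl] at this
    rw [this]
    rfl
  · have := hE (.inr ⟨j, ⟨0, hk j⟩⟩)
    simp only [trans_apply]
    rw [show modelMap r f f' (.inr ⟨j, ⟨0, hk j⟩⟩ : ModelType φ k) = f' j from rfl] at this
    rw [this]
    rfl

lemma minimalPeriod_pow_apply {X : Type} (r : Perm X) (m : ℕ) (x : X) :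
    minimalPeriod r ((r ^ m) x) = minimalPeriod r x := by
  refine minimalPeriod_eq_minimalPeriod_iff.2 fun q => ?_
  simp only [IsPeriodicPt, IsFixedPt, Perm.iterate_eq_pow]
  rw [← Perm.mul_apply, ← pow_add, add_comm, pow_add, Perm.mul_apply, EmbeddingLike.apply_eq_iff_eq]

lemma Model.card_markings (h : Model r f f' σ φ k) :
    card {g' : Fin p → Fin (chipSize φ k) // Model r f g' σ φ k} =
      card {π : Perm (Fin p) // k ∘ π = k} * ∏ j, k j := by
  have hpow : ∀ x (m : ℕ), r.SameCycle ((r ^ m) x) x := fun x m =>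
    Perm.sameCycle_pow_left.2 (.refl _ _)
  let Φ : (Σ π : {π : Perm (Fin p) // k ∘ π = k}, ∀ j, Fin (k (π.1 j))) →
      {g' : Fin p → Fin (chipSize φ k) // Model r f g' σ φ k} := fun x =>
    ⟨fun j => modelMap r f f' (.inr ⟨x.1.1 j, x.2 j⟩ : ModelType φ k), by
      obtain ⟨⟨π, hπ⟩, m⟩ := x
      refine ⟨h.inj, h.ret, h.notMem, fun j => ?_, fun j j' e => ?_, fun i j e => ?_⟩
      · exact (minimalPeriod_pow_apply _ _ _).trans ((h.period _).trans (congrFun hπ j))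
      · exact π.injective (h.disj _ _ ((hpow _ _).symm.trans (e.trans (hpow _ _))))
      · exact h.disj' i (π j) (e.trans (hpow _ _))⟩
  have hΦ : Bijective Φ := by
    constructor
    · rintro ⟨⟨π, hπ⟩, m⟩ ⟨⟨π', hπ'⟩, m'⟩ e
      have h1 : ∀ j, (⟨π j, m j⟩ : Σ j, Fin (k j)) = ⟨π' j, m' j⟩ := fun j =>
        Sum.inr_injective (h.injective (congrFun (congrArg Subtype.val e) j))
      obtain rfl : π = π' := by
        grind
      obtain rfl : m = m' := by
        grind
      rfl
    · rintro ⟨g', hg'⟩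
      have h1 : ∀ j, ∃ y : Σ j, Fin (k j), modelMap r f f' (.inr y : ModelType φ k) = g' j := by
        intro j
        obtain ⟨⟨i, m⟩ | y, hx⟩ := h.bijective.2 (g' j)
        · exact absurd (hx ▸ (hpow (f i) m).symm) (hg'.disj' i j)
        · grind
      choose y hy using h1
      have h2 : ∀ j, r.SameCycle (g' j) (f' (y j).1) := fun j => by rw [← hy]; exact hpow _ _
      have hinj : Injective fun j => (y j).1 := by
        intro j j' e
        simp only at e
        exact hg'.disj j j' ((h2 j).trans (e ▸ (h2 j').symm))
      let π := ofBijective _ (Finite.injective_iff_bijective.1 hinj)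
      have hk : k ∘ π = k := by
        funext j
        rw [← hg'.period j, ← hy]
        exact ((minimalPeriod_pow_apply _ _ _).trans (h.period _)).symm
      exact ⟨⟨⟨π, hk⟩, fun j => (y j).2⟩, Subtype.ext (funext hy)⟩
  rw [← Nat.card_eq_of_bijective Φ hΦ, Nat.card_sigma]
  have h3 : ∀ π : {π : Perm (Fin p) // k ∘ π = k}, card (∀ j, Fin (k (π.1 j))) =
      ∏ j, k j := fun π => by
    rw [Nat.card_pi]
    simp only [card_eq_fintype_card, Fintype.card_fin]
    exact prod_congr rfl fun j _ => congrFun π.2 j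
  simp only [h3, sum_const, card_univ, smul_eq_mul, card_eq_fintype_card]

lemma card_stabilizer (k : Fin p → ℕ) : card {π : Perm (Fin p) // k ∘ π = k} =
    ∏ m ∈ univ.image k, (card {j // k j = m}).factorial := by
  have h1 : ∀ j, k j ∈ univ.image k := fun j => Finset.mem_image_of_mem k (mem_univ j)
  let k' : Fin p → univ.image k := fun j => ⟨k j, h1 j⟩
  have h2 := DomMulAct.stabilizer_card (f := k')
  have h3 : card {π : Perm (Fin p) // k ∘ π = k} = Fintype.card {g : Perm (Fin p) // k' ∘ g = k'} := by
    rw [← card_eq_fintype_card]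
    refine card_congr (subtypeEquivRight fun π => ?_)
    simp only [funext_iff, comp_apply, k', Subtype.mk.injEq]
  rw [h3, h2, ← Finset.prod_coe_sort (univ.image k) fun m => (card {j // k j = m}).factorial]
  refine prod_congr rfl fun m _ => ?_
  rw [← card_eq_fintype_card]
  congr 1
  refine card_congr (subtypeEquivRight fun j => ?_)
  simp only [k', Subtype.ext_iff]

/-- The number of permutations that commute with `r` and fix the labels. -/
lemma Model.card_centralizer (h : Model r f f' σ φ k) (hk : ∀ j, 0 < k j) :
    card {c : Perm (Fin (chipSize φ k)) // (∀ x, c (r x) = r (c x)) ∧ ∀ i, c (f i) = f i} =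
      (∏ j, k j) * ∏ m ∈ univ.image k, (card {j // k j = m}).factorial := by
  rw [mul_comm, ← card_stabilizer, ← h.card_markings]
  refine Nat.card_eq_of_bijective (fun c => ⟨c.1 ∘ f', by
    have := h.comp c.1 c.2.1
    rwa [show (c.1 : _ → _) ∘ f = f from funext c.2.2] at this⟩) ⟨?_, ?_⟩
  · rintro ⟨c, hc1, hc2⟩ ⟨d, hd1, hd2⟩ e
    have e' : ∀ j, c (f' j) = d (f' j) := congrFun (congrArg Subtype.val e)
    refine Subtype.ext (Equiv.ext fun x => ?_)
    obtain ⟨y, rfl⟩ := h.bijective.2 x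
    have hpow : ∀ c : Perm (Fin (chipSize φ k)), (∀ x, c (r x) = r (c x)) → ∀ (m : ℕ) x,
        c ((r ^ m) x) = (r ^ m) (c x) := by
      intro c hc m x
      induction m with
      | zero => rfl
      | succ m ih => rw [pow_succ', Perm.mul_apply, Perm.mul_apply, hc, ih]
    rcases y with ⟨i, m⟩ | ⟨j, m⟩
    · exact (hpow c hc1 m _).trans ((congrArg _ ((hc2 i).trans (hd2 i).symm)).trans
        (hpow d hd1 m _).symm)
    · exact (hpow c hc1 m _).trans ((congrArg _ (e' j)).trans (hpow d hd1 m _).symm)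
  · rintro ⟨g', hg'⟩
    obtain ⟨c, hc1, hc2, hc3⟩ := h.exists_conj hg' hk
    exact ⟨⟨c, hc1, hc2⟩, Subtype.ext (funext hc3)⟩

end Fin

/-! ## The permutation of a chip -/

section AVertices

variable {n p N : ℕ}

/-- The cycles of `r` are the cycles of `σ`, with `φ i` points without labels after the label `i`,
and label-free cycles of lengths `k j`. -/
def HasChip (r : Perm (Fin N)) (F : Fin n ↪ Fin N) (σ : Perm (Fin n)) (φ : Fin n → ℕ)
    (k : Fin p → ℕ) : Prop :=
  nextLabel r F = σ ∧ (∀ i, returnTime r F i = φ i + 1) ∧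
  ∃ e : Cycles r ≃ Cycles σ ⊕ Fin p, ∀ A,
    (∀ s, e A = .inl s → ∀ i, (Quotient.mk _ (F i) : Cycles r) = A ↔ Quotient.mk _ i = s) ∧
    (∀ j, e A = .inr j → card {w // (Quotient.mk _ w : Cycles r) = A} = k j ∧
      ∀ i, (Quotient.mk _ (F i) : Cycles r) ≠ A)

lemma sameCycle_nextLabel {r : Perm (Fin N)} {F : Fin n ↪ Fin N} {i j : Fin n} :
    (nextLabel r F).SameCycle i j ↔ (Quotient.mk _ (F i) : Cycles r) = Quotient.mk _ (F j) := by
  constructor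
  · intro e
    obtain ⟨m, -, rfl⟩ := e.exists_pow_eq'
    clear e
    induction m with
    | zero => rfl
    | succ m ih => rw [pow_succ', Perm.mul_apply, nextLabel_spec, mk_pow_apply, ih]
  · intro e
    obtain ⟨m, hm⟩ := exists_pow_eq_of_mk_eq e
    clear e
    induction m using Nat.strong_induction_on generalizing i with
    | _ m ih =>
      have h1 := returnTime_spec r F i
      rcases Nat.lt_or_ge m (returnTime r F i) with hlt | hge
      · rcases Nat.eq_zero_or_pos m with rfl | h0
        · rw [F.injective (show F i = F j from hm)]
        · exact absurd ⟨j, hm.symm⟩ (notMem_range_of_lt_returnTime h0 hlt)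
      · obtain ⟨d, rfl⟩ := Nat.exists_eq_add_of_le hge
        rw [add_comm, pow_add, Perm.mul_apply, ← nextLabel_spec] at hm
        exact Perm.sameCycle_apply_left.1 (ih d (by omega) hm)

lemma card_cycle (r : Perm (Fin N)) (x : Fin N) :
    card {w // (Quotient.mk _ w : Cycles r) = Quotient.mk _ x} = minimalPeriod r x := by
  have hpos : 0 < minimalPeriod r x := minimalPeriod_pos_of_mem_periodicPts
    ⟨orderOf r, orderOf_pos r, by
      rw [IsPeriodicPt, IsFixedPt, Perm.iterate_eq_pow, pow_orderOf_eq_one]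
      rfl⟩
  rw [← Nat.card_fin (minimalPeriod r x)]
  symm
  refine Nat.card_eq_of_bijective (fun m => ⟨(r ^ (m : ℕ)) x, mk_pow_apply x m⟩) ⟨?_, ?_⟩
  · intro m m' e
    have e' : (r ^ (m : ℕ)) x = (r ^ (m' : ℕ)) x := congrArg Subtype.val e
    exact Fin.ext (iterate_injOn_Iio_minimalPeriod (f := r) (x := x) (x₁ := m) (x₂ := m')
      m.2 m'.2 (by simpa [Perm.iterate_eq_pow] using e'))
  · rintro ⟨w, hw⟩
    obtain ⟨m, rfl⟩ := exists_pow_eq_of_mk_eq hw.symm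
    refine ⟨⟨m % minimalPeriod r x, Nat.mod_lt _ hpos⟩, Subtype.ext ?_⟩
    have := iterate_mod_minimalPeriod_eq (f := r) (x := x) (n := m)
    rwa [Perm.iterate_eq_pow, Perm.iterate_eq_pow] at this

variable {r : Perm (Fin N)} {F : Fin n ↪ Fin N} {σ : Perm (Fin n)} {φ : Fin n → ℕ} {k : Fin p → ℕ}

lemma HasChip.exists_model (h : HasChip r F σ φ k) : ∃ f' : Fin p → Fin N, Model r F f' σ φ k := by
  obtain ⟨rfl, h2, e, he⟩ := h
  have hrep : ∀ j, ∃ x, (Quotient.mk _ x : Cycles r) = e.symm (.inr j) := fun j =>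
    exists_rep (e.symm (.inr j))
  choose f' hf' using hrep
  have he' : ∀ j, e (Quotient.mk _ (f' j)) = .inr j := fun j => by rw [hf', apply_symm_apply]
  refine ⟨f', F.injective, fun i => ?_, fun i m h0 hm => ?_, fun j => ?_, fun j j' e' => ?_,
    fun i j e' => ?_⟩
  · rw [nextLabel_spec, h2]
  · exact notMem_range_of_lt_returnTime h0 (by rw [h2]; omega)
  · rw [← card_cycle, ((he _).2 j (he' j)).1]
  · have h3 := mk_eq_mk_iff.2 e'
    grind
  · exact ((he _).2 j (he' j)).2 i (mk_eq_mk_iff.2 e')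

lemma Model.hasChip {r : Perm (Fin (chipSize φ k))} {F : Fin n ↪ Fin (chipSize φ k)}
    {f' : Fin p → Fin (chipSize φ k)} (h : Model r F f' σ φ k) : HasChip r F σ φ k := by
  have hret : ∀ i, returnTime r F i = φ i + 1 := fun i =>
    returnTime_eq (Nat.succ_pos _) ⟨σ i, (h.ret i).symm⟩ fun m h0 h1 => h.notMem i m h0 (by omega)
  have hnext : nextLabel r F = σ := by
    refine Equiv.ext fun i => F.injective ?_
    rw [nextLabel_spec, hret, h.ret]
  refine ⟨hnext, hret, ?_⟩
  have hlab : ∀ i j, (Quotient.mk _ (F i) : Cycles r) = Quotient.mk _ (F j) ↔ σ.SameCycle i j :=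
    fun i j => hnext ▸ sameCycle_nextLabel.symm
  let B : Cycles σ ⊕ Fin p → Cycles r := Sum.elim
    (Quotient.lift (fun i => (Quotient.mk _ (F i) : Cycles r)) fun i j e => (hlab i j).2 e)
    fun j => Quotient.mk _ (f' j)
  have hB : Bijective B := by
    constructor
    · rintro (C | j) (D | j') e
      · induction C using inductionOn with
        | h i =>
          induction D using inductionOn with
          | h i' => exact congrArg _ (mk_eq_mk_iff.2 ((hlab i i').1 e))
      · induction C using inductionOn with
        | h i => exact absurd (mk_eq_mk_iff.1 e) (h.disj' i j')
      · induction D using inductionOn with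
        | h i => exact absurd (mk_eq_mk_iff.1 e).symm (h.disj' i j)
      · exact congrArg _ (h.disj j j' (mk_eq_mk_iff.1 e))
    · intro A
      induction A using inductionOn with
      | h x =>
        obtain ⟨⟨i, m⟩ | ⟨j, m⟩, rfl⟩ := h.bijective.2 x
        · exact ⟨.inl (Quotient.mk _ i), (mk_pow_apply _ _).symm⟩
        · exact ⟨.inr j, (mk_pow_apply _ _).symm⟩
  refine ⟨(ofBijective B hB).symm, fun A => ⟨fun s hA i => ?_, fun j hA => ?_⟩⟩
  · rw [symm_apply_eq] at hA
    rw [hA]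
    exact (ofBijective B hB).injective.eq_iff (a := .inl (Quotient.mk _ i)) (b := .inl s)
      |>.trans (by simp)
  · rw [symm_apply_eq] at hA
    rw [hA]
    refine ⟨(card_cycle r (f' j)).trans (h.period j), fun i e => ?_⟩
    exact h.disj' i j (mk_eq_mk_iff.1 e)

end AVertices

section Diagram

variable (g : Perm ℕ × Perm ℕ)

lemma horizontal_horizontal (x : Node) : horizontal (horizontal x) = x := by
  obtain ⟨s, v, i⟩ := x
  cases s <;> rfl

lemma vertical_vertical (x : Node) : vertical g (vertical g x) = x := by
  obtain ⟨s, v, i⟩ := x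
  cases v <;> simp [vertical]

/-- `advance` as a permutation of the nodes. -/
def advancePerm : Perm Node where
  toFun := advance g
  invFun x := horizontal (vertical g x)
  left_inv x := by
    show horizontal (vertical g (vertical g (horizontal x))) = x
    rw [vertical_vertical, horizontal_horizontal]
  right_inv x := by rw [advance, horizontal_horizontal, vertical_vertical]

lemma advance_iterate (i : ℕ) (x : Node) : (advance g)^[i] x = (advancePerm g ^ i) x := by
  rw [← Perm.iterate_eq_pow]; rfl

lemma horizontal_pow (i : ℕ) (x : Node) :
    (advancePerm g ^ i) (horizontal x) = horizontal ((advancePerm g ^ i)⁻¹ x) := by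
  induction i generalizing x with
  | zero => rfl
  | succ i ih =>
    have h1 : advancePerm g (horizontal x) = horizontal ((advancePerm g)⁻¹ x) := by
      show vertical g (horizontal (horizontal x)) = horizontal (horizontal (vertical g x))
      rw [horizontal_horizontal, horizontal_horizontal]
    rw [pow_succ, Perm.mul_apply, h1, ih, mul_inv_rev, Perm.mul_apply,
      ← Perm.mul_apply, ← Perm.mul_apply, ← inv_pow, ← pow_succ, ← pow_succ']

variable {g} {x : Node}

lemma exists_inv_pow_eq (h : 0 < minimalPeriod (advance g) x) (i : ℕ) :
    ∃ j : ℕ, (advancePerm g ^ i)⁻¹ x = (advancePerm g ^ j) x := by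
  set P := minimalPeriod (advance g) x with hP
  have hper : (advancePerm g ^ P) x = x := by rw [← advance_iterate]; exact iterate_minimalPeriod
  have hmul : ∀ i : ℕ, (advancePerm g ^ (P * i)) x = x := fun i => by
    rw [pow_mul]
    exact (show IsFixedPt (advancePerm g ^ P) x from hper).perm_pow i
  refine ⟨(P - 1) * i, ?_⟩
  rw [Perm.inv_eq_iff_eq, ← Perm.mul_apply, ← pow_add]
  obtain ⟨q, hq⟩ := Nat.exists_eq_succ_of_ne_zero h.ne'
  rw [show i + (P - 1) * i = P * i by rw [hq, Nat.succ_sub_one, Nat.succ_eq_add_one]; ring, hmul]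

lemma mem_circleOf {y : Node} : y ∈ circleOf g x ↔
    ∃ i : ℕ, y = (advancePerm g ^ i) x ∨ y = horizontal ((advancePerm g ^ i) x) := by
  simp only [circleOf, mem_ofPred_eq, advance_iterate]

lemma minimalPeriod_horizontal (x : Node) :
    minimalPeriod (advance g) (horizontal x) = minimalPeriod (advance g) x := by
  refine minimalPeriod_eq_minimalPeriod_iff.2 fun i => ?_
  simp only [IsPeriodicPt, IsFixedPt, advance_iterate, horizontal_pow]
  constructor
  · intro h
    have := congrArg horizontal h
    rw [horizontal_horizontal, horizontal_horizontal, Perm.inv_eq_iff_eq] at this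
    grind
  · intro h
    congr 1
    rw [Perm.inv_eq_iff_eq, h]

lemma minimalPeriod_advance (x : Node) :
    minimalPeriod (advance g) (advance g x) = minimalPeriod (advance g) x :=
  minimalPeriod_pow_apply (advancePerm g) 1 x

lemma circleOf_horizontal (h : 0 < minimalPeriod (advance g) x) :
    circleOf g (horizontal x) = circleOf g x := by
  have key : ∀ x, 0 < minimalPeriod (advance g) x → circleOf g (horizontal x) ⊆ circleOf g x := by
    intro x h y hy
    obtain ⟨i, hi⟩ := mem_circleOf.1 hy
    obtain ⟨j, hj⟩ := exists_inv_pow_eq h i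
    rw [horizontal_pow, hj, horizontal_horizontal] at hi
    exact mem_circleOf.2 ⟨j, hi.symm⟩
  refine (key x h).antisymm ?_
  have := key (horizontal x) (by rwa [minimalPeriod_horizontal])
  rwa [horizontal_horizontal] at this

lemma circleOf_advance (h : 0 < minimalPeriod (advance g) x) :
    circleOf g (advance g x) = circleOf g x := by
  have h1 : ∀ i : ℕ, (advancePerm g ^ i) (advance g x) = (advancePerm g ^ (i + 1)) x := fun i => by
    rw [pow_succ, Perm.mul_apply]; rfl
  ext y
  rw [mem_circleOf, mem_circleOf]
  constructor
  · grind
  · rintro ⟨i, hi⟩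
    obtain ⟨j, hj⟩ := exists_inv_pow_eq h 1
    refine ⟨i + j, ?_⟩
    rwa [h1, add_assoc, pow_add, Perm.mul_apply, pow_succ', Perm.mul_apply, ← hj,
      pow_one, show advancePerm g ((advancePerm g)⁻¹ x) = x from apply_symm_apply _ _]

variable {n : ℕ}

lemma isEnd_horizontal (x : Node) : IsEnd n n (horizontal x) ↔ IsEnd n n x := by
  obtain ⟨s, v, i⟩ := x
  cases v <;> rfl

lemma onCircle_horizontal (h : 0 < minimalPeriod (advance g) x)
    (hx : OnCircle n n g x) : OnCircle n n g (horizontal x) := by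
  intro i
  obtain ⟨j, hj⟩ := exists_inv_pow_eq h i
  rw [advance_iterate, horizontal_pow, hj, isEnd_horizontal, ← advance_iterate]
  exact hx j

lemma onCircle_advance (hx : OnCircle n n g x) : OnCircle n n g (advance g x) := by
  intro i
  exact hx (i + 1)

/-- Every closed component contains a top node on the left. -/
lemma exists_left_top (h : 0 < minimalPeriod (advance g) x) (hx : OnCircle n n g x) :
    ∃ y, OnCircle n n g (.left, .top, y) ∧
      minimalPeriod (advance g) (.left, .top, y) = minimalPeriod (advance g) x ∧
      circleOf g (.left, .top, y) = circleOf g x := by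
  obtain ⟨s, v, i⟩ := x
  have key : ∀ i, 0 < minimalPeriod (advance g) (.right, .bottom, i) →
      OnCircle n n g (.right, .bottom, i) → ∃ y, OnCircle n n g (.left, .top, y) ∧
      minimalPeriod (advance g) (.left, .top, y) = minimalPeriod (advance g) (.right, .bottom, i) ∧
      circleOf g (.left, .top, y) = circleOf g (.right, .bottom, i) := fun i h hx =>
    ⟨g.1⁻¹ i, onCircle_advance hx, minimalPeriod_advance (g := g) (.right, .bottom, i),
      circleOf_advance h⟩
  have hh : ∀ s v i, horizontal (Side.swap s, v, i) = (s, v, i) := fun s v i =>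
    horizontal_horizontal (s, v, i)
  cases s <;> cases v
  · grind
  · have h1 := minimalPeriod_horizontal (g := g) (.left, .bottom, i)
    obtain ⟨y, h2, h3, h4⟩ := key i (by rw [← h1] at h; exact h) (onCircle_horizontal h hx)
    exact ⟨y, h2, h3.trans h1, h4.trans (circleOf_horizontal h)⟩
  · exact ⟨i, onCircle_horizontal h hx, minimalPeriod_horizontal (.right, .top, i),
      circleOf_horizontal h⟩
  · grind

variable (g) in
/-- The permutation `h₁⁻¹ h₂`. -/
def ratio : Perm ℕ := g.1⁻¹ * g.2

lemma advance_pow_left_top (i y : ℕ) :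
    (advancePerm g ^ (2 * i)) (.left, .top, y) = (.left, .top, (ratio g ^ i) y) := by
  induction i with
  | zero => rfl
  | succ i ih =>
    rw [show 2 * (i + 1) = 2 + 2 * i by ring, pow_add, Perm.mul_apply, ih]
    rw [pow_succ' (ratio g)]
    rfl

lemma advance_pow_left_top' (i y : ℕ) :
    (advancePerm g ^ (2 * i + 1)) (.left, .top, y) = (.right, .bottom, g.2 ((ratio g ^ i) y)) := by
  rw [pow_succ', Perm.mul_apply, advance_pow_left_top]
  rfl

lemma minimalPeriod_left_top (y : ℕ) : minimalPeriod (advance g) (.left, .top, y) =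
    2 * minimalPeriod (ratio g) y := by
  refine Nat.dvd_right_iff_eq.1 fun i => ?_
  rw [← isPeriodicPt_iff_minimalPeriod_dvd, IsPeriodicPt, IsFixedPt, advance_iterate]
  rcases Nat.even_or_odd' i with ⟨m, rfl | rfl⟩
  · rw [advance_pow_left_top, Nat.mul_dvd_mul_iff_left two_pos,
      ← isPeriodicPt_iff_minimalPeriod_dvd, IsPeriodicPt, IsFixedPt,
      Perm.iterate_eq_pow]
    simp
  · rw [advance_pow_left_top']
    constructor
    · intro e; simp at e
    · intro e
      have : 2 ∣ 2 * m + 1 := (Dvd.intro _ rfl).trans e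
      omega

lemma mem_circleOf_left_top {y y' : ℕ} : (.left, .top, y') ∈ circleOf g (.left, .top, y) ↔
    ∃ i : ℕ, (ratio g ^ i) y = y' := by
  rw [mem_circleOf]
  constructor
  · rintro ⟨i, hi⟩
    rcases Nat.even_or_odd' i with ⟨m, rfl | rfl⟩
    · rw [advance_pow_left_top] at hi
      rcases hi with hi | hi
      · simp only [Prod.mk.injEq, true_and] at hi
        grind
      · simp [horizontal, Side.swap] at hi
    · rw [advance_pow_left_top'] at hi
      rcases hi with hi | hi <;> simp [horizontal] at hi
  · rintro ⟨i, rfl⟩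
    exact ⟨2 * i, Or.inl (advance_pow_left_top i y).symm⟩

lemma circleOf_left_top_pow {y : ℕ} (h : 0 < minimalPeriod (ratio g) y) (i : ℕ) :
    circleOf g (.left, .top, (ratio g ^ i) y) = circleOf g (.left, .top, y) := by
  induction i with
  | zero => rfl
  | succ i ih =>
    have h1 : 0 < minimalPeriod (advance g) (.left, .top, (ratio g ^ i) y) := by
      rw [minimalPeriod_left_top, minimalPeriod_pow_apply]
      omega
    have h2 := circleOf_advance h1
    have h3 := circleOf_advance (x := advance g (.left, .top, (ratio g ^ i) y))
      (by rwa [minimalPeriod_advance])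
    rw [← ih, ← h2, ← h3, pow_succ', Perm.mul_apply]
    rfl

end Diagram

/-! ## Representatives of chips -/

section ChipModel

variable {n p : ℕ} {φ : Fin n → ℕ} {k : Fin p → ℕ} {σ : Perm (Fin n)}

lemma exists_pow_eq_of_period {X : Type} {r : Perm X} {x y : X}
    (hx : 0 < minimalPeriod r x) (h : r.SameCycle x y) : ∃ m : ℕ, (r ^ m) x = y := by
  obtain ⟨m, rfl⟩ := h
  obtain ⟨d, rfl | rfl⟩ := m.eq_nat_or_neg
  · simp
  · refine ⟨(minimalPeriod r x - 1) * d, ?_⟩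
    have h1 : (r ^ minimalPeriod r x) x = x := by
      rw [← Perm.iterate_eq_pow]; exact iterate_minimalPeriod
    rw [zpow_neg, zpow_natCast, Perm.eq_inv_iff_eq, ← Perm.mul_apply, ← pow_add,
      show d + (minimalPeriod r x - 1) * d = minimalPeriod r x * d by
        obtain ⟨q, hq⟩ := Nat.exists_eq_succ_of_ne_zero hx.ne'
        rw [hq, Nat.succ_sub_one, Nat.succ_eq_add_one]; ring, pow_mul]
    exact (show IsFixedPt (r ^ minimalPeriod r x) x from h1).perm_pow d

lemma natPerm_pow_apply {N : ℕ} (w : Perm (Fin N)) (m : ℕ) (i : Fin N) :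
    (natPerm w ^ m) i = ((w ^ m) i : Fin N) := by
  induction m with
  | zero => rfl
  | succ m ih => rw [pow_succ', pow_succ', Perm.mul_apply, ih, natPerm_apply, Perm.mul_apply]

lemma minimalPeriod_pos_of_fixes {s : Perm ℕ} {M : ℕ} (hs : ∀ i, M ≤ i → s i = i) (x : ℕ) :
    0 < minimalPeriod s x := by
  rcases lt_or_ge x M with hx | hx
  · rw [← natPerm_toFinPerm s hs]
    set w := toFinPerm M s hs
    refine minimalPeriod_pos_of_mem_periodicPts ⟨orderOf w, orderOf_pos w, ?_⟩
    rw [IsPeriodicPt, IsFixedPt, Perm.iterate_eq_pow]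
    have := natPerm_pow_apply w (orderOf w) ⟨x, hx⟩
    rwa [pow_orderOf_eq_one] at this
  · exact minimalPeriod_pos_of_mem_periodicPts ⟨1, one_pos, hs x hx⟩

variable {g : Perm ℕ × Perm ℕ}

lemma ratio_fixes (hg : g ∈ bisymmetricGroup) : ∃ M, ∀ i, M ≤ i → ratio g i = i := by
  have h1 : {i | ratio g i ≠ i}.Finite := by
    refine (Set.Finite.preimage (f := (g.2 : Perm ℕ)) (by simp)
      (show {i | (g.1 * g.2⁻¹) i ≠ i}.Finite from hg)).subset fun i hi hc => hi ?_
    have hc' : g.1 i = g.2 i := by simpa using hc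
    rw [ratio, Perm.mul_apply, Perm.inv_eq_iff_eq, hc']
  obtain ⟨M, hM⟩ := h1.bddAbove
  refine ⟨M + 1, fun i hi => ?_⟩
  by_contra hc
  have := hM hc
  omega

section Arcs

variable (hg : chipOf n n g = leftTrivialChip σ φ k)

lemma fst_label (hg : chipOf n n g = leftTrivialChip σ φ k) (j : Fin n) : g.1 j = j := by
  have h1 := congrFun (congrFun (congrFun (congrArg Chip.arc hg) (.left, .top, j))
    (.left, .bottom, j)) 0
  have h2 : (chipOf n n g).arc (.left, .top, j) (.left, .bottom, j) 0 := by
    rw [h1]; exact Or.inl ⟨j, rfl, Or.inl ⟨rfl, rfl⟩⟩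
  have h3 : ((.left, .bottom, g.1 j) : Node) = (.left, .bottom, (j : ℕ)) := h2.2.2.1
  grind

lemma inv_lt_label (hg : chipOf n n g = leftTrivialChip σ φ k) (y : ℕ) : g.1⁻¹ y < n ↔ y < n := by
  constructor
  · intro h
    have := fst_label hg ⟨_, h⟩
    rw [show g.1 (g.1⁻¹ y) = y from apply_symm_apply _ _] at this
    grind
  · intro h
    rw [show g.1⁻¹ y = y from Perm.inv_eq_iff_eq.2 (fst_label hg ⟨y, h⟩).symm]
    exact h

lemma ratio_arc (hg : chipOf n n g = leftTrivialChip σ φ k) (j : Fin n) :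
    (ratio g ^ (φ j + 1)) j = σ j ∧ ∀ m, 0 < m → m ≤ φ j → n ≤ (ratio g ^ m) (j : ℕ) := by
  have h1 := congrFun (congrFun (congrFun (congrArg Chip.arc hg) (.right, .top, j))
    (.right, .bottom, (σ j : ℕ))) (2 * φ j)
  have h2 : (chipOf n n g).arc (.right, .top, j) (.right, .bottom, (σ j : ℕ)) (2 * φ j) := by
    rw [h1]; exact Or.inr ⟨j, rfl, Or.inl ⟨rfl, rfl⟩⟩
  have h3 : ∀ i, (advance g)^[i] (vertical g (.right, .top, (j : ℕ))) =
      (advancePerm g ^ (i + 1)) (.left, .top, (j : ℕ)) := fun i => by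
    rw [advance_iterate, pow_succ, Perm.mul_apply]; rfl
  obtain ⟨-, -, h4, h5⟩ := h2
  constructor
  · rw [h3, advance_pow_left_top'] at h4
    simp only [Prod.mk.injEq, true_and] at h4
    rw [pow_succ', Perm.mul_apply, ratio, Perm.mul_apply, ← ratio, h4, Perm.inv_eq_iff_eq]
    exact (fst_label hg (σ j)).symm
  · intro m h0 hm
    have h6 := h5 (2 * m - 1) (by omega)
    rw [h3, show 2 * m - 1 + 1 = 2 * m by omega, advance_pow_left_top] at h6
    exact not_lt.1 h6

lemma onCircle_left_top (hg : chipOf n n g = leftTrivialChip σ φ k) (y : ℕ) :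
    OnCircle n n g (.left, .top, y) ↔ ∀ m : ℕ, n ≤ (ratio g ^ m) y := by
  constructor
  · intro h m
    have := h (2 * m)
    rw [advance_iterate, advance_pow_left_top] at this
    exact not_lt.1 this
  · intro h i
    rw [advance_iterate]
    rcases Nat.even_or_odd' i with ⟨m, rfl | rfl⟩
    · rw [advance_pow_left_top]
      exact not_lt.2 (h m)
    · rw [advance_pow_left_top']
      show ¬ g.2 ((ratio g ^ m) y) < n
      rw [← inv_lt_label hg]
      have := h (m + 1)
      rw [pow_succ'] at this
      exact not_lt.2 this

lemma exists_circles (hk : ∀ j, 2 ≤ k j) (hg : chipOf n n g = leftTrivialChip σ φ k) :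
    ∃ f' : Fin p → ℕ, (∀ j, OnCircle n n g (.left, .top, f' j)) ∧
      (∀ j, minimalPeriod (ratio g) (f' j) = k j) ∧
      (∀ j j', circleOf g (.left, .top, f' j) = circleOf g (.left, .top, f' j') → j = j') ∧
      ∀ y, OnCircle n n g (.left, .top, y) → 2 ≤ minimalPeriod (ratio g) y →
        ∃ j, circleOf g (.left, .top, y) = circleOf g (.left, .top, f' j) := by
  let C : ℕ → Set (Set Node) := fun m => {C : Set Node | ∃ x, OnCircle n n g x ∧
    minimalPeriod (advance g) x = 2 * m ∧ C = circleOf g x}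
  have h1 : ∀ m, 2 ≤ m → ∃ f, Set.BijOn f {j | k j = m} (C m) := by
    intro m hm
    have h2 := congrFun (congrArg Chip.circles hg) m
    refine Set.Finite.exists_bijOn_of_encard_eq (Set.toFinite _) ?_
    have h3 : (chipOf n n g).circles m = (C m).encard := if_pos hm
    rw [← h3, h2]
    rfl
  choose! f hf using h1
  have h2 : ∀ j, ∃ y, OnCircle n n g (.left, .top, y) ∧
      minimalPeriod (ratio g) y = k j ∧ circleOf g (.left, .top, y) = f (k j) j := by
    intro j
    obtain ⟨x, hx1, hx2, hx3⟩ := (hf (k j) (hk j)).mapsTo (show j ∈ {j' | k j' = k j} from rfl)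
    have := hk j
    obtain ⟨y, hy1, hy2, hy3⟩ := exists_left_top (by omega) hx1
    rw [minimalPeriod_left_top, hx2] at hy2
    grind
  choose f' h3 h4 h5 using h2
  refine ⟨f', h3, h4, fun j j' e => ?_, fun y hy1 hy2 => ?_⟩
  · have h6 : k j = k j' := by
      have h7 : ((.left, .top, f' j') : Node) ∈ circleOf g (.left, .top, f' j) := by
        rw [e]; exact mem_circleOf_left_top.2 ⟨0, rfl⟩
      obtain ⟨i, hi⟩ := mem_circleOf_left_top.1 h7
      rw [← h4 j', ← hi, minimalPeriod_pow_apply, h4]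
    rw [h5, h5, h6] at e
    exact (hf _ (hk j')).injOn h6 rfl e
  · obtain ⟨j, hj1, hj2⟩ := (hf _ hy2).surjOn
      (show circleOf g (.left, .top, y) ∈ C _ from ⟨_, hy1, minimalPeriod_left_top y, rfl⟩)
    grind

lemma exists_model_ratio (hk : ∀ j, 2 ≤ k j) (hg : chipOf n n g = leftTrivialChip σ φ k)
    (hg' : g ∈ bisymmetricGroup) : ∃ f' : Fin p → ℕ,
      Model (ratio g) (fun i : Fin n => (i : ℕ)) f' σ φ k ∧
      ∀ y, ratio g y ≠ y →
        y ∈ Set.range (modelMap (ratio g) (fun i : Fin n => (i : ℕ)) f' : ModelType φ k → ℕ) := by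
  obtain ⟨f', h1, h2, h3, h4⟩ := exists_circles hk hg
  obtain ⟨M, hM⟩ := ratio_fixes hg'
  have hpos := minimalPeriod_pos_of_fixes hM
  have hmod : Model (ratio g) (fun i : Fin n => (i : ℕ)) f' σ φ k := by
    refine ⟨Fin.val_injective, fun i => (ratio_arc hg i).1, fun i m h0 hm => ?_, h2,
      fun j j' e => ?_, fun i j e => ?_⟩
    · rintro ⟨i', hi'⟩
      have := (ratio_arc hg i).2 m h0 hm
      grind
    · obtain ⟨m, hm⟩ := exists_pow_eq_of_period (hpos _) e
      exact h3 j j' (by rw [← hm, circleOf_left_top_pow (hpos _)])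
    · obtain ⟨m, hm⟩ := exists_pow_eq_of_period (hpos _) e.symm
      have := (onCircle_left_top hg _).1 (h1 j) m
      omega
  refine ⟨f', hmod, fun y hy => ?_⟩
  set R := Set.range (modelMap (ratio g) (fun i : Fin n => (i : ℕ)) f' : ModelType φ k → ℕ) with hR
  have hclosed : ∀ x ∈ R, ∀ m : ℕ, (ratio g ^ m) x ∈ R := by
    intro x hx m
    induction m with
    | zero => exact hx
    | succ m ih =>
      obtain ⟨u, hu⟩ := ih
      exact ⟨modelSucc σ u, by rw [← hmod.apply_modelMap, hu, pow_succ', Perm.mul_apply]⟩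
  by_cases hc : ∀ m : ℕ, n ≤ (ratio g ^ m) y
  · have h5 : minimalPeriod (ratio g) y ≠ 1 := fun e => hy (minimalPeriod_eq_one_iff_isFixedPt.1 e)
    have h6 := hpos y
    obtain ⟨j, hj⟩ := h4 y ((onCircle_left_top hg y).2 hc) (by omega)
    have h7 : ((.left, .top, y) : Node) ∈ circleOf g (.left, .top, f' j) := by
      rw [← hj]; exact mem_circleOf_left_top.2 ⟨0, rfl⟩
    obtain ⟨i, rfl⟩ := mem_circleOf_left_top.1 h7
    exact hclosed _ ⟨.inr ⟨j, ⟨0, by have := hk j; omega⟩⟩, rfl⟩ i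
  · push Not at hc
    obtain ⟨m, hm⟩ := hc
    obtain ⟨d, hd⟩ := exists_pow_eq_of_period (hpos _)
      (Perm.sameCycle_pow_left.2 (Perm.SameCycle.refl (ratio g) y) :
        (ratio g).SameCycle ((ratio g ^ m) y) y)
    rw [← hd]
    exact hclosed _ ⟨.inl ⟨⟨_, hm⟩, 0⟩, rfl⟩ d

end Arcs

lemma Model.of_natPerm {N : ℕ} {s : Perm (Fin N)} {f : Fin n → Fin N} {f' : Fin p → Fin N}
    (h : Model (natPerm s) (fun i => (f i : ℕ)) (fun j => (f' j : ℕ)) σ φ k) :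
    Model s f f' σ φ k := by
  refine ⟨fun i j e => h.inj (congrArg val e), fun i => Fin.ext ?_, fun i m h0 hm => ?_,
    fun j => ?_, fun j j' e => h.disj j j' ((sameCycle_natPerm s _ _).2 e),
    fun i j e => h.disj' i j ((sameCycle_natPerm s _ _).2 e)⟩
  · rw [← natPerm_pow_apply, h.ret]
  · rintro ⟨i', hi'⟩
    exact h.notMem i m h0 hm ⟨i', by rw [natPerm_pow_apply, ← hi']⟩
  · rw [← h.period j]
    refine minimalPeriod_eq_minimalPeriod_iff.2 fun m => ?_
    simp only [IsPeriodicPt, IsFixedPt, Perm.iterate_eq_pow, natPerm_pow_apply, Fin.ext_iff]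

/-- Every element with the given chip is, up to permutations that fix the labels, the right
multiplication by a permutation of as many points as the chip has. -/
lemma exists_representative (hk : ∀ j, 2 ≤ k j) (g : bisymmetricGroup)
    (hg : chipOf n n (g : Perm ℕ × Perm ℕ) = leftTrivialChip σ φ k)
    (hN : n ≤ chipSize φ k) :
    ∃ (a q : Perm ℕ) (s : Perm (Fin (chipSize φ k))) (K : ℕ),
      g = Seating.diag a * rightMul s * Seating.diag q ∧ (∀ i < n, a i = i) ∧
      (∀ i, K ≤ i → q i = i) ∧ (∀ i < n, q i = i) ∧ HasChip s (castLEEmb hN) σ φ k := by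
  obtain ⟨⟨h1, h2⟩, hg'⟩ := g
  obtain ⟨f', hmod, hcov⟩ := exists_model_ratio hk hg hg'
  set μ : ModelType φ k → ℕ := modelMap (ratio (h1, h2)) (fun i : Fin n => (i : ℕ)) f' with hμ
  obtain ⟨B, hB⟩ := (Set.finite_range μ).bddAbove
  have E0 : ModelType φ k ≃ Fin (chipSize φ k) := Fintype.equivFinOfCardEq (card_modelType φ k)
  obtain ⟨π, hπ⟩ := Perm.exists_extending_pair (fun i : Fin n => E0 (.inl ⟨i, 0⟩))
    (castLEEmb hN) (fun i j e => (Sigma.mk.inj (Sum.inl_injective (E0.injective e))).1) (castLEEmb hN).injective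
  let E := E0.trans π
  let K := B + 1 + chipSize φ k
  have hBK : ∀ x, μ x < K := fun x => by have := hB ⟨x, rfl⟩; omega
  obtain ⟨q0, hq0⟩ := Perm.exists_extending_pair (fun x => (⟨μ x, hBK x⟩ : Fin K))
    (fun x => ⟨E x, by have := (E x).2; omega⟩)
    (fun x y e => hmod.injective (Fin.mk.inj e))
    (fun x y e => E.injective (Fin.ext (Fin.mk.inj e)))
  set q := natPerm q0
  have hq : ∀ x, q (μ x) = E x := fun x => by
    have := natPerm_apply q0 ⟨μ x, hBK x⟩
    grind
  have hql : ∀ i < n, q i = i := fun i hi => by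
    have h4 := hq (.inl ⟨⟨i, hi⟩, 0⟩)
    rw [show E (.inl ⟨⟨i, hi⟩, 0⟩) = castLEEmb hN ⟨i, hi⟩ from hπ ⟨i, hi⟩] at h4
    exact h4
  set s0 := q * ratio (h1, h2) * q⁻¹ with hs0
  have hfix : ∀ i, chipSize φ k ≤ i → s0 i = i := by
    intro i hi
    rw [hs0, Perm.mul_apply, Perm.mul_apply]
    by_contra hc
    obtain ⟨x, hx⟩ := hcov (q⁻¹ i) fun e => hc (by rw [e]; exact apply_symm_apply _ _)
    have h5 := hq x
    rw [hx, show q (q⁻¹ i) = i from apply_symm_apply _ _] at h5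
    grind
  refine ⟨h1 * q⁻¹, q, toFinPerm _ s0 hfix, K, ?_, fun i hi => ?_, fun i hi => natPerm_fixes q0 i hi,
    hql, ?_⟩
  · refine Subtype.ext (Prod.ext ?_ ?_)
    · show h1 = h1 * q⁻¹ * 1 * q
      group
    · show h2 = h1 * q⁻¹ * natPerm _ * q
      rw [natPerm_toFinPerm, hs0, ratio]
      group
  · rw [Perm.mul_apply, Perm.inv_eq_iff_eq.2 (hql i hi).symm]
    exact fst_label hg ⟨i, hi⟩
  · refine (Model.of_natPerm (f' := fun j => E (.inr ⟨j, ⟨0, by have := hk j; omega⟩⟩)) ?_).hasChip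
    rw [natPerm_toFinPerm]
    have h6 := hmod.comp q (r' := s0) fun x => by simp [hs0]
    have h7 : (q ∘ fun i : Fin n => (i : ℕ)) = fun i => (castLEEmb hN i : ℕ) :=
      funext fun i => hql i i.2
    have h8 : q ∘ f' = fun j => (E (.inr ⟨j, ⟨0, by have := hk j; omega⟩⟩) : ℕ) :=
      funext fun j => hq (.inr ⟨j, ⟨0, by have := hk j; omega⟩⟩)
    grind

end ChipModel

/-! ## The terms of the spreaded image -/

section Reindex

variable {B B' S S' : Type} [Fintype B] [Fintype B'] [Fintype S] [Fintype S'] {N : ℕ}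

lemma splitLaw_congr (p : Perm (Fin N)) (eB : B ≃ B') (eS : S ≃ S') {blk : Fin N → B}
    (hblk : Surjective blk) {blk' : Fin N → B'} {γ : Fin N → S} {γ' : Fin N → S'}
    (h1 : ∀ k, blk' (p k) = eB (blk k)) (h2 : ∀ k, γ' (p k) = eS (γ k)) {tot : B → ℝ}
    {tot' : B' → ℝ} (ht : ∀ b, 0 < tot b) (h3 : ∀ b, tot' (eB b) = tot b) :
    splitLaw blk γ tot = (splitLaw blk' γ' tot').map fun y s => y (eS s) := by
  classical
  have hS : Measurable fun (y : S' → ℝ) s => y (eS s) :=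
    measurable_pi_lambda _ fun s => measurable_pi_apply _
  have hblk' : Surjective blk' := fun b' => by
    obtain ⟨k, hk⟩ := hblk (eB.symm b')
    grind
  have ht' : ∀ b, 0 < tot' b := fun b => by rw [← eB.apply_symm_apply b, h3]; exact ht _
  refine Measure.ext_of_lintegral _ fun h hh => ?_
  rw [lintegral_map hh hS, ← convolution_eq_splitLaw hblk γ ht,
    ← convolution_eq_splitLaw hblk' γ' ht']
  have e1 := lintegral_normalized_pi blk hblk γ ht hh
  have e2 := lintegral_normalized_pi blk' hblk' γ' ht' (hh.comp hS)
  have hc : ∏ b, ofReal (1 / (card {k // blk' k = b}).factorial) =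
      ∏ b, ofReal (1 / (card {k // blk k = b}).factorial) := by
    refine (Fintype.prod_equiv eB _ _ fun b => ?_).symm
    congr 4
    exact card_congr (p.subtypeEquiv fun k => by rw [h1, eB.apply_eq_iff_eq])
  have hc0 : ∏ b, ofReal (1 / (card {k // blk k = b}).factorial) ≠ 0 :=
    Finset.prod_ne_zero_iff.2 fun b _ => by rw [Ne, ofReal_eq_zero, not_le]; positivity
  have hct : ∏ b, ofReal (1 / (card {k // blk k = b}).factorial) ≠ ∞ :=
    ENNReal.prod_ne_top fun b _ => ofReal_ne_top
  refine (mul_right_inj hc0 hct).1 ?_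
  rw [← e1]
  refine Eq.trans ?_ (e2.trans (by rw [hc]; rfl))
  symm
  rw [← (measurePreserving_piCongrLeft (fun _ : Fin N => posVol) p).lintegral_comp_emb
    (measurableEmbedding _)]
  refine lintegral_congr fun L => ?_
  have hL : ∀ k, MeasurableEquiv.piCongrLeft (fun _ : Fin N => ℝ) p L (p k) = L k := fun k =>
    piCongrLeft_apply_apply (fun _ => ℝ) p L k
  generalize MeasurableEquiv.piCongrLeft (fun _ : Fin N => ℝ) p L = L' at hL
  have hsum : ∀ b, ∑ k, (if blk' k = eB b then L' k else 0) = ∑ k, if blk k = b then L k else 0 := by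
    intro b
    rw [← Equiv.sum_comp p]
    simp only [h1, hL, eB.apply_eq_iff_eq]
  have hiff : (∀ b, ∑ k, (if blk' k = b then L' k else 0) ≤ 1) ↔
      ∀ b, (∑ k, if blk k = b then L k else 0) ≤ 1 := by
    rw [← eB.forall_congr_right]
    simp only [hsum]
  by_cases hcc : ∀ b, (∑ k, if blk k = b then L k else 0) ≤ 1
  · rw [if_pos hcc, if_pos (hiff.2 hcc), comp_apply]
    refine congrArg h (funext fun s => ?_)
    beta_reduce
    rw [← Equiv.sum_comp p fun k => if γ' k = eS s then _ else _]
    simp only [h2, h1, hL, h3, hsum, eS.apply_eq_iff_eq]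
  all_goals grind

end Reindex

section Conjugation

variable {n N : ℕ} {r r' : Perm (Fin N)} {F F' : Fin n ↪ Fin N} {p : Perm (Fin N)}

lemma conj_pow_apply (hp : ∀ y, p (r y) = r' (p y)) (m : ℕ) (y : Fin N) :
    p ((r ^ m) y) = (r' ^ m) (p y) := by
  induction m with
  | zero => rfl
  | succ m ih => rw [pow_succ', pow_succ', Perm.mul_apply, Perm.mul_apply, hp, ih]

lemma conj_sameCycle (hp : ∀ y, p (r y) = r' (p y)) (x y : Fin N) :
    r.SameCycle x y ↔ r'.SameCycle (p x) (p y) := by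
  have hr : r' = p * r * p⁻¹ := by ext y; simp [hp]
  rw [hr, Perm.sameCycle_conj]
  simp

lemma returnTime_conj (hp : ∀ y, p (r y) = r' (p y)) (hF : ∀ i, p (F i) = F' i) (i : Fin n) :
    returnTime r' F' i = returnTime r F i := by
  have h1 := returnTime_spec r F i
  refine returnTime_eq h1.1 ?_ fun m h0 hm hc => ?_
  · obtain ⟨j, hj⟩ := h1.2
    exact ⟨j, by rw [← hF, ← hF, hj, conj_pow_apply hp]⟩
  · obtain ⟨j, hj⟩ := hc
    refine notMem_range_of_lt_returnTime h0 hm ⟨j, p.injective ?_⟩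
    rw [conj_pow_apply hp, hF, hF, hj]

lemma nextLabel_conj (hp : ∀ y, p (r y) = r' (p y)) (hF : ∀ i, p (F i) = F' i) :
    nextLabel r' F' = nextLabel r F := by
  refine Equiv.ext fun i => F'.injective ?_
  rw [nextLabel_spec, returnTime_conj hp hF, ← hF, ← conj_pow_apply hp, ← nextLabel_spec, hF]

/-- The bijection of the cycles of conjugate permutations. -/
def cyclesEquiv (hp : ∀ y, p (r y) = r' (p y)) : Cycles r ≃ Cycles r' :=
  Quotient.congr p (conj_sameCycle hp)

/-- The bijection of the label-free cycles of conjugate permutations. -/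
def freeCyclesEquiv (hp : ∀ y, p (r y) = r' (p y)) (hF : ∀ i, p (F i) = F' i) :
    FreeCycles r F ≃ FreeCycles r' F' :=
  (cyclesEquiv hp).subtypeEquiv fun C => forall_congr' fun i => by
    rw [← hF, show (Quotient.mk _ (p (F i)) : Cycles r') = cyclesEquiv hp (Quotient.mk _ (F i)) from
      rfl, Ne, Ne, (cyclesEquiv hp).apply_eq_iff_eq]

lemma seg_conj (hp : ∀ y, p (r y) = r' (p y)) (hF : ∀ i, p (F i) = F' i) (y : Fin N) :
    seg r' F' (p y) = sumCongr (Equiv.refl _) (freeCyclesEquiv hp hF) (seg r F y) := by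
  rw [seg_eq_iff]
  obtain ⟨t, ht⟩ : ∃ t, seg r F y = t := ⟨_, rfl⟩
  rw [ht]
  have h1 := seg_eq_iff.1 ht
  rcases t with i | C
  · obtain ⟨m, hm, rfl⟩ := h1
    exact ⟨m, by rwa [returnTime_conj hp hF], by rw [conj_pow_apply hp, hF]; rfl⟩
  · exact congrArg (cyclesEquiv hp) h1

end Conjugation

section Term

variable {n N : ℕ}

/-- The restaurant with new arcs and tables `y` and the remaining tables `rest`. -/
def newRestaurant {ι : Type} (q : Perm (Fin N)) (F : Fin n ↪ Fin N)
    (rest : ι → ℝ) (y : Fin n ⊕ FreeCycles q F → ℝ) : HalfRestaurant n :=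
  ofData (ι := ι ⊕ FreeCycles q F) (nextLabel q F) (fun j => y (.inl j))
    (Sum.elim rest fun C => y (.inr C))

lemma measurable_newRestaurant {ι Ω : Type} [MeasurableSpace Ω] [Countable ι]
    (q : Perm (Fin N)) (F : Fin n ↪ Fin N) {rest : Ω → ι → ℝ} (hr : Measurable rest)
    {y : Ω → Fin n ⊕ FreeCycles q F → ℝ} (hy : Measurable y) :
    Measurable fun a => newRestaurant q F (rest a) (y a) := by
  refine measurable_const.prodMk (Measurable.prodMk (measurable_pi_lambda _ fun j =>
    (measurable_pi_apply (X := fun _ : Fin n ⊕ FreeCycles q F => ℝ) (.inl j)).comp hy) ?_)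
  have h1 : Measurable fun a => Measure.sum fun i : {i : ι ⊕ FreeCycles q F // True} =>
      dirac (Sum.elim (rest a) (fun C => y a (.inr C)) i.1) := by
    refine measurable_sum_dirac (p := fun _ _ => True)
      (f := fun a => Sum.elim (rest a) fun C => y a (.inr C)) (fun _ => MeasurableSet.univ) ?_
    rintro (i | C)
    · exact (measurable_pi_apply i).comp hr
    · exact (measurable_pi_apply (.inr C)).comp hy
  have h2 : ∀ a, (Measure.sum fun i : {i : ι ⊕ FreeCycles q F // True} =>
      dirac (Sum.elim (rest a) (fun C => y a (.inr C)) i.1)) =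
      Measure.sum fun i => dirac (Sum.elim (rest a) (fun C => y a (.inr C)) i) := fun a => by
    ext B hB
    rw [Measure.sum_apply _ hB, Measure.sum_apply _ hB]
    exact (subtypeUnivEquiv fun _ => trivial).tsum_eq
      (fun i => dirac (Sum.elim (rest a) (fun C => y a (.inr C)) i) B)
  simp_rw [h2] at h1
  exact h1

/-- The contribution of the seatings with the permutation `r`, where `q = r s` is the new
permutation, `lo` are the lengths of the tables without labels that are occupied, and `rest`
are the lengths of the remaining tables. -/
def spreadTerm {ι : Type} (z : ℝ) (r s q : Perm (Fin N)) (F : Fin n ↪ Fin N)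
    (l : Fin n → ℝ) (lo : FreeCycles r F → ℝ) (rest : ι → ℝ) : Measure (HalfRestaurant n × ℝ) :=
  arrivalWeight r F l lo • ((splitLaw (seg r F) (fun u => seg q F (s⁻¹ u)) (Sum.elim l lo)).map
      (newRestaurant q F rest)).prod
    (dirac (z ^ ((card (Cycles q) : ℤ) - card (Cycles r))))

lemma spreadTerm_conj {ι ι' : Type} [Countable ι'] (z : ℝ) {r s q r' s' q' p : Perm (Fin N)}
    {F F' : Fin n ↪ Fin N}
    (hr : ∀ y, p (r y) = r' (p y)) (hs : ∀ y, p (s y) = s' (p y)) (hq : ∀ y, p (q y) = q' (p y))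
    (hF : ∀ i, p (F i) = F' i) {l : Fin n → ℝ} (hl : ∀ i, 0 < l i) {lo : FreeCycles r F → ℝ}
    (hlo : ∀ b, 0 < lo b) {lo' : FreeCycles r' F' → ℝ}
    (hlo' : ∀ b, lo' (freeCyclesEquiv hr hF b) = lo b) {rest : ι → ℝ} {rest' : ι' → ℝ} (e : ι ≃ ι')
    (he : ∀ i, rest' (e i) = rest i) :
    spreadTerm z r s q F l lo rest = spreadTerm z r' s' q' F' l lo' rest' := by
  set eB := sumCongr (Equiv.refl (Fin n)) (freeCyclesEquiv hr hF)
  set eS := sumCongr (Equiv.refl (Fin n)) (freeCyclesEquiv hq hF)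
  have htot : ∀ b, Sum.elim l lo' (eB b) = Sum.elim l lo b := by
    all_goals grind
  have hpos : ∀ b, 0 < Sum.elim l lo b := by
    all_goals grind
  have hsplit := splitLaw_congr p eB eS (surjective_seg (r := r) (F := F)) (seg_conj hr hF)
    (γ := fun u => seg q F (s⁻¹ u)) (γ' := fun u => seg q' F' (s'⁻¹ u)) (fun k => by
      rw [← seg_conj hq hF]
      congr 1
      rw [Perm.inv_eq_iff_eq, ← hs]
      simp) hpos htot
  have hw : arrivalWeight r F l lo = arrivalWeight r' F' l lo' := by
    rw [arrivalWeight, arrivalWeight]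
    congr 1
    · exact Fintype.prod_equiv (freeCyclesEquiv hr hF) _ _ fun b => by rw [hlo']
    · refine Fintype.prod_equiv eB _ _ fun b => ?_
      rw [htot, show card {k // seg r F k = b} = card {k // seg r' F' k = eB b} from
        card_congr (p.subtypeEquiv fun k => by rw [seg_conj hr hF, eB.apply_eq_iff_eq])]
  rw [spreadTerm, spreadTerm, hw, hsplit, card_congr (cyclesEquiv hr), card_congr (cyclesEquiv hq)]
  congr 2
  have : Countable ι := e.countable_iff.2 inferInstance
  have hm : Measurable (newRestaurant q F rest) :=
    measurable_newRestaurant q F measurable_const measurable_id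
  rw [map_map hm (measurable_pi_lambda _ fun s => measurable_pi_apply _)]
  congr 1
  funext y
  rw [comp_apply, newRestaurant, newRestaurant, nextLabel_conj hq hF,
    ← HalfRestaurant.ofData_comp_equiv (sumCongr e (freeCyclesEquiv hq hF))]
  congr 1
  all_goals grind

end Term

/-! ## The spreaded image as a sum over permutations -/

section Surface

variable {n N p : ℕ} {τ σ : Perm (Fin n)} {φ : Fin n → ℕ} {k : Fin p → ℕ} {D : Decorated N τ}

lemma Decorated.rotB_mul_rotA (S : CheckerSurface N) : S.rotB * S.rotA = S.rotC := by
  simp [CheckerSurface.rotA, CheckerSurface.rotB, CheckerSurface.rotC, mul_assoc]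

lemma Decorated.Admissible.omega_label (hD : D.Admissible σ φ k) (i : Fin n) :
    D.ω (D.surface.vertexB (D.F i)) = .inl (Quotient.mk _ i) := by
  have h1 := (hD.labels_B _ i).1 rfl
  obtain ⟨T, hT⟩ | ⟨ν, hν⟩ : (∃ T, D.ω (D.surface.vertexB (D.F i)) = .inl T) ∨
      ∃ ν, D.ω (D.surface.vertexB (D.F i)) = .inr ν := by
    cases D.ω (D.surface.vertexB (D.F i)) <;> simp
  · rw [hT] at h1 ⊢
    exact congrArg _ (show Quotient.mk _ i = T from h1).symm
  · rw [hν] at h1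
    exact h1.elim

lemma Decorated.Admissible.omega_free (hD : D.Admissible σ φ k) {B : Cycles D.surface.rotB}
    (hB : ∀ i, D.surface.vertexB (D.F i) ≠ B) : ∃ ν, D.ω B = .inr ν := by
  cases h : D.ω B with
  | inr ν => exact ⟨ν, rfl⟩
  | inl T =>
    induction T using inductionOn with
    | h i =>
      have := (hD.labels_B B i).2 (by rw [h]; rfl)
      exact absurd this (hB i)

lemma Decorated.mem_T {t : Fin n ⊕ D.FreeB} {y : Fin N} :
    y ∈ D.T t ↔ seg D.surface.rotB D.F (D.surface.c⁻¹ y) = t := by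
  refine Iff.trans ?_ seg_eq_iff.symm
  rcases t with i | B
  · exact exists_congr fun m => and_congr_right fun _ => by rw [Perm.inv_eq_iff_eq]
  · constructor
    · rintro ⟨w, hw, rfl⟩
      show Quotient.mk _ (D.surface.c⁻¹ (D.surface.c w)) = B.1
      rwa [show D.surface.c⁻¹ (D.surface.c w) = w from symm_apply_apply _ _]
    · exact fun h => ⟨_, h, (apply_symm_apply D.surface.c y).symm⟩

lemma Decorated.mem_R {t : Fin n ⊕ D.FreeC} {y : Fin N} :
    y ∈ D.R t ↔ seg D.surface.rotC D.F (D.surface.b⁻¹ y) = t := by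
  refine Iff.trans ?_ seg_eq_iff.symm
  rcases t with i | B
  · exact exists_congr fun m => and_congr_right fun _ => by rw [Perm.inv_eq_iff_eq]
  · constructor
    · rintro ⟨w, hw, rfl⟩
      show Quotient.mk _ (D.surface.b⁻¹ (D.surface.b w)) = B.1
      rwa [show D.surface.b⁻¹ (D.surface.b w) = w from symm_apply_apply _ _]
    · exact fun h => ⟨_, h, (apply_symm_apply D.surface.b y).symm⟩

lemma Decorated.card_T_inter_R (t : Fin n ⊕ D.FreeB) (s : Fin n ⊕ D.FreeC) :
    card ↥(D.T t ∩ D.R s) = card {u // seg D.surface.rotB D.F u = t ∧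
      seg D.surface.rotC D.F (D.surface.rotA⁻¹ u) = s} := by
  refine card_congr ((D.surface.c.symm).subtypeEquiv fun y => ?_)
  rw [Set.mem_inter_iff, mem_T, mem_R]
  have : D.surface.rotA⁻¹ (D.surface.c.symm y) = D.surface.b⁻¹ y := by
    rw [CheckerSurface.rotA, mul_inv_rev, inv_inv, Perm.mul_apply, apply_symm_apply]
  rw [this]
  rfl

lemma Decorated.card_T (t : Fin n ⊕ D.FreeB) :
    card ↥(D.T t) = card {u // seg D.surface.rotB D.F u = t} :=
  card_congr ((D.surface.c.symm).subtypeEquiv fun _ => mem_T)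

lemma Decorated.cardAut_pos (D : Decorated N τ) : 0 < D.cardAut :=
  card_pos_iff.2 ⟨⟨⟨1, fun _ => ⟨rfl, rfl, rfl⟩, fun _ => rfl, fun _ => rfl⟩⟩, inferInstance⟩

lemma Decorated.Admissible.freeLength_pos (hD : D.Admissible σ φ k) {ℓ : ℕ → ℝ}
    (hℓ : ∀ ν, 0 < ℓ ν) (B : D.FreeB) : 0 < D.freeLength ℓ B := by
  obtain ⟨ν, hν⟩ := hD.omega_free B.2
  rw [freeLength, hν]
  exact hℓ ν

lemma arrivalWeight_eq_ofReal {r : Perm (Fin N)} {F : Fin n ↪ Fin N} {l : Fin n → ℝ}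
    (hl : ∀ i, 0 < l i) {lo : FreeCycles r F → ℝ} (hlo : ∀ b, 0 < lo b) :
    arrivalWeight r F l lo = ofReal ((∏ i, l i ^ (card {u // seg r F u = .inl i} - 1) /
          ((card {u // seg r F u = .inl i} - 1).factorial : ℝ)) *
        ∏ b, lo b ^ card {u // seg r F u = .inr b} /
          ((card {u // seg r F u = .inr b} - 1).factorial : ℝ)) := by
  rw [arrivalWeight, Fintype.prod_sum_type]
  simp only [Sum.elim_inl, Sum.elim_inr]
  rw [← ofReal_prod_of_nonneg fun b _ => (hlo b).le,
    ← ofReal_prod_of_nonneg fun b _ => div_nonneg (pow_nonneg (hl b).le _)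
      (Nat.cast_nonneg _), ← ofReal_prod_of_nonneg fun b _ => div_nonneg
      (pow_nonneg (hlo b).le _) (Nat.cast_nonneg _), mul_left_comm,
    ← ofReal_mul (prod_nonneg fun b _ => (hlo b).le), ← prod_mul_distrib,
    ← ofReal_mul (prod_nonneg fun b _ => div_nonneg (pow_nonneg (hl b).le _) (Nat.cast_nonneg _))]
  congr 2
  refine prod_congr rfl fun b _ => ?_
  obtain ⟨u, hu⟩ := surjective_seg (r := r) (F := F) (.inr b)
  have h1 : 0 < card {u // seg r F u = .inr b} := card_pos_iff.2 ⟨⟨⟨u, hu⟩⟩, inferInstance⟩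
  rw [← mul_div_assoc, mul_pow_sub_one h1.ne']

lemma Decorated.Admissible.cardAut_smul_summand (hD : D.Admissible σ φ k) (z : ℝ) {l : Fin n → ℝ}
    (hl : ∀ i, 0 < l i) {ℓ : ℕ → ℝ} (hℓ : ∀ ν, 0 < ℓ ν) :
    (D.cardAut : ℝ≥0∞) • D.summand z l ℓ =
      spreadTerm z D.surface.rotB D.surface.rotA D.surface.rotC D.F l (D.freeLength ℓ)
        fun ν : {ν : ℕ // .inr ν ∉ Set.range D.ω} => ℓ ν := by
  have hpos := hD.freeLength_pos hℓ
  have hpos' : ∀ b : Fin n ⊕ FreeCycles D.surface.rotB D.F, 0 < Sum.elim l (D.freeLength ℓ) b := by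
    rintro (i | b)
    · exact hl i
    · exact hpos b
  have h1 : D.newLengths l ℓ = splitLaw (seg D.surface.rotB D.F)
      (fun u => seg D.surface.rotC D.F (D.surface.rotA⁻¹ u)) (Sum.elim l (D.freeLength ℓ)) := by
    refine Eq.trans ?_ (convolution_eq_splitLaw surjective_seg _ hpos')
    exact congrArg convolution (funext fun t => congrArg₂ dirichlet
      (funext fun s => congrArg Nat.cast (card_T_inter_R t s)) rfl)
  have h2 : (D.cardAut : ℝ≥0∞) * ofReal (D.weight l ℓ) =
      arrivalWeight D.surface.rotB D.F l (D.freeLength ℓ) := by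
    have hc : (D.cardAut : ℝ) ≠ 0 := Nat.cast_ne_zero.2 D.cardAut_pos.ne'
    refine Eq.trans ?_ (arrivalWeight_eq_ofReal hl hpos).symm
    rw [← ENNReal.ofReal_natCast, ← ofReal_mul (Nat.cast_nonneg _), weight, mul_assoc,
      ← mul_assoc, mul_one_div_cancel hc, one_mul]
    simp only [card_T]
    refine congrArg ofReal (congrArg₂ _ rfl (prod_congr rfl fun B _ => ?_))
    have : D.surface.ordB B.1 = card {u // seg D.surface.rotB D.F u = .inr B} :=
      card_congr (subtypeEquivRight fun u => ⟨fun h => seg_eq_iff.2 h, fun h => seg_eq_iff.1 h⟩)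
    rw [this]
  rw [summand, smul_smul, h2, h1]
  rfl

/-- A permutation with the labels of the table permutation `τ`, and a choice of tables for its
label-free cycles. -/
abbrev Occupation (τ : Perm (Fin n)) (F : Fin n ↪ Fin N) : Type :=
  Σ w : {w : Perm (Fin N) // nextLabel w F = τ}, FreeCycles w.1 F ↪ ℕ

variable {F : Fin n ↪ Fin N} {s q : Perm (Fin N)} {x : Occupation τ F}

/-- The permutation `q` of the triangles identifies the occupation `x` with the decorated
surface `D`. -/
structure Matches (s : Perm (Fin N)) (D : Decorated N τ) (q : Perm (Fin N))
    (x : Occupation τ F) : Prop where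
  label : ∀ i, q (F i) = D.F i
  rotA : ∀ y, q (s y) = D.surface.rotA (q y)
  rotB : ∀ y, q (x.1.1 y) = D.surface.rotB (q y)
  omega : ∀ y, ∀ C : FreeCycles x.1.1 F, Quotient.mk _ y = C.1 →
    D.ω (D.surface.vertexB (q y)) = .inr (x.2 C)

lemma Matches.omega_eq_inr (h : Matches s D q x) (hD : D.Admissible σ φ k) {y : Fin N} {ν : ℕ}
    (hy : D.ω (D.surface.vertexB (q y)) = .inr ν) :
    ∃ C : FreeCycles x.1.1 F, Quotient.mk _ y = C.1 ∧ x.2 C = ν := by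
  have hfree : ∀ i, (Quotient.mk _ (F i) : Cycles x.1.1) ≠ Quotient.mk _ y := by
    intro i e
    have h1 : D.surface.vertexB (q (F i)) = D.surface.vertexB (q y) :=
      congrArg (cyclesEquiv h.rotB) e
    rw [← h1, h.label, hD.omega_label] at hy
    cases hy
  refine ⟨⟨_, hfree⟩, rfl, ?_⟩
  have := (h.omega y ⟨_, hfree⟩ rfl).symm.trans hy
  grind

lemma Matches.spreadTerm_eq (h : Matches s D q x) (hD : D.Admissible σ φ k) (z : ℝ)
    {l : Fin n → ℝ} (hl : ∀ i, 0 < l i) {ℓ : ℕ → ℝ} (hℓ : ∀ ν, 0 < ℓ ν) :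
    spreadTerm z x.1.1 s (x.1.1 * s) F l (fun b => ℓ (x.2 b))
      (fun ν : {ν // ν ∉ Set.range x.2} => ℓ ν) = (D.cardAut : ℝ≥0∞) • D.summand z l ℓ := by
  rw [hD.cardAut_smul_summand z hl hℓ]
  have hrange : ∀ ν, ν ∉ Set.range x.2 ↔ .inr ν ∉ Set.range D.ω := by
    refine fun ν => not_congr ⟨?_, ?_⟩
    · rintro ⟨C, rfl⟩
      obtain ⟨y, hy⟩ := exists_rep C.1
      exact ⟨_, h.omega y C hy⟩
    · rintro ⟨B, hB⟩
      induction B using inductionOn with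
      | h y =>
        obtain ⟨C, -, hC⟩ := h.omega_eq_inr hD (y := q.symm y) (ν := ν) (by
          rw [apply_symm_apply]; exact hB)
        exact ⟨C, hC⟩
  refine spreadTerm_conj z h.rotB h.rotA (fun y => ?_) h.label hl (fun b => hℓ _) (fun b => ?_)
    (subtypeEquivRight hrange) fun i => rfl
  · rw [← Decorated.rotB_mul_rotA, Perm.mul_apply, h.rotB, h.rotA, Perm.mul_apply]
  · obtain ⟨C, hC⟩ := b
    induction C using inductionOn with
    | h y =>
      have := h.omega y ⟨_, by assumption⟩ rfl
      show Sum.elim _ ℓ (D.ω (D.surface.vertexB (q y))) = _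
      rw [this]
      rfl

end Surface

lemma perm_inv_apply_self {X : Type} (f : Perm X) (x : X) : f⁻¹ (f x) = x := symm_apply_apply f x

lemma perm_apply_inv_self {X : Type} (f : Perm X) (x : X) : f (f⁻¹ x) = x := apply_symm_apply f x

section Surface

variable {n N p : ℕ} {τ σ : Perm (Fin n)} {φ : Fin n → ℕ} {k : Fin p → ℕ}
  {D D' : Decorated N τ} {F : Fin n ↪ Fin N} {s q q' : Perm (Fin N)} {x y : Occupation τ F}

lemma Matches.unique (h : Matches s D q x) (h' : Matches s D q y) : x = y := by
  obtain ⟨⟨w, hw⟩, o⟩ := x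
  obtain ⟨⟨w', hw'⟩, o'⟩ := y
  obtain rfl : w = w' := Equiv.ext fun u => q.injective ((h.rotB u).trans (h'.rotB u).symm)
  obtain rfl : o = o' := by
    refine DFunLike.ext _ _ fun C => ?_
    obtain ⟨u, hu⟩ := exists_rep C.1
    exact Sum.inr_injective ((h.omega u C hu).symm.trans (h'.omega u C hu))
  rfl

lemma Matches.omega_eq (h : Matches s D q x) (hD : D.Admissible σ φ k) (h' : Matches s D' q' x)
    (hD' : D'.Admissible σ φ k) (u : Fin N) :
    D'.ω (D'.surface.vertexB (q' u)) = D.ω (D.surface.vertexB (q u)) := by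
  by_cases hu : ∃ i, (Quotient.mk _ (F i) : Cycles x.1.1) = Quotient.mk _ u
  · obtain ⟨i, hi⟩ := hu
    have h1 : D.surface.vertexB (q (F i)) = D.surface.vertexB (q u) :=
      congrArg (cyclesEquiv h.rotB) hi
    have h2 : D'.surface.vertexB (q' (F i)) = D'.surface.vertexB (q' u) :=
      congrArg (cyclesEquiv h'.rotB) hi
    rw [← h1, ← h2, h.label, h'.label, hD.omega_label, hD'.omega_label]
  · rw [h.omega u ⟨_, not_exists.1 hu⟩ rfl, h'.omega u ⟨_, not_exists.1 hu⟩ rfl]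

lemma Matches.isIso (h : Matches s D q x) (h' : Matches s D' q' x) :
    CheckerSurface.IsIso D.surface D'.surface (q' * q⁻¹)
      (D'.surface.c * (q' * q⁻¹) * D.surface.c⁻¹) := by
  have hA : ∀ u, (q' * q⁻¹) (D.surface.rotA u) = D'.surface.rotA ((q' * q⁻¹) u) := fun u => by
    have := h.rotA (q⁻¹ u)
    rw [perm_apply_inv_self] at this
    rw [← this, Perm.mul_apply, Perm.mul_apply, perm_inv_apply_self, h'.rotA]
  have hB : ∀ u, (q' * q⁻¹) (D.surface.rotB u) = D'.surface.rotB ((q' * q⁻¹) u) := fun u => by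
    have := h.rotB (q⁻¹ u)
    rw [perm_apply_inv_self] at this
    rw [← this, Perm.mul_apply, Perm.mul_apply, perm_inv_apply_self, h'.rotB]
  generalize q' * q⁻¹ = P at hA hB ⊢
  refine fun u => ⟨?_, ?_, ?_⟩
  · have h1 := hB (D.surface.c⁻¹ (D.surface.a u))
    simp only [CheckerSurface.rotB, Perm.mul_apply, perm_apply_inv_self,
      perm_inv_apply_self, Perm.eq_inv_iff_eq] at h1
    exact h1
  · have h1 := hA u
    simp only [CheckerSurface.rotA, Perm.mul_apply, Perm.eq_inv_iff_eq] at h1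
    exact h1.symm
  · simp [Perm.mul_apply]

/-- Surfaces with the same occupation are isomorphic. -/
lemma Matches.equiv (h : Matches s D q x) (hD : D.Admissible σ φ k) (h' : Matches s D' q' x)
    (hD' : D'.Admissible σ φ k) : (Decorated.isoSetoid N τ).r D D' := by
  refine ⟨_, _, h.isIso h', fun i => ?_, fun u => ?_⟩
  · rw [Perm.mul_apply, ← h.label, perm_inv_apply_self, h'.label]
  · rw [Perm.mul_apply, h.omega_eq hD h' hD', perm_apply_inv_self]

lemma Decorated.rotA_iso {P Q : Perm (Fin N)}
    (h : CheckerSurface.IsIso D.surface D'.surface P Q) (u : Fin N) :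
    P (D.surface.rotA u) = D'.surface.rotA (P u) := by
  have h1 := (h (D.surface.rotA u)).2.2
  have h2 := (h u).2.1
  simp only [CheckerSurface.rotA, Perm.mul_apply, perm_apply_inv_self] at h1 ⊢
  rw [Perm.eq_inv_iff_eq, h2, h1]

lemma Decorated.rotB_iso {P Q : Perm (Fin N)}
    (h : CheckerSurface.IsIso D.surface D'.surface P Q) (u : Fin N) :
    P (D.surface.rotB u) = D'.surface.rotB (P u) := by
  have h1 := (h (D.surface.rotB u)).1
  have h2 := (h u).2.2
  simp only [CheckerSurface.rotB, Perm.mul_apply, perm_apply_inv_self] at h1 ⊢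
  rw [Perm.eq_inv_iff_eq, h2, h1]

lemma Matches.of_equiv (h : Matches s D q x) (h' : (Decorated.isoSetoid N τ).r D D') :
    ∃ q', Matches s D' q' x := by
  obtain ⟨P, Q, h1, h2, h3⟩ := h'
  refine ⟨P * q, fun i => ?_, fun u => ?_, fun u => ?_, fun u C hC => ?_⟩
  · rw [Perm.mul_apply, h.label, h2]
  · rw [Perm.mul_apply, h.rotA, Decorated.rotA_iso h1, Perm.mul_apply]
  · rw [Perm.mul_apply, h.rotB, Decorated.rotB_iso h1, Perm.mul_apply]
  · rw [Perm.mul_apply, h3, h.omega u C hC]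

lemma Matches.card_eq_cardAut (h : Matches s D q x) (hD : D.Admissible σ φ k) :
    card {q' // Matches s D q' x} = D.cardAut := by
  symm
  refine Nat.card_eq_of_bijective (fun a => ⟨a.1.1 * q, fun i => ?_, fun u => ?_, fun u => ?_,
    fun u C hC => ?_⟩) ⟨?_, ?_⟩
  · rw [Perm.mul_apply, h.label, a.2.2.1]
  · rw [Perm.mul_apply, h.rotA, Decorated.rotA_iso a.2.1, Perm.mul_apply]
  · rw [Perm.mul_apply, h.rotB, Decorated.rotB_iso a.2.1, Perm.mul_apply]
  · rw [Perm.mul_apply, a.2.2.2, h.omega u C hC]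
  · rintro ⟨⟨P, Q⟩, h1, h2⟩ ⟨⟨P', Q'⟩, h1', h2'⟩ e
    obtain rfl : P = P' := mul_right_cancel (congrArg Subtype.val e)
    obtain rfl : Q = Q' := Equiv.ext fun u => by
      have := ((h1 (D.surface.a⁻¹ u)).1).symm.trans (h1' (D.surface.a⁻¹ u)).1
      simpa using this
    rfl
  · rintro ⟨q', h'⟩
    refine ⟨⟨(q' * q⁻¹, _), h.isIso h', fun i => ?_, fun u => hD.injective ?_⟩, ?_⟩
    · rw [Perm.mul_apply, ← h.label, perm_inv_apply_self, h'.label, h.label]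
    · rw [Perm.mul_apply, h.omega_eq hD h' hD, perm_apply_inv_self]
    · simp

/-- Every surface with the given chip arises from some occupation. -/
lemma exists_matches (hD : D.Admissible σ φ k) (hq : ∀ i, q (F i) = D.F i)
    (hs : ∀ y, q (s y) = D.surface.rotA (q y)) : ∃ x : Occupation τ F, Matches s D q x := by
  set w := q⁻¹ * D.surface.rotB * q with hw
  have hB : ∀ y, q (w y) = D.surface.rotB (q y) := fun y => by simp [hw]
  have hfree : ∀ C : FreeCycles w F, ∃ ν, D.ω (cyclesEquiv hB C.1) = .inr ν := fun C =>
    hD.omega_free (freeCyclesEquiv hB hq C).2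
  choose o ho using hfree
  refine ⟨⟨⟨w, ?_⟩, ⟨o, fun C C' e => ?_⟩⟩, hq, hs, hB, fun y C hC => ?_⟩
  · rw [← hD.next_B, ← nextLabel_conj hB hq]
  · refine Subtype.ext ((cyclesEquiv hB).injective (hD.injective ?_))
    grind
  · show D.ω (cyclesEquiv hB (Quotient.mk _ y)) = _
    rw [hC, ho]
    rfl

/-- Every occupation arises from some surface. -/
lemma exists_decorated (hs : HasChip s F σ φ k) (x : Occupation τ F) :
    ∃ D : Decorated N τ, D.Admissible σ φ k ∧ Matches s D 1 x := by
  classical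
  obtain ⟨⟨w, rfl⟩, o⟩ := x
  let ω : Cycles w → Cycles (nextLabel w F) ⊕ ℕ := fun B =>
    if h : ∃ i, (Quotient.mk _ (F i) : Cycles w) = B then .inl (Quotient.mk _ h.choose)
    else .inr (o ⟨B, not_exists.1 h⟩)
  have hl : ∀ i, ω (Quotient.mk _ (F i)) = .inl (Quotient.mk _ i) := fun i => by
    have h : ∃ j, (Quotient.mk _ (F j) : Cycles w) = Quotient.mk _ (F i) := ⟨i, rfl⟩
    simp only [ω, dif_pos h]
    exact congrArg _ (mk_eq_mk_iff.2 (sameCycle_nextLabel.2 h.choose_spec))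
  have hr : ∀ C : FreeCycles w F, ω C.1 = .inr (o C) := fun C => dif_neg (not_exists.2 C.2)
  have hcase : ∀ B, (∃ i, (Quotient.mk _ (F i) : Cycles w) = B) ∨ ∃ C : FreeCycles w F, C.1 = B :=
    fun B => (em _).imp_right fun h => ⟨⟨B, not_exists.1 h⟩, rfl⟩
  let D : Decorated N (nextLabel w F) := ⟨⟨1, w * s, w⟩, F, ω⟩
  have hA : D.surface.rotA = s := inv_mul_cancel_left w s
  have hc : HasChip D.surface.rotA D.F σ φ k := by rw [hA]; exact hs
  refine ⟨D, ⟨hc.1, hc.2.1, hc.2.2, ?_, ?_, rfl⟩, fun i => rfl, fun y => ?_, fun y => rfl,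
    fun y C hC => ?_⟩
  · intro (B : Cycles w) (B' : Cycles w) (e : ω B = ω B')
    rcases hcase B with ⟨i, rfl⟩ | ⟨C, rfl⟩ <;> rcases hcase B' with ⟨j, rfl⟩ | ⟨C', rfl⟩
    · rw [hl, hl] at e
      exact sameCycle_nextLabel.1 (mk_eq_mk_iff.1 (Sum.inl_injective e))
    · rw [hl, hr] at e; cases e
    · rw [hl, hr] at e; cases e
    all_goals grind
  · intro (B : Cycles w) i
    show (Quotient.mk _ (F i) : Cycles w) = B ↔ i ∈ guests (ω B)
    rcases hcase B with ⟨j, rfl⟩ | ⟨C, rfl⟩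
    · rw [hl]
      exact sameCycle_nextLabel.symm.trans mk_eq_mk_iff.symm
    · rw [hr]
      exact ⟨fun e => C.2 i e, fun e => e.elim⟩
  · rw [hA]; rfl
  · show ω (Quotient.mk _ y) = _
    grind

end Surface

section Sum

variable {n p : ℕ} {τ σ : Perm (Fin n)} {φ : Fin n → ℕ} {k : Fin p → ℕ}
  {F : Fin n ↪ Fin (chipSize φ k)} {s : Perm (Fin (chipSize φ k))}

/-- The spreaded image is the sum of the contributions of all occupations. -/
lemma sum_spreadTerm (hk : ∀ j, 0 < k j) (hs : HasChip s F σ φ k) (z : ℝ) {l : Fin n → ℝ}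
    (hl : ∀ i, 0 < l i) {ℓ : ℕ → ℝ} (hℓ : ∀ ν, 0 < ℓ ν) :
    (Measure.sum fun x : Occupation τ F => spreadTerm z x.1.1 s (x.1.1 * s) F l (fun b => ℓ (x.2 b))
      (fun ν : {ν // ν ∉ Set.range x.2} => ℓ ν)) = spreadedImage z σ φ k τ l ℓ := by
  obtain ⟨f', hmod⟩ := hs.exists_model
  let out : Decorated.Classes (chipSize φ k) τ σ φ k → Decorated (chipSize φ k) τ :=
    fun X => (Quotient.out X).1
  have hout : ∀ X, (out X).Admissible σ φ k := fun X => (Quotient.out X).2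
  let Pt : Decorated.Classes (chipSize φ k) τ σ φ k → Type := fun X =>
    {q : Perm (Fin (chipSize φ k)) //
      (∀ i, q (F i) = (out X).F i) ∧ ∀ y, q (s y) = (out X).surface.rotA (q y)}
  have hPt : ∀ X, card (Pt X) =
      (∏ j, k j) * ∏ m ∈ univ.image k, (card {j // k j = m}).factorial := by
    intro X
    have hX : HasChip (out X).surface.rotA (out X).F σ φ k :=
      ⟨(hout X).next_A, (hout X).between_A, (hout X).vertices_A⟩
    obtain ⟨g', hmod'⟩ := hX.exists_model
    obtain ⟨c, hc1, hc2, -⟩ := hmod.exists_conj hmod' hk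
    rw [← hmod.card_centralizer hk]
    symm
    refine Nat.card_eq_of_bijective (fun d => ⟨c * d.1, fun i => ?_, fun y => ?_⟩) ⟨?_, ?_⟩
    · rw [Perm.mul_apply, d.2.2, hc2]
    · rw [Perm.mul_apply, d.2.1, hc1, Perm.mul_apply]
    · intro d d' e
      exact Subtype.ext (mul_left_cancel (congrArg Subtype.val e))
    · rintro ⟨q, h1, h2⟩
      refine ⟨⟨c⁻¹ * q, fun y => ?_, fun i => ?_⟩, Subtype.ext (mul_inv_cancel_left c q)⟩
      · rw [Perm.mul_apply, h2, Perm.inv_eq_iff_eq, hc1]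
        simp
      · rw [Perm.mul_apply, h1, Perm.inv_eq_iff_eq, hc2]
  have hocc : ∀ y : Σ X, Pt X, ∃ x : Occupation τ F, Matches s (out y.1) y.2.1 x := fun y =>
    exists_matches (hout y.1) y.2.2.1 y.2.2.2
  choose occ hocc using hocc
  have hfib : ∀ x : Occupation τ F, ∃ X, (∀ y, occ y = x → y.1 = X) ∧
      card {y // occ y = x} = (out X).cardAut ∧
      spreadTerm z x.1.1 s (x.1.1 * s) F l (fun b => ℓ (x.2 b))
        (fun ν : {ν // ν ∉ Set.range x.2} => ℓ ν) =
      ((out X).cardAut : ℝ≥0∞) • (out X).summand z l ℓ := by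
    intro x
    obtain ⟨D, hD, hDx⟩ := exists_decorated hs x
    let X : Decorated.Classes (chipSize φ k) τ σ φ k := Quotient.mk _ ⟨D, hD⟩
    have hX : (Decorated.isoSetoid _ τ).r D (out X) :=
      (Decorated.isoSetoid _ τ).symm (Quotient.exact (s := (Decorated.isoSetoid _ τ).comap
        (Subtype.val : {x : Decorated (chipSize φ k) τ // x.Admissible σ φ k} → _)) (out_eq X))
    obtain ⟨q, hq⟩ := hDx.of_equiv hX
    have huniq : ∀ y, occ y = x → y.1 = X := by
      rintro ⟨X', q'⟩ rfl
      refine (out_eq X').symm.trans (Eq.trans ?_ (out_eq X))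
      exact sound ((hocc ⟨X', q'⟩).equiv (hout X') hq (hout X))
    refine ⟨X, huniq, ?_, hq.spreadTerm_eq (hout X) z hl hℓ⟩
    rw [← hq.card_eq_cardAut (hout X)]
    symm
    refine Nat.card_eq_of_bijective (fun d => ⟨⟨X, ⟨d.1, d.2.label, d.2.rotA⟩⟩,
      Matches.unique (hocc ⟨X, ⟨d.1, d.2.label, d.2.rotA⟩⟩) d.2⟩) ⟨?_, ?_⟩
    · intro d d' e
      grind
    · rintro ⟨⟨X', q'⟩, hy⟩
      have hXX : X' = X := huniq _ hy
      clear_value X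
      subst hXX
      exact ⟨⟨q'.1, hy ▸ hocc ⟨X', q'⟩⟩, rfl⟩
  refine Measure.ext fun B hB => ?_
  have hfin : ∀ X, Finite (Pt X) := fun X => Subtype.finite
  have e1 : ∑' y : Σ X, Pt X, (out y.1).summand z l ℓ B =
      ∑' X, (card (Pt X) : ℝ≥0∞) * (out X).summand z l ℓ B := by
    rw [tsum_sigma']
    simp
  have e2 : ∑' y : Σ X, Pt X, (out y.1).summand z l ℓ B =
      ∑' x : Occupation τ F, spreadTerm z x.1.1 s (x.1.1 * s) F l (fun b => ℓ (x.2 b))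
        (fun ν : {ν // ν ∉ Set.range x.2} => ℓ ν) B := by
    rw [← (sigmaFiberEquiv occ).tsum_eq, tsum_sigma']
    refine tsum_congr fun x => ?_
    obtain ⟨X, h1, h2, h3⟩ := hfib x
    rw [h3, Measure.smul_apply, smul_eq_mul, ← h2]
    have hf : Finite {y // occ y = x} := Nat.finite_of_card_ne_zero
      (by rw [h2]; exact (Decorated.cardAut_pos _).ne')
    have := Fintype.ofFinite {y // occ y = x}
    rw [tsum_fintype, card_eq_fintype_card, ← nsmul_eq_mul, ← card_univ, ← sum_const]
    refine sum_congr rfl fun y _ => ?_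
    rw [← h1 y.1 y.2]
    rfl
  rw [Measure.sum_apply _ hB, ← e2, e1, spreadedImage, Measure.smul_apply, Measure.sum_apply _ hB,
    nsmul_eq_mul]
  simp_rw [hPt]
  rw [ENNReal.tsum_mul_left]

end Sum

/-! ## The kernel -/

section Rearrangement

/-- The `k`-th largest atom of a point configuration on the positive half-line. -/
def largestAtom (η : Measure ℝ) (k : ℕ) : ℝ :=
  (⨆ q : ℚ, {η : Measure ℝ | (k + 1 : ℝ≥0∞) ≤ η (Ici (q : ℝ))}.indicator
    (fun _ => ofReal q) η).toReal

lemma measurable_largestAtom : Measurable largestAtom := by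
  refine measurable_pi_lambda _ fun k => Measurable.ennreal_toReal (Measurable.iSup fun q => ?_)
  exact measurable_const.indicator
    (measurableSet_le measurable_const (measurable_coe measurableSet_Ici))

lemma exists_antitone_rearrangement {ℓ : ℕ → ℝ} (hℓ : ∀ ν, 0 < ℓ ν) (hs : Summable ℓ) :
    ∃ π : ℕ ≃ ℕ, Antitone (ℓ ∘ π) := by
  let f : ℕ → ℝ ×ₗ ℕ := fun ν => toLex (-ℓ ν, ν)
  have hf : Injective f := fun ν μ h => congrArg (fun x => (ofLex x).2) h
  have hle : ∀ {ν μ}, f ν ≤ f μ → ℓ μ ≤ ℓ ν := fun {ν μ} h => by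
    rcases (Prod.Lex.le_iff.1 h) with h | h
    · exact neg_le_neg_iff.1 (le_of_lt h)
    · exact neg_le_neg_iff.1 (le_of_eq h.1)
  have hfin : ∀ a, {ν | ℓ a ≤ ℓ ν}.Finite := fun a => by
    have h1 := hs.tendsto_cofinite_zero.eventually (gt_mem_nhds (hℓ a))
    exact (Filter.eventually_cofinite.1 h1).subset fun ν hν => not_lt.2 hν
  let T := Set.range f
  have hIic : ∀ a : T, (Iic a).Finite := by
    rintro ⟨_, a, rfl⟩
    refine ((hfin a).image fun ν => (⟨f ν, ν, rfl⟩ : T)).subset ?_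
    rintro ⟨_, ν, rfl⟩ h
    exact ⟨ν, hle h, rfl⟩
  let := LocallyFiniteOrder.ofFiniteIcc fun a b : T => (hIic b).subset Set.Icc_subset_Iic_self
  let : SuccOrder T := LinearLocallyFiniteOrder.succOrder T
  have : NoMaxOrder T := ⟨by
    rintro ⟨_, a, rfl⟩
    obtain ⟨ν, hν⟩ := (hfin a).infinite_compl.nonempty
    exact ⟨⟨f ν, ν, rfl⟩, not_le.1 fun h => hν (hle h)⟩⟩
  obtain ⟨m, hm, hm'⟩ := Set.exists_min_image (Iic (⟨f 0, 0, rfl⟩ : T)) id (hIic _)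
    ⟨_, Set.mem_Iic.2 le_rfl⟩
  let : PredOrder T := LinearLocallyFiniteOrder.predOrder T
  let : OrderBot T :=
    { bot := m, bot_le := fun a => (le_total a ⟨f 0, 0, rfl⟩).elim (hm' a) fun h => le_trans hm h }
  let o := orderIsoNatOfLinearSuccPredArch (ι := T)
  let e := ofInjective f hf
  refine ⟨o.symm.toEquiv.trans e.symm, fun i j hij => hle ?_⟩
  have h1 : ∀ x, f (e.symm x) = x := fun x => congrArg Subtype.val (e.apply_symm_apply x)
  rw [trans_apply, trans_apply, h1, h1]
  exact o.symm.monotone hij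

lemma exists_largestAtom_eq {ℓ : ℕ → ℝ} (hℓ : ∀ ν, 0 < ℓ ν) (hs : Summable ℓ) :
    ∃ π : ℕ ≃ ℕ, largestAtom (Measure.sum fun ν => dirac (ℓ ν)) = ℓ ∘ π := by
  obtain ⟨π, hπ⟩ := exists_antitone_rearrangement hℓ hs
  refine ⟨π, funext fun k => ?_⟩
  have h1 : ∀ q : ℚ, (k + 1 : ℝ≥0∞) ≤ (Measure.sum fun ν => dirac (ℓ ν)) (Ici (q : ℝ)) ↔
      (q : ℝ) ≤ ℓ (π k) := by
    intro q
    rw [Measure.sum_apply _ measurableSet_Ici, ← π.tsum_eq]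
    simp only [dirac_apply' _ measurableSet_Ici]
    constructor
    · intro h
      by_contra hc
      rw [tsum_eq_sum (s := range k)] at h
      · have h2 : ∑ j ∈ range k, (Ici (q : ℝ)).indicator (1 : ℝ → ℝ≥0∞) (ℓ (π j)) ≤ k := by
          refine (Finset.sum_le_sum fun j _ =>
            Set.indicator_le_self (M := ℝ≥0∞) (Ici (q : ℝ)) 1 (ℓ (π j))).trans ?_
          simp
        have h3 := h.trans h2
        norm_cast at h3
        omega
      · intro j hj
        refine indicator_of_notMem (fun hj' => hc ?_) _
        exact hj'.trans (hπ (not_lt.1 fun h => hj (mem_range.2 h)))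
    · intro h
      refine le_trans ?_ (ENNReal.sum_le_tsum (range (k + 1)))
      rw [sum_congr rfl fun j hj => indicator_of_mem
        (show ℓ (π j) ∈ Ici (q : ℝ) from h.trans (hπ (Finset.mem_range_succ_iff.1 hj))) _]
      simp
  rw [largestAtom, comp_apply, ← toReal_ofReal (hℓ (π k)).le]
  congr 1
  refine le_antisymm (iSup_le fun q => ?_) (le_of_forall_lt fun x hx => ?_)
  · exact Set.indicator_apply_le' (fun h => ENNReal.ofReal_le_ofReal ((h1 q).1 h)) fun _ => zero_le
  · obtain ⟨q, hq0, hq1, hq2⟩ := ENNReal.lt_iff_exists_rat_btwn.1 hx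
    refine hq1.trans_le (le_iSup_of_le q ?_)
    rw [indicator_of_mem]
    · exact le_rfl
    · refine (h1 q).2 ?_
      by_contra hc
      exact hq2.not_ge (ENNReal.ofReal_le_ofReal (not_le.1 hc).le)

end Rearrangement

section Kernel

variable {n N : ℕ} {τ : Perm (Fin n)}

lemma newRestaurant_comp_equiv {ι ι' : Type} (q : Perm (Fin N)) (F : Fin n ↪ Fin N)
    (e : ι ≃ ι') (rest : ι' → ℝ) :
    newRestaurant q F (fun i => rest (e i)) = newRestaurant q F rest := by
  funext y
  rw [newRestaurant, newRestaurant, ← HalfRestaurant.ofData_comp_equiv (sumCongr e (Equiv.refl _))]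
  congr 1
  grind

lemma spreadTerm_comp_equiv {ι ι' : Type} (z : ℝ) (r s q : Perm (Fin N)) (F : Fin n ↪ Fin N)
    (l : Fin n → ℝ) (lo : FreeCycles r F → ℝ) (e : ι ≃ ι') (rest : ι' → ℝ) :
    spreadTerm z r s q F l lo (fun i => rest (e i)) = spreadTerm z r s q F l lo rest := by
  rw [spreadTerm, spreadTerm, newRestaurant_comp_equiv]

lemma spreadTerm_apply {ι : Type} [Countable ι] (z : ℝ) (r s q : Perm (Fin N))
    (F : Fin n ↪ Fin N) (l : Fin n → ℝ) (lo : FreeCycles r F → ℝ) (rest : ι → ℝ)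
    {B : Set (HalfRestaurant n × ℝ)} (hB : MeasurableSet B) :
    spreadTerm z r s q F l lo rest B = arrivalWeight r F l lo *
      ∫⁻ y, B.indicator 1 (newRestaurant q F rest y, z ^ ((card (Cycles q) : ℤ) - card (Cycles r)))
        ∂splitLaw (seg r F) (fun u => seg q F (s⁻¹ u)) (Sum.elim l lo) := by
  have := isProbabilityMeasure_splitLaw surjective_seg (fun u => seg q F (s⁻¹ u))
    (Sum.elim l lo : Fin n ⊕ FreeCycles r F → ℝ)
  have hm : Measurable (newRestaurant q F rest) :=
    measurable_newRestaurant q F measurable_const measurable_id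
  have := Measure.isProbabilityMeasure_map (μ := splitLaw (seg r F) (fun u => seg q F (s⁻¹ u))
    (Sum.elim l lo)) hm.aemeasurable
  rw [spreadTerm, Measure.smul_apply, smul_eq_mul, Measure.prod_dirac,
    ← lintegral_indicator_one hB, lintegral_map (measurable_one.indicator hB) (by fun_prop)]
  congr 1
  exact lintegral_map ((measurable_one.indicator hB).comp (by fun_prop)) hm

/-- The sum of the contributions of all occupations of the restaurant `τ, l, ℓ`. -/
def spreadSum (z : ℝ) (s : Perm (Fin N)) (F : Fin n ↪ Fin N)
    (τ : Perm (Fin n)) (l : Fin n → ℝ) (ℓ : ℕ → ℝ) : Measure (HalfRestaurant n × ℝ) :=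
  Measure.sum fun x : Occupation τ F => spreadTerm z x.1.1 s (x.1.1 * s) F l (fun b => ℓ (x.2 b))
    (fun ν : {ν // ν ∉ Set.range x.2} => ℓ ν)

lemma measurable_spreadSum (z : ℝ) (s : Perm (Fin N)) (F : Fin n ↪ Fin N) (τ : Perm (Fin n)) :
    Measurable fun a : (Fin n → ℝ) × (ℕ → ℝ) => spreadSum z s F τ a.1 a.2 := by
  refine Measure.measurable_of_measurable_coe _ fun B hB => ?_
  simp only [spreadSum, Measure.sum_apply _ hB, spreadTerm_apply _ _ _ _ _ _ _ _ hB]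
  refine Measurable.tsum fun x => ?_
  have hlo : Measurable fun (a : (Fin n → ℝ) × (ℕ → ℝ)) (b : FreeCycles x.1.1 F) => a.2 (x.2 b) :=
    measurable_pi_lambda _ fun b => (measurable_pi_apply _).comp measurable_snd
  refine (measurable_arrivalWeight _ _ measurable_fst hlo).mul
    (measurable_lintegral_splitLaw surjective_seg _ (measurable_sumElim measurable_fst hlo) ?_)
  refine (measurable_one.indicator hB).comp (Measurable.prodMk ?_ measurable_const)
  exact measurable_newRestaurant _ _ (measurable_pi_lambda _ fun ν =>
    (measurable_pi_apply _).comp (measurable_snd.comp measurable_fst)) measurable_snd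

lemma spreadSum_comp (z : ℝ) (s : Perm (Fin N)) (F : Fin n ↪ Fin N)
    (τ : Perm (Fin n)) (l : Fin n → ℝ) (ℓ : ℕ → ℝ) (π : ℕ ≃ ℕ) :
    spreadSum z s F τ l (ℓ ∘ π) = spreadSum z s F τ l ℓ := by
  let E : Occupation τ F ≃ Occupation τ F :=
    sigmaCongrRight fun w => embeddingCongr (Equiv.refl _) π
  refine Measure.ext fun B hB => ?_
  symm
  rw [spreadSum, spreadSum, Measure.sum_apply _ hB, Measure.sum_apply _ hB, ← E.tsum_eq]
  refine tsum_congr fun x => ?_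
  have h1 : ∀ ν, ν ∉ Set.range x.2 ↔ π ν ∉ Set.range (E x).2 := fun ν => by
    refine not_congr (exists_congr fun b => ?_)
    exact π.apply_eq_iff_eq.symm
  exact congrArg (fun m : Measure _ => m B) (spreadTerm_comp_equiv z x.1.1 s (x.1.1 * s) F l (fun b => ℓ (π (x.2 b)))
    (π.subtypeEquiv h1) fun ν : {ν // ν ∉ Set.range (E x).2} => ℓ ν).symm

end Kernel

/-! ## The half-occupied restaurant of a point of the product space -/

lemma Seating.sum_arc (S : Seating) (N : ℕ) : ∑ i ∈ range N, S.arc N i =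
    ∑ i ∈ range N with ∀ j < i, S.tab j ≠ S.tab i, S.D i i := by
  induction N with
  | zero => simp
  | succ N ih =>
    rw [sum_filter, sum_range_succ, sum_range_succ, ← sum_filter, ← ih]
    simp only [← S.virt_succ_self_iff N]
    by_cases h : S.virt.perm (N + 1) N = N
    · rw [if_pos h]
      congr 1
      · refine sum_congr rfl fun i hi => S.arc_succ_of_ne (mem_range.1 hi) fun e => ?_
        rw [(S.virt.perm (N + 1)).injective (e.trans h.symm)] at hi
        simp at hi
      · rw [Seating.arc, h]
    · rw [if_neg h, add_zero]
      obtain ⟨j, hj⟩ := (S.virt.perm (N + 1)).surjective N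
      have hjN : j < N := by
        have h1 : j < N + 1 := by
          by_contra hc
          rw [S.virt.fixes _ _ (not_lt.1 hc)] at hj
          omega
        grind
      rw [S.arc_succ_last hjN hj, ← Finset.add_sum_erase _ _ (mem_range.2 hjN),
        ← Finset.add_sum_erase _ _ (mem_range.2 hjN), S.arc_succ_of_eq hj]
      have : ∑ x ∈ (range N).erase j, S.arc (N + 1) x = ∑ x ∈ (range N).erase j, S.arc N x := by
        refine sum_congr rfl fun i hi => ?_
        rw [mem_erase] at hi
        exact S.arc_succ_of_ne (mem_range.1 hi.2) fun e =>
          hi.1 ((S.virt.perm (N + 1)).injective (e.trans hj.symm))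
      rw [this]
      ring

section Restaurant

variable {ℓ U : ℕ → ℝ}

lemma nonempty_equiv_free {n : ℕ} (κ : Fin n → ℕ) : Nonempty (ℕ ≃ {ν // ∀ i, κ i ≠ ν}) := by
  have : Infinite {ν // ∀ i, κ i ≠ ν} := by
    have := (Set.finite_range κ).infinite_compl.to_subtype
    refine Infinite.of_injective (fun x : ↥(Set.range κ)ᶜ => (⟨x, fun i e => x.2 ⟨i, e⟩⟩ :
      {ν // ∀ i, κ i ≠ ν})) fun x y e => Subtype.ext (Subtype.mk.inj e)
  exact nonempty_equiv_of_countable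

lemma hasSum_free (hℓ : GoodSticks ℓ) (hU : GoodPoints U) (n : ℕ) :
    HasSum (fun ν : {ν // ∀ i : Fin n, tabOf ℓ (U i) ≠ ν} => ℓ ν) (1 - ∑ i, arcFin ℓ n U i) := by
  classical
  let t : ℕ → ℕ := fun i => tabOf ℓ (U i)
  obtain ⟨O, hO⟩ : ∃ O, O = (range n).filter fun i => ∀ j < i, t j ≠ t i := ⟨_, rfl⟩
  have hinj : Set.InjOn t O := by
    intro i hi j hj e
    simp only [hO, Finset.coe_filter, mem_ofPred_eq] at hi hj
    all_goals grind
  have hsum : ∑ i, arcFin ℓ n U i = ∑ ν ∈ O.image t, ℓ ν := by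
    rw [Finset.sum_image hinj]
    have h1 := (seating hℓ hU).sum_arc n
    rw [← Fin.sum_univ_eq_sum_range (fun i => (seating hℓ hU).arc n i)] at h1
    refine Eq.trans (sum_congr rfl fun i _ => ?_) (h1.trans ?_)
    · rw [arcFin, paint_eq hℓ hU]
      rfl
    · rw [hO]
      exact sum_congr rfl fun i _ => seating_D_self hℓ hU i
  have hmem : ∀ ν, ν ∉ O.image t ↔ ∀ i : Fin n, t i ≠ ν := by
    intro ν
    refine ⟨fun h i e => h ?_, fun h h' => ?_⟩
    · have hex : ∃ i, t i = ν := ⟨i, e⟩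
      have hle : find hex ≤ i := Nat.find_min' hex e
      refine mem_image.2 ⟨find hex, ?_, find_spec hex⟩
      rw [hO]
      refine mem_filter.2 ⟨mem_range.2 (hle.trans_lt i.2), fun j hj e' => ?_⟩
      exact Nat.find_min hex hj (e'.trans (find_spec hex))
    · obtain ⟨i, hi, e⟩ := mem_image.1 h'
      rw [hO] at hi
      exact h ⟨i, mem_range.1 (mem_filter.1 hi).1⟩ e
  have h1 : HasSum (fun ν : {ν // ν ∉ O.image t} => ℓ ν) (1 - ∑ i, arcFin ℓ n U i) := by
    rw [(O.image t).hasSum_compl_iff, hsum, sub_add_cancel]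
    exact hℓ.2
  exact ((subtypeEquivRight hmem).hasSum_iff
    (f := fun ν : {ν // ∀ i : Fin n, tabOf ℓ (U i) ≠ ν} => ℓ ν)).1 h1

lemma isRestaurant_free (hℓ : GoodSticks ℓ) (hU : GoodPoints U) {n : ℕ}
    (e : ℕ ≃ {ν // ∀ i : Fin n, tabOf ℓ (U i) ≠ ν}) :
    IsRestaurant (arcFin ℓ n U) fun m => ℓ (e m) :=
  ⟨arcFin_pos hℓ hU, fun _ => hℓ.1 _, e.hasSum_iff.2 (hasSum_free hℓ hU n)⟩

lemma forget_paint_equiv (hℓ : GoodSticks ℓ) (hU : GoodPoints U) (hE : EquiPoints U) {n : ℕ}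
    (e : ℕ ≃ {ν // ∀ i : Fin n, tabOf ℓ (U i) ≠ ν}) :
    forget n (paint (ℓ, U)) = ofData ((paint (ℓ, U)).fin n) (arcFin ℓ n U) fun m => ℓ (e m) := by
  rw [forget_paint hℓ hU hE]
  exact (HalfRestaurant.ofData_comp_equiv e _ _ fun ν => ℓ ν).symm

lemma Config.tables_eq_iff (hℓ : GoodSticks ℓ) (hU : GoodPoints U) {n : ℕ}
    {τ : Perm (Fin n)} {κ : Fin n → ℕ} (hc : Config ℓ τ κ U) (i j : Fin n) :
    κ i = κ j ↔ τ.SameCycle i j := by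
  rw [← hc.1, sameCycle_fin_iff, paint_eq hℓ hU,
    (seating hℓ hU).sameCycle_virt_iff i.2 j.2, ← hc.2, ← hc.2]
  rfl

end Restaurant

section Kernel

variable {n N : ℕ}

/-- The spreaded image of a half-occupied restaurant, as a function of the restaurant. -/
def spread (z : ℝ) (s : Perm (Fin N)) (F : Fin n ↪ Fin N)
    (t : HalfRestaurant n) : Measure (HalfRestaurant n × ℝ) :=
  spreadSum z s F t.1 t.2.1 (largestAtom t.2.2)

lemma measurable_spread (z : ℝ) (s : Perm (Fin N)) (F : Fin n ↪ Fin N) :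
    Measurable (spread z s F) := by
  have h1 : ∀ τ, Measurable fun a : (Fin n → ℝ) × Measure ℝ =>
      spreadSum z s F τ a.1 (largestAtom a.2) := fun τ => by
    have h := measurable_spreadSum z s F τ
    generalize spreadSum z s F τ = f at h
    exact h.comp (measurable_fst.prodMk (measurable_largestAtom.comp measurable_snd))
  unfold spread
  exact measurable_from_prod_countable_right h1

lemma spread_ofData (z : ℝ) (s : Perm (Fin N)) (F : Fin n ↪ Fin N)
    (τ : Perm (Fin n)) (l : Fin n → ℝ) {ℓ : ℕ → ℝ} (hℓ : ∀ ν, 0 < ℓ ν) (hs : Summable ℓ) :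
    spread z s F (ofData τ l ℓ) = spreadSum z s F τ l ℓ := by
  obtain ⟨π, hπ⟩ := exists_largestAtom_eq hℓ hs
  rw [← spreadSum_comp z s F τ l ℓ π, ← hπ]
  rfl

end Kernel

/-! ## The conditional law of the new restaurant -/

section Fill

variable {n N : ℕ} {h : n ≤ N} {τ : Perm (Fin n)} {κ : Fin n → ℕ} {ℓ : ℕ → ℝ}

/-- The restaurant obtained from the filling `x`, where `y` are the new lengths. -/
def Filling.restaurant (x : Filling h τ κ) (s : Perm (Fin N)) (ℓ : ℕ → ℝ)
    (y : Fin n ⊕ FreeCycles (x.1.1 * s) (castLEEmb h) → ℝ) : HalfRestaurant n :=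
  newRestaurant (x.1.1 * s) (castLEEmb h)
    (fun ν : {ν // (∀ i, κ i ≠ ν) ∧ ν ∉ Set.range x.2.1} => ℓ ν) y

lemma Filling.tables_ne_iff (x : Filling h τ κ) (ν : ℕ) :
    (∀ i, tables h x.1.1 κ x.2.1 i ≠ ν) ↔ (∀ i, κ i ≠ ν) ∧ ν ∉ Set.range x.2.1 := by
  have h1 : (∀ i, tables h x.1.1 κ x.2.1 i ≠ ν) ↔ ∀ t, Sum.elim κ x.2.1 t ≠ ν :=
    (Surjective.forall (p := fun t => Sum.elim κ x.2.1 t ≠ ν) surjective_seg).symm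
  rw [h1, Sum.forall]
  simp

lemma Filling.coarsen_eq (x : Filling h τ κ) (s : Perm (Fin N)) (L : Fin N → ℝ) :
    coarsen h s x.1.1 ℓ (tables h x.1.1 κ x.2.1) L = x.restaurant s ℓ fun t =>
      ∑ k, {k | seg (x.1.1 * s) (castLEEmb h) (s⁻¹ k) = t}.indicator L k := by
  classical
  have h1 : ∀ t, ∑ k with seg (x.1.1 * s) (castLEEmb h) k = t, L (s k) =
      ∑ k, {k | seg (x.1.1 * s) (castLEEmb h) (s⁻¹ k) = t}.indicator L k := by
    intro t
    rw [← Equiv.sum_comp s, sum_filter]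
    refine sum_congr rfl fun k _ => ?_
    simp only [indicator_apply, mem_ofPred_eq, perm_inv_apply_self]
  rw [coarsen, Filling.restaurant, newRestaurant]
  simp only [← h1]
  refine Eq.trans ?_ (HalfRestaurant.ofData_comp_equiv ((sumComm _ _).trans
    (sumCongr (subtypeEquivRight x.tables_ne_iff) (Equiv.refl _))) _ _ _)
  congr! with b
  rcases b with C | ν <;> rfl

lemma measurable_restaurant (x : Filling h τ κ) (s : Perm (Fin N)) (ℓ : ℕ → ℝ) :
    Measurable (x.restaurant s ℓ) :=
  measurable_newRestaurant _ _ measurable_const measurable_id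

lemma spreadSum_apply_eq_tsum_filling (z : ℝ) (s : Perm (Fin N)) (l : Fin n → ℝ)
    (e : ℕ ≃ {ν // ∀ i, κ i ≠ ν}) {B : Set (HalfRestaurant n × ℝ)} (hB : MeasurableSet B) :
    spreadSum z s (castLEEmb h) τ l (fun m => ℓ (e m)) B = ∑' x : Filling h τ κ,
        arrivalWeight x.1.1 (castLEEmb h) l (fun b => ℓ (x.2.1 b)) *
          ∫⁻ y, B.indicator 1 (x.restaurant s ℓ y, cycleRatio z x.1.1 s)
            ∂splitLaw (seg x.1.1 (castLEEmb h)) (fun k => seg (x.1.1 * s) (castLEEmb h) (s⁻¹ k))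
              (Sum.elim l fun b => ℓ (x.2.1 b)) := by
  let E : Occupation τ (castLEEmb h) ≃ Filling h τ κ := sigmaCongrRight fun w =>
    { toFun := fun o => ⟨o.trans (e.toEmbedding.trans (Embedding.subtype _)),
        fun b i he => (e (o b)).2 i he.symm⟩
      invFun := fun o => ⟨fun b => e.symm ⟨o.1 b, fun i he => o.2 b i he.symm⟩, fun b b' hb =>
        o.1.injective (congrArg Subtype.val (e.symm.injective hb))⟩
      left_inv := fun o => Embedding.ext fun b => e.symm_apply_apply (o b)
      right_inv := fun o => Subtype.ext (Embedding.ext fun b =>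
        congrArg Subtype.val (e.apply_symm_apply ⟨o.1 b, fun i he => o.2 b i he.symm⟩)) }
  rw [spreadSum, Measure.sum_apply _ hB, ← E.tsum_eq]
  refine tsum_congr fun x => ?_
  let e' : {m // m ∉ Set.range x.2} ≃ {ν // (∀ i, κ i ≠ ν) ∧ ν ∉ Set.range (E x).2.1} :=
    (e.subtypeEquiv (q := fun ν => ν.1 ∉ Set.range (E x).2.1) fun m => not_congr
      (exists_congr fun b => by rw [← e.apply_eq_iff_eq, Subtype.ext_iff]; rfl)).trans
      (subtypeSubtypeEquivSubtypeInter _ fun ν => ν ∉ Set.range (E x).2.1)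
  refine Eq.trans (congrArg (fun m : Measure _ => m B) (spreadTerm_comp_equiv z x.1.1 s
    (x.1.1 * s) (castLEEmb h) l (fun b => ℓ (e (x.2 b))) e' fun ν => ℓ ν)) ?_
  exact spreadTerm_apply z x.1.1 s (x.1.1 * s) _ l _ _ hB

end Fill

/-! ## The disintegration of the polymorphism -/

section Key

variable {n N : ℕ} {τ : Perm (Fin n)} {κ : Fin n → ℕ} {ℓ U : ℕ → ℝ}

lemma Config.forget_paint (hc : Config ℓ τ κ U) (hℓ : GoodSticks ℓ) (hU : GoodPoints U)
    (hE : EquiPoints U) (e : ℕ ≃ {ν // ∀ i, κ i ≠ ν}) :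
    forget n (paint (ℓ, U)) = ofData τ (arcFin ℓ n U) fun m => ℓ (e m) := by
  obtain ⟨rfl, h2⟩ := hc
  obtain rfl := funext h2
  exact forget_paint_equiv hℓ hU hE e

lemma Config.arcFin_eq (hc : Config ℓ τ κ U) :
    arcFin ℓ n U = fun i : Fin n => cdist ℓ (U i) (U (τ i)) := by
  obtain ⟨rfl, -⟩ := hc
  funext i
  rw [arcFin, VirtualPerm.fin, toFinPerm_apply]

lemma lintegral_eq_tsum_config {f : (ℕ → ℝ) → ℝ≥0∞} (hf : Measurable f) :
    ∫⁻ U, f U ∂pointsLaw = ∑' y : Perm (Fin n) × (Fin n → ℕ),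
      ∫⁻ U, {U | Config ℓ y.1 y.2 U}.indicator f U ∂pointsLaw := by
  rw [← lintegral_tsum fun y => (hf.indicator (measurableSet_config_right _ _)).aemeasurable]
  refine lintegral_congr fun U => ?_
  have h1 : Config ℓ ((paint (ℓ, U)).fin n) (fun i => tabOf ℓ (U i)) U := ⟨rfl, fun _ => rfl⟩
  rw [tsum_eq_single ((paint (ℓ, U)).fin n, fun i : Fin n => tabOf ℓ (U i))]
  · exact (indicator_of_mem (s := {U | Config ℓ _ _ U}) h1 f).symm
  · rintro ⟨τ, κ⟩ hne
    refine indicator_of_notMem (s := {U | Config ℓ τ κ U}) (fun hc => hne ?_) f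
    rw [← hc.1, ← funext hc.2]

variable (z : ℝ) (s : Perm (Fin N)) {A : Set (HalfRestaurant n)} {B : Set (HalfRestaurant n × ℝ)}

lemma measurable_indicator_forget (hA : MeasurableSet A) :
    Measurable fun p => A.indicator (1 : HalfRestaurant n → ℝ≥0∞) (forget n (paint p)) :=
  (measurable_one.indicator hA).comp ((measurable_forget n).comp measurable_paint)

lemma measurable_mul_indicator_act (hA : MeasurableSet A) (hB : MeasurableSet B) :
    Measurable fun p => A.indicator 1 (forget n (paint p)) * B.indicator (1 : _ × _ → ℝ≥0∞)
      (forget n (act (rightMul s) (paint p)), cycleRatio z ((paint p).fin N) s) :=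
  (measurable_indicator_forget hA).mul ((measurable_one.indicator hB).comp
    ((((measurable_forget n).comp (measurable_act _)).comp measurable_paint).prodMk
      ((measurable_cycleRatio z s).comp measurable_paint)))

lemma measurable_mul_spread (F : Fin n ↪ Fin N) (hA : MeasurableSet A) (hB : MeasurableSet B) :
    Measurable fun p => A.indicator 1 (forget n (paint p)) * spread z s F (forget n (paint p)) B :=
  (measurable_indicator_forget hA).mul ((measurable_coe hB).comp
    ((measurable_spread z s _).comp ((measurable_forget n).comp measurable_paint)))

lemma lintegral_forget_eq (h : n ≤ N) (hℓ : GoodSticks ℓ) (hA : MeasurableSet A) (hB : MeasurableSet B) :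
    ∫⁻ U, A.indicator 1 (forget n (paint (ℓ, U))) *
        B.indicator 1 (forget n (act (rightMul s) (paint (ℓ, U))),
          cycleRatio z ((paint (ℓ, U)).fin N) s) ∂pointsLaw =
      ∫⁻ U, A.indicator 1 (forget n (paint (ℓ, U))) *
        spread z s (castLEEmb h) (forget n (paint (ℓ, U))) B ∂pointsLaw := by
  have hpair : Measurable fun U : ℕ → ℝ => (ℓ, U) := measurable_const.prodMk measurable_id
  refine (lintegral_eq_tsum_config (n := n) (ℓ := ℓ)
    ((measurable_mul_indicator_act z s hA hB).comp hpair)).trans (Eq.trans ?_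
    (lintegral_eq_tsum_config (n := n) (ℓ := ℓ)
      ((measurable_mul_spread z s (castLEEmb h) hA hB).comp hpair)).symm)
  refine tsum_congr fun ⟨τ, κ⟩ => ?_
  by_cases hκ : ∀ i j, κ i = κ j ↔ τ.SameCycle i j
  swap
  · refine lintegral_congr_ae (ae_goodPoints.mono fun U hU => ?_)
    have hc : ¬ Config ℓ τ κ U := fun hc => hκ (hc.tables_eq_iff hℓ hU)
    exact (indicator_of_notMem (s := {U | Config ℓ τ κ U}) hc _).trans
      (indicator_of_notMem (s := {U | Config ℓ τ κ U}) hc _).symm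
  obtain ⟨e⟩ := nonempty_equiv_free κ
  let G : (ℕ → ℝ) → ℝ≥0∞ := fun U => A.indicator 1
    (ofData τ (fun i : Fin n => cdist ℓ (U i) (U (τ i))) fun m => ℓ (e m))
  have hG : Measurable G := by
    refine (measurable_one.indicator hA).comp (measurable_const.prodMk (Measurable.prodMk ?_
      measurable_const))
    exact measurable_pi_lambda _ fun i => (measurable_cdist_apply (i : ℕ) (τ i : ℕ)).comp
      (measurable_const.prodMk measurable_id)
  have hGloc : ∀ U U' : ℕ → ℝ, (∀ i < n, U i = U' i) → G U = G U' := by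
    intro U U' hUU
    have : (fun i : Fin n => cdist ℓ (U i) (U (τ i))) = fun i : Fin n => cdist ℓ (U' i) (U' (τ i)) :=
      funext fun i => by rw [hUU i i.2, hUU _ (τ i).2]
    simp only [G, this]
  let f : (ℕ → ℝ) → ℝ≥0∞ := fun U => B.indicator 1 (coarsen h s ((paint (ℓ, U)).fin N) ℓ
    (fun i => tabOf ℓ (U i)) (arcFin ℓ N U), cycleRatio z ((paint (ℓ, U)).fin N) s)
  have key := lintegral_eq_tsum_filling h hℓ hκ hG hGloc
    (γ := fun x k => seg (x.1.1 * s) (castLEEmb h) (s⁻¹ k))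
    (H := fun x y => B.indicator 1 (x.restaurant s ℓ y, cycleRatio z x.1.1 s))
    (fun x => (measurable_one.indicator hB).comp
      ((measurable_restaurant x s ℓ).prodMk measurable_const)) (f := f) fun x U _ hx => by
    obtain ⟨h1, h2⟩ : Config ℓ x.1.1 (tables h x.1.1 κ x.2.1) U := hx
    simp only [f]
    rw [h1, funext h2, x.coarsen_eq]
  refine Eq.trans (lintegral_congr_ae ?_) (key.trans (lintegral_congr_ae ?_))
  all_goals
    filter_upwards [ae_goodPoints, ae_equiPoints] with U hU hE
    by_cases hc : Config ℓ τ κ U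
    swap
    · simp only [indicator_of_notMem (show U ∉ {U | Config ℓ τ κ U} from hc), mul_zero]
    simp only [indicator_of_mem (show U ∈ {U | Config ℓ τ κ U} from hc), comp_apply]
    rw [show A.indicator 1 (forget n (paint (ℓ, U))) = G U by
      rw [hc.forget_paint hℓ hU hE e, hc.arcFin_eq]]
    congr 1
  · simp only [f]
    rw [forget_eq_coarsen hℓ hU hE h s fun M hM => act_rightMul_perm s _ hM]
  · rw [hc.forget_paint hℓ hU hE e, spread_ofData, spreadSum_apply_eq_tsum_filling z s _ e hB]
    · exact fun m => hℓ.1 _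
    · exact (hℓ.2.summable.subtype {ν | ∀ i, κ i ≠ ν}).comp_injective e.injective

lemma lintegral_forget_prod_eq (h : n ≤ N) (hz : 0 < z) (hA : MeasurableSet A) (hB : MeasurableSet B) :
    ∫⁻ p, A.indicator 1 (forget n (paint p)) *
        B.indicator 1 (forget n (act (rightMul s) (paint p)), cycleRatio z ((paint p).fin N) s)
        ∂(stickLaw z).prod pointsLaw =
      ∫⁻ p, A.indicator 1 (forget n (paint p)) *
        spread z s (castLEEmb h) (forget n (paint p)) B ∂(stickLaw z).prod pointsLaw := by
  rw [lintegral_prod _ (measurable_mul_indicator_act z s hA hB).aemeasurable,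
    lintegral_prod _ (measurable_mul_spread z s _ hA hB).aemeasurable]
  exact lintegral_congr_ae ((ae_stickLaw hz).mono fun ℓ hℓ => lintegral_forget_eq z s h hℓ hA hB)

end Key

section IsRestaurant

variable {n : ℕ}

lemma measure_eq_of_Ici {μ ν : Measure ℝ} (hμ : μ (Iic 0) = 0) (hν : ν (Iic 0) = 0)
    (hfin : ∀ q : ℚ, 0 < q → μ (Ici q) ≠ ∞)
    (h : ∀ q : ℚ, 0 < q → μ (Ici q) = ν (Ici q)) : μ = ν := by
  have h1 : ∀ q : {q : ℚ // 0 < q}, μ.restrict (Ici (q : ℚ)) = ν.restrict (Ici (q : ℚ)) := by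
    rintro ⟨q, hq⟩
    have : IsFiniteMeasure (μ.restrict (Ici (q : ℝ))) := ⟨by
      rw [Measure.restrict_apply_univ]; exact (hfin q hq).lt_top⟩
    refine ext_of_generate_finite _ ?_ Real.isPiSystem_Ici_rat ?_ ?_
    · rw [← Real.borel_eq_generateFrom_Ici_rat]
      exact BorelSpace.measurable_eq
    · simp only [Set.mem_iUnion, Set.mem_singleton_iff]
      rintro _ ⟨r, rfl⟩
      rw [Measure.restrict_apply measurableSet_Ici, Measure.restrict_apply measurableSet_Ici,
        Set.Ici_inter_Ici, ← Rat.cast_max]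
      grind
    · rw [Measure.restrict_apply_univ, Measure.restrict_apply_univ]
      exact h q hq
  have hU : ⋃ q : {q : ℚ // 0 < q}, Ici ((q : ℚ) : ℝ) = Ioi 0 := by
    ext x
    simp only [Set.mem_iUnion, Set.mem_Ici, mem_Ioi, Subtype.exists, exists_prop]
    constructor
    · rintro ⟨q, hq, hx⟩
      exact (Rat.cast_pos.2 hq).trans_le hx
    · intro hx
      obtain ⟨q, hq, hqx⟩ := exists_rat_btwn hx
      exact ⟨q, Rat.cast_pos.1 hq, hqx.le⟩
  have h2 := Measure.restrict_iUnion_congr.2 h1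
  have h3 : ∀ {m : Measure ℝ}, m (Iic 0) = 0 → m.restrict (Ioi 0) = m := fun hm =>
    Measure.restrict_eq_self_of_ae_mem (by
      rw [← Set.compl_Ioi] at hm
      exact hm)
  grind

/-- The sequence of all lengths. -/
def joinLengths (l : Fin n → ℝ) (ℓ : ℕ → ℝ) (m : ℕ) : ℝ :=
  if h : m < n then l ⟨m, h⟩ else ℓ (m - n)

lemma measurable_joinLengths : Measurable fun a : (Fin n → ℝ) × (ℕ → ℝ) => joinLengths a.1 a.2 := by
  refine measurable_pi_lambda _ fun m => ?_
  by_cases h : m < n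
  · simp only [joinLengths, dif_pos h]
    fun_prop
  · simp only [joinLengths, dif_neg h]
    fun_prop

lemma goodSticks_joinLengths {l : Fin n → ℝ} {ℓ : ℕ → ℝ} :
    GoodSticks (joinLengths l ℓ) ↔ IsRestaurant l ℓ := by
  have h1 : ∀ i : Fin n, joinLengths l ℓ i = l i := fun i => dif_pos i.2
  have h2 : ∀ ν, joinLengths l ℓ (ν + n) = ℓ ν := fun ν => by
    rw [joinLengths, dif_neg (by omega), Nat.add_sub_cancel]
  have h3 : ∑ i ∈ range n, joinLengths l ℓ i = ∑ i, l i := by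
    rw [← Fin.sum_univ_eq_sum_range]
    grind
  rw [GoodSticks, IsRestaurant, ← and_assoc, ← hasSum_nat_add_iff' n, h3, funext h2]
  refine and_congr_left fun _ => ⟨fun h => ⟨fun i => h1 i ▸ h i, fun ν => h2 ν ▸ h _⟩, ?_⟩
  rintro ⟨hl, hℓ⟩ m
  rw [joinLengths]
  all_goals grind

lemma sum_dirac_Iic {ℓ : ℕ → ℝ} (hℓ : ∀ ν, 0 < ℓ ν) :
    (Measure.sum fun ν => dirac (ℓ ν)) (Iic 0) = 0 := by
  rw [Measure.sum_apply _ measurableSet_Iic, ENNReal.tsum_eq_zero]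
  intro ν
  rw [dirac_apply' _ measurableSet_Iic]
  exact indicator_of_notMem (M := ℝ≥0∞) (not_le.2 (hℓ ν)) 1

lemma sum_dirac_Ici_ne_top {ℓ : ℕ → ℝ} (hℓ : ∀ ν, 0 < ℓ ν) (hs : Summable ℓ) {q : ℝ}
    (hq : 0 < q) : (Measure.sum fun ν => dirac (ℓ ν)) (Ici q) ≠ ∞ := by
  rw [Measure.sum_apply _ measurableSet_Ici]
  refine ne_top_of_le_ne_top (b := ∑' ν, ofReal (ℓ ν / q)) ?_ (ENNReal.tsum_le_tsum fun ν => ?_)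
  · rw [← ENNReal.ofReal_tsum_of_nonneg (fun ν => (div_pos (hℓ ν) hq).le) (hs.div_const q)]
    simp
  · rw [dirac_apply' _ measurableSet_Ici]
    refine Set.indicator_apply_le' (fun h => ?_) fun _ => zero_le
    rw [Pi.one_apply, ENNReal.one_le_ofReal, one_le_div hq]
    exact h

lemma largestAtom_isRestaurant {l : Fin n → ℝ} {ℓ : ℕ → ℝ} (h : IsRestaurant l ℓ) :
    IsRestaurant l (largestAtom (Measure.sum fun ν => dirac (ℓ ν))) ∧
      (Measure.sum fun ν => dirac (largestAtom (Measure.sum fun ν => dirac (ℓ ν)) ν)) =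
        Measure.sum fun ν => dirac (ℓ ν) := by
  obtain ⟨h1, h2, h3⟩ := h
  obtain ⟨π, hπ⟩ := exists_largestAtom_eq h2 h3.summable
  rw [hπ]
  exact ⟨⟨h1, fun ν => h2 _, π.hasSum_iff.2 h3⟩,
    congrArg (fun t : HalfRestaurant 0 => t.2.2) (HalfRestaurant.ofData_comp_equiv π 1 0 ℓ)⟩

/-- A measurable criterion for a point to have the data of a restaurant. -/
def IsRegular (t : HalfRestaurant n) : Prop :=
  GoodSticks (joinLengths t.2.1 (largestAtom t.2.2)) ∧ t.2.2 (Iic 0) = 0 ∧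
    ∀ q : {q : ℚ // 0 < q}, t.2.2 (Ici (q : ℚ)) ≠ ∞ ∧ t.2.2 (Ici (q : ℚ)) =
      (Measure.sum fun ν => dirac (largestAtom t.2.2 ν)) (Ici (q : ℚ))

lemma measurableSet_isRegular : MeasurableSet {t : HalfRestaurant n | IsRegular t} := by
  have h0 : Measurable fun t : HalfRestaurant n => t.2.2 := measurable_snd.comp measurable_snd
  have h1 : Measurable fun t : HalfRestaurant n => largestAtom t.2.2 := measurable_largestAtom.comp h0
  have h2 : Measurable fun t : HalfRestaurant n => joinLengths t.2.1 (largestAtom t.2.2) :=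
    measurable_joinLengths.comp ((measurable_fst.comp measurable_snd).prodMk h1)
  have h3 : ∀ q : ℚ, Measurable fun t : HalfRestaurant n => t.2.2 (Ici (q : ℝ)) := fun q =>
    (measurable_coe measurableSet_Ici).comp h0
  have h4 : ∀ q : ℚ, Measurable fun t : HalfRestaurant n =>
      (Measure.sum fun ν => dirac (largestAtom t.2.2 ν)) (Ici (q : ℝ)) := fun q => by
    simp only [Measure.sum_apply _ (measurableSet_Ici (a := (q : ℝ))),
      dirac_apply' _ (measurableSet_Ici (a := (q : ℝ)))]
    exact Measurable.tsum fun ν => (measurable_one.indicator measurableSet_Ici).comp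
      ((measurable_pi_apply ν).comp h1)
  refine ((measurable_goodSticks.comp h2).and (Measurable.and ?_ (Measurable.forall fun q =>
    Measurable.and ?_ ?_))).setOf
  · exact measurableSet_setOfPred.1
      (((measurable_coe measurableSet_Iic).comp h0) (measurableSet_singleton 0))
  · fun_prop
  · fun_prop

lemma isRegular_iff (t : HalfRestaurant n) :
    IsRegular t ↔ ∃ τ l, ∃ ℓ : ℕ → ℝ, IsRestaurant l ℓ ∧ t = ofData τ l ℓ := by
  constructor
  · rintro ⟨h1, h2, h3⟩
    have h1' := goodSticks_joinLengths.1 h1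
    refine ⟨t.1, t.2.1, largestAtom t.2.2, h1', Prod.ext rfl (Prod.ext rfl ?_)⟩
    exact measure_eq_of_Ici h2 (sum_dirac_Iic h1'.2.1) (fun q hq => (h3 ⟨q, hq⟩).1)
      fun q hq => (h3 ⟨q, hq⟩).2
  · rintro ⟨τ, l, ℓ, h, rfl⟩
    obtain ⟨h1, h2⟩ := largestAtom_isRestaurant h
    refine ⟨goodSticks_joinLengths.2 h1, sum_dirac_Iic h.2.1, fun ⟨q, hq⟩ => ⟨?_, ?_⟩⟩
    · exact sum_dirac_Ici_ne_top h.2.1 h.2.2.summable (Rat.cast_pos.2 hq)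
    · exact congrArg (fun m : Measure ℝ => m (Ici (q : ℝ))) h2.symm

end IsRestaurant

section Disintegration

variable (z : ℝ) (hz : 0 < z) {n N : ℕ} (s : Perm (Fin N))

lemma map_forget_paint : ((stickLaw z).prod pointsLaw).map (fun p => forget n (paint p)) =
    restaurantMeasure z hz n := by
  rw [restaurantMeasure, ← map_paint z hz, map_map (measurable_forget n) measurable_paint]
  rfl

lemma isProbabilityMeasure_restaurantMeasure : IsProbabilityMeasure (restaurantMeasure z hz n) :=
  Measure.isProbabilityMeasure_map (measurable_forget n).aemeasurable

lemma setLIntegral_spread (h : n ≤ N) {A : Set (HalfRestaurant n)}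
    {B : Set (HalfRestaurant n × ℝ)} (hA : MeasurableSet A) (hB : MeasurableSet B) :
    ∫⁻ t in A, spread z s (castLEEmb h) t B ∂restaurantMeasure z hz n =
      ((stickLaw z).prod pointsLaw).map (fun p => (forget n (paint p),
        forget n (act (rightMul s) (paint p)), cycleRatio z ((paint p).fin N) s)) (A ×ˢ B) := by
  have hm : Measurable fun p => (forget n (paint p),
      forget n (act (rightMul s) (paint p)), cycleRatio z ((paint p).fin N) s) :=
    ((measurable_forget n).comp measurable_paint).prodMk
      ((((measurable_forget n).comp (measurable_act _)).comp measurable_paint).prodMk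
        ((measurable_cycleRatio z s).comp measurable_paint))
  have hs : Measurable fun t => spread z s (castLEEmb h) t B :=
    (measurable_coe hB).comp (measurable_spread z s _)
  have hfp : Measurable fun p => forget n (paint p) := (measurable_forget n).comp measurable_paint
  rw [← lintegral_indicator hA, ← map_forget_paint z hz, lintegral_map (hs.indicator hA) hfp,
    ← lintegral_indicator_one (hA.prod hB),
    lintegral_map (measurable_one.indicator (hA.prod hB)) hm]
  refine Eq.trans (lintegral_congr fun p => ?_)
    ((lintegral_forget_prod_eq z s h hz hA hB).symm.trans (lintegral_congr fun p => ?_))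
  · by_cases hp : forget n (paint p) ∈ A
    · rw [indicator_of_mem hp, indicator_of_mem hp, Pi.one_apply, one_mul]
    · rw [indicator_of_notMem hp, indicator_of_notMem hp, zero_mul]
  · exact (Set.indicator_prod_one (M₀ := ℝ≥0∞)).symm

lemma ae_spread_univ (h : n ≤ N) : ∀ᵐ t ∂restaurantMeasure z hz n,
    spread z s (castLEEmb h) t Set.univ = 1 := by
  have := isProbabilityMeasure_restaurantMeasure z hz (n := n)
  refine ae_eq_of_forall_setLIntegral_eq_of_sigmaFinite ((measurable_coe .univ).comp
    (measurable_spread z s _)) measurable_const fun A hA _ => ?_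
  refine (setLIntegral_spread z hz s h hA .univ).trans ?_
  have hm : Measurable fun p => (forget n (paint p),
      forget n (act (rightMul s) (paint p)), cycleRatio z ((paint p).fin N) s) :=
    ((measurable_forget n).comp measurable_paint).prodMk
      ((((measurable_forget n).comp (measurable_act _)).comp measurable_paint).prodMk
        ((measurable_cycleRatio z s).comp measurable_paint))
  have hfp : Measurable fun p => forget n (paint p) := (measurable_forget n).comp measurable_paint
  rw [setLIntegral_one, ← map_forget_paint z hz, Measure.map_apply hm (hA.prod .univ),
    Measure.map_apply hfp hA]
  congr 1
  ext p
  simp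

lemma exists_kernel (h : n ≤ N) :
    ∃ κ : Kernel (HalfRestaurant n) (HalfRestaurant n × ℝ), IsMarkovKernel κ ∧
      ((stickLaw z).prod pointsLaw).map (fun p => (forget n (paint p),
        forget n (act (rightMul s) (paint p)), cycleRatio z ((paint p).fin N) s)) =
        restaurantMeasure z hz n ⊗ₘ κ ∧
      ∀ᵐ t ∂restaurantMeasure z hz n, κ t = spread z s (castLEEmb h) t := by
  classical
  have := isProbabilityMeasure_restaurantMeasure z hz (n := n)
  let T : Set (HalfRestaurant n) := {t | spread z s (castLEEmb h) t Set.univ = 1}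
  have hT : MeasurableSet T := ((measurable_coe .univ).comp (measurable_spread z s _))
    (measurableSet_singleton 1)
  let δ : HalfRestaurant n → Measure (HalfRestaurant n × ℝ) := fun _ => dirac ((1, 0, 0), 0)
  let κ : Kernel (HalfRestaurant n) (HalfRestaurant n × ℝ) :=
    ⟨T.piecewise (spread z s (castLEEmb h)) δ,
      (measurable_spread z s _).piecewise hT measurable_const⟩
  have hκT : ∀ t ∈ T, κ t = spread z s (castLEEmb h) t := fun t ht =>
    Set.piecewise_eq_of_mem T (spread z s (castLEEmb h)) δ ht
  have hκ : IsMarkovKernel κ := ⟨fun t => by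
    by_cases ht : t ∈ T
    · rw [hκT t ht]
      exact ⟨ht⟩
    · rw [show κ t = dirac ((1, 0, 0), 0) from
        Set.piecewise_eq_of_notMem T (spread z s (castLEEmb h)) δ ht]
      infer_instance⟩
  have hae : ∀ᵐ t ∂restaurantMeasure z hz n, κ t = spread z s (castLEEmb h) t :=
    (ae_spread_univ z hz s h).mono hκT
  refine ⟨κ, hκ, ?_, hae⟩
  symm
  refine Measure.ext_prod fun {A B} hA hB => ?_
  rw [Measure.compProd_apply_prod hA hB, ← setLIntegral_spread z hz s h hA hB]
  exact setLIntegral_congr_fun_ae hA (hae.mono fun t ht _ => by rw [ht])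

lemma ae_restaurantMeasure_ofData : ∀ᵐ t ∂restaurantMeasure z hz n,
    ∃ τ l, ∃ ℓ : ℕ → ℝ, IsRestaurant l ℓ ∧ t = ofData τ l ℓ := by
  simp only [← isRegular_iff]
  have hfp : Measurable fun p => forget n (paint p) := (measurable_forget n).comp measurable_paint
  rw [← map_forget_paint z hz, ae_map_iff hfp.aemeasurable measurableSet_isRegular]
  filter_upwards [ae_good z hz] with ⟨ℓ, U⟩ ⟨hℓ, hU, hE⟩
  obtain ⟨e⟩ := nonempty_equiv_free fun i : Fin n => tabOf ℓ (U i)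
  exact (isRegular_iff _).2 ⟨_, _, _, isRestaurant_free hℓ hU e, forget_paint_equiv hℓ hU hE e⟩

end Disintegration

end

end Chips

theorem mainTheorem3 (z : ℝ) (hz : 0 < z) (n p : ℕ) (σ : Equiv.Perm (Fin n)) (φ : Fin n → ℕ)
    (k : Fin p → ℕ) (hk : ∀ j, 2 ≤ k j) (g : Chips.bisymmetricGroup)
    (hg : Chips.chipOf n n (g : Equiv.Perm ℕ × Equiv.Perm ℕ) = Chips.leftTrivialChip σ φ k) :
    ∃ κ : Kernel (Chips.HalfRestaurant n) (Chips.HalfRestaurant n × ℝ),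
      IsMarkovKernel κ ∧
      Chips.polymorphism z hz n g = Chips.restaurantMeasure z hz n ⊗ₘ κ ∧
      ∀ᵐ t ∂Chips.restaurantMeasure z hz n,
        (∃ τ l ℓ, Chips.IsRestaurant l ℓ ∧ t = Chips.HalfRestaurant.ofData τ l ℓ) ∧
        ∀ (τ : Equiv.Perm (Fin n)) (l : Fin n → ℝ) (ℓ : ℕ → ℝ), Chips.IsRestaurant l ℓ →
          t = Chips.HalfRestaurant.ofData τ l ℓ → κ t = Chips.spreadedImage z σ φ k τ l ℓ := by
  have hN : n ≤ Chips.chipSize φ k := by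
    rw [Chips.chipSize, add_assoc]
    exact Nat.le_add_right _ _
  obtain ⟨a, q, s, K, hgs, ha, hq, hq', hs⟩ := Chips.exists_representative hk g hg hN
  obtain ⟨κ, hκ, hpoly, hspread⟩ := Chips.exists_kernel z hz s hN
  refine ⟨κ, hκ, (Chips.polymorphism_eq z hz s hgs ha hq hq').trans hpoly, ?_⟩
  filter_upwards [Chips.ae_restaurantMeasure_ofData z hz, hspread] with t ht ht'
  refine ⟨ht, ?_⟩
  rintro τ l ℓ ⟨hl, hℓ, hsum⟩ rfl
  rw [ht', Chips.spread_ofData z s _ τ l hℓ hsum.summable]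
  exact Chips.sum_spreadTerm (fun j => two_pos.trans_le (hk j)) hs z hl hℓ
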